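/- Let $a\in\mathbb C$ and let $V=M_a(1)$ be the rank one Heisenberg vertex algebra $M(1)=S(\hat{\mathfrak h}^-)=\mathbb C[\alpha_{-1},\alpha_{-2},\dots]$ with conformal vector $\omega^a=\tfrac12\alpha_{-1}^2\mathbf 1+a\,\alpha_{-2}\mathbf 1$; it is a vertex operator algebra of central charge $1-12a^2$, and its level zero Zhu algebra $A_0(V)=V/O_0(V)$ is the polynomial algebra $\mathbb C[x]$, $x=\alpha_{-1}\mathbf 1+O_0(V)$. For $\lambda\in\mathbb C$ and $k\in\mathbb Z_{>0}$ let $U(\lambda,k)=\mathbb C[x]/((x-\lambda)^k)$, an $A_0(V)$-module, and let $W=W(a,\lambda,k)=\mathfrak L_0(U(\lambda,k))$ be the induced $V$-module: $\mathfrak L_0(U)=M_0(U)/J$, where $M_0(U)=\mathcal U(\hat V)\otimes_{\mathcal U(P_0)}U$ is induced from the subalgebra $P_0$ of $\hat V$ of elements of degree $\le 0$ (with $\deg v(m)=\mathrm{wt}\,v-m-1$; negative degree acts by zero on $U$, and $v(\mathrm{wt}\,v-1)$ acts as $[v]\in A_0(V)$), and $J$ is the set of all $w\in M_0(U)$ such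 that $yw$ has zero component in degree $0$ for every $y\in\mathcal U(\hat V)$. Then $W\cong M(1)\otimes\Omega(\lambda,k)$ as a module over the Heisenberg Lie algebra $\hat{\mathfrak h}$, where $\Omega(\lambda,k)\cong U(\lambda,k)$ with $\alpha_0$ acting as $x$; its degree $\ell$ space $W(\ell)$ corresponds to $M(1)_\ell\otimes\Omega(\lambda,k)$, and these spaces form a $\mathbb Z_{\ge0}$-grading of $W$. A module is called interlocked if it is indecomposable and for every submodule $S$ there is a submodule $T$ with $S\cong W/T$ and $T\cong W/S$. An interlocked module (for a vertex operator algebra: an interlocked generalized module) is called strongly interlocked if its submodules form a finite chain $0=W^{(0)}\subsetneq W^{(1)}\subsetneq\cdots\subsetneq W^{(n)}=W$ such that all $W^{(j)}$ with $j\ge1$ are indecomposable, $W^{(1)}=\mathrm{Soc}\,W$ (the sum of the simple submodules), $W^{(n-1)}=\mathrm{Rad}\,W$ (the intersection of the maximal proper submodules), and $W^{(j)}\cong W/W^{(n-j)}$ for $0\le j\le n$. For all $a,\lambda\in\mathbb C$ and $k\in\mathbb Z_{>0}$: 1. The $A_0(V)$-module $U(\lambda,k)$ is strongly interlocked, and $W=W(a,\lambda,k)$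 is a strongly interlocked generalized $V$-module. 2. $W/\mathrm{Rad}\,W\cong\mathrm{Soc}\,W$ and $W/\mathrm{Soc}\,W\cong\mathrm{Rad}\,W$ as $V$-modules. 3. The chain of submodules of $W$ has length $n=k$. For every $\ell\ge0$, $\dim(\mathrm{Soc}\,W\cap W(\ell))=\mathfrak p(\ell)$, the number of partitions of $\ell$, and $W(\ell)$ has a basis of $k\,\mathfrak p(\ell)$ vectors, divided into $k$ consecutive blocks of $\mathfrak p(\ell)$ vectors, such that for $0\le j\le k$ the first $j$ blocks form a basis of $W^{(j)}\cap W(\ell)$ and such that for every homogeneous $v\in V$ the matrix of the zero mode $o(v)=v_{\mathrm{wt}\,v-1}$ on $W(\ell)$ in this basis is a $k\times k$ block matrix, with blocks of size $\mathfrak p(\ell)\times\mathfrak p(\ell)$, which is block upper triangular, has the same block $A$ (the matrix of $o(v)$ on $\mathrm{Soc}\,W\cap W(\ell)$) at all diagonal places, and whose first block row $(A,C_1,\dots,C_{k-2},B)$ and last block column, from top to bottom $(B,C_{k-2},\dots,C_1,A)$, are reverse to each other. Moreover, every indecomposable generalized $M_a(1)$-module is isomorphic to some $W(a,\lambda,k)$,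 and therefore is strongly interlocked. -/

import Mathlib

open scoped TensorProduct Polynomial

universe u

noncomputable section

/-! ## Indecomposable, interlocked and strongly interlocked modules over a ring -/

section Interlocked

variable (A : Type*) [Ring A] (W : Type*) [AddCommGroup W] [Module A W]

/-- A nonzero module that is not a direct sum of two nonzero submodules. -/
def IsIndecomposable : Prop :=
  Nontrivial W ∧ ∀ S T : Submodule A W, IsCompl S T → S = ⊥ ∨ T = ⊥

/-- The socle: the sum of all simple submodules.  (The radical, the intersection of all maximal
proper submodules, is Mathlib's `Module.jacobson`.) -/
def socle : Submodule A W :=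
  sSup {S : Submodule A W | IsSimpleModule A S}

/-- `W` is indecomposable, and for every submodule `S` there is a submodule `T` with
`S ≅ W / T` and `T ≅ W / S`. -/
def IsInterlocked : Prop :=
  IsIndecomposable A W ∧
    ∀ S : Submodule A W, ∃ T : Submodule A W,
      Nonempty (S ≃ₗ[A] W ⧸ T) ∧ Nonempty (T ≃ₗ[A] W ⧸ S)

/-- `0 = c 0 ⊂ c 1 ⊂ ⋯ ⊂ c n = W` is the list of all submodules of `W`, its nonzero members are
indecomposable, `c 1` is the socle, `c (n - 1)` is the radical, and `c j` is interlocked with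
`c (n - j)` for all `j`.  (As `j` runs over `0, …, n`, the last field gives both
`c j ≅ W / c (n - j)` and `c (n - j) ≅ W / c j`.) -/
structure IsInterlockedChain (n : ℕ) (c : Fin (n + 1) → Submodule A W) : Prop where
  bot : c 0 = ⊥
  top : c (Fin.last n) = ⊤
  strictMono : StrictMono c
  all : ∀ S : Submodule A W, ∃ j, c j = S
  indecomposable : ∀ j, j ≠ 0 → IsIndecomposable A (c j)
  eq_socle : ∀ j : Fin (n + 1), (j : ℕ) = 1 → c j = socle A W
  eq_radical : ∀ j : Fin (n + 1), (j : ℕ) + 1 = n → c j = Module.jacobson A W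
  interlocked : ∀ j : Fin (n + 1), Nonempty (c j ≃ₗ[A] W ⧸ c j.rev)

/-- Strongly interlocked modules over a ring. -/
def IsStronglyInterlocked : Prop :=
  IsInterlocked A W ∧
    ∃ (n : ℕ) (c : Fin (n + 1) → Submodule A W), IsInterlockedChain A W n c

end Interlocked

/-! ## Vertex operator algebras -/

/-- The data `(V, Y, 𝟏, ω)` of a vertex operator algebra, with `Y u v = Y(u, x) v ∈ V((x))`.
The axioms are in `VertexData.IsVertexOperatorAlgebra`. -/
structure VertexData (V : Type) [AddCommGroup V] [Module ℂ V] where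
  Y : V → V → LaurentSeries V
  vac : V
  omega : V

/-- The Jacobi identity in component form (Borcherds' identity) for operators `u_m` on `V` (the
first argument) and on `W` (the second argument). For a lower truncated action every
sum is finite. -/
def JacobiIdentity {V W : Type*} [AddCommGroup W]
    (modeV : V → ℤ → V → V) (modeW : V → ℤ → W → W) : Prop :=
  ∀ (u v : V) (w : W) (p q r : ℤ),
    (∑ᶠ i : ℕ, (Ring.choose p i : ℤ) • modeW (modeV u (r + i) v) (p + q - i) w) =
    ∑ᶠ i : ℕ, ((-1 : ℤ) ^ i * Ring.choose r i) •
      (modeW u (p + r - i) (modeW v (q + i) w)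
        - (r.negOnePow : ℤ) • modeW v (q + r - i) (modeW u (p + i) w))

namespace VertexData

variable {V : Type} [AddCommGroup V] [Module ℂ V] (D : VertexData V)

/-- `u_m v`, where `Y(u, x) v = ∑ u_m v x^{-m-1}`. -/
def mode (u : V) (m : ℤ) (v : V) : V := (D.Y u v).coeff (-m - 1)

/-- The Virasoro operator `L_n = ω_{n+1}` on `V`. -/
def L (n : ℤ) (v : V) : V := D.mode D.omega (n + 1) v

/-- `v ∈ V_n`, i.e. `L_0 v = n v`. -/
def HasWeight (n : ℤ) (v : V) : Prop := D.L 0 v = n • v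

/-- The axioms of a vertex operator algebra of central charge `c` (lower truncation is part of
the type of `Y`). -/
structure IsVertexOperatorAlgebra (c : ℂ) : Prop where
  add_left : ∀ u u' v, D.Y (u + u') v = D.Y u v + D.Y u' v
  smul_left : ∀ (z : ℂ) u v, D.Y (z • u) v = z • D.Y u v
  add_right : ∀ u v v', D.Y u (v + v') = D.Y u v + D.Y u v'
  smul_right : ∀ (z : ℂ) u v, D.Y u (z • v) = z • D.Y u v
  vacuum : ∀ v, D.Y D.vac v = HahnSeries.single 0 v
  creation : ∀ v, D.mode v (-1) D.vac = v ∧ ∀ m : ℤ, 0 ≤ m → D.mode v m D.vac = 0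
  jacobi : JacobiIdentity D.mode D.mode
  virasoro : ∀ (m n : ℤ) (v : V), D.L m (D.L n v) - D.L n (D.L m v) =
    (m - n) • D.L (m + n) v +
      (if m + n = 0 then ((m : ℂ) ^ 3 - m) / 12 * c else 0) • v
  derivative : ∀ (v : V) (m : ℤ) (w : V), D.mode (D.L (-1) v) m w = (-m) • D.mode v (m - 1) w
  graded : Submodule.span ℂ {v | ∃ n : ℤ, D.HasWeight n v} = ⊤
  finite : ∀ n : ℤ, FiniteDimensional ℂ (Submodule.span ℂ {v | D.HasWeight n v})
  bounded : ∃ N : ℤ, ∀ n < N, ∀ v, D.HasWeight n v → v = 0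

/-! ### The algebra `𝒰(V̂)` -/

/-- The symbol `v(m) = v ⊗ t^m` in the tensor algebra of `V ⊗ ℂ[t, t⁻¹]`. -/
def letter (v : V) (m : ℤ) : TensorAlgebra ℂ (ℤ →₀ V) :=
  TensorAlgebra.ι ℂ (Finsupp.single m v)

/-- The relations of `𝒰(V̂)`, for `V̂ = (V ⊗ ℂ[t, t⁻¹]) / (d/dt + L_{-1})` with the bracket
`[u(j), v(k)] = ∑_i (j choose i) (u_i v)(j + k - i)`. -/
inductive ModeRel : TensorAlgebra ℂ (ℤ →₀ V) → TensorAlgebra ℂ (ℤ →₀ V) → Prop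
  | derivative (v : V) (m : ℤ) :
      ModeRel (letter (D.L (-1) v) m + m • letter v (m - 1)) 0
  | bracket (u v : V) (j k : ℤ) (N : ℕ) (hN : ∀ i : ℕ, N ≤ i → D.mode u i v = 0) :
      ModeRel (letter u j * letter v k)
        (letter v k * letter u j +
          ∑ i ∈ Finset.range N, (Ring.choose j i : ℤ) • letter (D.mode u i v) (j + k - i))

/-- The universal enveloping algebra `𝒰(V̂)` of the Lie algebra `V̂`. -/
def ModeAlgebra : Type := RingQuot D.ModeRel

instance : Ring D.ModeAlgebra := inferInstanceAs (Ring (RingQuot D.ModeRel))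

instance : Algebra ℂ D.ModeAlgebra := inferInstanceAs (Algebra ℂ (RingQuot D.ModeRel))

/-- The element `v(m)` of `𝒰(V̂)`. -/
def gen (v : V) (m : ℤ) : D.ModeAlgebra :=
  RingQuot.mkAlgHom ℂ D.ModeRel (letter v m)

/-- Products `v₁(m₁) ⋯ v_s(m_s)` of total degree `d`, where `v(m)` has degree `wt v - m - 1`. -/
inductive IsMonomial : ℤ → D.ModeAlgebra → Prop
  | one : IsMonomial 0 1
  | cons (n m d : ℤ) (v : V) (x : D.ModeAlgebra) (hv : D.HasWeight n v) (hx : IsMonomial d x) :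
      IsMonomial (n - m - 1 + d) (D.gen v m * x)

/-! ### Modules

A weak `V`-module is in particular a `𝒰(V̂)`-module in which `v(m)` acts as `v_m`; submodules and
homomorphisms of weak modules are those of `𝒰(V̂)`-modules. -/

section Modules

variable (W : Type*) [AddCommGroup W] [Module ℂ W] [Module D.ModeAlgebra W]
  [IsScalarTower ℂ D.ModeAlgebra W]

/-- The axioms of a weak `V`-module for a `𝒰(V̂)`-module: lower truncation, vacuum and Jacobi
identity. -/
structure IsWeakModule : Prop where
  truncated : ∀ (v : V) (w : W), ∃ N : ℤ, ∀ m : ℤ, N ≤ m → D.gen v m • w = 0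
  vacuum : ∀ (m : ℤ) (w : W), D.gen D.vac m • w = if m = -1 then w else 0
  jacobi : JacobiIdentity D.mode (fun (v : V) (m : ℤ) (w : W) => D.gen v m • w)

/-- The action of an element of `𝒰(V̂)` as a linear operator on `W`. -/
def op (x : D.ModeAlgebra) : Module.End ℂ W := Algebra.lsmul ℂ ℂ W x

/-- The generalized eigenspace `W_μ` of `L_0 = ω_1`. -/
def weightSpace (μ : ℂ) : Submodule ℂ W :=
  (D.op W (D.gen D.omega 1)).maxGenEigenspace μ

/-- `W = ⨁_ℓ G ℓ` is a `ℤ_{≥0}`-grading of `W` as a weak `V`-module, with `G 0 ≠ 0`. -/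
structure IsGrading (G : ℤ → Submodule ℂ W) : Prop where
  internal : DirectSum.IsInternal G
  nonneg : ∀ ℓ < 0, G ℓ = ⊥
  zero_ne_bot : G 0 ≠ ⊥
  map : ∀ (n : ℤ) (v : V), D.HasWeight n v → ∀ (m ℓ : ℤ) (w : W), w ∈ G ℓ →
    D.gen v m • w ∈ G (ℓ + n - m - 1)

/-- Generalized `V`-modules: `ℤ_{≥0}`-gradable weak modules that are the direct sum of the
generalized eigenspaces `W_μ` of `L_0`, with `W_{μ+n} = 0` for `n ≪ 0` and `dim W_μ < ∞`. -/
structure IsGeneralizedModule : Prop where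
  weak : D.IsWeakModule W
  gradable : ∃ G : ℤ → Submodule ℂ W, D.IsGrading W G
  decomposition : DirectSum.IsInternal (D.weightSpace W)
  bounded : ∀ μ : ℂ, ∃ N : ℤ, ∀ n < N, D.weightSpace W (μ + n) = ⊥
  finite : ∀ μ : ℂ, FiniteDimensional ℂ (D.weightSpace W μ)

/-- Strongly interlocked generalized `V`-modules. -/
def IsStronglyInterlockedModule : Prop :=
  D.IsGeneralizedModule W ∧ IsStronglyInterlocked D.ModeAlgebra W

end Modules

/-! ### The level zero Zhu algebra -/

/-- `Res_x (1 + x)^n x^{-s} Y(u, x) v`. -/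
def zhuRes (n s : ℤ) (u v : V) : V :=
  ∑ᶠ i : ℕ, (Ring.choose n i : ℤ) • D.mode u (i - s) v

/-- `O_0(V)`. -/
def zhuO : Submodule ℂ V :=
  Submodule.span ℂ ({x | ∃ (n : ℤ) (u v : V), D.HasWeight n u ∧ x = D.zhuRes n 2 u v} ∪
    {x | ∃ v : V, x = D.L (-1) v + D.L 0 v})

/-- The multiplication table `[u][v] = [u * v]`, `[𝟏] = 1` of the Zhu algebra, where
`u * v = Res_x (1 + x)^{wt u} x⁻¹ Y(u, x) v` for homogeneous `u`. -/
inductive ZhuRel : TensorAlgebra ℂ (V ⧸ D.zhuO) → TensorAlgebra ℂ (V ⧸ D.zhuO) → Prop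
  | mul (n : ℤ) (u v : V) (hu : D.HasWeight n u) :
      ZhuRel (TensorAlgebra.ι ℂ (D.zhuO.mkQ u) * TensorAlgebra.ι ℂ (D.zhuO.mkQ v))
        (TensorAlgebra.ι ℂ (D.zhuO.mkQ (D.zhuRes n 1 u v)))
  | one : ZhuRel (TensorAlgebra.ι ℂ (D.zhuO.mkQ D.vac)) 1

/-- The level zero Zhu algebra `A_0(V)`, i.e. the vector space `V / O_0(V)` with the product `*`,
given as the associative unital algebra on the vector space `V / O_0(V)` with the multiplication
table `ZhuRel`.  For a vertex operator algebra the two are the same, since `*` makes `V / O_0(V)`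
an associative algebra with unit `[𝟏]`. -/
def ZhuAlgebra : Type := RingQuot D.ZhuRel

instance : Ring D.ZhuAlgebra := inferInstanceAs (Ring (RingQuot D.ZhuRel))

instance : Algebra ℂ D.ZhuAlgebra := inferInstanceAs (Algebra ℂ (RingQuot D.ZhuRel))

/-- The canonical linear map `V / O_0(V) → A_0(V)`. -/
def zhuOfQuotient : (V ⧸ D.zhuO) →ₗ[ℂ] D.ZhuAlgebra :=
  (RingQuot.mkAlgHom ℂ D.ZhuRel).toLinearMap ∘ₗ TensorAlgebra.ι ℂ

/-- The class `[v]` of `v` in `A_0(V)`. -/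
def zhuClass (v : V) : D.ZhuAlgebra := D.zhuOfQuotient (D.zhuO.mkQ v)

/-! ### The induction functor `𝔏_0` -/

section Induction

variable (U : Type) [AddCommGroup U] [Module ℂ U] [Module D.ZhuAlgebra U]
  [IsScalarTower ℂ D.ZhuAlgebra U]

/-- The relations that turn `𝒰(V̂) ⊗_ℂ U` into `𝒰(V̂) ⊗_{𝒰(P_0)} U`, where `P_0` is the part of
`V̂` of degree `≤ 0`: elements of negative degree act by zero on `U`, and `v(wt v - 1)` acts on
`U` as `[v] ∈ A_0(V)`. -/
def inducedRel : Submodule D.ModeAlgebra (D.ModeAlgebra ⊗[ℂ] U) :=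
  Submodule.span D.ModeAlgebra
    ({x | ∃ (n m : ℤ) (v : V) (y : U), D.HasWeight n v ∧ n - m - 1 < 0 ∧ x = D.gen v m ⊗ₜ y} ∪
     {x | ∃ (n : ℤ) (v : V) (y : U), D.HasWeight n v ∧
        x = D.gen v (n - 1) ⊗ₜ y - (1 : D.ModeAlgebra) ⊗ₜ (D.zhuClass v • y)})

/-- `M_0(U) = 𝒰(V̂) ⊗_{𝒰(P_0)} U`. -/
abbrev M0 : Type := (D.ModeAlgebra ⊗[ℂ] U) ⧸ D.inducedRel U

/-- `M_0(U)(ℓ) = 𝒰(V̂)_ℓ U`. -/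
def M0deg (ℓ : ℤ) : Submodule ℂ (D.M0 U) :=
  Submodule.span ℂ {w | ∃ (x : D.ModeAlgebra) (y : U), D.IsMonomial ℓ x ∧
    w = (D.inducedRel U).mkQ (x ⊗ₜ y)}

/-- The submodule `J` of `M_0(U)`.  Functionals `u' ∈ U^*` are extended to `M_0(U)` by `0` on
`M_0(U)(ℓ)`, `ℓ ≠ 0`, and `M_0(U)(0) = U`; hence `⟨u', x w⟩ = 0` for all `u'` says that `x w` has no
component in degree `0`. -/
def J : Submodule D.ModeAlgebra (D.M0 U) where
  carrier := {w | ∀ x : D.ModeAlgebra, x • w ∈ ⨆ ℓ : {ℓ : ℤ // ℓ ≠ 0}, D.M0deg U ℓ}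
  zero_mem' x := by rw [smul_zero]; exact Submodule.zero_mem _
  add_mem' h h' x := by rw [smul_add]; exact Submodule.add_mem _ (h x) (h' x)
  smul_mem' y w h x := by rw [← mul_smul]; exact h (x * y)

/-- The induced module `𝔏_0(U) = M_0(U) / J`. -/
abbrev L0 : Type := D.M0 U ⧸ D.J U

/-- The map `𝒰(V̂) ⊗_ℂ U → 𝔏_0(U)`. -/
def L0mk : D.ModeAlgebra ⊗[ℂ] U →ₗ[D.ModeAlgebra] D.L0 U :=
  (D.J U).mkQ ∘ₗ (D.inducedRel U).mkQ

/-- The degree `ℓ` subspace `𝔏_0(U)(ℓ)`. -/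
def L0deg (ℓ : ℤ) : Submodule ℂ (D.L0 U) :=
  (D.M0deg U ℓ).map ((D.J U).mkQ.restrictScalars ℂ)

end Induction

end VertexData

/-! ## The rank one Heisenberg vertex operator algebra -/

namespace Heisenberg

/-- The vector space `M(1) = S(𝔥̂⁻)`: polynomials in `α_{-1}, α_{-2}, …`, where the variable
`X i` stands for `α_{-(i+1)}`.  On it `α_{-n}`, `n > 0`, acts by multiplication, `α_0` by `0`,
and `α_n`, `n > 0`, by `n ∂/∂α_{-n}`. -/
abbrev Fock : Type := MvPolynomial ℕ ℂ

/-- The creation part `∑_{j ≥ 0} (i+j choose i) α_{-(i+j+1)} x^j` of the field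
`(1/i!) (d/dx)^i α(x)`, where `α(x) = ∑_n α_n x^{-n-1}`. -/
def creation (i : ℕ) : LaurentSeries Fock :=
  HahnSeries.ofPowerSeries ℤ Fock
    (PowerSeries.mk fun j => ((i + j).choose i : Fock) * MvPolynomial.X (i + j))

/-- The normally ordered product of `(1/i!) (d/dx)^i α(x)` with a field `F`. The sum
is over the annihilation operators `α_{j+1}`, which enter `(1/i!) (d/dx)^i α(x)` with
the coefficient `(-1)^i (i+j+1 choose i) x^{-(i+j+2)}`. -/
def normalOrder (i : ℕ) (F : Fock → LaurentSeries Fock) (w : Fock) : LaurentSeries Fock :=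
  creation i * F w +
    ∑ j ∈ w.vars, HahnSeries.single (-((i : ℤ) + j + 2))
        ((-1 : Fock) ^ i * ((i + j + 1).choose i : Fock)) *
      F (((j : Fock) + 1) * MvPolynomial.pderiv j w)

/-- The vertex operator map: `Y(α_{-i₁-1} ⋯ α_{-i_s-1} 𝟏, x)` is the normally ordered product of
the fields `(1/i₁!) (d/dx)^{i₁} α(x), …, (1/i_s!) (d/dx)^{i_s} α(x)`. -/
def vertexOp (v w : Fock) : LaurentSeries Fock :=
  ∑ s ∈ v.support, v.coeff s •
    ((Finsupp.toMultiset s).sort.foldr normalOrder (fun w => HahnSeries.single 0 w)) w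

/-- `M_a(1)`, with conformal vector `ω^a = ½ α_{-1}² 𝟏 + a α_{-2} 𝟏`. -/
def M (a : ℂ) : VertexData Fock where
  Y := vertexOp
  vac := 1
  omega := (1 / 2 : ℂ) • MvPolynomial.X 0 ^ 2 + a • MvPolynomial.X 1

/-- The generator `x = [α_{-1} 𝟏]` of the Zhu algebra `A_0(M_a(1))`. -/
def zhuX (a : ℂ) : (M a).ZhuAlgebra := (M a).zhuClass (MvPolynomial.X 0)

/-- The operator `α_n` as an element of `𝒰(V̂)`, `V = M_a(1)`. -/
def alpha (a : ℂ) (n : ℤ) : (M a).ModeAlgebra := (M a).gen (MvPolynomial.X 0) n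

/-- The `A_0(M_a(1))`-module `U(lam, k) = ℂ[x] / ((x - lam)^k)`, where `ℂ[x] = A_0(M_a(1))`. -/
abbrev U (a lam : ℂ) (k : ℕ) : Type :=
  (M a).ZhuAlgebra ⧸
    Ideal.span {(zhuX a - algebraMap ℂ (M a).ZhuAlgebra lam) ^ k}

/-- The `M_a(1)`-module `W(a, lam, k) = 𝔏_0(U(lam, k))`. -/
abbrev W (a lam : ℂ) (k : ℕ) : Type := (M a).L0 (U a lam k)

/-- The number `𝔭(ℓ)` of partitions of `ℓ`. -/
def numPartitions (ℓ : ℕ) : ℕ := Fintype.card (Nat.Partition ℓ)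

end Heisenberg

/-- A `k × k` block matrix with blocks of size `d × d` that is block upper triangular, has equal
diagonal blocks, and whose first block row `(A, C_1, …, C_{k-2}, B)` and last block column
`(B, C_{k-2}, …, C_1, A)`, read from the top, are reverse to each other. -/
structure IsInterlockedMatrix {k d : ℕ} (T : Matrix (Fin k × Fin d) (Fin k × Fin d) ℂ) : Prop where
  upper : ∀ i j : Fin k, j < i → ∀ s t : Fin d, T (i, s) (j, t) = 0
  diagonal : ∀ (i j : Fin k) (s t : Fin d), T (i, s) (i, t) = T (j, s) (j, t)
  reverse : ∀ i l j : Fin k, (i : ℕ) = 0 → (l : ℕ) + 1 = k →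
    ∀ s t : Fin d, T (i, s) (j, t) = T (j.rev, s) (l, t)

end

/-! Everything is realised on polynomials. For a commutative `ℂ`-algebra `R` and `t ∈ R`, the fields
of `M(1)` act on `R[α₋₁, α₋₂, …]` with `α₀` acting as `t` (`field`, `fieldMode`). The pair `(ℂ, 0)`
gives `V` itself, and `R = ℂ[τ]/(τ ^ k)` with `t = λ + τ` gives `M(1) ⊗ Ω(λ, k)`.

The hard input is the Jacobi identity for these fields (`fieldMode_jacobi`). Regard the difference
of its two sides as an operator in the last argument. Its commutator with a Heisenberg operator is a
combination of such differences for derivatives of the two states (`jacobiDefect_commutator`). By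
induction on the degrees of the states it commutes with all multiplications and all derivatives, so
it is multiplication by a constant (`eq_mul_of_commute`). For `t = 0` these constants satisfy one
recurrence from translation covariance and one from Pascal's rule, and with two explicit vacuum
evaluations they vanish. Over `(ℂ[x], x)` the derivative `d/dx` also commutes with the difference,
so the constant does not depend on `x`, and it vanishes at `x = 0`. Base change gives every `(R,
t)`.

On vectors of degree zero the zero mode of `v` is multiplication by `zeroMode t v`. Over `(ℂ[x], x)`
this is a map from the Zhu algebra to `ℂ[x]`. It is bijective, because modulo `O_0(V)` each `α₋ₙ₋₁`
can be replaced by `-α₋ₙ`. The resulting map from `M_0(U)` to the Fock module is onto, and its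
kernel is `J`: the degree zero part of `M_0(U)` is the image of `U`, and a nonzero Fock vector can
always be moved to a vector with nonzero degree zero component (`ker_M0ToFock`). Hence `W ≅ M(1) ⊗
ℂ[τ]/(τ ^ k)`.

A submodule of this Fock module is stable under `τ = α₀ - λ` and contains the coefficients of its
elements as vacuum vectors. So it comes from an ideal of `ℂ[τ]/(τ ^ k)`: the submodules are `ker τ ^
j = im τ ^ (k - j)` (`isUniserialFor_fockTrunc`), and the claims about socle, radical and chain are
formal consequences. Zero modes commute with `τ`, so in a basis of vectors `τ ^ m p` their matrices
are block Toeplitz (`exists_matrix`).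

For the converse, let `W` be indecomposable. As `α₀` is central, it has one generalized eigenvalue
`λ`. The operator `∑ α₋ₙ αₙ` is diagonalisable with eigenvalues in `ℕ`; its kernel `Ω` is
finite-dimensional, generates `W`, and carries the nilpotent `α₀ - λ`. A longest cyclic subspace of
`Ω` has an invariant complement, both parts generate complementary submodules of `W`, and so the
cyclic part generates everything (`exists_equiv_fockTrunc`). -/

noncomputable section

set_option linter.unusedSectionVars false

namespace Heisenberg

open MvPolynomial Filter

/-! ### Normally ordered products and the fields of `M(1)` over `(R, t)` -/

section Field

variable {R : Type*} [CommRing R] [Algebra ℂ R] (t : R)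

theorem mul_csmul (c : ℂ) (x y : LaurentSeries (MvPolynomial ℕ R)) :
    x * c • y = c • (x * y) := by
  have h : ∀ z : LaurentSeries (MvPolynomial ℕ R),
      c • z = HahnSeries.single 0 (algebraMap ℂ (MvPolynomial ℕ R) c) * z := fun z => by
    ext1
    funext n
    rw [HahnSeries.coeff_smul, HahnSeries.coeff_single_mul, sub_zero, Algebra.smul_def]
  rw [h, h, mul_left_comm]

/-- Coefficientwise application of a linear map to a Laurent series. -/
def coeffwise (B : MvPolynomial ℕ R →ₗ[ℂ] MvPolynomial ℕ R) :
    LaurentSeries (MvPolynomial ℕ R) →ₗ[ℂ] LaurentSeries (MvPolynomial ℕ R) where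
  toFun x := x.map B
  map_add' x y := by ext n; simp
  map_smul' c x := by ext n; simp

@[simp]
theorem coeffwise_coeff (B : MvPolynomial ℕ R →ₗ[ℂ] MvPolynomial ℕ R)
    (x : LaurentSeries (MvPolynomial ℕ R)) (n : ℤ) :
    (coeffwise B x).coeff n = B (x.coeff n) := rfl

theorem coeffwise_mul {B : MvPolynomial ℕ R →ₗ[ℂ] MvPolynomial ℕ R}
    (hB : ∀ p q, B (p * q) = B p * q + p * B q) (x y : LaurentSeries (MvPolynomial ℕ R)) :
    coeffwise B (x * y) = coeffwise B x * y + x * coeffwise B y := by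
  ext1
  funext n
  -- Applying `B` can only shrink supports, so all the products below may be summed over the
  -- antidiagonal of the original supports.
  have hx : (coeffwise B x).support ⊆ x.support := fun i hi h => hi (by simp [h])
  have hy : (coeffwise B y).support ⊆ y.support := fun i hi h => hi (by simp [h])
  rw [coeffwise_coeff, HahnSeries.coeff_add, HahnSeries.coeff_mul,
    HahnSeries.coeff_mul_left' x.isPWO_support hx, HahnSeries.coeff_mul_right' y.isPWO_support hy,
    map_sum, ← Finset.sum_add_distrib]
  exact Finset.sum_congr rfl fun ij _ => by simp only [coeffwise_coeff, hB]

/-- The part of the field `(1/i!) (d/dx)^i α(x)` that acts by multiplication, `α_0` acting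
as `t`. -/
def creationSeries (i : ℕ) : LaurentSeries (MvPolynomial ℕ R) :=
  HahnSeries.ofPowerSeries ℤ _
    (PowerSeries.mk fun j => ((i + j).choose i : MvPolynomial ℕ R) * X (i + j)) +
  HahnSeries.single (-((i : ℤ) + 1)) (C ((-1) ^ i * t))

/-- The coefficient of the annihilation operator `α_{j+1}` in `(1/i!) (d/dx)^i α(x)`. -/
def annihilationCoeff (R : Type*) [CommRing R] (i j : ℕ) : LaurentSeries (MvPolynomial ℕ R) :=
  HahnSeries.single (-((i : ℤ) + j + 2))
    ((-1 : MvPolynomial ℕ R) ^ i * ((i + j + 1).choose i : MvPolynomial ℕ R))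

/-- Derivatives in absent variables vanish, so the index set may be enlarged at will. This is what
makes a sum over `w.vars` additive in `w`. -/
theorem sum_vars_eq {A : Type*} [AddCommMonoid A] (w : MvPolynomial ℕ R) (S : Finset ℕ)
    (hS : w.vars ⊆ S) (f : ℕ → MvPolynomial ℕ R → A) (hf : ∀ k, f k 0 = 0) :
    ∑ k ∈ w.vars, f k (pderiv k w) = ∑ k ∈ S, f k (pderiv k w) :=
  Finset.sum_subset hS fun k _ hk => by rw [pderiv_eq_zero_of_notMem_vars hk, hf]

/-- The normally ordered product of `(1/i!) (d/dx)^i α(x)` with a linear field. -/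
def normalProd (i : ℕ) (F : MvPolynomial ℕ R →ₗ[ℂ] LaurentSeries (MvPolynomial ℕ R)) :
    MvPolynomial ℕ R →ₗ[ℂ] LaurentSeries (MvPolynomial ℕ R) where
  toFun w := creationSeries t i * F w +
    ∑ k ∈ w.vars, annihilationCoeff R i k * F (((k : MvPolynomial ℕ R) + 1) * pderiv k w)
  map_add' w w' := by
    classical
    have hS : w.vars ⊆ w.vars ∪ w'.vars ∪ (w + w').vars := by
      intro x hx; simp [hx]
    have hS' : w'.vars ⊆ w.vars ∪ w'.vars ∪ (w + w').vars := by
      intro x hx; simp [hx]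
    have hS'' : (w + w').vars ⊆ w.vars ∪ w'.vars ∪ (w + w').vars := by
      intro x hx; simp only [Finset.mem_union]; exact Or.inr hx
    rw [sum_vars_eq w _ hS (fun k p => annihilationCoeff R i k * F (((k : _) + 1) * p)) (by simp),
      sum_vars_eq w' _ hS' (fun k p => annihilationCoeff R i k * F (((k : _) + 1) * p)) (by simp),
      sum_vars_eq (w + w') _ hS'' (fun k p => annihilationCoeff R i k * F (((k : _) + 1) * p))
        (by simp)]
    simp only [map_add, mul_add, Finset.sum_add_distrib]
    abel
  map_smul' c w := by
    classical
    have hS : w.vars ⊆ w.vars ∪ (c • w).vars := Finset.subset_union_left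
    have hS' : (c • w).vars ⊆ w.vars ∪ (c • w).vars := Finset.subset_union_right
    rw [sum_vars_eq w _ hS (fun k p => annihilationCoeff R i k * F (((k : _) + 1) * p)) (by simp),
      sum_vars_eq (c • w) _ hS' (fun k p => annihilationCoeff R i k * F (((k : _) + 1) * p))
        (by simp)]
    have hp : ∀ k, pderiv k (c • w) = c • pderiv k w := fun k => by
      rw [← algebraMap_smul R c w, Derivation.map_smul, algebraMap_smul]
    simp only [hp, map_smul, mul_csmul, mul_smul_comm, Finset.smul_sum, smul_add, RingHom.id_apply]

theorem normalProd_apply (i : ℕ) (F : MvPolynomial ℕ R →ₗ[ℂ] LaurentSeries (MvPolynomial ℕ R))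
    (w : MvPolynomial ℕ R) : normalProd t i F w = creationSeries t i * F w +
    ∑ k ∈ w.vars, annihilationCoeff R i k * F (((k : MvPolynomial ℕ R) + 1) * pderiv k w) := rfl

/-- With the index set `Finset.range m` for all large `m`, finitely many such expansions can be
brought to a common `m` by intersecting eventual statements. Finite sums of unspecified length are
handled in this way from here on. -/
theorem normalProd_eventually (i : ℕ)
    (F : MvPolynomial ℕ R →ₗ[ℂ] LaurentSeries (MvPolynomial ℕ R)) (w : MvPolynomial ℕ R) :
    ∀ᶠ m in atTop, normalProd t i F w = creationSeries t i * F w +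
    ∑ k ∈ Finset.range m,
      annihilationCoeff R i k * F (((k : MvPolynomial ℕ R) + 1) * pderiv k w) := by
  filter_upwards [eventually_gt_atTop (w.vars.sup id)] with m hm
  rw [normalProd_apply, sum_vars_eq w (Finset.range m) (fun k hk => Finset.mem_range.2
    (lt_of_le_of_lt (Finset.le_sup (f := id) hk) hm))
    (fun k p => annihilationCoeff R i k * F (((k : _) + 1) * p)) (by simp)]

theorem normalProd_add (i : ℕ) (F G : MvPolynomial ℕ R →ₗ[ℂ] LaurentSeries (MvPolynomial ℕ R)) :
    normalProd t i (F + G) = normalProd t i F + normalProd t i G := by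
  refine LinearMap.ext fun w => ?_
  simp only [normalProd_apply, LinearMap.add_apply, mul_add, Finset.sum_add_distrib]
  abel

theorem normalProd_smul (i : ℕ) (c : ℂ)
    (F : MvPolynomial ℕ R →ₗ[ℂ] LaurentSeries (MvPolynomial ℕ R)) :
    normalProd t i (c • F) = c • normalProd t i F := by
  refine LinearMap.ext fun w => ?_
  simp only [normalProd_apply, LinearMap.smul_apply, mul_csmul, Finset.smul_sum, smul_add]

/-- `normalProd` as a linear operator on fields. -/
def normalProdHom (i : ℕ) : (MvPolynomial ℕ R →ₗ[ℂ] LaurentSeries (MvPolynomial ℕ R)) →ₗ[ℂ]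
    (MvPolynomial ℕ R →ₗ[ℂ] LaurentSeries (MvPolynomial ℕ R)) where
  toFun := normalProd t i
  map_add' := normalProd_add t i
  map_smul' := normalProd_smul t i

theorem pderiv_comm (k l : ℕ) (w : MvPolynomial ℕ R) :
    pderiv k (pderiv l w) = pderiv l (pderiv k w) := by
  classical
  induction w using MvPolynomial.induction_on with
  | C a => simp
  | add p q hp hq => simp only [map_add, hp, hq]
  | mul_X p i hp =>
    simp only [pderiv_mul, map_add, hp, pderiv_X, Pi.single_apply]
    split_ifs <;> simp [add_comm, add_left_comm]

theorem pderiv_natCast_add_one_mul (k l : ℕ) (w : MvPolynomial ℕ R) :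
    pderiv l (((k : MvPolynomial ℕ R) + 1) * w) = ((k : MvPolynomial ℕ R) + 1) * pderiv l w := by
  rw [pderiv_mul, map_add, Derivation.map_natCast, pderiv_one, add_zero, zero_mul, zero_add]

/-- The annihilation operators of the outer factor act on `w` before the inner creation part is
multiplied in, so no contraction terms occur. The result is visibly symmetric in `i` and `j`, up to
the order of derivatives. -/
theorem normalProd_normalProd_eventually (i j : ℕ)
    (F : MvPolynomial ℕ R →ₗ[ℂ] LaurentSeries (MvPolynomial ℕ R)) (w : MvPolynomial ℕ R) :
    ∀ᶠ m in atTop, normalProd t i (normalProd t j F) w =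
      creationSeries t i * (creationSeries t j * F w) +
      ∑ k ∈ Finset.range m, (creationSeries t i * annihilationCoeff R j k +
        creationSeries t j * annihilationCoeff R i k) *
          F (((k : MvPolynomial ℕ R) + 1) * pderiv k w) +
      ∑ k ∈ Finset.range m, ∑ l ∈ Finset.range m, annihilationCoeff R i k *
        annihilationCoeff R j l * F (((k : MvPolynomial ℕ R) + 1) *
          (((l : MvPolynomial ℕ R) + 1) * pderiv l (pderiv k w))) := by
  have h2 : ∀ᶠ m in atTop, ∀ k ∈ w.vars,
      normalProd t j F (((k : MvPolynomial ℕ R) + 1) * pderiv k w) =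
      creationSeries t j * F (((k : MvPolynomial ℕ R) + 1) * pderiv k w) +
      ∑ l ∈ Finset.range m, annihilationCoeff R j l * F (((l : MvPolynomial ℕ R) + 1) *
        pderiv l (((k : MvPolynomial ℕ R) + 1) * pderiv k w)) :=
    (eventually_all_finset _).2 fun k _ =>
      normalProd_eventually t j F (((k : MvPolynomial ℕ R) + 1) * pderiv k w)
  filter_upwards [normalProd_eventually t i (normalProd t j F) w,
    normalProd_eventually t j F w, h2] with m h1 h3 h2
  rw [h1, h3]
  have : ∀ k ∈ Finset.range m, annihilationCoeff R i k *
      normalProd t j F (((k : MvPolynomial ℕ R) + 1) * pderiv k w) =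
      annihilationCoeff R i k * (creationSeries t j *
        F (((k : MvPolynomial ℕ R) + 1) * pderiv k w)) +
      ∑ l ∈ Finset.range m, annihilationCoeff R i k *
        annihilationCoeff R j l * F (((k : MvPolynomial ℕ R) + 1) *
        (((l : MvPolynomial ℕ R) + 1) * pderiv l (pderiv k w))) := by
    intro k _
    by_cases hk : k ∈ w.vars
    · rw [h2 k hk, mul_add, Finset.mul_sum]
      congr 1
      refine Finset.sum_congr rfl fun l _ => ?_
      rw [mul_assoc, pderiv_natCast_add_one_mul, mul_left_comm ((l : MvPolynomial ℕ R) + 1)]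
    · simp [pderiv_eq_zero_of_notMem_vars hk]
  rw [Finset.sum_congr rfl this]
  clear this h1 h2 h3
  generalize annihilationCoeff R i = a, annihilationCoeff R j = b, creationSeries t i = c,
    creationSeries t j = d
  rw [Finset.sum_add_distrib, mul_add, Finset.mul_sum, ← add_assoc,
    add_assoc (c * (d * F w)), ← Finset.sum_add_distrib]
  congr 2
  exact Finset.sum_congr rfl fun k _ => by ring

/-- Needed so that a monomial, which is a multiset of variables, determines a field by
`Multiset.foldr`. -/
theorem normalProd_comm (i j : ℕ)
    (F : MvPolynomial ℕ R →ₗ[ℂ] LaurentSeries (MvPolynomial ℕ R)) :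
    normalProd t i (normalProd t j F) = normalProd t j (normalProd t i F) := by
  refine LinearMap.ext fun w => ?_
  obtain ⟨m, h1, h2⟩ := ((normalProd_normalProd_eventually t i j F w).and
    (normalProd_normalProd_eventually t j i F w)).exists
  rw [h1, h2]
  clear h1 h2
  refine congr_arg₂ (· + ·) (congr_arg₂ (· + ·) (mul_left_comm _ _ _) ?_) ?_
  · exact Finset.sum_congr rfl fun k _ => congr_arg (· * _) (add_comm _ _)
  · refine Finset.sum_comm.trans
      (Finset.sum_congr rfl fun k _ => Finset.sum_congr rfl fun l _ => ?_)
    rw [pderiv_comm k l, mul_comm (annihilationCoeff R i l),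
      mul_left_comm ((k : MvPolynomial ℕ R) + 1)]

instance : LeftCommutative (fun (i : ℕ)
    (F : MvPolynomial ℕ R →ₗ[ℂ] LaurentSeries (MvPolynomial ℕ R)) => normalProd t i F) :=
  ⟨fun i j F => normalProd_comm t i j F⟩

/-- The identity field. -/
def idField : MvPolynomial ℕ R →ₗ[ℂ] LaurentSeries (MvPolynomial ℕ R) where
  toFun w := HahnSeries.single 0 w
  map_add' := HahnSeries.single_add _
  map_smul' c w := by ext n; by_cases h : n = 0 <;> simp [h]

/-- The vertex operators of `M(1)` on `R[α_{-1}, α_{-2}, …]`, where `α_0` acts as `t`. -/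
def field : Fock →ₗ[ℂ] MvPolynomial ℕ R →ₗ[ℂ] LaurentSeries (MvPolynomial ℕ R) :=
  (basisMonomials ℕ ℂ).constr ℂ fun s =>
    (Finsupp.toMultiset s).foldr (fun i F => normalProd t i F) idField

theorem field_monomial (s : ℕ →₀ ℕ) (c : ℂ) : field t (monomial s c) =
    c • (Finsupp.toMultiset s).foldr (fun i F => normalProd t i F) idField := by
  rw [← mul_one c, ← smul_eq_mul, ← smul_monomial, map_smul, smul_eq_mul, mul_one]
  congr 1
  exact (basisMonomials ℕ ℂ).constr_basis ℂ _ s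

theorem field_one : field t 1 = idField := by
  have := field_monomial t 0 1
  simpa using this

theorem field_X_mul (i : ℕ) (v : Fock) : field t (X i * v) = normalProd t i (field t v) := by
  suffices h : (field t) ∘ₗ LinearMap.mulLeft ℂ (X i) = (normalProdHom t i) ∘ₗ (field t) from
    congr($h v)
  refine (basisMonomials ℕ ℂ).ext fun s => ?_
  simp only [coe_basisMonomials, LinearMap.comp_apply, LinearMap.mulLeft_apply]
  rw [X, monomial_mul, field_monomial, field_monomial, map_add, Finsupp.toMultiset_single,
    one_smul, Multiset.singleton_add, Multiset.foldr_cons, mul_one, one_smul, one_smul]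
  rfl

end Field

end Heisenberg

namespace Heisenberg

open MvPolynomial Filter

/-! ### Commutators of Heisenberg operators with fields -/

section Commutator

variable {R : Type*} [CommRing R] [Algebra ℂ R] (t : R)

/-- The product of a field with a fixed Laurent series. -/
def mulField (g : LaurentSeries (MvPolynomial ℕ R))
    (F : MvPolynomial ℕ R →ₗ[ℂ] LaurentSeries (MvPolynomial ℕ R)) :
    MvPolynomial ℕ R →ₗ[ℂ] LaurentSeries (MvPolynomial ℕ R) where
  toFun w := g * F w
  map_add' w w' := by rw [map_add, mul_add]
  map_smul' c w := by rw [map_smul, mul_csmul, RingHom.id_apply]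

/-- The commutator of an operator on the state space with a field. -/
def fieldComm (B : MvPolynomial ℕ R →ₗ[ℂ] MvPolynomial ℕ R)
    (F : MvPolynomial ℕ R →ₗ[ℂ] LaurentSeries (MvPolynomial ℕ R)) :
    MvPolynomial ℕ R →ₗ[ℂ] LaurentSeries (MvPolynomial ℕ R) :=
  coeffwise B ∘ₗ F - F ∘ₗ B

/-- The monomial `(s choose i) x^{s-i}`. -/
def binomSeries (R : Type*) [CommRing R] (s : ℤ) (i : ℕ) : LaurentSeries (MvPolynomial ℕ R) :=
  HahnSeries.single (s - i) ((Ring.choose s i : ℤ) : MvPolynomial ℕ R)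

/-- `B` commutes with the normally ordered product up to `κ (s choose i) x^{s-i}`, as the
operator `α_{s+1}` does. -/
def IsModeLike (B : MvPolynomial ℕ R →ₗ[ℂ] MvPolynomial ℕ R) (κ s : ℤ) : Prop :=
  ∀ (i : ℕ) (F : MvPolynomial ℕ R →ₗ[ℂ] LaurentSeries (MvPolynomial ℕ R)),
    fieldComm B (normalProd t i F) =
      normalProd t i (fieldComm B F) + κ • mulField (binomSeries R s i) F

theorem mulField_normalProd (g : LaurentSeries (MvPolynomial ℕ R)) (i : ℕ)
    (F : MvPolynomial ℕ R →ₗ[ℂ] LaurentSeries (MvPolynomial ℕ R)) :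
    mulField g (normalProd t i F) = normalProd t i (mulField g F) := by
  refine LinearMap.ext fun w => ?_
  change g * normalProd t i F w = _
  rw [normalProd_apply, normalProd_apply, mul_add, Finset.mul_sum, mul_left_comm]
  exact congr_arg₂ (· + ·) rfl (Finset.sum_congr rfl fun k _ => mul_left_comm _ _ _)

theorem mulField_zero (g : LaurentSeries (MvPolynomial ℕ R)) : mulField g 0 = 0 :=
  LinearMap.ext fun _ => mul_zero g

theorem mulField_add (g : LaurentSeries (MvPolynomial ℕ R))
    (F G : MvPolynomial ℕ R →ₗ[ℂ] LaurentSeries (MvPolynomial ℕ R)) :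
    mulField g (F + G) = mulField g F + mulField g G :=
  LinearMap.ext fun _ => mul_add g _ _

theorem fieldComm_add (B : MvPolynomial ℕ R →ₗ[ℂ] MvPolynomial ℕ R)
    (F G : MvPolynomial ℕ R →ₗ[ℂ] LaurentSeries (MvPolynomial ℕ R)) :
    fieldComm B (F + G) = fieldComm B F + fieldComm B G := by
  simp only [fieldComm, LinearMap.comp_add, LinearMap.add_comp]
  abel

theorem fieldComm_smul (B : MvPolynomial ℕ R →ₗ[ℂ] MvPolynomial ℕ R) (c : ℂ)
    (F : MvPolynomial ℕ R →ₗ[ℂ] LaurentSeries (MvPolynomial ℕ R)) :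
    fieldComm B (c • F) = c • fieldComm B F := by
  refine LinearMap.ext fun w => ?_
  change coeffwise B (c • F w) - c • F (B w) = c • (coeffwise B (F w) - F (B w))
  rw [map_smul]
  ext1
  funext n
  simp only [HahnSeries.coeff_sub, HahnSeries.coeff_smul, smul_sub]

theorem fieldComm_idField (B : MvPolynomial ℕ R →ₗ[ℂ] MvPolynomial ℕ R) :
    fieldComm B idField = 0 := by
  refine LinearMap.ext fun w => ?_
  ext1
  funext n
  by_cases h : n = 0 <;> simp [fieldComm, idField, h]

/-- Each factor of the normally ordered product contributes one contraction. In the induction the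
new factor `X j` contributes the summand `i = j`, which is the extra term of the Leibniz rule for
`pderiv i (X j * p)`. -/
theorem fieldComm_field {B : MvPolynomial ℕ R →ₗ[ℂ] MvPolynomial ℕ R} {κ s : ℤ}
    (hB : IsModeLike t B κ s) (v : Fock) : ∀ᶠ m in atTop, fieldComm B (field t v) =
      κ • ∑ i ∈ Finset.range m, mulField (binomSeries R s i) (field t (pderiv i v)) := by
  induction v using MvPolynomial.induction_on with
  | C a =>
    refine Eventually.of_forall fun m => ?_
    rw [← mul_one (C a), ← smul_eq_C_mul, map_smul, field_one, fieldComm_smul, fieldComm_idField]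
    simp [mulField_zero]
  | add p q hp hq =>
    filter_upwards [hp, hq] with m hp hq
    simp only [map_add, fieldComm_add, hp, hq, mulField_add, Finset.sum_add_distrib, smul_add]
  | mul_X p j hp =>
    filter_upwards [hp, eventually_gt_atTop j] with m hp hj
    rw [mul_comm, field_X_mul, hB, hp]
    have h1 : ∀ i, mulField (binomSeries R s i) (field t (pderiv i (X j * p))) =
        normalProd t j (mulField (binomSeries R s i) (field t (pderiv i p))) +
        if j = i then mulField (binomSeries R s j) (field t p) else 0 := by
      intro i
      classical
      rw [pderiv_mul, pderiv_X, Pi.single_apply, map_add, mulField_add, field_X_mul,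
        mulField_normalProd, add_comm]
      split_ifs with h
      · rw [h, one_mul]
      · rw [zero_mul, map_zero, mulField_zero]
    have h2 : ∀ F, normalProd t j F = normalProdHom t j F := fun _ => rfl
    simp only [h1, h2, Finset.sum_add_distrib, smul_add, map_zsmul, map_sum, Finset.sum_ite_eq,
      Finset.mem_range, hj, if_true]

/-- The mode `v_q` of the field `field t v`. -/
def fieldMode (v : Fock) (q : ℤ) : MvPolynomial ℕ R →ₗ[ℂ] MvPolynomial ℕ R where
  toFun w := (field t v w).coeff (-q - 1)
  map_add' w w' := by rw [map_add, HahnSeries.coeff_add]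
  map_smul' c w := by rw [map_smul, HahnSeries.coeff_smul, RingHom.id_apply]

theorem fieldMode_apply (v : Fock) (q : ℤ) (w : MvPolynomial ℕ R) :
    fieldMode t v q w = (field t v w).coeff (-q - 1) := rfl

theorem coeff_sum {ι A : Type*} [AddCommMonoid A] (S : Finset ι) (f : ι → LaurentSeries A)
    (n : ℤ) : (∑ i ∈ S, f i).coeff n = ∑ i ∈ S, (f i).coeff n := by
  classical
  induction S using Finset.induction_on with
  | empty => simp
  | insert a S ha ih => rw [Finset.sum_insert ha, Finset.sum_insert ha, HahnSeries.coeff_add, ih]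

theorem coeff_zsmul (κ : ℤ) (x : LaurentSeries (MvPolynomial ℕ R)) (n : ℤ) :
    (κ • x).coeff n = κ • x.coeff n := by
  rw [← Int.cast_smul_eq_zsmul ℂ, ← Int.cast_smul_eq_zsmul ℂ, HahnSeries.coeff_smul]

theorem fieldMode_commutator {B : MvPolynomial ℕ R →ₗ[ℂ] MvPolynomial ℕ R} {κ s : ℤ}
    (hB : IsModeLike t B κ s) (v : Fock) : ∀ᶠ m in atTop, ∀ (q : ℤ) (w : MvPolynomial ℕ R),
      B (fieldMode t v q w) - fieldMode t v q (B w) = κ • ∑ i ∈ Finset.range m,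
        Ring.choose s i • fieldMode t (pderiv i v) (s + q - i) w := by
  filter_upwards [fieldComm_field t hB v] with m hm q w
  have h := congr_arg (fun x => x.coeff (-q - 1)) (DFunLike.congr_fun hm w)
  simp only [LinearMap.smul_apply, LinearMap.sum_apply, coeff_zsmul, coeff_sum] at h
  refine h.trans (congr_arg _ (Finset.sum_congr rfl fun i _ => ?_))
  change (binomSeries R s i * field t (pderiv i v) w).coeff (-q - 1) = _
  rw [binomSeries, HahnSeries.coeff_single_mul, fieldMode_apply, zsmul_eq_mul]
  congr 2
  ring

/-- A derivation that commutes with all `pderiv k` kills integers and hence the annihilation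
coefficients, so it sees a normally ordered product only through the creation series. -/
theorem isModeLike_of_derivation {B : MvPolynomial ℕ R →ₗ[ℂ] MvPolynomial ℕ R} {s : ℤ}
    (hB : ∀ p q, B (p * q) = B p * q + p * B q) (hd : ∀ k w, B (pderiv k w) = pderiv k (B w))
    (hc : ∀ i, coeffwise B (creationSeries t i) = binomSeries R s i) : IsModeLike t B 1 s := by
  have hB1 : B 1 = 0 := by simpa using hB 1 1
  have hBn : ∀ n : ℕ, B n = 0 := fun n => by
    rw [← nsmul_one, map_nsmul, hB1, smul_zero]
  have hBi : ∀ (i : ℕ), B ((-1) ^ i) = 0 := fun i => by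
    rcases neg_one_pow_eq_or (MvPolynomial ℕ R) i with h | h <;> simp [h, hB1]
  intro i F
  refine LinearMap.ext fun w => ?_
  obtain ⟨m, h1, h2, h3⟩ := ((normalProd_eventually t i F w).and
    ((normalProd_eventually t i F (B w)).and
      (normalProd_eventually t i (fieldComm B F) w))).exists
  simp only [one_smul, LinearMap.add_apply]
  rw [h3]
  change coeffwise B (normalProd t i F w) - normalProd t i F (B w) = _ + _ * _
  rw [h1, h2, map_add, coeffwise_mul hB, hc, map_sum]
  have h4 : ∀ k, coeffwise B (annihilationCoeff R i k) = 0 := fun k => by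
    ext1
    funext n
    rw [coeffwise_coeff, annihilationCoeff, HahnSeries.coeff_single]
    split_ifs
    · rw [hB, hBn, hBi]; simp
    · simp
  have h5 : ∀ k, coeffwise B (annihilationCoeff R i k *
      F (((k : MvPolynomial ℕ R) + 1) * pderiv k w)) =
      annihilationCoeff R i k * F (((k : MvPolynomial ℕ R) + 1) * pderiv k (B w)) +
      annihilationCoeff R i k * fieldComm B F (((k : MvPolynomial ℕ R) + 1) * pderiv k w) := by
    intro k
    rw [coeffwise_mul hB, h4, zero_mul, zero_add, ← mul_add]
    congr 1
    have : B (((k : MvPolynomial ℕ R) + 1) * pderiv k w) =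
        ((k : MvPolynomial ℕ R) + 1) * pderiv k (B w) := by
      rw [hB, map_add, hBn, hB1, hd]; simp
    change _ = _ + (coeffwise B (F _) - F (B _))
    rw [this]
    abel
  simp only [h5, Finset.sum_add_distrib]
  change _ = creationSeries t i * (coeffwise B (F w) - F (B w)) + _ + _
  rw [mul_sub]
  abel

end Commutator

end Heisenberg

namespace Heisenberg

open MvPolynomial Filter

/-! ### The operators `αₙ`, `n ≠ 0`, and `d/dx` as mode-like operators -/

section ModeLike

variable {R : Type*} [CommRing R] [Algebra ℂ R] (t : R)

theorem ofPowerSeries_coeff {A : Type*} [Semiring A] (f : PowerSeries A) (n : ℤ) :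
    (HahnSeries.ofPowerSeries ℤ A f).coeff n =
      if 0 ≤ n then PowerSeries.coeff n.toNat f else 0 := by
  have := PowerSeries.coeff_coe f n
  rw [this]
  split_ifs with h1 h2 h2
  · omega
  · rfl
  · congr; omega
  · omega

theorem creationSeries_coeff (i : ℕ) (n : ℤ) : (creationSeries t i).coeff n =
    (if 0 ≤ n then ((i + n.toNat).choose i : MvPolynomial ℕ R) * X (i + n.toNat) else 0) +
      if n = -((i : ℤ) + 1) then C ((-1) ^ i * t) else 0 := by
  rw [creationSeries, HahnSeries.coeff_add, ofPowerSeries_coeff, HahnSeries.coeff_single,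
    PowerSeries.coeff_mk]
  congr

/-- Partial derivatives as `ℂ`-linear operators. -/
def pderivC (R : Type*) [CommRing R] [Algebra ℂ R] (k : ℕ) :
    MvPolynomial ℕ R →ₗ[ℂ] MvPolynomial ℕ R :=
  (pderiv (R := R) k).toLinearMap.restrictScalars ℂ

@[simp]
theorem pderivC_apply (k : ℕ) (w : MvPolynomial ℕ R) : pderivC R k w = pderiv k w := rfl

/-- The creation series contains `X k` only in the coefficient of `x ^ (k - i)`, with factor
`k.choose i`. For `k < i` it does not occur at all, and the binomial coefficient vanishes too. -/
theorem isModeLike_pderiv (k : ℕ) : IsModeLike t (pderivC R k) 1 k := by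
  classical
  refine isModeLike_of_derivation t (fun p q => by simp [mul_comm, add_comm])
    (fun l w => pderiv_comm k l w) fun i => ?_
  ext1
  funext n
  rw [coeffwise_coeff, creationSeries_coeff, binomSeries, HahnSeries.coeff_single,
    Ring.choose_natCast, map_add, pderivC_apply, pderivC_apply]
  have h1 : pderiv k (if n = -((i : ℤ) + 1) then C ((-1) ^ i * t) else 0) = 0 := by
    split_ifs
    · exact pderiv_C
    · exact map_zero _
  rw [h1, add_zero]
  split_ifs with h2 h3 h3
  · have h4 : i + n.toNat = k := by omega
    rw [h4]
    simp
  · rw [pderiv_mul, pderiv_X_of_ne (by omega), Derivation.map_natCast]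
    simp
  · rw [Nat.choose_eq_zero_of_lt (by omega)]
    simp
  · simp

theorem choose_neg_add_two (k i : ℕ) :
    Ring.choose (-(k : ℤ) - 2) i = (-1) ^ i * ((i + k + 1).choose i : ℤ) := by
  have h := Ring.choose_neg ((k : ℤ) + 2) i
  rw [show (-(k : ℤ) - 2) = -((k : ℤ) + 2) by ring, h,
    show (k : ℤ) + 2 + i - 1 = ((i + k + 1 : ℕ) : ℤ) by push_cast; ring, Ring.choose_natCast,
    Units.smul_def, smul_eq_mul, Int.negOnePow]
  simp

/-- Multiplication by `X k` as a `ℂ`-linear operator. -/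
def mulX (R : Type*) [CommRing R] [Algebra ℂ R] (k : ℕ) :
    MvPolynomial ℕ R →ₗ[ℂ] MvPolynomial ℕ R :=
  LinearMap.mulLeft ℂ (X k)

@[simp]
theorem mulX_apply (k : ℕ) (w : MvPolynomial ℕ R) : mulX R k w = X k * w := rfl

theorem coeffwise_mulX (k : ℕ) (x : LaurentSeries (MvPolynomial ℕ R)) :
    coeffwise (mulX R k) x = HahnSeries.single 0 (X k) * x := by
  ext1
  funext n
  rw [coeffwise_coeff, HahnSeries.coeff_single_mul, sub_zero, mulX_apply]

/-- Multiplication by `X k` commutes with the creation part. The only correction comes from `pderiv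
k (X k * w) = X k * pderiv k w + w`, which leaves `k + 1` times the annihilation coefficient, and
that is `x ^ (-k-2-i)` times the binomial `(-k-2 choose i)`. -/
theorem isModeLike_mulX (k : ℕ) : IsModeLike t (mulX R k) (-((k : ℤ) + 1)) (-(k : ℤ) - 2) := by
  classical
  intro i F
  refine LinearMap.ext fun w => ?_
  obtain ⟨m, h1, h2, h3, h4⟩ := ((normalProd_eventually t i F w).and
    ((normalProd_eventually t i F (X k * w)).and
      ((normalProd_eventually t i (fieldComm (mulX R k) F) w).and
        (eventually_gt_atTop k)))).exists
  have hL : fieldComm (mulX R k) (normalProd t i F) w =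
    coeffwise (mulX R k) (normalProd t i F w) - normalProd t i F (X k * w) := rfl
  have hR : mulField (binomSeries R (-(k : ℤ) - 2) i) F w =
    binomSeries R (-(k : ℤ) - 2) i * F w := rfl
  rw [LinearMap.add_apply, LinearMap.smul_apply, h3, hL, hR]
  have h5 : ∀ l : ℕ, F (((l : MvPolynomial ℕ R) + 1) * pderiv l (X k * w)) =
      F (X k * (((l : MvPolynomial ℕ R) + 1) * pderiv l w)) +
      if k = l then F (((k : MvPolynomial ℕ R) + 1) * w) else 0 := by
    intro l
    rw [← map_zero F, ← apply_ite F, ← map_add, pderiv_mul, pderiv_X, Pi.single_apply]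
    congr 1
    split_ifs with h
    · subst h; ring
    · ring
  have h6 : F (((k : MvPolynomial ℕ R) + 1) * w) = ((k : ℤ) + 1) • F w := by
    rw [← map_zsmul, zsmul_eq_mul]
    push_cast
    rfl
  have h7 : annihilationCoeff R i k = binomSeries R (-(k : ℤ) - 2) i := by
    rw [annihilationCoeff, binomSeries, choose_neg_add_two]
    push_cast
    congr 2
    ring
  have h8 : ∀ w, fieldComm (mulX R k) F w = HahnSeries.single 0 (X k) * F w - F (X k * w) :=
    fun w => by
      rw [← coeffwise_mulX]
      rfl
  have h9 : ∑ l ∈ Finset.range m,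
      annihilationCoeff R i l * F (((l : MvPolynomial ℕ R) + 1) * pderiv l (X k * w)) =
      (∑ l ∈ Finset.range m,
        annihilationCoeff R i l * F (X k * (((l : MvPolynomial ℕ R) + 1) * pderiv l w))) +
      annihilationCoeff R i k * ((k : ℤ) + 1) • F w := by
    rw [← h6, ← Finset.sum_ite_eq_of_mem (Finset.range m) k
      (fun l => annihilationCoeff R i l * F (((k : MvPolynomial ℕ R) + 1) * w))
      (Finset.mem_range.2 h4), ← Finset.sum_add_distrib]
    refine Finset.sum_congr rfl fun l _ => ?_
    rw [h5, mul_add, mul_ite, mul_zero]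
  have h10 : ∑ l ∈ Finset.range m, annihilationCoeff R i l *
      fieldComm (mulX R k) F (((l : MvPolynomial ℕ R) + 1) * pderiv l w) =
      HahnSeries.single 0 (X k) * (∑ l ∈ Finset.range m,
        annihilationCoeff R i l * F (((l : MvPolynomial ℕ R) + 1) * pderiv l w)) -
      ∑ l ∈ Finset.range m,
        annihilationCoeff R i l * F (X k * (((l : MvPolynomial ℕ R) + 1) * pderiv l w)) := by
    rw [Finset.mul_sum, ← Finset.sum_sub_distrib]
    refine Finset.sum_congr rfl fun l _ => ?_
    rw [h8, mul_sub, mul_left_comm]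
  rw [h1, h2, coeffwise_mulX, h9, h10, h8, h7]
  generalize (∑ l ∈ Finset.range m,
    annihilationCoeff R i l * F (X k * (((l : MvPolynomial ℕ R) + 1) * pderiv l w))) = A,
    (∑ l ∈ Finset.range m,
        annihilationCoeff R i l * F (((l : MvPolynomial ℕ R) + 1) * pderiv l w)) = A',
    creationSeries t i = c, F w = f, F (X k * w) = f', binomSeries R (-(k : ℤ) - 2) i = b,
    (HahnSeries.single 0 (X k) : LaurentSeries (MvPolynomial ℕ R)) = x
  rw [zsmul_eq_mul, zsmul_eq_mul]
  push_cast
  ring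

/-- Coefficientwise derivative on `ℂ[x][α_{-1}, α_{-2}, …]`. -/
def derivCoeffFun (w : MvPolynomial ℕ (Polynomial ℂ)) : MvPolynomial ℕ (Polynomial ℂ) :=
  ∑ s ∈ w.support, monomial s (Polynomial.derivative (coeff s w))

theorem coeff_derivCoeffFun (w : MvPolynomial ℕ (Polynomial ℂ)) (s : ℕ →₀ ℕ) :
    coeff s (derivCoeffFun w) = Polynomial.derivative (coeff s w) := by
  classical
  rw [derivCoeffFun, MvPolynomial.coeff_sum]
  simp only [coeff_monomial, Finset.sum_ite_eq', mem_support_iff]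
  split_ifs with h
  · rfl
  · rw [not_not.1 h, map_zero]

/-- Coefficientwise derivative on `ℂ[x][α_{-1}, α_{-2}, …]`, as a linear map. -/
def derivCoeff : MvPolynomial ℕ (Polynomial ℂ) →ₗ[ℂ] MvPolynomial ℕ (Polynomial ℂ) where
  toFun := derivCoeffFun
  map_add' p q := by
    ext1 s
    simp only [coeff_derivCoeffFun, coeff_add, map_add]
  map_smul' c p := by
    ext1 s
    simp only [coeff_derivCoeffFun, coeff_smul, RingHom.id_apply]
    rw [Polynomial.derivative_smul]

theorem coeff_derivCoeff (w : MvPolynomial ℕ (Polynomial ℂ)) (s : ℕ →₀ ℕ) :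
    coeff s (derivCoeff w) = Polynomial.derivative (coeff s w) := coeff_derivCoeffFun w s

theorem derivCoeff_mul (p q : MvPolynomial ℕ (Polynomial ℂ)) :
    derivCoeff (p * q) = derivCoeff p * q + p * derivCoeff q := by
  classical
  ext1 s
  rw [coeff_derivCoeff, coeff_add, coeff_mul, coeff_mul, coeff_mul, map_sum,
    ← Finset.sum_add_distrib]
  exact Finset.sum_congr rfl fun x _ => by
    rw [Polynomial.derivative_mul, coeff_derivCoeff, coeff_derivCoeff]

theorem derivCoeff_C (r : Polynomial ℂ) : derivCoeff (C r) = C (Polynomial.derivative r) := by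
  classical
  ext1 s
  rw [coeff_derivCoeff, coeff_C, coeff_C]
  split_ifs <;> simp

theorem derivCoeff_X (k : ℕ) : derivCoeff (X k) = 0 := by
  classical
  ext1 s
  rw [coeff_derivCoeff, coeff_X, coeff_zero]
  split_ifs <;> simp

/-- With `α₀` acting as a formal parameter `x`, the derivative `d/dx` plays the part of an operator
conjugate to `α₀`. Only the `α₀`-term of the creation series depends on `x`, and its sign is the
binomial `(-1 choose i)`. -/
theorem isModeLike_derivCoeff : IsModeLike (Polynomial.X : Polynomial ℂ) derivCoeff 1 (-1) := by
  refine isModeLike_of_derivation _ derivCoeff_mul (fun k w => ?_) fun i => ?_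
  · ext1 s
    simp only [coeff_derivCoeff, coeff_pderiv]
    rw [Polynomial.derivative_mul, map_add, Polynomial.derivative_natCast,
      Polynomial.derivative_one, add_zero, mul_zero, add_zero]
  · ext1
    funext n
    have hn : ∀ j : ℕ, derivCoeff (j : MvPolynomial ℕ (Polynomial ℂ)) = 0 := fun j => by
      rw [← map_natCast C, derivCoeff_C, Polynomial.derivative_natCast, map_zero]
    have h1 : Ring.choose (-1 : ℤ) i = (-1) ^ i := by
      have h := Ring.choose_neg (1 : ℤ) i
      rw [h, show (1 : ℤ) + i - 1 = (i : ℤ) by ring, Ring.choose_natCast,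
        Units.smul_def, smul_eq_mul, Int.negOnePow]
      simp
    rw [coeffwise_coeff, creationSeries_coeff, binomSeries, HahnSeries.coeff_single, h1, map_add,
      apply_ite derivCoeff, apply_ite derivCoeff, derivCoeff_mul, hn, derivCoeff_X, derivCoeff_C,
      map_zero, zero_mul, mul_zero, add_zero, ite_self, zero_add,
      show -((i : ℤ) + 1) = -1 - i by ring]
    split_ifs
    · rcases Nat.even_or_odd i with h | h <;> simp [h.neg_one_pow]
    · rfl

end ModeLike

end Heisenberg

namespace Heisenberg

open MvPolynomial Filter

/-! ### The defect of the Jacobi identity and its commutators -/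

theorem finsum_eventually {A : Type*} [AddCommMonoid A] {f : ℕ → A} (h : ∀ᶠ i in atTop, f i = 0) :
    ∀ᶠ m in atTop, ∑ᶠ i, f i = ∑ i ∈ Finset.range m, f i := by
  obtain ⟨N, hN⟩ := eventually_atTop.1 h
  filter_upwards [eventually_ge_atTop N] with m hm
  refine finsum_eq_sum_of_support_subset _ fun i hi => ?_
  simp only [Finset.coe_range, Set.mem_Iio]
  by_contra hc
  exact hi (hN i (by omega))

/-- Vandermonde's convolution. Since `G` vanishes from `N` on, summing over a rectangle or over
antidiagonals gives the same as soon as both ranges reach `N`. -/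
theorem sum_choose_mul_choose {A : Type*} [AddCommGroup A] (p s : ℤ) (G : ℕ → A) {N M L : ℕ}
    (hG : ∀ n, N ≤ n → G n = 0) (hM : N ≤ M) (hL : N ≤ L) :
    ∑ i ∈ Finset.range M, ∑ k ∈ Finset.range L, (Ring.choose p i * Ring.choose s k) • G (i + k) =
      ∑ l ∈ Finset.range M, Ring.choose (p + s) l • G l := by
  have h1 : ∀ l ∈ Finset.range M, Ring.choose (p + s) l • G l =
      ∑ x ∈ Finset.HasAntidiagonal.antidiagonal l, (Ring.choose p x.1 * Ring.choose s x.2) • G (x.1 + x.2) := by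
    intro l _
    rw [Ring.add_choose_eq l (Commute.all p s), Finset.sum_smul]
    exact Finset.sum_congr rfl fun x hx => by rw [Finset.HasAntidiagonal.mem_antidiagonal.1 hx]
  rw [Finset.sum_congr rfl h1, ← Finset.sum_product', Finset.sum_sigma',
    ← Finset.sum_filter_of_ne (p := fun x => x.1 + x.2 < N)]
  · symm
    rw [← Finset.sum_filter_of_ne (p := fun x => x.2.1 + x.2.2 < N)]
    · refine Finset.sum_nbij' (fun x => (x.2.1, x.2.2)) (fun x => ⟨x.1 + x.2, x⟩) ?_ ?_ ?_ ?_ ?_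
      · rintro ⟨l, i, k⟩ h
        simp only [Finset.mem_filter, Finset.mem_sigma, Finset.mem_range, Finset.HasAntidiagonal.mem_antidiagonal,
          Finset.mem_product] at h ⊢
        omega
      · rintro ⟨i, k⟩ h
        have h3 := (Finset.mem_filter.1 h).2
        exact Finset.mem_filter.2 ⟨Finset.mem_sigma.2 ⟨Finset.mem_range.2 (lt_of_lt_of_le h3 hM),
          Finset.HasAntidiagonal.mem_antidiagonal.2 rfl⟩, h3⟩
      · rintro ⟨l, i, k⟩ h
        simp only [Finset.mem_filter, Finset.mem_sigma, Finset.mem_range,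
          Finset.HasAntidiagonal.mem_antidiagonal] at h
        obtain ⟨⟨_, rfl⟩, _⟩ := h
        rfl
      · rintro ⟨i, k⟩ _
        rfl
      · rintro ⟨l, i, k⟩ _
        rfl
    · rintro ⟨l, i, k⟩ _ h
      by_contra hc
      exact h (by rw [hG _ (by simpa using hc), smul_zero])
  · rintro ⟨i, k⟩ _ h
    by_contra hc
    exact h (by rw [hG _ (by simpa using hc), smul_zero])

theorem choose_mul_choose (s : ℤ) (j k : ℕ) :
    Ring.choose s (k + j) * Ring.choose ((k + j : ℕ) : ℤ) j =
      Ring.choose s j * Ring.choose (s - j) k := by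
  have h := Ring.choose_add_smul_choose (s - j) k j
  rw [sub_add_cancel, nsmul_eq_mul] at h
  rw [← h, Ring.choose_natCast, mul_comm]

section Defect

variable {R : Type*} [CommRing R] [Algebra ℂ R] (t : R)

theorem fieldMode_truncated (v : Fock) (w : MvPolynomial ℕ R) :
    ∃ N : ℤ, ∀ q, N ≤ q → fieldMode t v q w = 0 := by
  refine ⟨-(field t v w).order, fun q hq => ?_⟩
  exact HahnSeries.coeff_eq_zero_of_lt_order (by omega)

theorem fieldMode_truncated_nat (v : Fock) (w : MvPolynomial ℕ R) (n : ℤ) :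
    ∀ᶠ i : ℕ in atTop, fieldMode t v (n + i) w = 0 := by
  obtain ⟨N, hN⟩ := fieldMode_truncated t v w
  filter_upwards [eventually_ge_atTop (N - n).toNat] with i hi
  exact hN _ (by omega)

/-- `fieldMode` as a linear map in the field. -/
def fieldModeLin (q : ℤ) (w : MvPolynomial ℕ R) : Fock →ₗ[ℂ] MvPolynomial ℕ R where
  toFun v := fieldMode t v q w
  map_add' u v := by
    rw [fieldMode_apply, map_add, LinearMap.add_apply, HahnSeries.coeff_add]
    rfl
  map_smul' c v := by
    rw [fieldMode_apply, map_smul, LinearMap.smul_apply, HahnSeries.coeff_smul]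
    rfl

theorem fieldModeLin_apply (q : ℤ) (w : MvPolynomial ℕ R) (v : Fock) :
    fieldModeLin t q w v = fieldMode t v q w := rfl

@[simp]
theorem fieldMode_zero (q : ℤ) : fieldMode t 0 q = 0 :=
  LinearMap.ext fun w => map_zero (fieldModeLin t q w)

/-- The terms on the left hand side of the Jacobi identity. -/
def jacobiLeft (u v : Fock) (w : MvPolynomial ℕ R) (p q r : ℤ) (i : ℕ) : MvPolynomial ℕ R :=
  Ring.choose p i • fieldMode t (fieldMode (0 : ℂ) u (r + i) v) (p + q - i) w

/-- The terms on the right hand side of the Jacobi identity. -/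
def jacobiRight (u v : Fock) (w : MvPolynomial ℕ R) (p q r : ℤ) (i : ℕ) : MvPolynomial ℕ R :=
  ((-1 : ℤ) ^ i * Ring.choose r i) •
    (fieldMode t u (p + r - i) (fieldMode t v (q + i) w) -
      (r.negOnePow : ℤ) • fieldMode t v (q + r - i) (fieldMode t u (p + i) w))

/-- The difference of both sides of the Jacobi identity. -/
def jacobiDefect (u v : Fock) (w : MvPolynomial ℕ R) (p q r : ℤ) : MvPolynomial ℕ R :=
  ∑ᶠ i, jacobiLeft t u v w p q r i - ∑ᶠ i, jacobiRight t u v w p q r i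

theorem jacobiLeft_eventually (u v : Fock) (w : MvPolynomial ℕ R) (p q r : ℤ) :
    ∀ᶠ i in atTop, jacobiLeft t u v w p q r i = 0 := by
  filter_upwards [fieldMode_truncated_nat (0 : ℂ) u v r] with i hi
  rw [jacobiLeft, hi, fieldMode_zero, LinearMap.zero_apply, smul_zero]

theorem jacobiRight_eventually (u v : Fock) (w : MvPolynomial ℕ R) (p q r : ℤ) :
    ∀ᶠ i in atTop, jacobiRight t u v w p q r i = 0 := by
  filter_upwards [fieldMode_truncated_nat t u w p, fieldMode_truncated_nat t v w q] with i hi hi'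
  rw [jacobiRight, hi, hi', map_zero, map_zero, smul_zero, sub_zero, smul_zero]

theorem jacobiDefect_eventually (u v : Fock) (w : MvPolynomial ℕ R) (p q r : ℤ) :
    ∀ᶠ m in atTop, jacobiDefect t u v w p q r = ∑ i ∈ Finset.range m, jacobiLeft t u v w p q r i -
      ∑ i ∈ Finset.range m, jacobiRight t u v w p q r i := by
  filter_upwards [finsum_eventually (jacobiLeft_eventually t u v w p q r),
    finsum_eventually (jacobiRight_eventually t u v w p q r)] with m h1 h2
  rw [jacobiDefect, h1, h2]

theorem eventually_pderiv_eq_zero (v : Fock) : ∀ᶠ m in atTop, ∀ i, m ≤ i → pderiv i v = 0 := by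
  filter_upwards [eventually_gt_atTop (v.vars.sup id)] with m hm i hi
  exact pderiv_eq_zero_of_notMem_vars fun h => absurd (Finset.le_sup (f := id) h) (by simp; omega)

theorem fieldMode_commutator_of_le {B : MvPolynomial ℕ R →ₗ[ℂ] MvPolynomial ℕ R} {κ s : ℤ}
    (hB : IsModeLike t B κ s) {v : Fock} {m : ℕ} (hm : ∀ i, m ≤ i → pderiv i v = 0) (q : ℤ)
    (w : MvPolynomial ℕ R) :
    B (fieldMode t v q w) = fieldMode t v q (B w) + κ • ∑ i ∈ Finset.range m,
        Ring.choose s i • fieldMode t (pderiv i v) (s + q - i) w := by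
  obtain ⟨m', h1, h2⟩ := ((fieldMode_commutator t hB v).and (eventually_ge_atTop m)).exists
  rw [← sub_eq_iff_eq_add', h1, Finset.sum_subset (Finset.range_subset_range.2 h2) fun i _ hi => ?_]
  rw [hm i (by simpa using hi), fieldMode_zero, LinearMap.zero_apply, smul_zero]

/-- Leibniz rule for the two products of modes. The shift `s - j` of a mode index is absorbed by `p`
for derivatives of `u` and by `q` for derivatives of `v`, in both orders of the product. -/
theorem jacobiRight_commutator {B : MvPolynomial ℕ R →ₗ[ℂ] MvPolynomial ℕ R} {κ s : ℤ}
    (hB : IsModeLike t B κ s) {u v : Fock} {m : ℕ} (hu : ∀ i, m ≤ i → pderiv i u = 0)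
    (hv : ∀ i, m ≤ i → pderiv i v = 0) (w : MvPolynomial ℕ R) (p q r : ℤ) (i : ℕ) :
    B (jacobiRight t u v w p q r i) = jacobiRight t u v (B w) p q r i +
      κ • ∑ j ∈ Finset.range m, Ring.choose s j •
        (jacobiRight t (pderiv j u) v w (p + s - j) q r i +
          jacobiRight t u (pderiv j v) w p (q + s - j) r i) := by
  have key : ∀ {u v : Fock}, (∀ i, m ≤ i → pderiv i u = 0) → (∀ i, m ≤ i → pderiv i v = 0) →
      ∀ x y : ℤ, B (fieldMode t u x (fieldMode t v y w)) =
      fieldMode t u x (fieldMode t v y (B w)) + κ • ∑ j ∈ Finset.range m, Ring.choose s j •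
        (fieldMode t (pderiv j u) (s + x - j) (fieldMode t v y w) +
          fieldMode t u x (fieldMode t (pderiv j v) (s + y - j) w)) := by
    intro u v hu hv x y
    rw [fieldMode_commutator_of_le t hB hu, fieldMode_commutator_of_le t hB hv, map_add, map_zsmul,
      map_sum, add_assoc, ← smul_add, ← Finset.sum_add_distrib]
    simp only [map_zsmul, smul_add, add_comm]
  have h : ∑ j ∈ Finset.range m, Ring.choose s j •
        (jacobiRight t (pderiv j u) v w (p + s - j) q r i +
          jacobiRight t u (pderiv j v) w p (q + s - j) r i) =
      ((-1 : ℤ) ^ i * Ring.choose r i) •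
        ((∑ j ∈ Finset.range m, Ring.choose s j •
        (fieldMode t (pderiv j u) (s + (p + r - i) - j) (fieldMode t v (q + i) w) +
          fieldMode t u (p + r - i) (fieldMode t (pderiv j v) (s + (q + i) - j) w))) -
        (r.negOnePow : ℤ) • ∑ j ∈ Finset.range m, Ring.choose s j •
        (fieldMode t (pderiv j v) (s + (q + r - i) - j) (fieldMode t u (p + i) w) +
          fieldMode t v (q + r - i) (fieldMode t (pderiv j u) (s + (p + i) - j) w))) := by
    rw [Finset.smul_sum, ← Finset.sum_sub_distrib, Finset.smul_sum]
    refine Finset.sum_congr rfl fun j _ => ?_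
    rw [jacobiRight, jacobiRight, show p + s - (j : ℤ) + r - i = s + (p + r - i) - j by ring,
      show p + s - (j : ℤ) + i = s + (p + i) - j by ring,
      show q + s - (j : ℤ) + r - i = s + (q + r - i) - j by ring,
      show q + s - (j : ℤ) + i = s + (q + i) - j by ring]
    module
  rw [h, jacobiRight, map_zsmul, map_sub, map_zsmul, key hu hv, key hv hu, jacobiRight]
  module

/-- Commuting `B` past the field of `u_{r+i} v` produces derivatives of `u_{r+i} v`. These are
expanded once more, because `pderiv k` is itself mode-like on the vertex algebra, the case `t = 0`.
The terms with derivatives of `u` are then collected by Vandermonde. -/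
theorem jacobiLeft_commutator {B : MvPolynomial ℕ R →ₗ[ℂ] MvPolynomial ℕ R} {κ s : ℤ}
    (hB : IsModeLike t B κ s) {u v : Fock} {m : ℕ} (hu : ∀ i, m ≤ i → pderiv i u = 0)
    (hv : ∀ i, m ≤ i → pderiv i v = 0) (w : MvPolynomial ℕ R) (p q r : ℤ) :
    ∀ᶠ n in atTop, B (∑ i ∈ Finset.range n, jacobiLeft t u v w p q r i) =
      ∑ i ∈ Finset.range n, jacobiLeft t u v (B w) p q r i +
      κ • ∑ j ∈ Finset.range m, Ring.choose s j •
        (∑ i ∈ Finset.range n, jacobiLeft t (pderiv j u) v w (p + s - j) q r i +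
          ∑ i ∈ Finset.range n, jacobiLeft t u (pderiv j v) w p (q + s - j) r i) := by
  have h1 : ∀ᶠ n in atTop, ∀ j ∈ Finset.range m, ∀ i, n ≤ i →
      fieldMode (0 : ℂ) (pderiv j u) (r + (i : ℕ)) v = 0 :=
    (eventually_all_finset _).2 fun j _ => by
      obtain ⟨N, hN⟩ := eventually_atTop.1 (fieldMode_truncated_nat (0 : ℂ) (pderiv j u) v r)
      filter_upwards [eventually_ge_atTop N] with n hn i hi
      exact hN i (hn.trans hi)
  obtain ⟨N, hN⟩ := h1.exists
  have hder : ∀ (k : ℕ) (x : ℤ), pderiv k (fieldMode (0 : ℂ) u x v) =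
      fieldMode (0 : ℂ) u x (pderiv k v) + ∑ j ∈ Finset.range m,
        Ring.choose (k : ℤ) j • fieldMode (0 : ℂ) (pderiv j u) (k + x - j) v := by
    intro k x
    have := fieldMode_commutator_of_le (0 : ℂ) (isModeLike_pderiv (0 : ℂ) k) hu x v
    rwa [one_smul] at this
  have hK : ∀ (i k : ℕ), m + N ≤ k → pderiv k (fieldMode (0 : ℂ) u (r + i) v) = 0 := by
    intro i k hk
    rw [hder, hv k (by omega), map_zero, zero_add]
    refine Finset.sum_eq_zero fun j hj => ?_
    have hj' := Finset.mem_range.1 hj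
    rw [show (k : ℤ) + (r + i) - j = r + ((k + i - j : ℕ) : ℤ) by omega,
      hN j hj _ (by omega), smul_zero]
  filter_upwards [eventually_ge_atTop (m + N)] with n hn
  let G : ℕ → ℕ → MvPolynomial ℕ R := fun j l =>
    fieldMode t (fieldMode (0 : ℂ) (pderiv j u) (r + l) v) (p + s - j + q - l) w
  have hG : ∀ j ∈ Finset.range m, ∀ l, N ≤ l → G j l = 0 := fun j hj l hl => by
    simp only [G]
    rw [hN j hj l hl, fieldMode_zero, LinearMap.zero_apply]
  have hterm : ∀ i, B (jacobiLeft t u v w p q r i) = jacobiLeft t u v (B w) p q r i +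
      κ • (∑ k ∈ Finset.range (m + N), Ring.choose s k •
          jacobiLeft t u (pderiv k v) w p (q + s - k) r i +
        ∑ j ∈ Finset.range m, ∑ k ∈ Finset.range (m + N - j), Ring.choose s j •
          (Ring.choose p i * Ring.choose (s - j) k) • G j (i + k)) := by
    intro i
    have h2 : ∀ k ∈ Finset.range (m + N), Ring.choose s k •
        fieldMode t (pderiv k (fieldMode (0 : ℂ) u (r + i) v)) (s + (p + q - i) - k) w =
        Ring.choose s k • fieldMode t (fieldMode (0 : ℂ) u (r + i) (pderiv k v))
          (s + (p + q - i) - k) w + ∑ j ∈ Finset.range m, (Ring.choose s k * Ring.choose (k : ℤ) j) •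
          fieldMode t (fieldMode (0 : ℂ) (pderiv j u) (k + (r + i) - j) v)
            (s + (p + q - i) - k) w := by
      intro k _
      rw [hder, ← fieldModeLin_apply t, map_add, map_sum, smul_add, Finset.smul_sum]
      simp only [map_zsmul, smul_smul, fieldModeLin_apply]
    have h3 : ∀ j ∈ Finset.range m, ∑ k ∈ Finset.range (m + N),
        (Ring.choose s k * Ring.choose (k : ℤ) j) •
          fieldMode t (fieldMode (0 : ℂ) (pderiv j u) (k + (r + i) - j) v)
            (s + (p + q - i) - k) w =
        ∑ k ∈ Finset.range (m + N - j), Ring.choose s j • (Ring.choose (s - j) k) •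
          G j (i + k) := by
      intro j hj
      have hj' := Finset.mem_range.1 hj
      rw [show m + N = j + (m + N - j) by omega, Finset.sum_range_add,
        Finset.sum_eq_zero, zero_add]
      · rw [show j + (m + N - j) - j = m + N - j by omega]
        refine Finset.sum_congr rfl fun k _ => ?_
        rw [add_comm j k, choose_mul_choose, mul_smul]
        simp only [G]
        congr 2
        rw [show ((k + j : ℕ) : ℤ) + (r + i) - j = r + ((i + k : ℕ) : ℤ) by push_cast; ring,
          show s + (p + q - i) - ((k + j : ℕ) : ℤ) = p + s - j + q - ((i + k : ℕ) : ℤ) by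
            push_cast; ring]
      · intro k hk
        rw [Ring.choose_natCast, Nat.choose_eq_zero_of_lt (Finset.mem_range.1 hk)]
        simp
    rw [jacobiLeft, map_zsmul, fieldMode_commutator_of_le t hB (hK i), smul_add, jacobiLeft]
    congr 1
    rw [smul_comm, Finset.sum_congr rfl h2, Finset.sum_add_distrib, Finset.sum_comm,
      Finset.sum_congr rfl h3, smul_add, Finset.smul_sum, Finset.smul_sum]
    congr 2
    · refine Finset.sum_congr rfl fun k _ => ?_
      rw [jacobiLeft, smul_comm, show p + (q + s - (k : ℤ)) - i = s + (p + q - i) - k by ring]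
    · refine Finset.sum_congr rfl fun j _ => ?_
      rw [Finset.smul_sum]
      refine Finset.sum_congr rfl fun k _ => ?_
      rw [smul_comm, mul_smul]
  rw [map_sum, Finset.sum_congr rfl fun i _ => hterm i, Finset.sum_add_distrib, ← Finset.smul_sum,
    Finset.sum_add_distrib]
  congr 2
  simp only [smul_add, Finset.sum_add_distrib]
  rw [add_comm]
  congr 1
  · rw [Finset.sum_comm]
    refine Finset.sum_congr rfl fun j hj => ?_
    have hj' := Finset.mem_range.1 hj
    simp only [← Finset.smul_sum]
    congr 1
    -- The products of binomials in `p` and `s - j` add up to a binomial in `p + s - j`, the shifted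
    -- first index.
    rw [sum_choose_mul_choose p (s - j) (G j) (hG j hj) (by omega) (by omega)]
    refine Finset.sum_congr rfl fun l _ => ?_
    rw [jacobiLeft, ← add_sub_assoc]
  · rw [Finset.sum_comm]
    simp only [← Finset.smul_sum]
    symm
    refine Finset.sum_subset (Finset.range_subset_range.2 (by omega)) fun k _ hk => ?_
    refine smul_eq_zero_of_right _ (Finset.sum_eq_zero fun i _ => ?_)
    rw [jacobiLeft, hv k (by simpa using hk), map_zero, fieldMode_zero, LinearMap.zero_apply,
      smul_zero]

/-- Driving recursion of the proof: once the identity is known with a derivative in place of `u` or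
`v`, the defect commutes with `B` as an operator in `w`. -/
theorem jacobiDefect_commutator {B : MvPolynomial ℕ R →ₗ[ℂ] MvPolynomial ℕ R} {κ s : ℤ}
    (hB : IsModeLike t B κ s) {u v : Fock} {m : ℕ} (hu : ∀ i, m ≤ i → pderiv i u = 0)
    (hv : ∀ i, m ≤ i → pderiv i v = 0) (w : MvPolynomial ℕ R) (p q r : ℤ) :
    B (jacobiDefect t u v w p q r) = jacobiDefect t u v (B w) p q r +
      κ • ∑ j ∈ Finset.range m, Ring.choose s j •
        (jacobiDefect t (pderiv j u) v w (p + s - j) q r +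
          jacobiDefect t u (pderiv j v) w p (q + s - j) r) := by
  have h1 : ∀ᶠ n in atTop, ∀ j ∈ Finset.range m,
      jacobiDefect t (pderiv j u) v w (p + s - j) q r =
        ∑ i ∈ Finset.range n, jacobiLeft t (pderiv j u) v w (p + s - j) q r i -
        ∑ i ∈ Finset.range n, jacobiRight t (pderiv j u) v w (p + s - j) q r i :=
    (eventually_all_finset _).2 fun j _ => jacobiDefect_eventually t _ _ _ _ _ _
  have h2 : ∀ᶠ n in atTop, ∀ j ∈ Finset.range m,
      jacobiDefect t u (pderiv j v) w p (q + s - j) r =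
        ∑ i ∈ Finset.range n, jacobiLeft t u (pderiv j v) w p (q + s - j) r i -
        ∑ i ∈ Finset.range n, jacobiRight t u (pderiv j v) w p (q + s - j) r i :=
    (eventually_all_finset _).2 fun j _ => jacobiDefect_eventually t _ _ _ _ _ _
  obtain ⟨n, h1, h2, h3, h4, h5⟩ := (h1.and (h2.and ((jacobiDefect_eventually t u v w p q r).and
    ((jacobiDefect_eventually t u v (B w) p q r).and
      (jacobiLeft_commutator t hB hu hv w p q r))))).exists
  have h6 : ∑ j ∈ Finset.range m, Ring.choose s j •
        (jacobiDefect t (pderiv j u) v w (p + s - j) q r +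
          jacobiDefect t u (pderiv j v) w p (q + s - j) r) =
      ∑ j ∈ Finset.range m, Ring.choose s j •
        (∑ i ∈ Finset.range n, jacobiLeft t (pderiv j u) v w (p + s - j) q r i +
          ∑ i ∈ Finset.range n, jacobiLeft t u (pderiv j v) w p (q + s - j) r i) -
      ∑ i ∈ Finset.range n, ∑ j ∈ Finset.range m, Ring.choose s j •
        (jacobiRight t (pderiv j u) v w (p + s - j) q r i +
          jacobiRight t u (pderiv j v) w p (q + s - j) r i) := by
    rw [Finset.sum_comm, ← Finset.sum_sub_distrib]
    refine Finset.sum_congr rfl fun j hj => ?_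
    rw [← Finset.smul_sum, Finset.sum_add_distrib, ← smul_sub, h1 j hj, h2 j hj]
    congr 1
    abel
  rw [h6, h3, h4, map_sub, h5, map_sum,
    Finset.sum_congr rfl fun i _ => jacobiRight_commutator t hB hu hv w p q r i,
    Finset.sum_add_distrib, ← Finset.smul_sum, smul_sub]
  abel

end Defect
end Heisenberg

namespace Heisenberg

open MvPolynomial Filter

/-! ### A Schur lemma for polynomial Fock spaces -/

section Scalar

variable {R : Type*} [CommRing R] [Algebra ℂ R] (t : R)

theorem coeffwise_mulLeft (p : MvPolynomial ℕ R) (x : LaurentSeries (MvPolynomial ℕ R)) :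
    coeffwise (LinearMap.mulLeft ℂ p) x = HahnSeries.single 0 p * x := by
  ext1
  funext n
  rw [coeffwise_coeff, HahnSeries.coeff_single_mul, sub_zero, LinearMap.mulLeft_apply]

theorem isModeLike_mulC (r : R) : IsModeLike t (LinearMap.mulLeft ℂ (C r)) 0 0 := by
  intro i F
  have hF : ∀ F w, fieldComm (LinearMap.mulLeft ℂ (C r)) F w =
      HahnSeries.single 0 (C r) * F w - F (C r * w) := fun F w => by
    rw [← coeffwise_mulLeft]
    rfl
  refine LinearMap.ext fun w => ?_
  obtain ⟨m, h1, h2, h3⟩ := ((normalProd_eventually t i F w).and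
    ((normalProd_eventually t i F (C r * w)).and
      (normalProd_eventually t i (fieldComm (LinearMap.mulLeft ℂ (C r)) F) w))).exists
  rw [zero_smul, add_zero, h3, hF, hF, h1, h2]
  have h4 : ∀ k : ℕ, annihilationCoeff R i k * fieldComm (LinearMap.mulLeft ℂ (C r)) F
      (((k : MvPolynomial ℕ R) + 1) * pderiv k w) =
      HahnSeries.single 0 (C r) * (annihilationCoeff R i k *
        F (((k : MvPolynomial ℕ R) + 1) * pderiv k w)) -
      annihilationCoeff R i k * F (((k : MvPolynomial ℕ R) + 1) * pderiv k (C r * w)) := by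
    intro k
    rw [hF, mul_sub, mul_left_comm, pderiv_C_mul, mul_left_comm (C r)]
  rw [Finset.sum_congr rfl fun k _ => h4 k, Finset.sum_sub_distrib, ← Finset.mul_sum]
  ring

theorem fieldMode_C_mul (v : Fock) (q : ℤ) (r : R) (w : MvPolynomial ℕ R) :
    fieldMode t v q (C r * w) = C r * fieldMode t v q w := by
  obtain ⟨m, hm⟩ := (eventually_pderiv_eq_zero v).exists
  have := fieldMode_commutator_of_le t (isModeLike_mulC t r) hm q w
  rw [zero_smul, add_zero] at this
  exact this.symm

theorem totalDegree_pderiv_lt {v : Fock} {j : ℕ} (h : pderiv j v ≠ 0) :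
    (pderiv j v).totalDegree < v.totalDegree := by
  have key : ∀ s ∈ (pderiv j v).support, (s.sum fun _ e => e) + 1 ≤ v.totalDegree := by
    intro s hs
    have h1 : coeff (s + Finsupp.single j 1) v ≠ 0 := fun h0 => by
      rw [mem_support_iff, coeff_pderiv, h0, zero_mul] at hs
      exact hs rfl
    have h2 := le_totalDegree (mem_support_iff.2 h1)
    rwa [Finsupp.sum_add_index' (fun _ => rfl) (fun _ _ _ => rfl),
      Finsupp.sum_single_index rfl] at h2
  obtain ⟨s, hs⟩ := support_nonempty.2 h
  have h0 : 0 < v.totalDegree := by have := key s hs; omega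
  rw [totalDegree, Finset.sup_lt_iff (by simpa using h0)]
  exact fun s hs => key s hs

/-- Induction on the sum of the total degrees, which every nonzero derivative lowers. -/
theorem pderiv_induction₂ {P : Fock → Fock → Prop} (h0 : ∀ v, P 0 v) (h0' : ∀ u, P u 0)
    (h : ∀ u v, (∀ j, P (pderiv j u) v) → (∀ j, P u (pderiv j v)) → P u v) (u v : Fock) :
    P u v := by
  induction hn : u.totalDegree + v.totalDegree using Nat.strong_induction_on generalizing u v with
  | _ n ih =>
    refine h u v (fun j => ?_) fun j => ?_
    · by_cases hj : pderiv j u = 0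
      · rw [hj]; exact h0 v
      · exact ih _ (by have := totalDegree_pderiv_lt hj; omega) _ _ rfl
    · by_cases hj : pderiv j v = 0
      · rw [hj]; exact h0' u
      · exact ih _ (by have := totalDegree_pderiv_lt hj; omega) _ _ rfl

theorem eq_C_of_pderiv_eq_zero {p : MvPolynomial ℕ R} (h : ∀ k, pderiv k p = 0) :
    p = C (constantCoeff p) := by
  classical
  ext1 s
  rw [coeff_C]
  split_ifs with hs
  · rw [← hs]; rfl
  · obtain ⟨k, hk⟩ : ∃ k, s k ≠ 0 := by
      by_contra hc
      push Not at hc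
      exact hs (Finsupp.ext fun k => (hc k).symm)
    have h1 := congr_arg (coeff (s - Finsupp.single k 1)) (h k)
    have h2 : s - Finsupp.single k 1 + Finsupp.single k 1 = s :=
      tsub_add_cancel_of_le (by simpa [Nat.one_le_iff_ne_zero] using hk)
    rw [coeff_pderiv, h2, coeff_zero] at h1
    generalize (s - Finsupp.single k 1 : ℕ →₀ ℕ) k = n at h1
    -- As `R` is a `ℂ`-algebra, positive integers act invertibly on it even if `R` has zero
    -- divisors.
    have h3 : ((n : R) + 1) = algebraMap ℂ R ((n : ℂ) + 1) := by simp
    rw [h3, mul_comm, ← Algebra.smul_def,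
      smul_eq_zero_iff_right (Nat.cast_add_one_ne_zero n)] at h1
    exact h1

/-- The vector `E 1` is killed by all derivatives, so it is a constant. As `E` commutes with
constants and variables, it is determined by `E 1`. -/
theorem eq_mul_of_commute {E : MvPolynomial ℕ R → MvPolynomial ℕ R}
    (hadd : ∀ w w', E (w + w') = E w + E w') (hC : ∀ r w, E (C r * w) = C r * E w)
    (hX : ∀ k w, E (X k * w) = X k * E w) (hd : ∀ k w, E (pderiv k w) = pderiv k (E w))
    (w : MvPolynomial ℕ R) : E w = C (constantCoeff (E 1)) * w := by
  have h0 : E 0 = 0 := by simpa using hC 0 0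
  rw [← eq_C_of_pderiv_eq_zero fun k => by rw [← hd, pderiv_one, h0]]
  induction w using MvPolynomial.induction_on with
  | C a => rw [← mul_one (C a), hC, mul_one, mul_comm]
  | add p q hp hq => rw [hadd, hp, hq, mul_add]
  | mul_X p i hp => rw [mul_comm, hX, hp, mul_left_comm]

theorem jacobiDefect_add (u v : Fock) (w w' : MvPolynomial ℕ R) (p q r : ℤ) :
    jacobiDefect t u v (w + w') p q r =
      jacobiDefect t u v w p q r + jacobiDefect t u v w' p q r := by
  obtain ⟨m, h1, h2, h3⟩ := ((jacobiDefect_eventually t u v w p q r).and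
    ((jacobiDefect_eventually t u v w' p q r).and
      (jacobiDefect_eventually t u v (w + w') p q r))).exists
  rw [h1, h2, h3]
  simp only [jacobiLeft, jacobiRight, map_add, smul_add, smul_sub, Finset.sum_add_distrib,
    Finset.sum_sub_distrib]
  abel

theorem jacobiDefect_zero_left (v : Fock) (w : MvPolynomial ℕ R) (p q r : ℤ) :
    jacobiDefect t 0 v w p q r = 0 := by
  simp [jacobiDefect, jacobiLeft, jacobiRight]

theorem jacobiDefect_zero_right (u : Fock) (w : MvPolynomial ℕ R) (p q r : ℤ) :
    jacobiDefect t u 0 w p q r = 0 := by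
  simp [jacobiDefect, jacobiLeft, jacobiRight]

theorem jacobiDefect_comm_of_forall {B : MvPolynomial ℕ R →ₗ[ℂ] MvPolynomial ℕ R} {κ s : ℤ}
    (hB : IsModeLike t B κ s) {u v : Fock}
    (hu : ∀ j w p q r, jacobiDefect t (pderiv j u) v w p q r = 0)
    (hv : ∀ j w p q r, jacobiDefect t u (pderiv j v) w p q r = 0) (w : MvPolynomial ℕ R)
    (p q r : ℤ) : B (jacobiDefect t u v w p q r) = jacobiDefect t u v (B w) p q r := by
  obtain ⟨m, h1, h2⟩ := ((eventually_pderiv_eq_zero u).and (eventually_pderiv_eq_zero v)).exists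
  rw [jacobiDefect_commutator t hB h1 h2]
  simp [hu, hv]

theorem jacobiDefect_eq_mul {u v : Fock}
    (hu : ∀ j w p q r, jacobiDefect t (pderiv j u) v w p q r = 0)
    (hv : ∀ j w p q r, jacobiDefect t u (pderiv j v) w p q r = 0) (w : MvPolynomial ℕ R)
    (p q r : ℤ) : jacobiDefect t u v w p q r =
      C (constantCoeff (jacobiDefect t u v 1 p q r)) * w :=
  eq_mul_of_commute (E := fun w => jacobiDefect t u v w p q r)
    (fun w w' => jacobiDefect_add t u v w w' p q r)
    (fun r' w => (jacobiDefect_comm_of_forall t (isModeLike_mulC t r') hu hv w p q r).symm)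
    (fun k w => (jacobiDefect_comm_of_forall t (isModeLike_mulX t k) hu hv w p q r).symm)
    (fun k w => (jacobiDefect_comm_of_forall t (isModeLike_pderiv t k) hu hv w p q r).symm) w

end Scalar

/-! ### Base change along `R → S` -/

section Map

theorem hahnSeries_map_mul {A B : Type*} [CommRing A] [CommRing B] (f : A →+* B)
    (x y : LaurentSeries A) : (x * y).map f = x.map f * y.map f := by
  ext1
  funext n
  have hx : (x.map f).support ⊆ x.support := fun i hi h => hi (by simp [h])
  have hy : (y.map f).support ⊆ y.support := fun i hi h => hi (by simp [h])
  rw [HahnSeries.map_coeff, HahnSeries.coeff_mul,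
    HahnSeries.coeff_mul_left' x.isPWO_support hx]
  rw [map_sum]
  symm
  refine (Finset.sum_subset (Finset.antidiagonal_mono_right hy) fun ij h1 h2 => ?_).trans
    (Finset.sum_congr rfl fun _ _ => (map_mul f _ _).symm)
  simp only [Finset.mem_antidiagonal] at h1 h2
  have : (y.map f).coeff ij.2 = 0 := by
    by_contra hc
    exact h2 ⟨h1.1, hc, h1.2.2⟩
  rw [this, mul_zero]

variable {R S : Type*} [CommRing R] [Algebra ℂ R] [CommRing S] [Algebra ℂ S] (f : R →ₐ[ℂ] S)
  (t : R)

theorem map_creationSeries (i : ℕ) :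
    (creationSeries t i).map (map (σ := ℕ) f.toRingHom) = creationSeries (f t) i := by
  ext1
  funext n
  rw [HahnSeries.map_coeff, creationSeries_coeff, creationSeries_coeff, map_add]
  congr 1
  · split_ifs <;> simp
  · split_ifs <;> simp

theorem map_annihilationCoeff (i j : ℕ) :
    (annihilationCoeff R i j).map (map (σ := ℕ) f.toRingHom) = annihilationCoeff S i j := by
  ext1
  funext n
  rw [HahnSeries.map_coeff, annihilationCoeff, annihilationCoeff, HahnSeries.coeff_single,
    HahnSeries.coeff_single]
  split_ifs <;> simp

theorem hahnSeries_map_add {A B : Type*} [CommRing A] [CommRing B] (g : A →+* B)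
    (x y : LaurentSeries A) : (x + y).map g = x.map g + y.map g := by
  ext1; funext n; simp

theorem hahnSeries_map_sum {A B ι : Type*} [CommRing A] [CommRing B] (g : A →+* B)
    (s : Finset ι) (x : ι → LaurentSeries A) :
    (∑ i ∈ s, x i).map g = ∑ i ∈ s, (x i).map g := by
  ext1; funext n; simp

theorem map_field (v : Fock) (w : MvPolynomial ℕ R) :
    (field t v w).map (map (σ := ℕ) f.toRingHom) = field (f t) v (map f.toRingHom w) := by
  induction v using MvPolynomial.induction_on generalizing w with
  | C a =>
    rw [← mul_one (C a), ← smul_eq_C_mul, map_smul, map_smul, field_one, field_one]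
    ext1
    funext n
    by_cases hn : n = 0 <;> simp [idField, hn, Algebra.smul_def]
  | add p q hp hq =>
    rw [map_add, map_add, LinearMap.add_apply, LinearMap.add_apply, hahnSeries_map_add, hp, hq]
  | mul_X p i hp =>
    obtain ⟨m, h1, h2⟩ := ((normalProd_eventually t i (field t p) w).and
      (normalProd_eventually (f t) i (field (f t) p) (map f.toRingHom w))).exists
    rw [mul_comm, field_X_mul, field_X_mul, h1, h2, hahnSeries_map_add, hahnSeries_map_mul,
      hahnSeries_map_sum, map_creationSeries, hp]
    congr 1
    refine Finset.sum_congr rfl fun k _ => ?_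
    rw [hahnSeries_map_mul, map_annihilationCoeff, hp, pderiv_map, map_mul, map_add, map_natCast,
      map_one]

theorem map_fieldMode (v : Fock) (q : ℤ) (w : MvPolynomial ℕ R) :
    map f.toRingHom (fieldMode t v q w) = fieldMode (f t) v q (map f.toRingHom w) := by
  rw [fieldMode_apply, fieldMode_apply, ← map_field]
  rfl

/-- Fields are built by ring operations and derivatives from `t`, so they commute with base change.
This allows both specialising `x` to `0` and passing from `(ℂ[x], x)` to an arbitrary `(R, t)`. -/
theorem map_jacobiDefect (u v : Fock) (w : MvPolynomial ℕ R) (p q r : ℤ) :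
    map f.toRingHom (jacobiDefect t u v w p q r) =
      jacobiDefect (f t) u v (map f.toRingHom w) p q r := by
  obtain ⟨m, h1, h2⟩ := ((jacobiDefect_eventually t u v w p q r).and
    (jacobiDefect_eventually (f t) u v (map f.toRingHom w) p q r)).exists
  rw [h1, h2, map_sub, map_sum, map_sum]
  simp only [jacobiLeft, jacobiRight, map_zsmul, map_sub, map_fieldMode]

end Map

end Heisenberg

namespace Heisenberg

open MvPolynomial Filter

/-! ### Vacuum expectations, creation property and skew-symmetry -/

section Vacuum

variable {R : Type*} [CommRing R] [Algebra ℂ R] (t : R)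

/-- The ring homomorphism `α_{-i-1} ↦ (-1)^i t x^{-i-1}`, the vacuum expectation of a field. -/
def evalSeries : Fock →+* LaurentSeries R :=
  eval₂Hom (HahnSeries.C.comp (algebraMap ℂ R))
    fun i => HahnSeries.single (-((i : ℤ) + 1)) ((-1) ^ i * t)

theorem map_constantCoeff_creationSeries (i : ℕ) :
    (creationSeries t i).map (constantCoeff (R := R) (σ := ℕ)) =
      HahnSeries.single (-((i : ℤ) + 1)) ((-1) ^ i * t) := by
  ext1
  funext n
  rw [HahnSeries.map_coeff, creationSeries_coeff, map_add, HahnSeries.coeff_single]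
  have h1 : constantCoeff (if 0 ≤ n then
      ((i + n.toNat).choose i : MvPolynomial ℕ R) * X (i + n.toNat) else 0) = 0 := by
    split_ifs <;> simp
  rw [h1, zero_add]
  split_ifs <;> simp

theorem normalProd_one (i : ℕ) (F : MvPolynomial ℕ R →ₗ[ℂ] LaurentSeries (MvPolynomial ℕ R)) :
    normalProd t i F 1 = creationSeries t i * F 1 := by
  rw [normalProd_apply, vars_one, Finset.sum_empty, add_zero]

/-- Nothing can be annihilated in the vacuum `1`, so the field acts there by a product of creation
series, and taking constant terms is multiplicative. -/
theorem map_constantCoeff_field_one (v : Fock) :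
    (field t v 1).map (constantCoeff (R := R) (σ := ℕ)) = evalSeries t v := by
  induction v using MvPolynomial.induction_on with
  | C a =>
    rw [evalSeries, coe_eval₂Hom, eval₂_C, ← mul_one (C a), ← smul_eq_C_mul, map_smul, field_one]
    ext1
    funext n
    by_cases hn : n = 0 <;>
      simp [idField, hn, HahnSeries.C_apply, Algebra.smul_def]
  | add p q hp hq => rw [map_add, map_add, LinearMap.add_apply, hahnSeries_map_add, hp, hq]
  | mul_X p i hp =>
    rw [mul_comm, field_X_mul, normalProd_one, hahnSeries_map_mul, hp,
      map_constantCoeff_creationSeries, map_mul (evalSeries t)]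
    congr 1
    rw [evalSeries, coe_eval₂Hom, eval₂_X]

theorem constantCoeff_fieldMode_one (v : Fock) (q : ℤ) :
    constantCoeff (fieldMode t v q 1) = (evalSeries t v).coeff (-q - 1) := by
  rw [← map_constantCoeff_field_one]
  rfl

theorem evalSeries_zero (v : Fock) :
    evalSeries (0 : ℂ) v = HahnSeries.single 0 (constantCoeff v) := by
  have : evalSeries (0 : ℂ) = (HahnSeries.C).comp constantCoeff := by
    refine MvPolynomial.ringHom_ext (fun a => ?_) fun i => ?_
    · simp [evalSeries]
    · simp [evalSeries]
  rw [this]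
  rfl

theorem constantCoeff_vacuum (v : Fock) (q : ℤ) :
    constantCoeff (fieldMode (0 : ℂ) v q 1) = if q = -1 then constantCoeff v else 0 := by
  rw [constantCoeff_fieldMode_one, evalSeries_zero, HahnSeries.coeff_single]
  split_ifs <;> first | rfl | omega

theorem fieldMode_one (q : ℤ) (w : MvPolynomial ℕ R) :
    fieldMode t 1 q w = if q = -1 then w else 0 := by
  rw [fieldMode_apply, field_one]
  change (HahnSeries.single 0 w).coeff (-q - 1) = _
  rw [HahnSeries.coeff_single]
  split_ifs <;> first | rfl | omega

/-- For `t = 0` the creation series have no pole, which gives the creation axiom. -/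
theorem field_zero_one (v : Fock) : ∃ f : PowerSeries Fock,
    field (0 : ℂ) v 1 = HahnSeries.ofPowerSeries ℤ _ f ∧ PowerSeries.constantCoeff f = v := by
  induction v using MvPolynomial.induction_on with
  | C a =>
    refine ⟨PowerSeries.C (C a), ?_, by simp⟩
    rw [← mul_one (C a), ← smul_eq_C_mul, map_smul, field_one, HahnSeries.ofPowerSeries_C]
    ext1
    funext n
    by_cases hn : n = 0 <;> simp [idField, hn, HahnSeries.C_apply]
  | add p q hp hq =>
    obtain ⟨f, hf, hf'⟩ := hp
    obtain ⟨g, hg, hg'⟩ := hq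
    exact ⟨f + g, by rw [map_add, LinearMap.add_apply, hf, hg, map_add], by rw [map_add, hf', hg']⟩
  | mul_X p i hp =>
    obtain ⟨f, hf, hf'⟩ := hp
    refine ⟨PowerSeries.mk (fun j => ((i + j).choose i : Fock) * X (i + j)) * f, ?_, ?_⟩
    · rw [mul_comm, field_X_mul, normalProd_one, hf, map_mul, creationSeries]
      simp
    · rw [map_mul, hf', ← PowerSeries.coeff_zero_eq_constantCoeff_apply, PowerSeries.coeff_mk]
      simp [mul_comm]

theorem fieldMode_creation (v : Fock) : fieldMode (0 : ℂ) v (-1) 1 = v ∧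
    ∀ q : ℤ, 0 ≤ q → fieldMode (0 : ℂ) v q 1 = 0 := by
  obtain ⟨f, hf, hf'⟩ := field_zero_one v
  constructor
  · rw [fieldMode_apply, hf, ofPowerSeries_coeff]
    simpa using hf'
  · intro q hq
    rw [fieldMode_apply, hf, ofPowerSeries_coeff, if_neg (by omega)]

/-- For `t = 0` the creation series of the factor `X j` has no constant terms, so only its
annihilation part survives. -/
theorem constantCoeff_fieldMode_X_mul (v u : Fock) (j : ℕ) (r : ℤ) : ∀ᶠ m in atTop,
    constantCoeff (fieldMode (0 : ℂ) (X j * v) r u) = ∑ k ∈ Finset.range m,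
      (-1) ^ j * ((j + k + 1).choose j : ℂ) * (k + 1) *
        constantCoeff (fieldMode (0 : ℂ) v (r - j - k - 2) (pderiv k u)) := by
  filter_upwards [normalProd_eventually (0 : ℂ) j (field 0 v) u] with m hm
  rw [fieldMode_apply, field_X_mul, hm, HahnSeries.coeff_add, map_add, coeff_sum, map_sum]
  have h1 : constantCoeff ((creationSeries (0 : ℂ) j * field 0 v u).coeff (-r - 1)) = 0 := by
    have := hahnSeries_map_mul (constantCoeff (R := ℂ) (σ := ℕ)) (creationSeries (0 : ℂ) j)
      (field 0 v u)
    rw [map_constantCoeff_creationSeries, mul_zero, map_zero, zero_mul] at this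
    exact congr_arg (fun x => x.coeff (-r - 1)) this
  rw [h1, zero_add]
  refine Finset.sum_congr rfl fun k _ => ?_
  have h2 : ((k : Fock) + 1) * pderiv k u = C ((k : ℂ) + 1) * pderiv k u := by simp
  rw [annihilationCoeff, HahnSeries.coeff_single_mul,
    show -r - 1 - -((j : ℤ) + k + 2) = -(r - j - k - 2) - 1 by ring, h2, ← fieldMode_apply,
    fieldMode_C_mul]
  simp
  ring

theorem succ_mul_choose_symm (i j : ℕ) :
    (j + 1) * (i + j + 1).choose i = (i + 1) * (i + j + 1).choose j := by
  have h := Nat.choose_succ_right_eq (i + j + 1) j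
  rw [show i + j + 1 - j = i + 1 by omega, ← Nat.choose_symm (n := i + j + 1) (k := j + 1) (by omega),
    show i + j + 1 - (j + 1) = i by omega] at h
  linarith

/-- Skew-symmetry without the terms in the image of translation, since these have no constant
coefficient. Both sides obey the same recursion in `v`: on the left a factor `X j` is moved through
the field of `u` by the commutator, on the right it is contracted with `u` directly; either way a
derivative of `u` remains. -/
theorem constantCoeff_skew (u v : Fock) (r : ℤ) : constantCoeff (fieldMode (0 : ℂ) u r v) =
    -(((r.negOnePow : ℤ) : ℂ) * constantCoeff (fieldMode (0 : ℂ) v r u)) := by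
  induction v using MvPolynomial.induction_on generalizing u r with
  | C a =>
    have h1 : fieldMode (0 : ℂ) u r (C a) = C a * fieldMode (0 : ℂ) u r 1 := by
      rw [← fieldMode_C_mul, mul_one]
    have h2 : fieldMode (0 : ℂ) (C a) r u = a • fieldMode (0 : ℂ) 1 r u := by
      rw [← fieldModeLin_apply, ← fieldModeLin_apply, ← map_smul, smul_eq_C_mul, mul_one]
    rw [h1, h2, fieldMode_one, map_mul, constantCoeff_vacuum, constantCoeff_C]
    split_ifs with h
    · subst h; simp [smul_eq_C_mul]
    · simp
  | add p q hp hq =>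
    rw [map_add, map_add, hp, hq, ← fieldModeLin_apply _ _ _ (p + q), map_add, map_add,
      fieldModeLin_apply, fieldModeLin_apply]
    ring
  | mul_X p j hp =>
    obtain ⟨m, h1, h2⟩ := ((constantCoeff_fieldMode_X_mul p u j r).and
      (eventually_pderiv_eq_zero u)).exists
    have h3 := congr_arg constantCoeff
      (fieldMode_commutator_of_le (0 : ℂ) (isModeLike_mulX (0 : ℂ) j) h2 r p)
    rw [mulX_apply, mulX_apply, map_mul, constantCoeff_X, zero_mul, map_add, map_zsmul,
      map_sum] at h3
    rw [mul_comm p, h1, eq_neg_of_add_eq_zero_left h3.symm, zsmul_eq_mul, ← neg_mul,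
      Finset.mul_sum, Finset.mul_sum, ← Finset.sum_neg_distrib]
    refine Finset.sum_congr rfl fun i _ => ?_
    rw [map_zsmul, hp, choose_neg_add_two, zsmul_eq_mul,
      show -(j : ℤ) - 2 + r - i = r - j - i - 2 by ring]
    have h4 : (((r - j - i - 2).negOnePow : ℤ) : ℂ) = (r.negOnePow : ℤ) * (-1) ^ j * (-1) ^ i := by
      rw [Int.negOnePow_sub, Int.negOnePow_sub, Int.negOnePow_sub]
      simp [Int.negOnePow]
    -- The pairing of `α_{-j-1}` with `α_{-i-1}` is symmetric; this is what makes the two recursions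
    -- agree.
    have h5 : ((j : ℂ) + 1) * ((i + j + 1).choose i : ℂ) =
        (i + 1) * ((j + i + 1).choose j : ℂ) := by
      have := succ_mul_choose_symm i j
      rw [add_comm j i]
      exact_mod_cast this
    have h6 : ((-1 : ℂ) ^ i) * (-1) ^ i = 1 := by rw [← mul_pow]; simp
    rw [h4]
    push_cast
    linear_combination (-((r.negOnePow : ℤ) : ℂ) * (-1) ^ j *
      constantCoeff (fieldMode (0 : ℂ) p (r - j - i - 2) (pderiv i u))) *
      (h5 + ((j : ℂ) + 1) * ((i + j + 1).choose i : ℂ) * (h6))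

end Vacuum

end Heisenberg

namespace Heisenberg

open MvPolynomial Filter

/-! ### Pascal's rule for the defect -/

section Recurrence

variable {R : Type*} [CommRing R] [Algebra ℂ R] (t : R)

theorem eventually_succ {P : ℕ → Prop} (h : ∀ᶠ n in atTop, P n) : ∀ᶠ n in atTop, P (n + 1) :=
  (tendsto_add_atTop_nat 1).eventually h

theorem sum_choose_succ {A : Type*} [AddCommGroup A] (p : ℤ) (f : ℕ → A) (n : ℕ) :
    ∑ i ∈ Finset.range (n + 1), Ring.choose (p + 1) i • f i =
      ∑ i ∈ Finset.range (n + 1), Ring.choose p i • f i +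
        ∑ i ∈ Finset.range n, Ring.choose p i • f (i + 1) := by
  rw [Finset.sum_range_succ', Finset.sum_range_succ' _ n]
  simp only [Ring.choose_succ_succ, add_smul, Finset.sum_add_distrib, Ring.choose_zero_right]
  abel

/-- The indices `p`, `q`, `r` are the exponents of `x₁`, `x₂` and `x₁ - x₂` in the generating
function form of the identity, and the relation is `x₁ = x₂ + (x₁ - x₂)`. On the left it is Pascal's
rule for `p`, on the right for `r`. -/
theorem jacobiDefect_pascal (u v : Fock) (w : MvPolynomial ℕ R) (p q r : ℤ) :
    jacobiDefect t u v w (p + 1) q r =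
      jacobiDefect t u v w p (q + 1) r + jacobiDefect t u v w p q (r + 1) := by
  let a : ℕ → MvPolynomial ℕ R := fun i => fieldMode t u (p + r + 1 - i) (fieldMode t v (q + i) w)
  let b : ℕ → MvPolynomial ℕ R := fun i => (r.negOnePow : ℤ) •
    fieldMode t v (q + r + 1 - i) (fieldMode t u (p + i) w)
  let f : ℕ → MvPolynomial ℕ R := fun i =>
    fieldMode t (fieldMode (0 : ℂ) u (r + i) v) (p + q + 1 - i) w
  have hL1 : ∀ i, jacobiLeft t u v w (p + 1) q r i = Ring.choose (p + 1) i • f i := fun i => by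
    simp only [jacobiLeft, f, show p + 1 + q - (i : ℤ) = p + q + 1 - i by ring]
  have hL2 : ∀ i, jacobiLeft t u v w p (q + 1) r i = Ring.choose p i • f i := fun i => by
    simp only [jacobiLeft, f, show p + (q + 1) - (i : ℤ) = p + q + 1 - i by ring]
  have hL3 : ∀ i, jacobiLeft t u v w p q (r + 1) i = Ring.choose p i • f (i + 1) := fun i => by
    simp only [jacobiLeft, f]
    rw [show r + 1 + (i : ℤ) = r + ((i + 1 : ℕ) : ℤ) by push_cast; ring,
      show p + q + 1 - ((i + 1 : ℕ) : ℤ) = p + q - i by push_cast; ring]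
  have hR1 : ∀ i, jacobiRight t u v w (p + 1) q r i =
      Ring.choose r i • (-1 : ℤ) ^ i • (a i - b (i + 1)) := fun i => by
    simp only [jacobiRight, a, b]
    rw [show p + 1 + r - (i : ℤ) = p + r + 1 - i by ring,
      show q + r + 1 - ((i + 1 : ℕ) : ℤ) = q + r - i by push_cast; ring,
      show p + 1 + (i : ℤ) = p + ((i + 1 : ℕ) : ℤ) by push_cast; ring]
    module
  have hR2 : ∀ i, jacobiRight t u v w p (q + 1) r i =
      Ring.choose r i • (-1 : ℤ) ^ i • (a (i + 1) - b i) := fun i => by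
    simp only [jacobiRight, a, b]
    rw [show p + r + 1 - ((i + 1 : ℕ) : ℤ) = p + r - i by push_cast; ring,
      show q + 1 + r - (i : ℤ) = q + r + 1 - i by ring,
      show q + 1 + (i : ℤ) = q + ((i + 1 : ℕ) : ℤ) by push_cast; ring]
    module
  have hR3 : ∀ i, jacobiRight t u v w p q (r + 1) i =
      Ring.choose (r + 1) i • (-1 : ℤ) ^ i • (a i + b i) := fun i => by
    simp only [jacobiRight, a, b]
    rw [show p + (r + 1) - (i : ℤ) = p + r + 1 - i by ring,
      show q + (r + 1) - (i : ℤ) = q + r + 1 - i by ring, Int.negOnePow_succ]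
    push_cast
    module
  obtain ⟨n, h1, h2, h3, h4, h5, h6⟩ :=
    ((eventually_succ (jacobiDefect_eventually t u v w (p + 1) q r)).and
    ((eventually_succ (jacobiDefect_eventually t u v w p (q + 1) r)).and
    ((eventually_succ (jacobiDefect_eventually t u v w p q (r + 1))).and
    ((jacobiLeft_eventually t u v w p q (r + 1)).and
    ((eventually_succ (fieldMode_truncated_nat t v w q)).and
      (eventually_succ (fieldMode_truncated_nat t u w p))))))).exists
  rw [h1, h2, h3, Finset.sum_range_succ (jacobiLeft t u v w p q (r + 1)), h4]
  simp only [hL1, hL2, hL3, hR1, hR2, hR3]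
  rw [sum_choose_succ, sum_choose_succ r (fun i => (-1 : ℤ) ^ i • (a i + b i))]
  -- The added last term is zero because `n` is beyond the truncation bounds of both modes; now all
  -- sums have the same range.
  have h6 : ∑ i ∈ Finset.range n, Ring.choose r i • (-1 : ℤ) ^ (i + 1) • (a (i + 1) + b (i + 1)) =
      ∑ i ∈ Finset.range (n + 1), Ring.choose r i • (-1 : ℤ) ^ (i + 1) • (a (i + 1) + b (i + 1)) := by
    rw [Finset.sum_range_succ]
    simp only [a, b, h5, h6, map_zero, smul_zero, add_zero]
  rw [h6]
  have h7 : ∑ i ∈ Finset.range (n + 1), Ring.choose r i • (-1 : ℤ) ^ i • (a i - b (i + 1)) =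
    ∑ i ∈ Finset.range (n + 1), Ring.choose r i • (-1 : ℤ) ^ i • (a (i + 1) - b i) +
    (∑ i ∈ Finset.range (n + 1), Ring.choose r i • (-1 : ℤ) ^ i • (a i + b i) +
    ∑ i ∈ Finset.range (n + 1), Ring.choose r i • (-1 : ℤ) ^ (i + 1) •
      (a (i + 1) + b (i + 1))) := by
    rw [← Finset.sum_add_distrib, ← Finset.sum_add_distrib]
    refine Finset.sum_congr rfl fun i _ => ?_
    rw [pow_succ]
    module
  rw [h7]
  abel

end Recurrence

/-! ### The translation operator and translation covariance -/

section Translation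

/-- The translation operator `α_{-i-1} ↦ (i + 1) α_{-i-2}` on `M(1)`. -/
def translation : Derivation ℂ Fock Fock :=
  mkDerivation ℂ fun i => ((i : ℂ) + 1) • X (i + 1)

theorem translation_X (i : ℕ) : translation (X i) = ((i : ℂ) + 1) • X (i + 1) :=
  mkDerivation_X ℂ _ i

theorem translation_C (c : ℂ) : translation (C c) = 0 := derivation_C _ c

theorem constantCoeff_translation (w : Fock) : constantCoeff (translation w) = 0 := by
  induction w using MvPolynomial.induction_on with
  | C a => rw [translation_C, map_zero]
  | add p q hp hq => rw [map_add, map_add, hp, hq, add_zero]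
  | mul_X p i hp =>
    rw [Derivation.leibniz, translation_X]
    simp [hp, smul_eq_C_mul]

/-- For `k = 0` the truncated subtraction in `k - 1` is harmless, as the coefficient is zero. -/
theorem pderiv_translation (k : ℕ) (w : Fock) :
    pderiv k (translation w) = translation (pderiv k w) + (k : ℂ) • pderiv (k - 1) w := by
  classical
  induction w using MvPolynomial.induction_on with
  | C a => simp
  | add p q hp hq => simp only [map_add, hp, hq, smul_add]; abel
  | mul_X p i hp =>
    have h : pderiv k (((i : ℂ) + 1) • X (i + 1) : Fock) = (k : ℂ) • pderiv (k - 1) (X i) := by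
      rw [Derivation.map_smul, pderiv_X, pderiv_X, Pi.single_apply, Pi.single_apply]
      rcases k with _ | k
      · simp
      · simp only [Nat.add_right_cancel_iff, Nat.add_sub_cancel]
        split_ifs with h
        · subst h; push_cast; rfl
        · simp
    obtain ⟨c, hc⟩ : ∃ c : ℂ, pderiv k (X i : Fock) = C c := by
      rw [pderiv_X, Pi.single_apply]
      split_ifs
      · exact ⟨1, (C_1).symm⟩
      · exact ⟨0, (C_0).symm⟩
    have hT : ∀ f g : Fock, translation (f * g) = f * translation g + g * translation f :=
      fun f g => by rw [Derivation.leibniz, smul_eq_mul, smul_eq_mul]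
    rw [hT, translation_X, map_add, pderiv_mul, pderiv_mul, h, hp, pderiv_mul, hc, map_add, hT, hT,
      translation_X, translation_C, pderiv_mul]
    simp only [smul_eq_C_mul]
    ring

theorem isModeLike_zero {R : Type*} [CommRing R] [Algebra ℂ R] (t : R) (s : ℤ) :
    IsModeLike t 0 0 s := by
  have h : ∀ F : MvPolynomial ℕ R →ₗ[ℂ] LaurentSeries (MvPolynomial ℕ R), fieldComm 0 F = 0 := by
    intro F
    refine LinearMap.ext fun w => ?_
    ext1
    funext n
    simp [fieldComm]
  intro i F
  rw [h, h, zero_smul, add_zero]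
  exact ((normalProdHom t i).map_zero).symm

theorem isModeLike_zsmul {R : Type*} [CommRing R] [Algebra ℂ R] {t : R}
    {B : MvPolynomial ℕ R →ₗ[ℂ] MvPolynomial ℕ R} {κ s : ℤ} (hB : IsModeLike t B κ s) (c : ℤ) :
    IsModeLike t (c • B) (c * κ) s := by
  have h : ∀ F : MvPolynomial ℕ R →ₗ[ℂ] LaurentSeries (MvPolynomial ℕ R),
      fieldComm (c • B) F = c • fieldComm B F := by
    intro F
    refine LinearMap.ext fun w => ?_
    ext1
    funext n
    change c • B ((F w).coeff n) - (F (c • B w)).coeff n =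
      (c • (coeffwise B (F w) - F (B w))).coeff n
    rw [map_zsmul, coeff_zsmul, coeff_zsmul, ← smul_sub]
    rfl
  intro i F
  rw [h, h, hB, smul_add, mul_smul]
  congr 1
  exact (map_zsmul (normalProdHom t i) c (fieldComm B F)).symm

theorem choose_sub_one (s : ℤ) (i : ℕ) :
    (s - i) * Ring.choose s i = s * Ring.choose (s - 1) i := by
  have h1 := Ring.choose_add_smul_choose (s - 1) i 1
  have h2 := Ring.choose_smul_choose s (Nat.le_succ i)
  simp only [Nat.choose_one_right, Nat.cast_one, sub_add_cancel, Ring.choose_one_right,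
    nsmul_eq_mul, Nat.choose_succ_self_right] at h1 h2
  rw [← h1, h2]
  simp [mul_comm]

theorem pderiv_induction {P : Fock → Prop} (h0 : P 0) (h : ∀ v, (∀ j, P (pderiv j v)) → P v)
    (v : Fock) : P v := by
  induction hn : v.totalDegree using Nat.strong_induction_on generalizing v with
  | _ n ih =>
    refine h v fun j => ?_
    by_cases hj : pderiv j v = 0
    · rw [hj]; exact h0
    · exact ih _ (by have := totalDegree_pderiv_lt hj; omega) _ rfl

/-- The commutator of `B` with translation is again mode-like, with `s` lowered by one. The rule `(s
- i) (s choose i) = s (s - 1 choose i)` then makes the correction terms cancel, and the defect of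
translation covariance commutes with `B`. -/
theorem translation_commutator {B B' : Fock →ₗ[ℂ] Fock} {κ s : ℤ}
    (hB : IsModeLike (0 : ℂ) B κ s) (hB' : IsModeLike (0 : ℂ) B' (s * κ) (s - 1))
    (hT : ∀ w, B (translation w) = translation (B w) + B' w) {v : Fock}
    (ih : ∀ (j : ℕ) (q : ℤ) (w : Fock), translation (fieldMode (0 : ℂ) (pderiv j v) q w) =
      fieldMode (0 : ℂ) (pderiv j v) q (translation w) -
        q • fieldMode (0 : ℂ) (pderiv j v) (q - 1) w) (q : ℤ) (w : Fock) :
    B (translation (fieldMode (0 : ℂ) v q w) - fieldMode (0 : ℂ) v q (translation w) +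
      q • fieldMode (0 : ℂ) v (q - 1) w) =
    translation (fieldMode (0 : ℂ) v q (B w)) - fieldMode (0 : ℂ) v q (translation (B w)) +
      q • fieldMode (0 : ℂ) v (q - 1) (B w) := by
  obtain ⟨m, hm⟩ := (eventually_pderiv_eq_zero v).exists
  have hB0 := fun q w => fieldMode_commutator_of_le (0 : ℂ) hB hm q w
  rw [map_add, map_sub, map_zsmul, hT, hB0, hB0, hB0, hT,
    fieldMode_commutator_of_le (0 : ℂ) hB' hm, map_add, map_add, map_zsmul, map_sum]
  have h1 : ∑ i ∈ Finset.range m,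
      translation (Ring.choose s i • fieldMode (0 : ℂ) (pderiv i v) (s + q - i) w) =
      ∑ i ∈ Finset.range m,
        Ring.choose s i • fieldMode (0 : ℂ) (pderiv i v) (s + q - i) (translation w) -
      (s • ∑ i ∈ Finset.range m,
        Ring.choose (s - 1) i • fieldMode (0 : ℂ) (pderiv i v) (s - 1 + q - i) w +
      q • ∑ i ∈ Finset.range m,
        Ring.choose s i • fieldMode (0 : ℂ) (pderiv i v) (s + (q - 1) - i) w) := by
    rw [Finset.smul_sum, Finset.smul_sum, ← Finset.sum_add_distrib, ← Finset.sum_sub_distrib]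
    refine Finset.sum_congr rfl fun i _ => ?_
    rw [map_zsmul, ih, smul_sub, smul_smul, smul_smul, ← choose_sub_one,
      show s + (q - 1) - (i : ℤ) = s - 1 + q - i by ring,
      show s + q - (i : ℤ) - 1 = s - 1 + q - i by ring]
    module
  rw [h1, mul_comm s κ, mul_smul]
  module

/-- The same Schur argument as for the Jacobi identity: by induction on `v` the defect commutes with
the Heisenberg operators, so it is a constant, read off from the vacuum. -/
theorem fieldMode_translation (v : Fock) (q : ℤ) (w : Fock) :
    translation (fieldMode (0 : ℂ) v q w) =
      fieldMode (0 : ℂ) v q (translation w) - q • fieldMode (0 : ℂ) v (q - 1) w := by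
  induction v using pderiv_induction generalizing q w with
  | h0 => simp
  | h v ih =>
    rw [← sub_eq_zero, sub_sub_eq_add_sub, add_sub_right_comm]
    have hd : ∀ k : ℕ, IsModeLike (0 : ℂ) ((k : ℤ) • pderivC ℂ (k - 1)) (k * 1) (k - 1) := by
      intro k
      rcases k with _ | k
      · simpa using isModeLike_zero (0 : ℂ) (-1)
      · have := isModeLike_zsmul (isModeLike_pderiv (0 : ℂ) k) (k + 1 : ℕ)
        rw [show ((k + 1 : ℕ) : ℤ) - 1 = k by push_cast; ring]
        exact this
    have hX : ∀ k : ℕ, IsModeLike (0 : ℂ) (-((k : ℤ) + 1) • mulX ℂ (k + 1))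
        ((-(k : ℤ) - 2) * -((k : ℤ) + 1)) (-(k : ℤ) - 2 - 1) := by
      intro k
      have := isModeLike_zsmul (isModeLike_mulX (0 : ℂ) (k + 1)) (-((k : ℤ) + 1))
      rw [show (-(k : ℤ) - 2) * -((k : ℤ) + 1) = -((k : ℤ) + 1) * -(((k + 1 : ℕ) : ℤ) + 1) by
        push_cast; ring, show -(k : ℤ) - 2 - 1 = -((k + 1 : ℕ) : ℤ) - 2 by push_cast; ring]
      exact this
    rw [eq_mul_of_commute (E := fun w => translation (fieldMode (0 : ℂ) v q w) -
      fieldMode (0 : ℂ) v q (translation w) + q • fieldMode (0 : ℂ) v (q - 1) w)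
      (fun w w' => by simp only [map_add, smul_add]; abel)
      (fun r w => by
        simp only [← smul_eq_C_mul, map_smul, Derivation.map_smul, smul_add, smul_sub]
        rw [smul_comm r q])
      (fun k w => (translation_commutator (isModeLike_mulX (0 : ℂ) k) (hX k) (fun w => by
        simp only [mulX_apply, LinearMap.smul_apply, Derivation.leibniz, translation_X, smul_eq_mul]
        rw [zsmul_eq_mul, smul_eq_C_mul]
        push_cast
        simp
        ring) ih q w).symm)
      (fun k w => (translation_commutator (isModeLike_pderiv (0 : ℂ) k) (hd k) (fun w => by
        simp only [pderivC_apply, LinearMap.smul_apply]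
        rw [pderiv_translation, natCast_zsmul, ← Nat.cast_smul_eq_nsmul ℂ]) ih q w).symm) w]
    have h1 : translation (1 : Fock) = 0 := by rw [← C_1, translation_C]
    -- On the vacuum only `q • v_{q-1}` can have a constant term, namely for `q = 0`, where the
    -- factor `q` removes it.
    rw [map_add, map_sub, constantCoeff_translation, h1, map_zero, map_zero, map_zsmul,
      constantCoeff_vacuum]
    split_ifs with h
    · rw [show q = 0 by omega]; simp
    · simp

end Translation

end Heisenberg

namespace Heisenberg

open MvPolynomial Filter

/-! ### The Jacobi identity -/

section Jacobi

theorem succ_mul_choose_succ (r : ℤ) (i : ℕ) :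
    ((i : ℤ) + 1) * Ring.choose r (i + 1) = (r - i) * Ring.choose r i := by
  have h2 := Ring.choose_smul_choose r (Nat.le_succ i)
  simp only [Nat.succ_eq_add_one, nsmul_eq_mul, Nat.choose_succ_self_right,
    Nat.add_sub_cancel_left, Ring.choose_one_right] at h2
  push_cast at h2
  rw [h2, mul_comm]

/-- Unlike the left hand side, this does not hold term by term: the individual terms differ by a
telescoping sum, whose end terms vanish by truncation. -/
theorem jacobiRight_translation (u v w : Fock) (p q r : ℤ) : ∀ᶠ n in atTop,
    translation (∑ i ∈ Finset.range n, jacobiRight (0 : ℂ) u v w p q r i) =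
      ∑ i ∈ Finset.range n, jacobiRight (0 : ℂ) u v (translation w) p q r i -
      p • ∑ i ∈ Finset.range n, jacobiRight (0 : ℂ) u v w (p - 1) q r i -
      q • ∑ i ∈ Finset.range n, jacobiRight (0 : ℂ) u v w p (q - 1) r i := by
  let g : ℕ → Fock := fun i =>
    fieldMode (0 : ℂ) u (p + r - i) (fieldMode (0 : ℂ) v (q - 1 + i) w) -
      (r.negOnePow : ℤ) • fieldMode (0 : ℂ) v (q + r - i) (fieldMode (0 : ℂ) u (p - 1 + i) w)
  -- The telescoping term; the difference of consecutive values is matched by `(i + 1) (r choose i +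
  -- 1) = (r - i) (r choose i)`.
  let h : ℕ → Fock := fun i => ((-1 : ℤ) ^ i * (i * Ring.choose r i)) • g i
  filter_upwards [fieldMode_truncated_nat (0 : ℂ) v w (q - 1),
    fieldMode_truncated_nat (0 : ℂ) u w (p - 1)] with n h1 h2
  have hterm : ∀ i, translation (jacobiRight (0 : ℂ) u v w p q r i) =
      (h (i + 1) - h i) + jacobiRight (0 : ℂ) u v (translation w) p q r i -
      p • jacobiRight (0 : ℂ) u v w (p - 1) q r i -
      q • jacobiRight (0 : ℂ) u v w p (q - 1) r i := by
    intro i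
    simp only [h, g]
    push_cast
    rw [succ_mul_choose_succ]
    simp only [jacobiRight, map_zsmul, map_sub, fieldMode_translation]
    rw [show p - 1 + r - (i : ℤ) = p + r - (i + 1) by ring,
      show p + r - (i : ℤ) - 1 = p + r - (i + 1) by ring,
      show q - 1 + ((i : ℤ) + 1) = q + i by ring,
      show q + (i : ℤ) - 1 = q - 1 + i by ring,
      show q + r - (i : ℤ) - 1 = q + r - (i + 1) by ring,
      show q - 1 + r - (i : ℤ) = q + r - (i + 1) by ring,
      show p - 1 + ((i : ℤ) + 1) = p + i by ring,
      show p + (i : ℤ) - 1 = p - 1 + i by ring, pow_succ]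
    module
  have h0 : h 0 = 0 := by simp [h]
  have hn : h n = 0 := by
    simp only [h, g, h1, h2, map_zero, smul_zero, sub_zero]
  rw [map_sum, Finset.sum_congr rfl fun i _ => hterm i, Finset.sum_sub_distrib,
    Finset.sum_sub_distrib, Finset.sum_add_distrib, Finset.sum_range_sub, h0, hn,
    Finset.smul_sum, Finset.smul_sum]
  abel

theorem jacobiLeft_translation (u v w : Fock) (p q r : ℤ) (i : ℕ) :
    translation (jacobiLeft (0 : ℂ) u v w p q r i) =
      jacobiLeft (0 : ℂ) u v (translation w) p q r i -
      p • jacobiLeft (0 : ℂ) u v w (p - 1) q r i -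
      q • jacobiLeft (0 : ℂ) u v w p (q - 1) r i := by
  have h := choose_sub_one p i
  rw [jacobiLeft, map_zsmul, fieldMode_translation, jacobiLeft, jacobiLeft, jacobiLeft,
    smul_smul p, ← h, show p - 1 + q - (i : ℤ) = p + q - i - 1 by ring,
    show p + (q - 1) - (i : ℤ) = p + q - i - 1 by ring]
  module

theorem jacobiDefect_translation (u v w : Fock) (p q r : ℤ) :
    translation (jacobiDefect (0 : ℂ) u v w p q r) =
      jacobiDefect (0 : ℂ) u v (translation w) p q r -
      p • jacobiDefect (0 : ℂ) u v w (p - 1) q r -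
      q • jacobiDefect (0 : ℂ) u v w p (q - 1) r := by
  obtain ⟨n, h1, h2, h3, h4, h5⟩ := ((jacobiDefect_eventually (0 : ℂ) u v w p q r).and
    ((jacobiDefect_eventually (0 : ℂ) u v (translation w) p q r).and
    ((jacobiDefect_eventually (0 : ℂ) u v w (p - 1) q r).and
    ((jacobiDefect_eventually (0 : ℂ) u v w p (q - 1) r).and
      (jacobiRight_translation u v w p q r))))).exists
  rw [h1, h2, h3, h4, map_sub, h5, map_sum,
    Finset.sum_congr rfl fun i _ => jacobiLeft_translation u v w p q r i, Finset.sum_sub_distrib,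
    Finset.sum_sub_distrib, ← Finset.smul_sum, ← Finset.smul_sum, smul_sub, smul_sub]
  abel

theorem jacobiDefect_vacuum_zero (u v : Fock) (r : ℤ) :
    jacobiDefect (0 : ℂ) u v 1 0 (-1) r = 0 := by
  have h1 : ∑ᶠ i, jacobiLeft (0 : ℂ) u v 1 0 (-1) r i = fieldMode (0 : ℂ) u r v := by
    rw [finsum_eq_single _ 0]
    · simp [jacobiLeft, (fieldMode_creation _).1]
    · intro i hi
      rw [jacobiLeft, Ring.choose_zero_pos _ (Nat.pos_of_ne_zero hi), zero_smul]
  have h2 : ∑ᶠ i, jacobiRight (0 : ℂ) u v 1 0 (-1) r i = fieldMode (0 : ℂ) u r v := by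
    rw [finsum_eq_single _ 0]
    · simp [jacobiRight, (fieldMode_creation _).1, (fieldMode_creation u).2]
    · intro i hi
      rw [jacobiRight, (fieldMode_creation v).2 _ (by omega),
        (fieldMode_creation u).2 _ (by omega), map_zero, map_zero]
      simp
  rw [jacobiDefect, h1, h2, sub_self]

/-- At the vacuum, for `p = -1` and `q = 0`, the constant term of the identity is exactly
skew-symmetry. This is the one place where the symmetry between `u` and `v` enters. -/
theorem constantCoeff_jacobiDefect_vacuum (u v : Fock) (r : ℤ) :
    constantCoeff (jacobiDefect (0 : ℂ) u v 1 (-1) 0 r) = 0 := by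
  obtain ⟨n, h1, hn⟩ := ((jacobiDefect_eventually (0 : ℂ) u v 1 (-1) 0 r).and
    (eventually_gt_atTop 0)).exists
  rw [h1, map_sub, map_sum, map_sum, Finset.sum_eq_single 0, Finset.sum_eq_single 0]
  · have h2 : fieldMode (0 : ℂ) v 0 1 = 0 := (fieldMode_creation v).2 0 le_rfl
    simp only [jacobiLeft, jacobiRight, map_zsmul, map_sub]
    simp [h2, (fieldMode_creation u).1, constantCoeff_vacuum, constantCoeff_skew u v r]
  · intro i _ hi
    rw [jacobiRight, (fieldMode_creation v).2 _ (by omega), (fieldMode_creation u).2 _ (by omega)]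
    simp
  · intro h; simp [hn] at h
  · intro i _ hi
    rw [jacobiLeft, map_zsmul, constantCoeff_vacuum, if_neg (by omega), smul_zero]
  · intro h; simp [hn] at h

/-- By induction on the states the defect is a constant `d p q r`. The relations `hT` and `hP` leave
only `d 0 (-1) r` and `d (-1) 0 r` to be computed, and these are the creation property and
skew-symmetry. -/
theorem jacobiDefect_vertex (u v w : Fock) (p q r : ℤ) :
    jacobiDefect (0 : ℂ) u v w p q r = 0 := by
  revert w p q r
  refine pderiv_induction₂ (P := fun u v => ∀ (w : Fock) (p q r : ℤ),
    jacobiDefect (0 : ℂ) u v w p q r = 0) (jacobiDefect_zero_left 0)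
    (jacobiDefect_zero_right 0) (fun u v hu hv => ?_) u v
  have hmul := jacobiDefect_eq_mul (0 : ℂ) hu hv
  let d : ℤ → ℤ → ℤ → ℂ := fun p q r => constantCoeff (jacobiDefect (0 : ℂ) u v 1 p q r)
  suffices hd : ∀ p q r, d p q r = 0 by
    intro w p q r
    rw [hmul]
    change C (d p q r) * w = 0
    rw [hd, C_0, zero_mul]
  have hT : ∀ p q r : ℤ, (p : ℂ) * d (p - 1) q r + q * d p (q - 1) r = 0 := by
    intro p q r
    have h := congr_arg constantCoeff (jacobiDefect_translation u v 1 p q r)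
    have h1 : translation (1 : Fock) = 0 := by rw [← C_1, translation_C]
    rw [constantCoeff_translation, h1, hmul 0, mul_zero, zero_sub, map_sub, map_neg, map_zsmul,
      map_zsmul, zsmul_eq_mul, zsmul_eq_mul] at h
    simp only [d]
    linear_combination h
  have hP : ∀ p q r : ℤ, d (p + 1) q r = d p (q + 1) r + d p q (r + 1) := fun p q r => by
    simp only [d]
    rw [jacobiDefect_pascal, map_add]
  -- For `p = 0` the translation relation reads `(q + 1) * d 0 q r = 0`, so only `q = -1` is left.
  have h0 : ∀ q r, d 0 q r = 0 := by
    intro q r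
    by_cases hq : q = -1
    · simp only [d]
      rw [hq, jacobiDefect_vacuum_zero, map_zero]
    · have h := hT 0 (q + 1) r
      rw [Int.cast_zero, zero_mul, zero_add, add_sub_cancel_right] at h
      have h' : ((q + 1 : ℤ) : ℂ) ≠ 0 := by
        rw [Int.cast_ne_zero]; omega
      exact (mul_eq_zero.1 h).resolve_left h'
  have hpos : ∀ (p : ℕ) (q r : ℤ), d p q r = 0 := by
    intro p
    induction p with
    | zero => exact h0
    | succ p ih =>
      intro q r
      push_cast
      rw [hP, ih, ih, add_zero]
  -- On `q = 0` the translation relation carries the vanishing from `p` to `p - 1`, starting at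
  -- `-1`.
  have hneg0 : ∀ (p : ℕ) (r : ℤ), d (-(p : ℤ) - 1) 0 r = 0 := by
    intro p r
    rcases p with _ | p
    · simpa [d] using constantCoeff_jacobiDefect_vacuum u v r
    · have h := hT (-(p : ℤ) - 1) 0 r
      rw [Int.cast_zero, zero_mul, add_zero] at h
      have h' : ((-(p : ℤ) - 1 : ℤ) : ℂ) ≠ 0 := by
        rw [Int.cast_ne_zero]; omega
      have h2 := (mul_eq_zero.1 h).resolve_left h'
      rw [show -((p + 1 : ℕ) : ℤ) - 1 = -(p : ℤ) - 1 - 1 by push_cast; ring]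
      exact h2
  -- Once the row `-p` vanishes, Pascal's rule identifies neighbouring values of `q` in the next
  -- lower row up to sign and a shift of `r`, so `q = 0` determines the row in both directions.
  have hneg : ∀ (p : ℕ) (q r : ℤ), d (-(p : ℤ)) q r = 0 := by
    intro p
    induction p with
    | zero => simpa using h0
    | succ p ih =>
      have hs : ∀ q r, d (-(p : ℤ) - 1) (q + 1) r = -d (-(p : ℤ) - 1) q (r + 1) := fun q r => by
        have h := hP (-(p : ℤ) - 1) q r
        rw [sub_add_cancel, ih] at h
        exact eq_neg_of_add_eq_zero_left h.symm
      intro q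
      rw [show -((p + 1 : ℕ) : ℤ) = -(p : ℤ) - 1 by push_cast; ring]
      induction q using Int.induction_on with
      | zero => exact hneg0 p
      | succ n ihn => intro r; rw [hs, ihn, neg_zero]
      | pred n ihn =>
        intro r
        have h := hs (-(n : ℤ) - 1) (r - 1)
        rw [sub_add_cancel, sub_add_cancel, ihn] at h
        exact neg_eq_zero.1 h.symm
  intro p q r
  obtain ⟨n, rfl | rfl⟩ := p.eq_nat_or_neg
  · exact hpos n q r
  · exact hneg n q r

/-- The defect is again a constant, now a polynomial `δ` in `x`. As `derivCoeff` is mode-like, it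
commutes with the defect, and applied to the vacuum this gives `δ' = 0`; the specialisation `x = 0`
is the case already settled. -/
theorem jacobiDefect_polynomial (u v : Fock) (w : MvPolynomial ℕ (Polynomial ℂ)) (p q r : ℤ) :
    jacobiDefect (Polynomial.X : Polynomial ℂ) u v w p q r = 0 := by
  revert w p q r
  refine pderiv_induction₂ (P := fun u v => ∀ (w : MvPolynomial ℕ (Polynomial ℂ)) (p q r : ℤ),
    jacobiDefect (Polynomial.X : Polynomial ℂ) u v w p q r = 0) (jacobiDefect_zero_left _)
    (jacobiDefect_zero_right _) (fun u v hu hv => ?_) u v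
  have hmul := jacobiDefect_eq_mul (Polynomial.X : Polynomial ℂ) hu hv
  intro w p q r
  rw [hmul]
  set δ := constantCoeff (jacobiDefect (Polynomial.X : Polynomial ℂ) u v 1 p q r) with hδ
  have h1 : jacobiDefect (Polynomial.X : Polynomial ℂ) u v 1 p q r = C δ := by
    rw [hmul 1, mul_one]
  have h2 : Polynomial.derivative δ = 0 := by
    have h := jacobiDefect_comm_of_forall (Polynomial.X : Polynomial ℂ) isModeLike_derivCoeff
      hu hv 1 p q r
    have h3 : derivCoeff 1 = 0 := by rw [← C_1, derivCoeff_C]; simp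
    rw [h1, derivCoeff_C, h3, hmul 0, mul_zero] at h
    exact (C_eq_zero).1 h
  have h4 : (Polynomial.aeval (0 : ℂ)) δ = 0 := by
    have h := map_jacobiDefect (Polynomial.aeval (0 : ℂ)) (Polynomial.X : Polynomial ℂ) u v 1 p q r
    rw [Polynomial.aeval_X, jacobiDefect_vertex, h1, map_C] at h
    exact (C_eq_zero).1 h
  rw [Polynomial.eq_C_of_derivative_eq_zero h2] at h4 ⊢
  rw [Polynomial.aeval_C] at h4
  have h5 : δ.coeff 0 = 0 := h4
  rw [h5, Polynomial.C_0, C_0, zero_mul]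

variable {R : Type*} [CommRing R] [Algebra ℂ R] (t : R)

theorem jacobiDefect_C_mul (u v : Fock) (c : R) (w : MvPolynomial ℕ R) (p q r : ℤ) :
    jacobiDefect t u v (C c * w) p q r = C c * jacobiDefect t u v w p q r := by
  have h1 : ∀ i, jacobiLeft t u v (C c * w) p q r i = C c * jacobiLeft t u v w p q r i := by
    intro i
    rw [jacobiLeft, jacobiLeft, fieldMode_C_mul, mul_smul_comm]
  have h2 : ∀ i, jacobiRight t u v (C c * w) p q r i = C c * jacobiRight t u v w p q r i := by
    intro i
    simp only [jacobiRight, fieldMode_C_mul, mul_smul_comm, mul_sub]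
  obtain ⟨n, ha, hb⟩ := ((jacobiDefect_eventually t u v w p q r).and
    (jacobiDefect_eventually t u v (C c * w) p q r)).exists
  rw [ha, hb, mul_sub, Finset.mul_sum, Finset.mul_sum]
  simp only [h1, h2]

/-- The defect is `R`-linear in `w`, and monomials with coefficient `1` come from `(ℂ[x], x)` by the
base change `x ↦ t`. -/
theorem jacobiDefect_eq_zero (u v : Fock) (w : MvPolynomial ℕ R) (p q r : ℤ) :
    jacobiDefect t u v w p q r = 0 := by
  have hmap : ∀ w' : MvPolynomial ℕ (Polynomial ℂ),
      jacobiDefect t u v (map (Polynomial.aeval t : Polynomial ℂ →ₐ[ℂ] R).toRingHom w') p q r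
        = 0 := by
    intro w'
    have h := map_jacobiDefect (Polynomial.aeval t) (Polynomial.X : Polynomial ℂ) u v w' p q r
    rw [jacobiDefect_polynomial, map_zero, Polynomial.aeval_X] at h
    exact h.symm
  induction w using MvPolynomial.induction_on' with
  | monomial s c =>
    have h : monomial s c = C c * map (Polynomial.aeval t : Polynomial ℂ →ₐ[ℂ] R).toRingHom
        (monomial s 1) := by
      rw [map_monomial, map_one, C_mul_monomial, mul_one]
    rw [h, jacobiDefect_C_mul, hmap, mul_zero]
  | add f g hf hg => rw [jacobiDefect_add, hf, hg, add_zero]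

theorem fieldMode_jacobi (u v : Fock) (w : MvPolynomial ℕ R) (p q r : ℤ) :
    ∑ᶠ i, jacobiLeft t u v w p q r i = ∑ᶠ i, jacobiRight t u v w p q r i :=
  sub_eq_zero.1 (jacobiDefect_eq_zero t u v w p q r)

end Jacobi

end Heisenberg

namespace Heisenberg
open MvPolynomial Filter

/-! ### The modes of `α₋₁𝟏` -/

section AlphaModes

variable {R : Type*} [CommRing R] [Algebra ℂ R] (t : R)

theorem fieldMode_X_zero (q : ℤ) (w : MvPolynomial ℕ R) :
    fieldMode t (X 0) q w = (creationSeries t 0).coeff (-q - 1) * w +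
      ∑ k ∈ w.vars, if -q - 1 = -((k : ℤ) + 2) then
        ((k : MvPolynomial ℕ R) + 1) * pderiv k w else 0 := by
  rw [fieldMode_apply, ← mul_one (X 0 : Fock), field_X_mul, field_one, normalProd_apply,
    HahnSeries.coeff_add, coeff_sum]
  congr 1
  · change (creationSeries t 0 * HahnSeries.single 0 w).coeff (-q - 1) = _
    rw [HahnSeries.coeff_mul_single_zero]
  · refine Finset.sum_congr rfl fun k _ => ?_
    change (annihilationCoeff R 0 k * HahnSeries.single 0 _).coeff (-q - 1) = _
    rw [HahnSeries.coeff_mul_single_zero, annihilationCoeff, HahnSeries.coeff_single]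
    simp

theorem fieldMode_X_zero_neg (i : ℕ) (w : MvPolynomial ℕ R) :
    fieldMode t (X 0) (-((i : ℤ) + 1)) w = X i * w := by
  rw [fieldMode_X_zero, Finset.sum_eq_zero fun k _ => if_neg (by omega), add_zero]
  congr 1
  rw [creationSeries_coeff, if_pos (by omega), if_neg (by push_cast; omega),
    show (-(-((i : ℤ) + 1)) - 1).toNat = i by omega]
  simp

theorem fieldMode_X_zero_zero (w : MvPolynomial ℕ R) :
    fieldMode t (X 0) 0 w = C t * w := by
  rw [fieldMode_X_zero, Finset.sum_eq_zero fun k _ => if_neg (by omega), add_zero]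
  congr 1
  rw [creationSeries, HahnSeries.coeff_add, ofPowerSeries_coeff]
  simp

theorem fieldMode_X_zero_pos (i : ℕ) (w : MvPolynomial ℕ R) :
    fieldMode t (X 0) ((i : ℤ) + 1) w = ((i : ℂ) + 1) • pderiv i w := by
  have h : (creationSeries t 0).coeff (-((i : ℤ) + 1) - 1) = 0 := by
    rw [creationSeries_coeff, if_neg (by omega), if_neg (by push_cast; omega), add_zero]
  rw [fieldMode_X_zero, h, zero_mul, zero_add, Finset.sum_eq_single i]
  · rw [if_pos (by ring), Algebra.smul_def]
    simp
  · exact fun k _ hk => if_neg (by omega)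
  · intro hi
    rw [pderiv_eq_zero_of_notMem_vars hi, mul_zero, ite_self]

theorem fieldMode_C (c : ℂ) (q : ℤ) (w : MvPolynomial ℕ R) :
    fieldMode t (C c) q w = if q = -1 then c • w else 0 := by
  have h : fieldMode t (C c) q w = c • fieldMode t 1 q w := by
    rw [← fieldModeLin_apply, ← fieldModeLin_apply, ← map_smul, smul_eq_C_mul, mul_one]
  rw [h, fieldMode_one, smul_ite, smul_zero]

end AlphaModes

/-! ### Comparison with the vertex operators of `M_a(1)` -/

section VertexOp

theorem creationSeries_zero (i : ℕ) : creationSeries (0 : ℂ) i = creation i := by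
  rw [creationSeries, creation, mul_zero, C_0, HahnSeries.single_eq_zero, add_zero]

theorem foldr_normalOrder (l : List ℕ) (w : Fock) :
    l.foldr normalOrder (fun w => HahnSeries.single 0 w) w =
      l.foldr (fun i F => normalProd (0 : ℂ) i F) idField w := by
  induction l generalizing w with
  | nil => rfl
  | cons i l ih =>
    rw [List.foldr_cons, List.foldr_cons, normalProd_apply, creationSeries_zero, normalOrder, ih]
    simp only [ih]
    rfl

/-- The definition multiplies the factors in sorted order, but normally ordered products commute, so
the order is immaterial. -/
theorem vertexOp_eq (v w : Fock) : vertexOp v w = field (0 : ℂ) v w := by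
  have h : field (0 : ℂ) v = ∑ s ∈ v.support, v.coeff s •
      (Finsupp.toMultiset s).foldr (fun i F => normalProd (0 : ℂ) i F) idField := by
    conv_lhs => rw [v.as_sum, map_sum]
    exact Finset.sum_congr rfl fun s _ => field_monomial _ _ _
  rw [h, vertexOp, LinearMap.sum_apply]
  refine Finset.sum_congr rfl fun s _ => ?_
  rw [foldr_normalOrder, LinearMap.smul_apply, ← Multiset.coe_foldr, Multiset.sort_eq]

theorem mode_eq (a : ℂ) (v w : Fock) (q : ℤ) : (M a).mode v q w = fieldMode (0 : ℂ) v q w := by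
  rw [fieldMode_apply, ← vertexOp_eq]
  rfl

end VertexOp

/-! ### The conformal vector, the commutator formula and the derivative property -/

section Virasoro

variable {R : Type*} [CommRing R] [Algebra ℂ R] (t : R) (a : ℂ)

/-- The conformal vector `ω^a`. -/
abbrev conformalVector : Fock := (1 / 2 : ℂ) • X 0 ^ 2 + a • X 1

theorem pderiv_conformalVector (i : ℕ) : pderiv i (conformalVector a) =
    if i = 0 then X 0 else if i = 1 then C a else 0 := by
  rw [conformalVector, map_add, Derivation.map_smul, Derivation.map_smul, pderiv_pow]
  rcases eq_or_ne i 0 with rfl | h0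
  · rw [pderiv_X_self, pderiv_X_of_ne (by norm_num), if_pos rfl, smul_zero, add_zero,
      smul_eq_C_mul]
    have h : (C (1 / 2 : ℂ) * ((2 : ℕ) : Fock)) = 1 := by
      rw [← map_natCast (C : ℂ →+* Fock), ← C_mul]
      norm_num
    rw [← mul_assoc, ← mul_assoc, h]
    simp
  · rw [pderiv_X_of_ne h0.symm, if_neg h0, mul_zero, smul_zero, zero_add]
    rcases eq_or_ne i 1 with rfl | h1
    · rw [pderiv_X_self, if_pos rfl, smul_eq_C_mul, mul_one]
    · rw [pderiv_X_of_ne h1.symm, if_neg h1, smul_zero]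

-- Only two derivatives of `ω^a` are nonzero, namely `α₋₁` in the first variable and the constant
-- `a` in the second, so the commutator sum has two terms.
variable {t} in
theorem commutator_conformalVector {B : MvPolynomial ℕ R →ₗ[ℂ] MvPolynomial ℕ R} {κ s : ℤ}
    (hB : IsModeLike t B κ s) (q : ℤ) (w : MvPolynomial ℕ R) :
    B (fieldMode t (conformalVector a) q w) = fieldMode t (conformalVector a) q (B w) +
      κ • (fieldMode t (X 0) (s + q) w + if s + q = 0 then s • a • w else 0) := by
  rw [fieldMode_commutator_of_le t hB (m := 2) fun i hi => by
    rw [pderiv_conformalVector, if_neg (by omega), if_neg (by omega)]]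
  rw [Finset.sum_range_succ, Finset.sum_range_one, pderiv_conformalVector, if_pos rfl,
    pderiv_conformalVector, if_neg one_ne_zero, if_pos rfl, fieldMode_C, Ring.choose_zero_right,
    Ring.choose_one_right]
  simp only [Nat.cast_zero, sub_zero, one_smul, Nat.cast_one, smul_ite, smul_zero]
  congr 4
  simp only [eq_iff_iff]; omega

theorem conformal_X_mul (k : ℕ) (n : ℤ) (w : MvPolynomial ℕ R) :
    fieldMode t (conformalVector a) (n + 1) (X k * w) =
      X k * fieldMode t (conformalVector a) (n + 1) w +
      ((k : ℤ) + 1) • (fieldMode t (X 0) (n - k - 1) w -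
        if n = k + 1 then ((k : ℤ) + 2) • a • w else 0) := by
  have h := commutator_conformalVector a (isModeLike_mulX t k) (n + 1) w
  rw [mulX_apply, mulX_apply] at h
  rw [h, show -(k : ℤ) - 2 + (n + 1) = n - k - 1 by ring]
  by_cases hn : n = k + 1
  · rw [if_pos hn, if_pos (by omega)]; module
  · rw [if_neg hn, if_neg (by omega)]; module

/-- The vector is killed by all derivatives, hence is a constant, and the constant is the vacuum
expectation of `ω^a`. The sign of `a • t` comes from `α₋₂ ↦ -t x ^ (-2)`. -/
theorem conformal_one (n : ℤ) (hn : 0 ≤ n) :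
    fieldMode t (conformalVector a) (n + 1) 1 =
      if n = 0 then C ((1 / 2 : ℂ) • t ^ 2 - a • t) else 0 := by
  have h : ∀ k, pderiv k (fieldMode t (conformalVector a) (n + 1) 1) = 0 := fun k => by
    have h := commutator_conformalVector a (isModeLike_pderiv t k) (n + 1) 1
    rw [pderivC_apply, pderivC_apply, pderiv_one, map_zero, if_neg (by omega),
      show (k : ℤ) + (n + 1) = ((k + n.toNat : ℕ) : ℤ) + 1 by omega, fieldMode_X_zero_pos,
      pderiv_one] at h
    simpa using h
  rw [eq_C_of_pderiv_eq_zero h, constantCoeff_fieldMode_one]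
  have h2 : evalSeries t (conformalVector a) =
      HahnSeries.single (-2) ((1 / 2 : ℂ) • t ^ 2 - a • t) := by
    rw [conformalVector, smul_eq_C_mul, smul_eq_C_mul, evalSeries]
    simp only [map_add, map_mul, coe_eval₂Hom, eval₂_C, eval₂_X, RingHom.comp_apply,
      HahnSeries.C_apply, sq, HahnSeries.single_mul_single]
    rw [sub_eq_add_neg, HahnSeries.single_add]
    congr 1
    · rw [Algebra.smul_def]
      norm_num
    · rw [Algebra.smul_def]
      norm_num
  rw [h2, HahnSeries.coeff_single]
  by_cases hn : n = 0
  · rw [if_pos hn, if_pos (by omega)]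
  · rw [if_neg hn, if_neg (by omega), C_0]

theorem conformal_neg_one (v : Fock) :
    fieldMode (0 : ℂ) (conformalVector a) 0 v = translation v := by
  induction v using MvPolynomial.induction_on with
  | C c =>
    rw [translation_C, ← mul_one (C c), fieldMode_C_mul, (fieldMode_creation _).2 0 le_rfl,
      mul_zero]
  | add p q hp hq => rw [map_add, map_add, hp, hq]
  | mul_X p k hp =>
    have h := conformal_X_mul (0 : ℂ) a k (-1) p
    rw [if_neg (by omega), show (-1 : ℤ) - k - 1 = -(((k + 1 : ℕ) : ℤ) + 1) by push_cast; ring,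
      fieldMode_X_zero_neg, neg_add_cancel, hp, sub_zero] at h
    rw [mul_comm p, h, Derivation.leibniz, translation_X, smul_eq_mul, smul_eq_mul,
      mul_smul_comm, mul_comm p, ← Int.cast_smul_eq_zsmul ℂ]
    push_cast
    rfl

theorem translation_eq (v : Fock) : translation v = fieldMode (0 : ℂ) v (-2) 1 := by
  have h := fieldMode_translation v (-1) 1
  rw [(fieldMode_creation v).1, ← C_1, translation_C, map_zero] at h
  rw [h]
  simp

theorem fieldMode_commutator_formula (u v : Fock) (p q : ℤ) (w : MvPolynomial ℕ R) :
    fieldMode t u p (fieldMode t v q w) - fieldMode t v q (fieldMode t u p w) =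
      ∑ᶠ i : ℕ, Ring.choose p i • fieldMode t (fieldMode (0 : ℂ) u i v) (p + q - i) w := by
  have h := fieldMode_jacobi t u v w p q 0
  rw [finsum_eq_single (jacobiRight t u v w p q 0) 0 fun i hi => by
    rw [jacobiRight, Ring.choose_zero_pos ℤ (by omega), mul_zero, zero_smul]] at h
  simp only [jacobiRight, jacobiLeft, zero_add] at h
  rw [h]
  simp

/-- The Jacobi identity with second state the vacuum, `p = 0` and `r = -2`: the left side is the
mode of `v_{-2} 𝟏`, and on the right the vacuum modes select at most one summand. -/
theorem fieldMode_translation_left (v : Fock) (q : ℤ) (w : MvPolynomial ℕ R) :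
    fieldMode t (translation v) q w = -q • fieldMode t v (q - 1) w := by
  have h := fieldMode_jacobi t v 1 w 0 q (-2)
  rw [finsum_eq_single (jacobiLeft t v 1 w 0 q (-2)) 0 fun i hi => by
    rw [jacobiLeft, Ring.choose_zero_pos ℤ (by omega), zero_smul]] at h
  have h0 : jacobiLeft t v 1 w 0 q (-2) 0 = fieldMode t (translation v) q w := by
    simp [jacobiLeft, translation_eq]
  have hc : ∀ i : ℕ, (-1 : ℤ) ^ i * Ring.choose (-2 : ℤ) i = i + 1 := fun i => by
    rw [Ring.choose_neg, show (2 : ℤ) + i - 1 = ((i + 1 : ℕ) : ℤ) by push_cast; ring,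
      Ring.choose_natCast, Nat.choose_succ_self_right, Units.smul_def, smul_eq_mul, ← mul_assoc,
      Int.coe_negOnePow_natCast, ← mul_pow]
    simp
  rw [h0] at h
  rw [h]
  -- The first product survives for `q < 0` at `i = -1 - q`, the second for `q > 0` at `i = q - 1`,
  -- each with weight `i + 1 = |q|`; for `q = 0` nothing survives.
  have hr : ∀ i : ℕ, jacobiRight t v 1 w 0 q (-2) i =
      if q < 0 then (if i = (-1 - q).toNat then -q • fieldMode t v (q - 1) w else 0) else
        (if 0 < q ∧ i = (q - 1).toNat then -q • fieldMode t v (q - 1) w else 0) := by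
    intro i
    rw [jacobiRight, hc, fieldMode_one, fieldMode_one]
    have hp : (((-2 : ℤ).negOnePow : ℤˣ) : ℤ) = 1 := by decide
    rw [hp, one_smul]
    rcases lt_trichotomy q 0 with hq | rfl | hq
    · rw [if_pos hq, if_neg (show ¬q + -2 - i = -1 by omega), sub_zero]
      by_cases hi : i = (-1 - q).toNat
      · rw [if_pos hi, if_pos (by omega), show (i : ℤ) + 1 = -q by omega,
          show (0 : ℤ) + -2 - i = q - 1 by omega]
      · rw [if_neg hi, if_neg (by omega), map_zero, smul_zero]
    · simp [show ¬(i : ℤ) = -1 by omega, show ¬(-2 - i : ℤ) = -1 by omega]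
    · rw [if_neg (show ¬q + i = -1 by omega), if_neg (show ¬q < 0 by omega), map_zero, zero_sub]
      by_cases hi : i = (q - 1).toNat
      · rw [if_pos (show 0 < q ∧ _ from ⟨hq, hi⟩), if_pos (by omega), show (i : ℤ) + 1 = q by omega,
          show (0 : ℤ) + i = q - 1 by omega, smul_neg, neg_smul]
      · rw [if_neg (show ¬q + -2 - i = -1 by omega), if_neg (fun h => hi h.2), neg_zero, smul_zero]
  simp only [hr]
  rcases lt_trichotomy q 0 with hq | rfl | hq
  · simp only [if_pos hq]
    rw [finsum_eq_single _ (-1 - q).toNat fun i hi => if_neg hi, if_pos rfl]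
  · simp
  · rw [finsum_eq_single _ (q - 1).toNat fun i hi => by
      rw [if_neg (by omega), if_neg (fun h => hi h.2)], if_neg (by omega), if_pos ⟨hq, rfl⟩]

end Virasoro

/-! ### The grading by degree and the action of `L₀` -/

section Degree

variable {R : Type*} [CommRing R] [Algebra ℂ R] (t : R) (a : ℂ)

/-- The degree of a monomial, where `α_{-(i+1)}` has degree `i + 1`. -/
abbrev wt : (ℕ →₀ ℕ) →+ ℕ := Finsupp.weight fun i : ℕ => i + 1

theorem wt_single (i n : ℕ) : wt (Finsupp.single i n) = n * (i + 1) := by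
  simp [wt, Finsupp.weight_apply]

theorem finsupp_induction {P : (ℕ →₀ ℕ) → Prop} (h0 : P 0)
    (h : ∀ k s, P s → P (Finsupp.single k 1 + s)) (s : ℕ →₀ ℕ) : P s := by
  obtain ⟨m, rfl⟩ := Multiset.toFinsupp.surjective s
  induction m using Multiset.induction_on with
  | empty => simpa using h0
  | cons k m ih =>
    rw [← Multiset.singleton_add, map_add, Multiset.toFinsupp_singleton]
    exact h k _ ih

theorem conformal_monomial (s : ℕ →₀ ℕ) (r : R) :
    fieldMode t (conformalVector a) 1 (monomial s r) =
      wt s • monomial s r + C ((1 / 2 : ℂ) • t ^ 2 - a • t) * monomial s r := by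
  induction s using finsupp_induction with
  | h0 =>
    have h := conformal_one t a 0 le_rfl
    rw [zero_add, if_pos rfl] at h
    rw [map_zero, zero_smul, zero_add]
    change fieldMode t (conformalVector a) 1 (C r) = _ * C r
    rw [← mul_one (C r), fieldMode_C_mul, h, mul_one, mul_comm]
  | h k s ih =>
    have hm : (monomial (Finsupp.single k 1 + s) r : MvPolynomial ℕ R) = X k * monomial s r := by
      rw [X, monomial_mul, one_mul]
    have h := conformal_X_mul t a k 0 (monomial s r)
    rw [if_neg (by omega), sub_zero, zero_add, show (0 : ℤ) - k - 1 = -((k : ℤ) + 1) by ring,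
      fieldMode_X_zero_neg, ih] at h
    rw [hm, h, map_add, wt_single, one_mul, add_smul, mul_add, mul_smul_comm]
    rw [mul_left_comm]
    module

theorem coeff_conformal (s : ℕ →₀ ℕ) (w : MvPolynomial ℕ R) :
    coeff s (fieldMode t (conformalVector a) 1 w) =
      wt s • coeff s w + ((1 / 2 : ℂ) • t ^ 2 - a • t) * coeff s w := by
  classical
  induction w using MvPolynomial.induction_on' with
  | monomial s' r =>
    rw [conformal_monomial, coeff_add, coeff_smul, coeff_C_mul, coeff_monomial]
    split_ifs with h
    · rw [h]
    · simp
  | add p q hp hq => rw [map_add, coeff_add, hp, hq, coeff_add]; ring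

/-- The homogeneous polynomials of degree `ℓ`, where `α_{-(i+1)}` has degree `i + 1`. -/
def degreePart (R : Type*) [CommRing R] [Algebra ℂ R] (ℓ : ℤ) :
    Submodule ℂ (MvPolynomial ℕ R) where
  carrier := {w | ∀ s, coeff s w ≠ 0 → (wt s : ℤ) = ℓ}
  zero_mem' s h := absurd (coeff_zero s) h
  add_mem' {x y} hx hy s h := by
    by_contra hs
    apply h
    rw [coeff_add, not_not.1 fun h1 => hs (hx s h1), not_not.1 fun h1 => hs (hy s h1), add_zero]
  smul_mem' c x hx s h := hx s fun h1 => h (by rw [coeff_smul, h1, smul_zero])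

theorem mem_degreePart {ℓ : ℤ} {w : MvPolynomial ℕ R} :
    w ∈ degreePart R ℓ ↔ ∀ s, coeff s w ≠ 0 → (wt s : ℤ) = ℓ := Iff.rfl

/-- Turns statements on degrees into commutators with `L₀`, which acts on `M(1) ⊗ R` as the degree
plus the constant `t² / 2 - a t`. -/
theorem mem_degreePart_iff {ℓ : ℤ} {w : MvPolynomial ℕ R} : w ∈ degreePart R ℓ ↔
    fieldMode t (conformalVector a) 1 w = ℓ • w + C ((1 / 2 : ℂ) • t ^ 2 - a • t) * w := by
  rw [mem_degreePart, MvPolynomial.ext_iff]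
  refine forall_congr' fun s => ?_
  rw [coeff_conformal, coeff_add, coeff_smul, coeff_C_mul, add_left_inj, ← natCast_zsmul,
    ← sub_eq_zero (a := (wt s : ℤ) • _), ← sub_smul, ← Int.cast_smul_eq_zsmul ℂ, smul_eq_zero, Int.cast_eq_zero,
    sub_eq_zero]
  tauto

theorem hasWeight_iff {n : ℤ} {v : Fock} : (M a).HasWeight n v ↔ v ∈ degreePart ℂ n := by
  rw [mem_degreePart_iff 0 a]
  simp only [VertexData.HasWeight, VertexData.L, mode_eq, zero_add]
  rw [zero_pow two_ne_zero, smul_zero, smul_zero, sub_zero, C_0, zero_mul, add_zero]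
  rfl

theorem fieldMode_zsmul_left (n : ℤ) (v : Fock) (q : ℤ) (w : MvPolynomial ℕ R) :
    fieldMode t (n • v) q w = n • fieldMode t v q w :=
  map_zsmul (fieldModeLin t q w) n v

theorem fieldMode_smul_left (c : ℂ) (v : Fock) (q : ℤ) (w : MvPolynomial ℕ R) :
    fieldMode t (c • v) q w = c • fieldMode t v q w :=
  map_smul (fieldModeLin t q w) c v

theorem fieldMode_add_left (u v : Fock) (q : ℤ) (w : MvPolynomial ℕ R) :
    fieldMode t (u + v) q w = fieldMode t u q w + fieldMode t v q w :=
  map_add (fieldModeLin t q w) u v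

/-- From `[L₀, v_m] = (L₋₁ v)_{m+1} + (L₀ v)_m = (n - m - 1) v_m`. -/
theorem fieldMode_mem_degreePart {n ℓ m : ℤ} {v : Fock} {w : MvPolynomial ℕ R}
    (hv : v ∈ degreePart ℂ n) (hw : w ∈ degreePart R ℓ) :
    fieldMode t v m w ∈ degreePart R (ℓ + n - m - 1) := by
  -- Degrees do not depend on `a`, so the conformal vector with `a = 0` may be used.
  have h := fieldMode_commutator_formula t (conformalVector 0) v 1 m w
  have hc : ∀ i : ℕ, 2 ≤ i → Ring.choose (1 : ℤ) i = 0 := fun i hi => by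
    have := Ring.choose_natCast (R := ℤ) 1 i
    rw [Nat.cast_one] at this
    rw [this, Nat.choose_eq_zero_of_lt (by omega), Nat.cast_zero]
  rw [finsum_eq_sum_of_support_subset (s := Finset.range 2) _ fun i hi => by
    rw [Finset.coe_range, Set.mem_Iio]
    by_contra h
    exact hi (by simp only [hc i (by omega), zero_smul])] at h
  rw [mem_degreePart_iff 0 0, zero_pow two_ne_zero, smul_zero, smul_zero, sub_zero, C_0, zero_mul,
    add_zero] at hv
  rw [mem_degreePart_iff t 0] at hw ⊢
  rw [Finset.sum_range_succ, Finset.sum_range_one, Ring.choose_zero_right, Ring.choose_one_right,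
    Nat.cast_zero, conformal_neg_one, fieldMode_translation_left, Nat.cast_one, hv, hw] at h
  rw [fieldMode_zsmul_left, map_add, map_zsmul,
    fieldMode_C_mul, sub_eq_iff_eq_add] at h
  rw [h, show (1 : ℤ) + m - 0 - 1 = m by ring, show (1 : ℤ) + m - 1 = m by ring]
  module

end Degree
end Heisenberg

namespace Heisenberg
open MvPolynomial Filter

/-! ### `M_a(1)` is a vertex operator algebra -/

section VOA

variable (a : ℂ)

theorem fieldMode_X_zero_X_zero (n : ℕ) :
    fieldMode (0 : ℂ) (X 0) n (X 0) = if n = 1 then 1 else 0 := by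
  rcases n with _ | n
  · rw [Nat.cast_zero, fieldMode_X_zero_zero, C_0, zero_mul, if_neg zero_ne_one]
  · rw [Nat.cast_add, Nat.cast_one, fieldMode_X_zero_pos]
    rcases n with _ | n
    · simp
    · rw [pderiv_X_of_ne (by omega), smul_zero, if_neg (by omega)]

theorem conformalVector_mem : conformalVector a ∈ degreePart ℂ 2 := by
  classical
  refine Submodule.add_mem _ (Submodule.smul_mem _ _ ?_) (Submodule.smul_mem _ _ ?_)
  · intro s hs
    rw [X_pow_eq_monomial, coeff_monomial] at hs
    rw [← (ite_ne_right_iff.1 hs).1, wt_single]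
    rfl
  · intro s hs
    rw [X, coeff_monomial] at hs
    rw [← (ite_ne_right_iff.1 hs).1, wt_single]
    rfl

/-- The products of `ω^a` with itself, which determine the Virasoro bracket. In the third product `½
α₋₁²` contributes `1 / 2` and `a α₋₂` contributes `-6 a²`, together half of the central charge. -/
theorem conformal_conformal (n : ℕ) :
    fieldMode (0 : ℂ) (conformalVector a) n (conformalVector a) =
      if n = 0 then translation (conformalVector a) else if n = 1 then (2 : ℤ) • conformalVector a
        else if n = 3 then C ((1 - 12 * a ^ 2) / 2) else 0 := by
  match n with
  | 0 => exact conformal_neg_one a _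
  | 1 =>
    have h := conformalVector_mem a
    rw [mem_degreePart_iff 0 a] at h
    rw [if_neg one_ne_zero, if_pos rfl, Nat.cast_one, h, zero_pow two_ne_zero, smul_zero,
      smul_zero, sub_zero, C_0, zero_mul, add_zero]
  | (n + 2) =>
    -- This mode of `ω^a` is `L_{n+1}`, which kills the vacuum; its values on `X 0`, `X 1` and `X 0
    -- * X 0` follow by moving it through one factor at a time.
    have h1 : fieldMode (0 : ℂ) (conformalVector a) (((n + 1 : ℕ) : ℤ) + 1) 1 = 0 := by
      rw [conformal_one _ _ _ (by omega), if_neg (by omega)]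
    have hX0 := conformal_X_mul (0 : ℂ) a 0 ((n + 1 : ℕ) : ℤ) 1
    have hX1 := conformal_X_mul (0 : ℂ) a 1 ((n + 1 : ℕ) : ℤ) 1
    have hX00 := conformal_X_mul (0 : ℂ) a 0 ((n + 1 : ℕ) : ℤ) (X 0)
    have e : ((n + 1 : ℕ) : ℤ) - (0 : ℕ) - 1 = n := by push_cast; ring
    rw [e, fieldMode_X_zero_X_zero] at hX00
    rw [h1, mul_zero, zero_add, mul_one] at hX0 hX1
    rw [e, (fieldMode_creation _).2 _ (by omega)] at hX0
    rw [hX0] at hX00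
    have h2 : fieldMode (0 : ℂ) (X 0) (((n + 1 : ℕ) : ℤ) - (1 : ℕ) - 1) 1 =
        if n = 0 then X 0 else 0 := by
      rcases n with _ | n
      · exact (fieldMode_creation _).1
      · rw [(fieldMode_creation _).2 _ (by push_cast; omega), if_neg (by omega)]
    rw [h2] at hX1
    have e2 : ((n + 2 : ℕ) : ℤ) = ((n + 1 : ℕ) : ℤ) + 1 := by push_cast; ring
    rw [e2]
    have hω : ∀ q, fieldMode (0 : ℂ) (conformalVector a) q (conformalVector a) =
        (1 / 2 : ℂ) • fieldMode (0 : ℂ) (conformalVector a) q (X 0 * X 0) +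
          a • fieldMode (0 : ℂ) (conformalVector a) q (X 1) := fun q => by
      rw [← map_smul, ← map_smul, ← map_add, ← sq]
    rw [hω, hX00, hX1]
    match n with
    | 0 =>
      simp only [← Int.cast_smul_eq_zsmul ℂ, smul_eq_C_mul]
      simp
      ring_nf
      have hC : C (1 / 2) * (2 : Fock) = 1 := by
        rw [← map_ofNat (C : ℂ →+* Fock) 2, ← C_mul]
        norm_num
      linear_combination (-(X 0 * C 2 * C a)) * hC
    | 1 =>
      simp only [← Int.cast_smul_eq_zsmul ℂ, smul_eq_C_mul]
      simp
      ring_nf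
      simp only [← C_mul, ← C_pow, ← C_sub]
      congr 1
      ring
    | (n + 2) =>
      simp
      rw [if_neg (by omega), if_neg (by omega), if_neg (by omega)]
      simp

theorem wt_eq_sum (s : ℕ →₀ ℕ) : wt s = ((Finsupp.toMultiset s).map (· + 1)).sum := by
  induction s using finsupp_induction with
  | h0 => simp
  | h k s ih =>
    rw [map_add, map_add, Multiset.map_add, Multiset.sum_add, ih, wt_single,
      Finsupp.toMultiset_single]
    simp

/-- Monomials of degree `n` correspond to partitions of `n`. -/
def partitionEquiv (n : ℕ) : {s : ℕ →₀ ℕ // wt s = n} ≃ Nat.Partition n where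
  toFun s :=
    { parts := (Finsupp.toMultiset s.1).map (· + 1)
      parts_pos := fun {i} hi => by
        obtain ⟨j, -, rfl⟩ := Multiset.mem_map.1 hi
        exact j.succ_pos
      parts_sum := by rw [← wt_eq_sum, s.2] }
  invFun p := ⟨Multiset.toFinsupp (p.parts.map (· - 1)), by
    rw [wt_eq_sum, Multiset.toFinsupp_toMultiset, Multiset.map_map]
    conv_rhs => rw [← p.parts_sum]
    congr 1
    refine (Multiset.map_congr rfl fun i hi => ?_).trans (Multiset.map_id _)
    have := p.parts_pos hi
    simp only [Function.comp_apply, id]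
    omega⟩
  left_inv s := by
    apply Subtype.ext
    dsimp only
    rw [Multiset.map_map]
    simp
  right_inv p := by
    apply Nat.Partition.ext
    dsimp only
    rw [Multiset.toFinsupp_toMultiset, Multiset.map_map]
    refine (Multiset.map_congr rfl fun i hi => ?_).trans (Multiset.map_id _)
    have := p.parts_pos hi
    simp only [Function.comp_apply, id]
    omega

instance (n : ℕ) : Finite {s : ℕ →₀ ℕ // wt s = n} := Finite.of_equiv _ (partitionEquiv n).symm

theorem finite_setOf_wt (n : ℕ) : {s : ℕ →₀ ℕ | wt s = n}.Finite :=
  inferInstanceAs (Finite {s : ℕ →₀ ℕ // wt s = n})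

theorem degreePart_eq_span (n : ℤ) : degreePart ℂ n =
    Submodule.span ℂ ((fun s => monomial s 1) '' {s | (wt s : ℤ) = n}) := by
  apply le_antisymm
  · intro w hw
    rw [w.as_sum]
    refine Submodule.sum_mem _ fun s hs => ?_
    rw [← mul_one (coeff s w), ← smul_eq_mul, ← smul_monomial]
    exact Submodule.smul_mem _ _ (Submodule.subset_span ⟨s, hw s (mem_support_iff.1 hs), rfl⟩)
  · rw [Submodule.span_le]
    rintro _ ⟨s, hs, rfl⟩ s' h
    classical
    rw [coeff_monomial] at h
    have := (ite_ne_right_iff.1 h).1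
    rwa [← this]

theorem finiteDimensional_degreePart (n : ℤ) : FiniteDimensional ℂ (degreePart ℂ n) := by
  rw [degreePart_eq_span]
  refine FiniteDimensional.span_of_finite ℂ (Set.Finite.image _ ?_)
  refine (finite_setOf_wt n.toNat).subset fun s hs => ?_
  have h : (wt s : ℤ) = n := hs
  change wt s = n.toNat
  omega

theorem virasoro (m n : ℤ) (v : Fock) :
    fieldMode (0 : ℂ) (conformalVector a) (m + 1) (fieldMode (0 : ℂ) (conformalVector a) (n + 1) v)
      - fieldMode (0 : ℂ) (conformalVector a) (n + 1)
        (fieldMode (0 : ℂ) (conformalVector a) (m + 1) v) =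
      (m - n) • fieldMode (0 : ℂ) (conformalVector a) (m + n + 1) v +
        (if m + n = 0 then ((m : ℂ) ^ 3 - m) / 12 * (1 - 12 * a ^ 2) else 0) • v := by
  rw [fieldMode_commutator_formula, finsum_eq_sum_of_support_subset (s := Finset.range 4) _
    fun i hi => by
      rw [Finset.coe_range, Set.mem_Iio]
      by_contra h
      refine hi ?_
      dsimp only
      rw [conformal_conformal, if_neg (by omega), if_neg (by omega), if_neg (by omega),
        fieldMode_zero, LinearMap.zero_apply, smul_zero]]
  simp only [Finset.sum_range_succ, Finset.sum_range_zero, conformal_conformal]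
  simp only [if_true, one_ne_zero, if_false, OfNat.ofNat_ne_zero, OfNat.ofNat_ne_one, zero_add,
    Ring.choose_zero_right,
    Ring.choose_one_right, Nat.cast_zero, Nat.cast_one]
  rw [fieldMode_C, fieldMode_zsmul_left,
    fieldMode_translation_left]
  -- The cubic binomial of `m + 1` is the source of the factor `m ^ 3 - m` of the central term.
  have h3 : ((Ring.choose (m + 1) 3 : ℤ) : ℂ) = ((m : ℂ) ^ 3 - m) / 6 := by
    have h := Ring.descPochhammer_eq_factorial_smul_choose (m + 1) 3
    simp [descPochhammer_succ_right, Polynomial.smeval_mul, Polynomial.smeval_sub, Nat.factorial] at h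
    have e' : (2 : Polynomial ℤ).smeval (m + 1) = 2 := by
      have h := Polynomial.smeval_natCast ℤ (m + 1) 2
      simpa using h
    rw [e'] at h
    have h' : ((m : ℂ) + 1) * m * (m + 1 - 2) = 6 * (Ring.choose (m + 1) 3 : ℤ) := by
      exact_mod_cast h
    linear_combination -h' / 6
  rw [if_neg (by omega), fieldMode_zero, LinearMap.zero_apply, smul_zero, add_zero,
    show m + 1 + (n + 1) - 0 - 1 = m + n + 1 by ring, show m + 1 + (n + 1) - 1 = m + n + 1 by ring]
  by_cases hmn : m + n = 0
  · rw [if_pos hmn, if_pos (by push_cast; omega), ← Int.cast_smul_eq_zsmul ℂ (Ring.choose _ _), h3]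
    congr 1
    · module
    · rw [smul_smul]
      congr 1
      ring
  · rw [if_neg hmn, if_neg (by push_cast; omega), smul_zero, zero_smul]
    module

theorem isVertexOperatorAlgebra : (M a).IsVertexOperatorAlgebra (1 - 12 * a ^ 2) where
  add_left u u' v := by
    change vertexOp _ _ = vertexOp _ _ + vertexOp _ _
    simp only [vertexOp_eq, map_add, LinearMap.add_apply]
  smul_left z u v := by
    change vertexOp _ _ = z • vertexOp _ _
    simp only [vertexOp_eq, map_smul, LinearMap.smul_apply]
  add_right u v v' := by
    change vertexOp _ _ = vertexOp _ _ + vertexOp _ _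
    simp only [vertexOp_eq, map_add]
  smul_right z u v := by
    change vertexOp _ _ = z • vertexOp _ _
    simp only [vertexOp_eq, map_smul]
  vacuum v := by
    change vertexOp 1 v = _
    rw [vertexOp_eq, field_one]
    rfl
  creation v := by
    simp only [mode_eq]
    exact fieldMode_creation v
  jacobi u v w p q r := by
    simp only [mode_eq]
    exact fieldMode_jacobi 0 u v w p q r
  virasoro m n v := by
    simp only [VertexData.L, mode_eq]
    exact virasoro a m n v
  derivative v m w := by
    simp only [VertexData.L, mode_eq]
    rw [← fieldMode_translation_left, ← conformal_neg_one a]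
    rfl
  graded := by
    rw [eq_top_iff]
    rintro w -
    rw [w.as_sum]
    refine Submodule.sum_mem _ fun s _ => Submodule.subset_span ⟨wt s, ?_⟩
    rw [hasWeight_iff]
    intro s' h
    classical
    rw [coeff_monomial] at h
    rw [(ite_ne_right_iff.1 h).1]
  finite n := by
    rw [show {v | (M a).HasWeight n v} = (degreePart ℂ n : Set Fock) from
      Set.ext fun v => hasWeight_iff a, Submodule.span_eq]
    exact finiteDimensional_degreePart n
  bounded := by
    refine ⟨0, fun n hn v hv => ?_⟩
    rw [hasWeight_iff] at hv
    ext s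
    by_contra h
    have := hv s h
    omega

end VOA

end Heisenberg

/-! ### Calculus in `𝒰(V̂)` and transport of weak modules -/

namespace VertexData

variable {V : Type} [AddCommGroup V] [Module ℂ V] (D : VertexData V)

/-- `v ↦ v(m)` as a linear map. -/
def genHom (m : ℤ) : V →ₗ[ℂ] D.ModeAlgebra :=
  (RingQuot.mkAlgHom ℂ D.ModeRel).toLinearMap ∘ₗ TensorAlgebra.ι ℂ ∘ₗ Finsupp.lsingle m

theorem gen_add (u v : V) (m : ℤ) : D.gen (u + v) m = D.gen u m + D.gen v m :=
  map_add (D.genHom m) u v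

theorem gen_smul (c : ℂ) (v : V) (m : ℤ) : D.gen (c • v) m = c • D.gen v m :=
  map_smul (D.genHom m) c v

theorem gen_zero (m : ℤ) : D.gen 0 m = 0 := map_zero (D.genHom m)

theorem gen_derivative (v : V) (m : ℤ) : D.gen (D.L (-1) v) m = -m • D.gen v (m - 1) := by
  have h := RingQuot.mkAlgHom_rel ℂ (ModeRel.derivative (D := D) v m)
  rw [map_add, map_zsmul, map_zero] at h
  rw [neg_smul]
  exact eq_neg_of_add_eq_zero_left h

theorem gen_bracket (u v : V) (j k : ℤ) (N : ℕ) (hN : ∀ i : ℕ, N ≤ i → D.mode u i v = 0) :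
    D.gen u j * D.gen v k = D.gen v k * D.gen u j +
      ∑ i ∈ Finset.range N, (Ring.choose j i : ℤ) • D.gen (D.mode u i v) (j + k - i) := by
  have h := RingQuot.mkAlgHom_rel ℂ (ModeRel.bracket (D := D) u v j k N hN)
  rw [map_add, map_mul, map_mul, map_sum] at h
  simp only [map_zsmul] at h
  exact h

theorem modeAlgebra_induction {P : D.ModeAlgebra → Prop} (hc : ∀ c : ℂ, P (algebraMap ℂ _ c))
    (hg : ∀ v m, P (D.gen v m)) (ha : ∀ x y, P x → P y → P (x + y))
    (hm : ∀ x y, P x → P y → P (x * y)) (x : D.ModeAlgebra) : P x := by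
  obtain ⟨x, rfl⟩ := RingQuot.mkAlgHom_surjective ℂ D.ModeRel x
  induction x using TensorAlgebra.induction with
  | algebraMap c =>
    rw [AlgHom.commutes]
    exact hc c
  | ι f =>
    induction f using Finsupp.induction_linear with
    | zero =>
      rw [map_zero, map_zero, ← map_zero (algebraMap ℂ _)]
      exact hc 0
    | add f g hf hg => rw [map_add, map_add]; exact ha _ _ hf hg
    | single m v => exact hg v m
  | mul x y hx hy => rw [map_mul]; exact hm _ _ hx hy
  | add x y hx hy => rw [map_add]; exact ha _ _ hx hy

section

variable {W W' : Type*} [AddCommGroup W] [Module ℂ W] [Module D.ModeAlgebra W]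
  [IsScalarTower ℂ D.ModeAlgebra W] [AddCommGroup W'] [Module ℂ W'] [Module D.ModeAlgebra W']
  [IsScalarTower ℂ D.ModeAlgebra W']

/-- A linear map that commutes with all `v(m)` is a homomorphism of `𝒰(V̂)`-modules. -/
def homOfGen (f : W →ₗ[ℂ] W') (hf : ∀ v m w, f (D.gen v m • w) = D.gen v m • f w) :
    W →ₗ[D.ModeAlgebra] W' where
  toFun := f
  map_add' := map_add f
  map_smul' x w := by
    rw [RingHom.id_apply]
    induction x using D.modeAlgebra_induction generalizing w with
    | hc c => rw [algebraMap_smul, algebraMap_smul, map_smul]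
    | hg v m => exact hf v m w
    | ha x y hx hy => rw [add_smul, add_smul, map_add, hx, hy]
    | hm x y hx hy => rw [mul_smul, mul_smul, hx, hy]

/-- A subspace that is stable under all `v(m)` is a `𝒰(V̂)`-submodule. -/
def submoduleOfGen (S : Submodule ℂ W) (hS : ∀ v m, ∀ w ∈ S, D.gen v m • w ∈ S) :
    Submodule D.ModeAlgebra W where
  carrier := S
  zero_mem' := S.zero_mem
  add_mem' := S.add_mem
  smul_mem' x w hw := by
    induction x using D.modeAlgebra_induction generalizing w with
    | hc c => rw [algebraMap_smul]; exact S.smul_mem c hw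
    | hg v m => exact hS v m w hw
    | ha x y hx hy => rw [add_smul]; exact S.add_mem (hx w hw) (hy w hw)
    | hm x y hx hy => rw [mul_smul]; exact hx _ (hy _ hw)

variable {D} in
theorem IsWeakModule.ofEquiv (h : D.IsWeakModule W) (e : W ≃ₗ[D.ModeAlgebra] W') :
    D.IsWeakModule W' where
  truncated v w := by
    obtain ⟨N, hN⟩ := h.truncated v (e.symm w)
    refine ⟨N, fun m hm => e.symm.injective ?_⟩
    rw [map_smul, map_zero, hN m hm]
  vacuum m w := e.symm.injective <| by
    rw [map_smul, h.vacuum]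
    split_ifs <;> simp
  jacobi u v w p q r := by
    have h1 := congr_arg (e.toLinearMap.restrictScalars ℤ).toAddMonoidHom
      (h.jacobi u v (e.symm w) p q r)
    have hi : Function.Injective (e.toLinearMap.restrictScalars ℤ).toAddMonoidHom := e.injective
    rw [AddMonoidHom.map_finsum_of_injective _ hi, AddMonoidHom.map_finsum_of_injective _ hi] at h1
    have he : ∀ x, (e.toLinearMap.restrictScalars ℤ).toAddMonoidHom x = e x := fun _ => rfl
    simp only [he, map_zsmul, map_sub, map_smul, e.apply_symm_apply] at h1
    exact h1

end

end VertexData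

namespace Heisenberg
open MvPolynomial Filter

/-! ### The Fock modules `M(1) ⊗ R` -/

section FockModule

variable {R : Type*} [CommRing R] [Algebra ℂ R] (a : ℂ) (t : R)

/-- The modes `v_m` acting on `R[α_{-1}, α_{-2}, …]` define a representation of `𝒰(V̂)`. -/
def action : (M a).ModeAlgebra →ₐ[ℂ] Module.End ℂ (MvPolynomial ℕ R) :=
  RingQuot.liftAlgHom ℂ ⟨TensorAlgebra.lift ℂ (Finsupp.lsum ℂ fun m : ℤ =>
    ({ toFun := fun v => fieldMode t v m
       map_add' := fun u v => LinearMap.ext fun w => fieldMode_add_left t u v m w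
       map_smul' := fun c v => LinearMap.ext fun w => fieldMode_smul_left t c v m w } :
      Fock →ₗ[ℂ] Module.End ℂ (MvPolynomial ℕ R))), by
    have hl : ∀ v m, TensorAlgebra.lift ℂ (Finsupp.lsum ℂ fun m : ℤ =>
      ({ toFun := fun v => fieldMode t v m
         map_add' := fun u v => LinearMap.ext fun w => fieldMode_add_left t u v m w
         map_smul' := fun c v => LinearMap.ext fun w => fieldMode_smul_left t c v m w } :
        Fock →ₗ[ℂ] Module.End ℂ (MvPolynomial ℕ R))) (VertexData.letter v m) =
          fieldMode t v m := fun v m => by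
      rw [VertexData.letter, TensorAlgebra.lift_ι_apply, Finsupp.lsum_single]
      rfl
    intro x y h
    induction h with
    | derivative v m =>
      rw [map_add, map_zsmul, hl, hl, map_zero]
      refine LinearMap.ext fun w => ?_
      have h1 : (M a).L (-1) v = translation v := by
        rw [VertexData.L, mode_eq, ← conformal_neg_one a]
        rfl
      rw [h1, LinearMap.add_apply, fieldMode_translation_left, LinearMap.smul_apply, neg_smul,
        neg_add_cancel, LinearMap.zero_apply]
    | bracket u v j k N hN =>
      rw [map_add, map_mul, map_mul, map_sum]
      simp only [map_zsmul, hl]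
      refine LinearMap.ext fun w => ?_
      rw [LinearMap.add_apply, ← sub_eq_iff_eq_add', LinearMap.sum_apply]
      refine (fieldMode_commutator_formula t u v j k w).trans ?_
      simp only [mode_eq] at hN ⊢
      rw [finsum_eq_sum_of_support_subset (s := Finset.range N) _ fun i hi => by
        rw [Finset.coe_range, Set.mem_Iio]
        by_contra h
        exact hi (by simp only [hN i (by omega), fieldMode_zero, LinearMap.zero_apply, smul_zero])]
      rfl⟩

theorem action_gen (v : Fock) (m : ℤ) : action a t ((M a).gen v m) = fieldMode t v m := by
  rw [VertexData.gen, action]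
  refine (RingQuot.liftAlgHom_mkAlgHom_apply ..).trans ?_
  rw [VertexData.letter, TensorAlgebra.lift_ι_apply, Finsupp.lsum_single]
  rfl

/-- The Heisenberg module `M(1) ⊗ R`, on which `α_0` acts as `t`. -/
def FockModule (_a : ℂ) {R : Type*} [CommRing R] [Algebra ℂ R] (_t : R) : Type _ :=
  MvPolynomial ℕ R

instance : AddCommGroup (FockModule a t) := inferInstanceAs (AddCommGroup (MvPolynomial ℕ R))

instance : Module ℂ (FockModule a t) := inferInstanceAs (Module ℂ (MvPolynomial ℕ R))

instance : Module (M a).ModeAlgebra (FockModule a t) :=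
  Module.compHom (MvPolynomial ℕ R) (action a t).toRingHom

/-- The identification of the space of `FockModule a t` with the polynomial ring. -/
def toPoly : FockModule a t ≃ₗ[ℂ] MvPolynomial ℕ R := LinearEquiv.refl ℂ _

theorem toPoly_smul (x : (M a).ModeAlgebra) (w : FockModule a t) :
    toPoly a t (x • w) = action a t x (toPoly a t w) := rfl

theorem toPoly_gen_smul (v : Fock) (m : ℤ) (w : FockModule a t) :
    toPoly a t ((M a).gen v m • w) = fieldMode t v m (toPoly a t w) := by
  rw [toPoly_smul, action_gen]

instance : IsScalarTower ℂ (M a).ModeAlgebra (FockModule a t) := ⟨fun c x w => by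
  change action a t (c • x) (toPoly a t w) = c • action a t x (toPoly a t w)
  rw [map_smul, LinearMap.smul_apply]⟩

theorem fockModule_isWeakModule : (M a).IsWeakModule (FockModule a t) where
  truncated v w := by
    obtain ⟨N, hN⟩ := fieldMode_truncated t v (toPoly a t w)
    refine ⟨N, fun m hm => (toPoly a t).injective ?_⟩
    rw [toPoly_gen_smul, hN m hm, map_zero]
  vacuum m w := (toPoly a t).injective <| by
    rw [toPoly_gen_smul]
    change fieldMode t 1 m _ = _
    rw [fieldMode_one]
    split_ifs <;> simp
  jacobi u v w p q r := by
    have h := fieldMode_jacobi t u v (toPoly a t w) p q r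
    simp only [mode_eq]
    refine (finsum_congr fun i => ?_).trans (h.trans (finsum_congr fun i => ?_))
    · exact (toPoly a t).injective (by rw [map_zsmul, toPoly_gen_smul]; rfl)
    · exact (toPoly a t).injective (by
        simp only [map_zsmul, map_sub, toPoly_gen_smul]
        rfl)

end FockModule

/-! ### Weak modules are determined by their Heisenberg operators -/

section WeakModule

variable {a : ℂ} {W W' : Type*} [AddCommGroup W] [Module ℂ W] [Module (M a).ModeAlgebra W]
  [IsScalarTower ℂ (M a).ModeAlgebra W] [AddCommGroup W'] [Module ℂ W']
  [Module (M a).ModeAlgebra W'] [IsScalarTower ℂ (M a).ModeAlgebra W']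

theorem gen_C_smul (hW : (M a).IsWeakModule W) (c : ℂ) (m : ℤ) (w : W) :
    (M a).gen (C c) m • w = c • if m = -1 then w else 0 := by
  rw [← hW.vacuum, ← smul_assoc, ← VertexData.gen_smul]
  congr 2
  change C c = c • 1
  rw [smul_eq_C_mul, mul_one]

/-- Since `X j * v` is the product `α_{-j-1} v`, this is the Jacobi identity with `p = 0` and `r =
-(j + 1)`. It expresses all modes by modes of `α₋₁𝟏`, so that subspaces and linear maps need to be
checked on the operators `αₙ` only. -/
theorem gen_X_mul_smul (hW : (M a).IsWeakModule W) (j : ℕ) (v : Fock) (m : ℤ) (w : W) :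
    ∀ᶠ n in atTop, (M a).gen (X j * v) m • w = ∑ i ∈ Finset.range n,
      ((-1 : ℤ) ^ i * Ring.choose (-((j : ℤ) + 1)) i) •
      (alpha a (-((j : ℤ) + 1) - i) • (M a).gen v (m + i) • w -
        ((-((j : ℤ) + 1)).negOnePow : ℤ) •
          (M a).gen v (m - ((j : ℤ) + 1) - i) • alpha a i • w) := by
  have h := hW.jacobi (X 0) v w 0 m (-((j : ℤ) + 1))
  rw [finsum_eq_single _ 0 fun i hi => by rw [Ring.choose_zero_pos ℤ (by omega), zero_smul]] at h
  simp only [mode_eq, Nat.cast_zero, add_zero, fieldMode_X_zero_neg, Ring.choose_zero_right,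
    one_smul, zero_add, sub_zero] at h
  obtain ⟨N1, h1⟩ := hW.truncated v w
  obtain ⟨N2, h2⟩ := hW.truncated (X 0) w
  filter_upwards [eventually_ge_atTop (max (N1 - m).toNat N2.toNat)] with n hn
  rw [h, finsum_eq_sum_of_support_subset (s := Finset.range n)]
  · rfl
  · intro i hi
    rw [Finset.coe_range, Set.mem_Iio]
    by_contra hin
    apply hi
    dsimp only
    rw [h1 _ (by omega), h2 _ (by omega)]
    simp only [smul_zero, sub_zero]

theorem gen_smul_mem (hW : (M a).IsWeakModule W) {S : Submodule ℂ W}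
    (hS : ∀ m, ∀ w ∈ S, alpha a m • w ∈ S) (v : Fock) :
    ∀ m, ∀ w ∈ S, (M a).gen v m • w ∈ S := by
  induction v using MvPolynomial.induction_on with
  | C c =>
    intro m w hw
    rw [gen_C_smul hW]
    apply S.smul_mem
    split_ifs
    exacts [hw, S.zero_mem]
  | add p q hp hq =>
    intro m w hw
    rw [VertexData.gen_add, add_smul]
    exact S.add_mem (hp m w hw) (hq m w hw)
  | mul_X v j ih =>
    intro m w hw
    obtain ⟨n, hn⟩ := (gen_X_mul_smul hW j v m w).exists
    rw [mul_comm, hn]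
    refine Submodule.sum_mem _ fun i _ => zsmul_mem (Submodule.sub_mem _ ?_ (zsmul_mem ?_ _)) _
    · exact hS _ _ (ih _ _ hw)
    · exact ih _ _ (hS _ _ hw)

theorem map_gen_smul (hW : (M a).IsWeakModule W) (hW' : (M a).IsWeakModule W') (f : W →ₗ[ℂ] W')
    (hf : ∀ m w, f (alpha a m • w) = alpha a m • f w) (v : Fock) :
    ∀ m w, f ((M a).gen v m • w) = (M a).gen v m • f w := by
  induction v using MvPolynomial.induction_on with
  | C c =>
    intro m w
    rw [gen_C_smul hW, gen_C_smul hW', map_smul]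
    split_ifs <;> simp
  | add p q hp hq =>
    intro m w
    rw [VertexData.gen_add, add_smul, add_smul, map_add, hp, hq]
  | mul_X v j ih =>
    intro m w
    obtain ⟨n, hn, hn'⟩ := ((gen_X_mul_smul hW j v m w).and
      (gen_X_mul_smul hW' j v m (f w))).exists
    rw [mul_comm, hn, hn', map_sum]
    simp only [map_zsmul, map_sub, hf, ih]

/-- A linear map of weak modules that commutes with the Heisenberg operators is a homomorphism. -/
def homOfAlpha (hW : (M a).IsWeakModule W) (hW' : (M a).IsWeakModule W') (f : W →ₗ[ℂ] W')
    (hf : ∀ m w, f (alpha a m • w) = alpha a m • f w) : W →ₗ[(M a).ModeAlgebra] W' :=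
  (M a).homOfGen f fun v m w => map_gen_smul hW hW' f hf v m w

/-- A subspace of a weak module that is stable under the Heisenberg operators is a submodule. -/
def submoduleOfAlpha (hW : (M a).IsWeakModule W) (S : Submodule ℂ W)
    (hS : ∀ m, ∀ w ∈ S, alpha a m • w ∈ S) : Submodule (M a).ModeAlgebra W :=
  (M a).submoduleOfGen S fun v m w hw => gen_smul_mem hW hS v m w hw

end WeakModule

section FockModuleAlpha

variable {R : Type*} [CommRing R] [Algebra ℂ R] (a : ℂ) (t : R)

theorem toPoly_alpha_neg (i : ℕ) (w : FockModule a t) :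
    toPoly a t (alpha a (-((i : ℤ) + 1)) • w) = X i * toPoly a t w := by
  rw [alpha, toPoly_gen_smul, fieldMode_X_zero_neg]

theorem toPoly_alpha_zero (w : FockModule a t) :
    toPoly a t (alpha a 0 • w) = C t * toPoly a t w := by
  rw [alpha, toPoly_gen_smul, fieldMode_X_zero_zero]

theorem toPoly_alpha_pos (i : ℕ) (w : FockModule a t) :
    toPoly a t (alpha a ((i : ℤ) + 1) • w) = ((i : ℂ) + 1) • pderiv i (toPoly a t w) := by
  rw [alpha, toPoly_gen_smul, fieldMode_X_zero_pos]

end FockModuleAlpha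

end Heisenberg

namespace Heisenberg
open MvPolynomial Filter

/-! ### Zero modes on vectors of degree zero -/

section ZeroMode

variable {R : Type*} [CommRing R] [Algebra ℂ R] (t : R)

/-- The scalar by which the zero mode of `v` acts on the vectors of degree zero. -/
def zeroMode : Fock →ₐ[ℂ] R := aeval fun i => (-1) ^ i * t

theorem zeroMode_X (i : ℕ) : zeroMode t (X i) = (-1) ^ i * t := aeval_X _ i

theorem evalSeries_monomial (s : ℕ →₀ ℕ) (c : ℂ) : evalSeries t (monomial s c) =
    HahnSeries.single (-(wt s : ℤ)) (zeroMode t (monomial s c)) := by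
  induction s using finsupp_induction with
  | h0 =>
    change evalSeries t (C c) = HahnSeries.single _ (zeroMode t (C c))
    rw [evalSeries, coe_eval₂Hom, eval₂_C, zeroMode, aeval_C, map_zero]
    rfl
  | h k s ih =>
    have hm : (monomial (Finsupp.single k 1 + s) c : Fock) = X k * monomial s c := by
      rw [X, monomial_mul, one_mul]
    have hX : evalSeries t (X k) = HahnSeries.single (-((k : ℤ) + 1)) ((-1) ^ k * t) := by
      rw [evalSeries, coe_eval₂Hom, eval₂_X]
    rw [hm, map_mul, ih, hX, HahnSeries.single_mul_single, map_mul (zeroMode t), zeroMode_X, map_add,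
      wt_single]
    congr 1
    push_cast
    ring_nf

theorem coeff_evalSeries {n : ℤ} {v : Fock} (hv : v ∈ degreePart ℂ n) :
    (evalSeries t v).coeff (-n) = zeroMode t v := by
  conv_rhs => rw [v.as_sum, map_sum]
  conv_lhs => rw [v.as_sum, map_sum, HahnSeries.coeff_sum]
  refine Finset.sum_congr rfl fun s hs => ?_
  rw [evalSeries_monomial, hv s (mem_support_iff.1 hs), HahnSeries.coeff_single_same]

theorem wt_eq_zero {s : ℕ →₀ ℕ} (h : wt s = 0) : s = 0 := by
  ext k
  have := Finsupp.le_weight (w := fun i : ℕ => i + 1) (s := k) k.succ_ne_zero s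
  change s k ≤ wt s at this
  simpa [h] using this

theorem eq_C_of_mem_degreePart_zero {w : MvPolynomial ℕ R} (hw : w ∈ degreePart R 0) :
    w = C (constantCoeff w) := by
  classical
  ext s
  rw [coeff_C]
  split_ifs with h
  · rw [← h]; rfl
  · by_contra hs
    exact h (wt_eq_zero (by exact_mod_cast hw s hs)).symm

theorem C_mem_degreePart (r : R) : C r ∈ degreePart R 0 := by
  classical
  intro s hs
  rw [coeff_C] at hs
  rw [← (ite_ne_right_iff.1 hs).1, map_zero, Nat.cast_zero]

theorem eq_zero_of_mem_degreePart {n : ℤ} (hn : n < 0) {w : MvPolynomial ℕ R}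
    (hw : w ∈ degreePart R n) : w = 0 := by
  ext s
  by_contra h
  have := hw s h
  omega

theorem fieldMode_C_of_lt {n m : ℤ} {v : Fock} (hv : v ∈ degreePart ℂ n) (hm : n - m - 1 < 0)
    (r : R) : fieldMode t v m (C r) = 0 :=
  eq_zero_of_mem_degreePart (by omega) (fieldMode_mem_degreePart t hv (C_mem_degreePart r))

/-- A zero mode preserves the constants and is `R`-linear, so it is multiplication by its vacuum
expectation. -/
theorem fieldMode_zeroMode {n : ℤ} {v : Fock} (hv : v ∈ degreePart ℂ n) (r : R) :
    fieldMode t v (n - 1) (C r) = C (zeroMode t v * r) := by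
  have h := fieldMode_mem_degreePart t (m := n - 1) hv (C_mem_degreePart (1 : R))
  rw [show 0 + n - (n - 1) - 1 = 0 by ring] at h
  rw [← mul_one (C r), fieldMode_C_mul, ← C_1, eq_C_of_mem_degreePart_zero h, C_1,
    constantCoeff_fieldMode_one, show -(n - 1) - 1 = -n by ring, coeff_evalSeries t hv, ← C_mul,
    mul_comm]

theorem zhuRes_eventually (a : ℂ) (n s : ℤ) (u v : Fock) :
    ∀ᶠ N in atTop, (M a).zhuRes n s u v =
      ∑ i ∈ Finset.range N, Ring.choose n i • fieldMode (0 : ℂ) u (i - s) v := by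
  obtain ⟨N, hN⟩ := fieldMode_truncated (0 : ℂ) u v
  filter_upwards [eventually_ge_atTop (N + s).toNat] with m hm
  rw [VertexData.zhuRes]
  simp only [mode_eq]
  refine finsum_eq_sum_of_support_subset _ fun i hi => ?_
  rw [Finset.coe_range, Set.mem_Iio]
  by_contra h
  exact hi (by dsimp only; rw [hN _ (by omega), smul_zero])

theorem zhuRes_add_right (a : ℂ) (n s : ℤ) (u v v' : Fock) :
    (M a).zhuRes n s u (v + v') = (M a).zhuRes n s u v + (M a).zhuRes n s u v' := by
  obtain ⟨N, h1, h2, h3⟩ := ((zhuRes_eventually a n s u (v + v')).and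
    ((zhuRes_eventually a n s u v).and (zhuRes_eventually a n s u v'))).exists
  rw [h1, h2, h3, ← Finset.sum_add_distrib]
  simp only [map_add, smul_add]

theorem mem_degreePart_monomial (s : ℕ →₀ ℕ) (r : R) : monomial s r ∈ degreePart R (wt s) := by
  classical
  intro s' h
  rw [coeff_monomial] at h
  rw [(ite_ne_right_iff.1 h).1]

/-- The Jacobi identity on the vacuum with `p = wt u`, `q = wt v + s - 2` and `r = -s`. The left
side is the zero mode of the residue. On the right every term passes through negative degree, except
the one for `s = 1`, `i = 0`, which is the product of the two zero modes. -/
theorem C_zeroMode_zhuRes (a : ℂ) {n m s : ℤ} {u v : Fock} (hu : u ∈ degreePart ℂ n)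
    (hv : v ∈ degreePart ℂ m) (hs : 1 ≤ s) :
    (C (zeroMode t ((M a).zhuRes n s u v)) : MvPolynomial ℕ R) = if s = 1
      then C (zeroMode t u * zeroMode t v) else 0 := by
  have h := fieldMode_jacobi t u v 1 n (m + s - 2) (-s)
  obtain ⟨N₀, h2⟩ := eventually_atTop.1 (jacobiLeft_eventually t u v 1 n (m + s - 2) (-s))
  obtain ⟨N, h1, hN₀⟩ := ((zhuRes_eventually a n s u v).and (eventually_ge_atTop N₀)).exists
  rw [h1, map_sum, map_sum]
  have hl : ∀ i : ℕ, (C (zeroMode t (Ring.choose n i • fieldMode (0 : ℂ) u (i - s) v)) : MvPolynomial ℕ R) =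
      jacobiLeft t u v 1 n (m + s - 2) (-s) i := by
    intro i
    have hm := fieldMode_mem_degreePart (0 : ℂ) (m := i - s) hu hv
    have h3 := fieldMode_zeroMode t hm 1
    rw [mul_one, C_1, show m + n - (i - s) - 1 - 1 = n + (m + s - 2) - i by ring] at h3
    rw [jacobiLeft, show -s + (i : ℤ) = i - s by ring, h3, map_zsmul, map_zsmul]
  simp only [hl]
  rw [finsum_eq_sum_of_support_subset (s := Finset.range N) _ fun i hi => by
    rw [Finset.coe_range, Set.mem_Iio]
    by_contra hN
    exact hi (h2 i (by omega))] at h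
  rw [h, finsum_eq_single _ 0]
  · rw [jacobiRight, ← C_1, fieldMode_C_of_lt t hu (m := n + (0 : ℕ)) (by omega), map_zero,
      smul_zero, sub_zero]
    by_cases h1 : s = 1
    · subst h1
      rw [if_pos rfl, show m + 1 - 2 + ((0 : ℕ) : ℤ) = m - 1 by push_cast; ring,
        fieldMode_zeroMode t hv, show n + -1 - ((0 : ℕ) : ℤ) = n - 1 by push_cast; ring,
        fieldMode_zeroMode t hu]
      simp
    · rw [if_neg h1, fieldMode_C_of_lt t hv (by omega), map_zero, smul_zero]
  · intro i hi
    rw [jacobiRight, ← C_1, fieldMode_C_of_lt t hu (m := n + (i : ℕ)) (by omega), map_zero,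
      fieldMode_C_of_lt t hv (by omega), map_zero, smul_zero, sub_zero, smul_zero]

theorem zeroMode_zhuRes_two (a : ℂ) {n : ℤ} {u : Fock} (hu : u ∈ degreePart ℂ n) (v : Fock) :
    zeroMode t ((M a).zhuRes n 2 u v) = 0 := by
  induction v using MvPolynomial.induction_on' with
  | monomial s c =>
    have h := C_zeroMode_zhuRes t a hu (mem_degreePart_monomial s c) (s := 2) (by norm_num)
    rw [if_neg (by norm_num)] at h
    exact C_eq_zero.1 h
  | add p q hp hq => rw [zhuRes_add_right, map_add, hp, hq, add_zero]

theorem zeroMode_zhuRes_one (a : ℂ) {n : ℤ} {u : Fock} (hu : u ∈ degreePart ℂ n) (v : Fock) :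
    zeroMode t ((M a).zhuRes n 1 u v) = zeroMode t u * zeroMode t v := by
  induction v using MvPolynomial.induction_on' with
  | monomial s c =>
    have h := C_zeroMode_zhuRes t a hu (mem_degreePart_monomial s c) (s := 1) le_rfl
    rw [if_pos rfl] at h
    exact C_injective _ _ h
  | add p q hp hq => rw [zhuRes_add_right, map_add, hp, hq, map_add, mul_add]

/-- The operator `L₋₁ + L₀` is a derivation that sends `X k` to `(k + 1)(X (k + 1) + X k)`, and the
signs `(-1) ^ k` in `zeroMode` make this sum vanish. -/
theorem zeroMode_derivative (a : ℂ) (v : Fock) :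
    zeroMode t ((M a).L (-1) v + (M a).L 0 v) = 0 := by
  simp only [VertexData.L, mode_eq, neg_add_cancel, zero_add]
  change zeroMode t (fieldMode (0 : ℂ) (conformalVector a) 0 v +
    fieldMode (0 : ℂ) (conformalVector a) 1 v) = 0
  rw [conformal_neg_one]
  induction v using MvPolynomial.induction_on with
  | C c =>
    have h := (mem_degreePart_iff (0 : ℂ) a).1 (C_mem_degreePart c)
    rw [h, translation_C, zero_pow two_ne_zero]
    simp
  | add p q hp hq =>
    rw [map_add translation, map_add (fieldMode (0 : ℂ) (conformalVector a) 1),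
      add_add_add_comm, map_add, hp, hq, add_zero]
  | mul_X p k ih =>
    have h := conformal_X_mul (0 : ℂ) a k 0 p
    rw [if_neg (by omega), sub_zero, zero_add, show (0 : ℤ) - k - 1 = -((k : ℤ) + 1) by ring,
      fieldMode_X_zero_neg] at h
    rw [mul_comm p, h, Derivation.leibniz, translation_X, smul_eq_mul, smul_eq_mul]
    have h2 : X k * translation p + p * ((k : ℂ) + 1) • X (k + 1) +
      (X k * fieldMode (0 : ℂ) (conformalVector a) 1 p + ((k : ℤ) + 1) • (X k * p)) =
      X k * (translation p + fieldMode (0 : ℂ) (conformalVector a) 1 p) +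
        ((k : ℂ) + 1) • (p * (X (k + 1) + X k)) := by
      rw [← Int.cast_smul_eq_zsmul ℂ]
      push_cast
      rw [mul_smul_comm, mul_add, mul_add, mul_comm p (X k)]
      module
    rw [h2, map_add, map_mul, ih, mul_zero, zero_add, map_smul, map_mul, map_add, zeroMode_X,
      zeroMode_X, pow_succ]
    simp

end ZeroMode

/-! ### The Zhu algebra of `M_a(1)` is `ℂ[x]` -/

section ZhuAlgebra

variable (a : ℂ)

theorem zeroMode_zhuO {x : Fock} (hx : x ∈ (M a).zhuO) :
    zeroMode (Polynomial.X : Polynomial ℂ) x = 0 := by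
  induction hx using Submodule.span_induction with
  | mem x h =>
    rcases h with ⟨n, u, v, hu, rfl⟩ | ⟨v, rfl⟩
    · exact zeroMode_zhuRes_two _ a ((hasWeight_iff a).1 hu) v
    · exact zeroMode_derivative _ a v
  | zero => exact map_zero _
  | add x y _ _ hx hy => rw [map_add, hx, hy, add_zero]
  | smul c x _ hx => rw [map_smul, hx, smul_zero]

/-- The map `V / O_0(V) → ℂ[x]`. -/
def zhuQuotientToPoly : (Fock ⧸ (M a).zhuO) →ₗ[ℂ] Polynomial ℂ :=
  (M a).zhuO.liftQ (zeroMode Polynomial.X).toLinearMap fun _ hx => zeroMode_zhuO a hx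

theorem zhuQuotientToPoly_mkQ (v : Fock) :
    zhuQuotientToPoly a ((M a).zhuO.mkQ v) = zeroMode Polynomial.X v := rfl

/-- The homomorphism `A_0(V) → ℂ[x]`. -/
def zhuToPoly : (M a).ZhuAlgebra →ₐ[ℂ] Polynomial ℂ :=
  RingQuot.liftAlgHom ℂ ⟨TensorAlgebra.lift ℂ (zhuQuotientToPoly a), by
    intro x y h
    induction h with
    | mul n u v hu =>
      rw [map_mul, TensorAlgebra.lift_ι_apply, TensorAlgebra.lift_ι_apply,
        TensorAlgebra.lift_ι_apply, zhuQuotientToPoly_mkQ, zhuQuotientToPoly_mkQ,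
        zhuQuotientToPoly_mkQ, zeroMode_zhuRes_one _ a ((hasWeight_iff a).1 hu)]
    | one =>
      rw [TensorAlgebra.lift_ι_apply, zhuQuotientToPoly_mkQ, map_one]
      exact map_one _⟩

theorem zhuToPoly_zhuOfQuotient (x : Fock ⧸ (M a).zhuO) :
    zhuToPoly a ((M a).zhuOfQuotient x) = zhuQuotientToPoly a x := by
  rw [zhuToPoly, VertexData.zhuOfQuotient]
  refine (RingQuot.liftAlgHom_mkAlgHom_apply ..).trans ?_
  rw [TensorAlgebra.lift_ι_apply]

theorem zhuToPoly_zhuClass (v : Fock) :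
    zhuToPoly a ((M a).zhuClass v) = zeroMode Polynomial.X v :=
  zhuToPoly_zhuOfQuotient a _

theorem fieldMode_X {R : Type*} [CommRing R] [Algebra ℂ R] (t : R) (k : ℕ) (q : ℤ)
    (w : MvPolynomial ℕ R) : fieldMode t (X k) q w =
      ((-1 : ℤ) ^ k * Ring.choose q k) • fieldMode t (X 0) (q - k) w := by
  induction k generalizing q with
  | zero => simp
  | succ k ih =>
    have h := fieldMode_translation_left t (X k) q w
    rw [translation_X, fieldMode_smul_left, ih] at h
    have h1 := Ring.choose_smul_choose q (Nat.le_succ k)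
    rw [Nat.succ_eq_add_one, Nat.add_sub_cancel_left, Ring.choose_one_right,
      Nat.choose_succ_self_right, nsmul_eq_mul, mul_comm (Ring.choose q k), choose_sub_one] at h1
    have h2 : (k : ℂ) + 1 ≠ 0 := by exact_mod_cast k.succ_ne_zero
    apply (smul_right_injective _ h2)
    dsimp only
    rw [h, smul_smul, ← Int.cast_smul_eq_zsmul ℂ, ← Int.cast_smul_eq_zsmul ℂ (_ * _), smul_smul]
    rw [show q - 1 - (k : ℤ) = q - ((k + 1 : ℕ) : ℤ) by push_cast; ring]
    congr 1
    have h3 : ((k : ℂ) + 1) * Ring.choose q (k + 1) = q * Ring.choose (q - 1) k := by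
      exact_mod_cast h1
    push_cast
    rw [pow_succ]
    linear_combination (-1) ^ k * h3

/-- For `i ≥ 2` the summand contains both `(k + 1).choose i` and `(i - 2).choose k`, which are never
nonzero together. Only `i = 0` and `i = 1` remain. -/
theorem zhuRes_two_X (k : ℕ) (v : Fock) : (M a).zhuRes (k + 1) 2 (X k) v =
    ((k : ℤ) + 1) • (X (k + 1) * v + X k * v) := by
  obtain ⟨N, h, hN⟩ := ((zhuRes_eventually a (k + 1) 2 (X k) v).and
    (eventually_ge_atTop 2)).exists
  rw [h, ← Finset.sum_subset (Finset.range_subset_range.2 hN) fun i _ hi => ?_]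
  · rw [Finset.sum_range_succ, Finset.sum_range_one,
      fieldMode_X 0 k (((0 : ℕ) : ℤ) - 2), fieldMode_X 0 k (((1 : ℕ) : ℤ) - 2),
      Ring.choose_zero_right, Ring.choose_one_right, one_smul, Nat.cast_zero, Nat.cast_one,
      show (0 : ℤ) - 2 - k = -(((k + 1 : ℕ) : ℤ) + 1) by push_cast; ring,
      show (1 : ℤ) - 2 - k = -((k : ℤ) + 1) by ring, fieldMode_X_zero_neg, fieldMode_X_zero_neg]
    have h1 := Ring.choose_neg (2 : ℤ) k
    have h2 := Ring.choose_neg (1 : ℤ) k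
    rw [show (2 : ℤ) + k - 1 = ((k + 1 : ℕ) : ℤ) by push_cast; ring, Ring.choose_natCast,
      Nat.choose_succ_self_right, Units.smul_def, smul_eq_mul, Int.coe_negOnePow_natCast] at h1
    rw [show (1 : ℤ) + k - 1 = (k : ℤ) by ring, Ring.choose_natCast,
      Nat.choose_self, Units.smul_def, smul_eq_mul, Int.coe_negOnePow_natCast] at h2
    rw [show (0 : ℤ) - 2 = -2 by ring, show (1 : ℤ) - 2 = -1 by ring, h1, h2, ← mul_assoc,
      ← mul_assoc, ← mul_pow, neg_one_mul, neg_neg, one_pow]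
    simp only [one_mul, Nat.cast_one, one_smul, smul_add]
    push_cast
    rfl
  · have hi2 : 2 ≤ i := by simpa [Nat.succ_le_iff] using hi
    rw [fieldMode_X, show (i : ℤ) - 2 = ((i - 2 : ℕ) : ℤ) by omega,
      show (k : ℤ) + 1 = ((k + 1 : ℕ) : ℤ) by push_cast; ring, Ring.choose_natCast,
      Ring.choose_natCast]
    rcases le_or_gt i (k + 1) with hk | hk
    · rw [Nat.choose_eq_zero_of_lt (show i - 2 < k by omega), Nat.cast_zero, mul_zero, zero_smul,
        smul_zero]
    · rw [Nat.choose_eq_zero_of_lt hk, Nat.cast_zero, zero_smul]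

theorem hasWeight_X (k : ℕ) : (M a).HasWeight (k + 1) (X k) := by
  rw [hasWeight_iff]
  have h := mem_degreePart_monomial (Finsupp.single k 1) (1 : ℂ)
  rw [wt_single, one_mul] at h
  exact_mod_cast h

theorem mkQ_X_succ_mul (k : ℕ) (v : Fock) :
    (M a).zhuO.mkQ (X (k + 1) * v) = -(M a).zhuO.mkQ (X k * v) := by
  rw [eq_neg_iff_add_eq_zero, ← map_add, Submodule.mkQ_apply, Submodule.Quotient.mk_eq_zero]
  have h : (M a).zhuRes (k + 1) 2 (X k) v ∈ (M a).zhuO :=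
    Submodule.subset_span (Or.inl ⟨_, _, _, hasWeight_X a k, rfl⟩)
  rw [zhuRes_two_X, ← Int.cast_smul_eq_zsmul ℂ] at h
  exact (Submodule.smul_mem_iff _ (by exact_mod_cast k.succ_ne_zero)).1 h

theorem mkQ_X_mul (k : ℕ) (v : Fock) :
    (M a).zhuO.mkQ (X k * v) = (-1 : ℂ) ^ k • (M a).zhuO.mkQ (X 0 * v) := by
  induction k with
  | zero => simp
  | succ k ih => rw [mkQ_X_succ_mul, ih, pow_succ, mul_neg_one, neg_smul]

/-- Modulo `O_0(V)` every variable can be traded for `± X 0`. The exponent `j` collects the factors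
`X 0` obtained so far. -/
theorem exists_mkQ_eq (v : Fock) (j : ℕ) : ∃ f : Polynomial ℂ,
    (M a).zhuO.mkQ (X 0 ^ j * v) = (M a).zhuO.mkQ (Polynomial.aeval (X 0 : Fock) f) := by
  induction v using MvPolynomial.induction_on generalizing j with
  | C c =>
    refine ⟨Polynomial.C c * Polynomial.X ^ j, ?_⟩
    rw [map_mul (Polynomial.aeval _), Polynomial.aeval_C, map_pow, Polynomial.aeval_X, mul_comm]
    rfl
  | add p q hp hq =>
    obtain ⟨f, hf⟩ := hp j
    obtain ⟨g, hg⟩ := hq j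
    exact ⟨f + g, by rw [mul_add, map_add, hf, hg, map_add, map_add]⟩
  | mul_X p k ih =>
    obtain ⟨f, hf⟩ := ih (j + 1)
    refine ⟨(-1 : ℂ) ^ k • f, ?_⟩
    rw [show X 0 ^ j * (p * X k) = X k * (X 0 ^ j * p) by ring, mkQ_X_mul,
      show X 0 * (X 0 ^ j * p) = X 0 ^ (j + 1) * p by ring, hf, map_smul, map_smul]

theorem zhuQuotientToPoly_bijective : Function.Bijective (zhuQuotientToPoly a) := by
  have h : ∀ f : Polynomial ℂ,
      zhuQuotientToPoly a ((M a).zhuO.mkQ (Polynomial.aeval (X 0 : Fock) f)) = f := fun f => by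
    rw [zhuQuotientToPoly_mkQ, ← Polynomial.aeval_algHom_apply, zeroMode_X, pow_zero, one_mul,
      Polynomial.aeval_X_left_apply]
  refine ⟨(injective_iff_map_eq_zero _).2 fun x hx => ?_, fun f => ⟨_, h f⟩⟩
  obtain ⟨v, rfl⟩ := (M a).zhuO.mkQ_surjective x
  obtain ⟨f, hf⟩ := exists_mkQ_eq a v 0
  rw [pow_zero, one_mul] at hf
  rw [hf, h] at hx
  rw [hf, hx, map_zero, map_zero]

/-- The Zhu algebra is given by a presentation, so a collapse has to be excluded: injectivity is
detected by the map to `ℂ[x]`. For surjectivity the image contains `1` and is closed under products,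
after splitting the left factor into homogeneous parts. -/
theorem zhuOfQuotient_bijective : Function.Bijective (M a).zhuOfQuotient := by
  constructor
  · intro x y h
    apply (zhuQuotientToPoly_bijective a).1
    rw [← zhuToPoly_zhuOfQuotient, h, zhuToPoly_zhuOfQuotient]
  · suffices h : ∀ x, x ∈ LinearMap.range (M a).zhuOfQuotient from fun x => h x
    have h1 : (1 : (M a).ZhuAlgebra) ∈ LinearMap.range (M a).zhuOfQuotient := by
      refine ⟨(M a).zhuO.mkQ (M a).vac, ?_⟩
      exact (RingQuot.mkAlgHom_rel ℂ (VertexData.ZhuRel.one (D := M a))).trans (map_one _)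
    have hmul : ∀ x y, x ∈ LinearMap.range (M a).zhuOfQuotient →
        y ∈ LinearMap.range (M a).zhuOfQuotient →
        x * y ∈ LinearMap.range (M a).zhuOfQuotient := by
      rintro _ _ ⟨x, rfl⟩ ⟨y, rfl⟩
      obtain ⟨u, rfl⟩ := (M a).zhuO.mkQ_surjective x
      obtain ⟨v, rfl⟩ := (M a).zhuO.mkQ_surjective y
      rw [u.as_sum, map_sum, map_sum, Finset.sum_mul]
      refine Submodule.sum_mem _ fun s _ => ?_
      have hr := RingQuot.mkAlgHom_rel ℂ (VertexData.ZhuRel.mul (D := M a) (wt s)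
        (monomial s (coeff s u)) v ((hasWeight_iff a).2 (mem_degreePart_monomial s _)))
      rw [map_mul] at hr
      exact ⟨_, hr.symm⟩
    intro x
    obtain ⟨x, rfl⟩ := RingQuot.mkAlgHom_surjective ℂ (M a).ZhuRel x
    induction x using TensorAlgebra.induction with
    | algebraMap c =>
      rw [AlgHom.commutes, Algebra.algebraMap_eq_smul_one]
      exact Submodule.smul_mem _ c h1
    | ι x => exact ⟨x, rfl⟩
    | mul x y hx hy => rw [map_mul]; exact hmul _ _ hx hy
    | add x y hx hy => rw [map_add]; exact Submodule.add_mem _ hx hy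

theorem zhuToPoly_bijective : Function.Bijective (zhuToPoly a) := by
  have h : (zhuToPoly a : _ → _) ∘ (M a).zhuOfQuotient = zhuQuotientToPoly a :=
    funext (zhuToPoly_zhuOfQuotient a)
  rw [← Function.Bijective.of_comp_iff _ (zhuOfQuotient_bijective a), h]
  exact zhuQuotientToPoly_bijective a

theorem zhuToPoly_zhuX : zhuToPoly a (zhuX a) = Polynomial.X := by
  rw [zhuX, zhuToPoly_zhuClass, zeroMode_X, pow_zero, one_mul]

theorem aeval_zhuX_bijective : Function.Bijective (Polynomial.aeval (R := ℂ) (zhuX a)) := by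
  have h : (zhuToPoly a : _ → _) ∘ Polynomial.aeval (R := ℂ) (zhuX a) = id := by
    funext f
    rw [Function.comp_apply, ← Polynomial.aeval_algHom_apply, zhuToPoly_zhuX,
      Polynomial.aeval_X_left_apply, id]
  rw [← Function.Bijective.of_comp_iff' (zhuToPoly_bijective a), h]
  exact Function.bijective_id

end ZhuAlgebra

end Heisenberg

/-! ### Spanning `M_0(U)` by operators of positive degree -/

namespace VertexData

variable {V : Type} [AddCommGroup V] [Module ℂ V] (D : VertexData V)
  (U : Type) [AddCommGroup U] [Module ℂ U] [Module D.ZhuAlgebra U] [IsScalarTower ℂ D.ZhuAlgebra U]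

/-- The inclusion `U → M_0(U)`. -/
def lowest : U →ₗ[ℂ] D.M0 U :=
  (D.inducedRel U).mkQ.restrictScalars ℂ ∘ₗ TensorProduct.mk ℂ D.ModeAlgebra U 1

theorem lowest_apply (y : U) : D.lowest U y = (D.inducedRel U).mkQ (1 ⊗ₜ y) := rfl

theorem smul_lowest (x : D.ModeAlgebra) (y : U) :
    x • D.lowest U y = (D.inducedRel U).mkQ (x ⊗ₜ y) := by
  rw [lowest_apply, ← map_smul, TensorProduct.smul_tmul', smul_eq_mul, mul_one]

theorem gen_smul_lowest_of_lt {n m : ℤ} {v : V} (hv : D.HasWeight n v) (hm : n - m - 1 < 0)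
    (y : U) : D.gen v m • D.lowest U y = 0 := by
  rw [smul_lowest, Submodule.mkQ_apply, Submodule.Quotient.mk_eq_zero]
  exact Submodule.subset_span (Or.inl ⟨n, m, v, y, hv, hm, rfl⟩)

theorem gen_smul_lowest {n : ℤ} {v : V} (hv : D.HasWeight n v) (y : U) :
    D.gen v (n - 1) • D.lowest U y = D.lowest U (D.zhuClass v • y) := by
  rw [smul_lowest, lowest_apply, ← sub_eq_zero, ← map_sub, Submodule.mkQ_apply,
    Submodule.Quotient.mk_eq_zero]
  exact Submodule.subset_span (Or.inr ⟨n, v, y, hv, rfl⟩)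

/-- The vectors obtained from `U` by applying operators of positive degree. -/
inductive IsPositive : ℤ → D.M0 U → Prop
  | lowest (y : U) : IsPositive 0 (D.lowest U y)
  | cons (n m d : ℤ) (v : V) (w : D.M0 U) (hv : D.HasWeight n v) (hm : 0 < n - m - 1)
      (hw : IsPositive d w) : IsPositive (n - m - 1 + d) (D.gen v m • w)

variable {D U} in
theorem IsPositive.nonneg {d : ℤ} {w : D.M0 U} (h : D.IsPositive U d w) :
    0 ≤ d ∧ (d = 0 → ∃ y, w = D.lowest U y) := by
  induction h with
  | lowest y => exact ⟨le_rfl, fun _ => ⟨y, rfl⟩⟩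
  | cons n m d v w hv hm hw ih => exact ⟨by omega, fun h => by omega⟩

theorem gen_smul_mem_span_of_forall {P Q : D.M0 U → Prop} {x : D.ModeAlgebra}
    (h : ∀ w, P w → x • w ∈ Submodule.span ℂ {w | Q w}) {w : D.M0 U}
    (hw : w ∈ Submodule.span ℂ {w | P w}) : x • w ∈ Submodule.span ℂ {w | Q w} := by
  induction hw using Submodule.span_induction with
  | mem w hw => exact h w hw
  | zero => rw [smul_zero]; exact Submodule.zero_mem _
  | add w w' _ _ hw hw' => rw [smul_add]; exact Submodule.add_mem _ hw hw'
  | smul c w _ hw => rw [smul_comm]; exact Submodule.smul_mem _ c hw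

variable {D U} in
/-- In a vertex algebra whose modes respect weights, operators of arbitrary degree preserve the
span of the vectors obtained from `U` by operators of positive degree. -/
theorem IsPositive.gen_smul_mem
    (hmode : ∀ n k m u v, D.HasWeight n u → D.HasWeight k v →
      D.HasWeight (k + n - m - 1) (D.mode u m v))
    {d : ℤ} {w : D.M0 U} (h : D.IsPositive U d w) {n m : ℤ} {v : V} (hv : D.HasWeight n v) :
    D.gen v m • w ∈ Submodule.span ℂ {w | D.IsPositive U (n - m - 1 + d) w} := by
  by_cases hm : 0 < n - m - 1
  · exact Submodule.subset_span (IsPositive.cons n m d v w hv hm h)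
  induction h generalizing n m v with
  | lowest y =>
    rcases lt_or_eq_of_le (not_lt.1 hm) with hm | hm
    · rw [gen_smul_lowest_of_lt D U hv hm]
      exact Submodule.zero_mem _
    · rw [show m = n - 1 by omega, gen_smul_lowest D U hv, show n - (n - 1) - 1 + 0 = 0 by ring]
      exact Submodule.subset_span (IsPositive.lowest _)
  | cons k l d u w hu hl hw ih =>
    have ih' : ∀ {n m : ℤ} {v : V}, D.HasWeight n v →
        D.gen v m • w ∈ Submodule.span ℂ {w | D.IsPositive U (n - m - 1 + d) w} := by
      intro n m v hv
      by_cases h : 0 < n - m - 1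
      · exact Submodule.subset_span (IsPositive.cons n m d v w hv h hw)
      · exact ih hv h
    obtain ⟨N, hN⟩ : ∃ N : ℕ, ∀ i : ℕ, N ≤ i → D.mode v i u = 0 := by
      refine ⟨(-(D.Y v u).order).toNat, fun i hi => ?_⟩
      exact HahnSeries.coeff_eq_zero_of_lt_order (by omega)
    -- The operator of degree `≤ 0` is moved past the leftmost positive one. In the reordered term
    -- it acts on the shorter word, and each bracket term is a single operator on the shorter word.
    rw [← mul_smul, D.gen_bracket v u m l N hN, add_smul, Finset.sum_smul, mul_smul]
    refine Submodule.add_mem _ ?_ (Submodule.sum_mem _ fun i _ => ?_)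
    · refine D.gen_smul_mem_span_of_forall U (fun w' hw' => ?_) (ih' hv)
      refine Submodule.subset_span ?_
      have := IsPositive.cons k l _ u w' hu hl hw'
      rwa [show k - l - 1 + (n - m - 1 + d) = n - m - 1 + (k - l - 1 + d) by ring] at this
    · rw [smul_assoc]
      refine zsmul_mem ?_ _
      have := ih' (m := m + l - i) (hmode n k i v u hv hu)
      rwa [show k + n - i - 1 - (m + l - i) - 1 + d = n - m - 1 + (k - l - 1 + d) by ring] at this

theorem M0deg_le (hmode : ∀ n k m u v, D.HasWeight n u → D.HasWeight k v →
      D.HasWeight (k + n - m - 1) (D.mode u m v)) (d : ℤ) :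
    D.M0deg U d ≤ Submodule.span ℂ {w | D.IsPositive U d w} := by
  rw [M0deg, Submodule.span_le]
  rintro _ ⟨x, y, hx, rfl⟩
  rw [← smul_lowest]
  induction hx with
  | one => rw [one_smul]; exact Submodule.subset_span (IsPositive.lowest y)
  | cons n m d v x hv hx ih =>
    rw [mul_smul]
    exact D.gen_smul_mem_span_of_forall U (fun w hw => hw.gen_smul_mem hmode hv) ih

theorem gen_smul_mem_M0deg {n m d : ℤ} {v : V} {w : D.M0 U} (hv : D.HasWeight n v)
    (hw : w ∈ D.M0deg U d) : D.gen v m • w ∈ D.M0deg U (n - m - 1 + d) := by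
  refine D.gen_smul_mem_span_of_forall U (fun w hw => ?_) hw
  obtain ⟨x, y, hx, rfl⟩ := hw
  refine Submodule.subset_span ⟨D.gen v m * x, y, IsMonomial.cons n m d v x hv hx, ?_⟩
  rw [← smul_lowest, ← smul_lowest, mul_smul]

theorem lowest_mem_M0deg (y : U) : D.lowest U y ∈ D.M0deg U 0 :=
  Submodule.subset_span ⟨1, y, IsMonomial.one, rfl⟩

theorem iSup_M0deg (hV : Submodule.span ℂ {v | ∃ n : ℤ, D.HasWeight n v} = ⊤) :
    ⨆ d, D.M0deg U d = ⊤ := by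
  have h : ∀ v m, ∀ w ∈ ⨆ d, D.M0deg U d, D.gen v m • w ∈ ⨆ d, D.M0deg U d := by
    intro v m w hw
    have hv : v ∈ Submodule.span ℂ {v | ∃ n : ℤ, D.HasWeight n v} := hV ▸ Submodule.mem_top
    induction hv using Submodule.span_induction with
    | mem v hv =>
      obtain ⟨n, hv⟩ := hv
      induction hw using Submodule.iSup_induction' with
      | mem d w hw => exact Submodule.mem_iSup_of_mem _ (D.gen_smul_mem_M0deg U hv hw)
      | zero => rw [smul_zero]; exact Submodule.zero_mem _
      | add w w' _ _ h h' => rw [smul_add]; exact Submodule.add_mem _ h h'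
    | zero => rw [gen_zero, zero_smul]; exact Submodule.zero_mem _
    | add v v' _ _ h h' => rw [gen_add, add_smul]; exact Submodule.add_mem _ h h'
    | smul c v _ h => rw [gen_smul, smul_assoc]; exact Submodule.smul_mem _ c h
  rw [eq_top_iff]
  rintro w -
  obtain ⟨z, rfl⟩ := (D.inducedRel U).mkQ_surjective w
  induction z using TensorProduct.induction_on with
  | zero => rw [map_zero]; exact Submodule.zero_mem _
  | tmul x y =>
    rw [← smul_lowest]
    exact (D.submoduleOfGen _ h).smul_mem x (Submodule.mem_iSup_of_mem 0 (D.lowest_mem_M0deg U y))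
  | add z z' h h' => rw [map_add]; exact Submodule.add_mem _ h h'

end VertexData

namespace Heisenberg
open MvPolynomial Filter

theorem hasWeight_mode (a : ℂ) (n k m : ℤ) (u v : Fock) (hu : (M a).HasWeight n u)
    (hv : (M a).HasWeight k v) : (M a).HasWeight (k + n - m - 1) ((M a).mode u m v) := by
  rw [hasWeight_iff] at *
  rw [mode_eq]
  exact fieldMode_mem_degreePart 0 hu hv

/-! ### Identification of `𝔏_0(U)` with a Fock module -/

section Induced

variable (a : ℂ) {R : Type} [CommRing R] [Algebra ℂ R] (t : R)
  (U : Type) [AddCommGroup U] [Module ℂ U] [Module (M a).ZhuAlgebra U]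
  [IsScalarTower ℂ (M a).ZhuAlgebra U]

/-- The vectors of degree zero of the Fock module. -/
def vacuumVector : R →ₗ[ℂ] FockModule a t :=
  (toPoly a t).symm.toLinearMap ∘ₗ (Algebra.linearMap R (MvPolynomial ℕ R)).restrictScalars ℂ

theorem toPoly_vacuumVector (r : R) : toPoly a t (vacuumVector a t r) = C r := rfl

variable {U} (u : U ≃ₗ[ℂ] R)
  (hu : ∀ v y, u ((M a).zhuClass v • y) = zeroMode t v * u y)

/-- The homomorphism `𝒰(V̂) ⊗ U → M(1) ⊗ R`. -/
def tensorToFock : (M a).ModeAlgebra ⊗[ℂ] U →ₗ[(M a).ModeAlgebra] FockModule a t :=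
  TensorProduct.AlgebraTensorModule.lift
    { toFun := fun x => (Algebra.lsmul ℂ ℂ (FockModule a t) x) ∘ₗ vacuumVector a t ∘ₗ u.toLinearMap
      map_add' := fun x x' => LinearMap.ext fun _ => add_smul x x' _
      map_smul' := fun x x' => LinearMap.ext fun _ => mul_smul x x' _ }

theorem tensorToFock_tmul (x : (M a).ModeAlgebra) (y : U) :
    tensorToFock a t u (x ⊗ₜ y) = x • vacuumVector a t (u y) := rfl

theorem inducedRel_le_ker (hu : ∀ v y, u ((M a).zhuClass v • y) = zeroMode t v * u y) : (M a).inducedRel U ≤ LinearMap.ker (tensorToFock a t u) := by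
  rw [VertexData.inducedRel, Submodule.span_le]
  rintro _ (⟨n, m, v, y, hv, hm, rfl⟩ | ⟨n, v, y, hv, rfl⟩)
  · refine (toPoly a t).injective ?_
    rw [tensorToFock_tmul, toPoly_gen_smul, toPoly_vacuumVector,
      fieldMode_C_of_lt t ((hasWeight_iff a).1 hv) hm, map_zero]
  · refine (toPoly a t).injective ?_
    rw [map_sub, tensorToFock_tmul, tensorToFock_tmul, one_smul, map_sub, toPoly_gen_smul,
      toPoly_vacuumVector, toPoly_vacuumVector, fieldMode_zeroMode t ((hasWeight_iff a).1 hv), hu,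
      sub_self, map_zero]

/-- The homomorphism `M_0(U) → M(1) ⊗ R`. -/
def M0ToFock : (M a).M0 U →ₗ[(M a).ModeAlgebra] FockModule a t :=
  ((M a).inducedRel U).liftQ (tensorToFock a t u) (inducedRel_le_ker a t u hu)

theorem M0ToFock_lowest (y : U) :
    M0ToFock a t u hu ((M a).lowest U y) = vacuumVector a t (u y) :=
  one_smul (M a).ModeAlgebra _

theorem smul_mem_degreePart {n m d : ℤ} {v : Fock} (hv : (M a).HasWeight n v)
    {w : FockModule a t} (hw : toPoly a t w ∈ degreePart R d) :
    toPoly a t ((M a).gen v m • w) ∈ degreePart R (n - m - 1 + d) := by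
  rw [toPoly_gen_smul, show n - m - 1 + d = d + n - m - 1 by ring]
  exact fieldMode_mem_degreePart t ((hasWeight_iff a).1 hv) hw

theorem isMonomial_smul_mem {d e : ℤ} {x : (M a).ModeAlgebra} (hx : (M a).IsMonomial d x)
    {w : FockModule a t} (hw : toPoly a t w ∈ degreePart R e) :
    toPoly a t (x • w) ∈ degreePart R (d + e) := by
  induction hx with
  | one => rwa [one_smul, zero_add]
  | cons n m d v x hv hx ih =>
    rw [mul_smul, add_assoc]
    exact smul_mem_degreePart a t hv ih

theorem M0ToFock_mem {d : ℤ} {w : (M a).M0 U} (hw : w ∈ (M a).M0deg U d) :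
    toPoly a t (M0ToFock a t u hu w) ∈ degreePart R d := by
  induction hw using Submodule.span_induction with
  | mem w hw =>
    obtain ⟨x, y, hx, rfl⟩ := hw
    rw [← VertexData.smul_lowest, map_smul, M0ToFock_lowest, ← add_zero d]
    exact isMonomial_smul_mem a t hx (C_mem_degreePart _)
  | zero => rw [map_zero, map_zero]; exact Submodule.zero_mem _
  | add w w' _ _ h h' => rw [map_add, map_add]; exact Submodule.add_mem _ h h'
  | smul c w _ h =>
    rw [LinearMap.map_smul_of_tower, map_smul]
    exact Submodule.smul_mem _ c h

theorem exists_monomial (s : ℕ →₀ ℕ) : ∃ x : (M a).ModeAlgebra, (M a).IsMonomial (wt s) x ∧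
    ∀ r : R, toPoly a t (x • vacuumVector a t r) = monomial s r := by
  induction s using finsupp_induction with
  | h0 => exact ⟨1, by simpa using VertexData.IsMonomial.one, fun r => by rw [one_smul]; rfl⟩
  | h k s ih =>
    obtain ⟨x, hx, h⟩ := ih
    refine ⟨alpha a (-((k : ℤ) + 1)) * x, ?_, fun r => ?_⟩
    · have h1 := VertexData.IsMonomial.cons (D := M a) 1 (-((k : ℤ) + 1)) _ (X 0) x
        (by simpa using hasWeight_X a 0) hx
      rw [map_add, wt_single]
      convert h1 using 1
      · push_cast
        ring
      · rfl
    · rw [mul_smul, toPoly_alpha_neg, h, X, monomial_mul, one_mul]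

theorem M0ToFock_mem_of_degreePart {d : ℤ} {w : FockModule a t}
    (hw : toPoly a t w ∈ degreePart R d) : ∃ w' ∈ (M a).M0deg U d, M0ToFock a t u hu w' = w := by
  choose x hx h using exists_monomial a t
  refine ⟨∑ s ∈ (toPoly a t w).support, x s • (M a).lowest U (u.symm (coeff s (toPoly a t w))),
    Submodule.sum_mem _ fun s hs => ?_, ?_⟩
  · refine Submodule.subset_span ⟨x s, _, ?_, (M a).smul_lowest U _ _⟩
    rw [← hw s (mem_support_iff.1 hs)]
    exact hx s
  · rw [map_sum]
    apply (toPoly a t).injective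
    rw [map_sum]
    simp only [map_smul, M0ToFock_lowest, u.apply_symm_apply, h]
    exact (toPoly a t w).support_sum_monomial_coeff

theorem M0ToFock_surjective : Function.Surjective (M0ToFock a t u hu) := by
  intro w
  choose x hx h using exists_monomial a t
  refine ⟨∑ s ∈ (toPoly a t w).support, x s • (M a).lowest U (u.symm (coeff s (toPoly a t w))), ?_⟩
  rw [map_sum]
  apply (toPoly a t).injective
  rw [map_sum]
  simp only [map_smul, M0ToFock_lowest, u.apply_symm_apply, h]
  exact (toPoly a t w).support_sum_monomial_coeff

/-- Annihilation operators move any coefficient into degree zero, up to a nonzero factor. This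
nondegeneracy is why a Fock module has no nonzero submodule without component in degree zero. -/
theorem eq_zero_of_constantCoeff {w : FockModule a t}
    (h : ∀ x : (M a).ModeAlgebra, constantCoeff (toPoly a t (x • w)) = 0) : w = 0 := by
  apply (toPoly a t).injective
  rw [map_zero]
  ext s
  rw [coeff_zero]
  induction s using finsupp_induction generalizing w with
  | h0 =>
    have h1 := h 1
    rwa [one_smul] at h1
  | h k s ih =>
    have h1 := ih (w := alpha a ((k : ℤ) + 1) • w) fun x => by rw [← mul_smul]; exact h _
    have h2 : (k : ℂ) + 1 ≠ 0 := Nat.cast_add_one_ne_zero k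
    rw [toPoly_alpha_pos, coeff_smul, smul_eq_zero_iff_right h2, coeff_pderiv] at h1
    have h3 : ((s k : R) + 1) = algebraMap ℂ R ((s k : ℂ) + 1) := by simp
    rwa [h3, mul_comm, ← Algebra.smul_def, smul_eq_zero_iff_right (Nat.cast_add_one_ne_zero _),
      add_comm] at h1

theorem constantCoeff_eq_zero {d : ℤ} (hd : d ≠ 0) {w : MvPolynomial ℕ R}
    (hw : w ∈ degreePart R d) : constantCoeff w = 0 := by
  by_contra h
  exact hd (by simpa using (hw 0 h).symm)

theorem constantCoeff_M0ToFock {w : (M a).M0 U}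
    (hw : w ∈ ⨆ ℓ : {ℓ : ℤ // ℓ ≠ 0}, (M a).M0deg U ℓ) :
    constantCoeff (toPoly a t (M0ToFock a t u hu w)) = 0 := by
  induction hw using Submodule.iSup_induction' with
  | mem ℓ w hw => exact constantCoeff_eq_zero ℓ.2 (M0ToFock_mem a t u hu hw)
  | zero => simp
  | add w w' _ _ h h' => rw [map_add, map_add, map_add, h, h', add_zero]

/-- A vector in the kernel has zero degree zero part, because that part lies in `U`, where the map
is injective; this applies to all its multiples, so it is in `J`. Conversely the image of a vector
of `J` never meets degree zero and vanishes by nondegeneracy. -/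
theorem ker_M0ToFock : LinearMap.ker (M0ToFock a t u hu) = (M a).J U := by
  ext w
  rw [LinearMap.mem_ker]
  constructor
  · intro hw x
    have hx : M0ToFock a t u hu (x • w) = 0 := by rw [map_smul, hw, smul_zero]
    generalize x • w = z at hx
    have hz : z ∈ ⨆ d, (M a).M0deg U d := by
      rw [(M a).iSup_M0deg U (isVertexOperatorAlgebra a).graded]
      exact Submodule.mem_top
    have hle : ⨆ d, (M a).M0deg U d ≤
        (M a).M0deg U 0 ⊔ ⨆ ℓ : {ℓ : ℤ // ℓ ≠ 0}, (M a).M0deg U ℓ := by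
      refine iSup_le fun d => ?_
      by_cases hd : d = 0
      · rw [hd]; exact le_sup_left
      · exact le_sup_of_le_right (le_iSup (fun ℓ : {ℓ : ℤ // ℓ ≠ 0} => (M a).M0deg U ℓ) ⟨d, hd⟩)
    obtain ⟨z0, h0, z1, h1, rfl⟩ := Submodule.mem_sup.1 (hle hz)
    -- A word of positive operators has degree zero only if it is empty, so the degree zero part is
    -- the image of `U`.
    have hy : ∀ z ∈ (M a).M0deg U 0, ∃ y, z = (M a).lowest U y := by
      intro z hz
      have := (M a).M0deg_le U (hasWeight_mode a) 0 hz
      clear hz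
      induction this using Submodule.span_induction with
      | mem z h => exact h.nonneg.2 rfl
      | zero => exact ⟨0, (map_zero _).symm⟩
      | add z z' _ _ h h' =>
        obtain ⟨y, rfl⟩ := h
        obtain ⟨y', rfl⟩ := h'
        exact ⟨y + y', (map_add _ _ _).symm⟩
      | smul c z _ h =>
        obtain ⟨y, rfl⟩ := h
        exact ⟨c • y, (map_smul _ _ _).symm⟩
    obtain ⟨y, rfl⟩ := hy z0 h0
    have h2 := congr_arg (constantCoeff ∘ toPoly a t) hx
    rw [Function.comp_apply, Function.comp_apply] at h2
    rw [map_add, map_add, map_add, constantCoeff_M0ToFock a t u hu h1, M0ToFock_lowest,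
      toPoly_vacuumVector, constantCoeff_C, map_zero, map_zero, add_zero,
      LinearEquiv.map_eq_zero_iff] at h2
    rwa [h2, map_zero, zero_add]
  · intro hw
    refine eq_zero_of_constantCoeff a t fun x => ?_
    rw [← map_smul]
    exact constantCoeff_M0ToFock a t u hu (hw x)

/-- The isomorphism of `𝔏_0(U)` with the Fock module `M(1) ⊗ R`. -/
def inducedEquiv : (M a).L0 U ≃ₗ[(M a).ModeAlgebra] FockModule a t :=
  (Submodule.quotEquivOfEq _ _ (ker_M0ToFock a t u hu).symm).trans
    ((M0ToFock a t u hu).quotKerEquivOfSurjective (M0ToFock_surjective a t u hu))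

theorem inducedEquiv_L0mk (x : (M a).ModeAlgebra) (y : U) :
    inducedEquiv a t u hu ((M a).L0mk U (x ⊗ₜ y)) = x • vacuumVector a t (u y) := rfl

theorem mem_L0deg_iff {ℓ : ℤ} {w : (M a).L0 U} :
    w ∈ (M a).L0deg U ℓ ↔ toPoly a t (inducedEquiv a t u hu w) ∈ degreePart R ℓ := by
  constructor
  · rintro ⟨w, hw, rfl⟩
    exact M0ToFock_mem a t u hu hw
  · intro h
    obtain ⟨w', hw', h'⟩ := M0ToFock_mem_of_degreePart a t u hu h
    refine ⟨w', hw', (inducedEquiv a t u hu).injective ?_⟩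
    exact h'

/-- The isomorphism `M(1) ⊗ U ≅ 𝔏_0(U)`. -/
def tensorEquiv : Fock ⊗[ℂ] U ≃ₗ[ℂ] (M a).L0 U :=
  (TensorProduct.congr (LinearEquiv.refl ℂ Fock) u).trans <|
    (TensorProduct.comm ℂ Fock R).trans <|
      ((algebraTensorAlgEquiv (σ := ℕ) ℂ R).restrictScalars ℂ).toLinearEquiv.trans <|
        (toPoly a t).symm.trans ((inducedEquiv a t u hu).symm.restrictScalars ℂ)

theorem toPoly_tensorEquiv (p : Fock) (y : U) :
    toPoly a t (inducedEquiv a t u hu (tensorEquiv a t u hu (p ⊗ₜ y))) =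
      C (u y) * map (algebraMap ℂ R) p := by
  have h : inducedEquiv a t u hu (tensorEquiv a t u hu (p ⊗ₜ y)) =
      (toPoly a t).symm (algebraTensorAlgEquiv ℂ R (u y ⊗ₜ p)) :=
    (inducedEquiv a t u hu).apply_symm_apply _
  rw [h, LinearEquiv.apply_symm_apply, algebraTensorAlgEquiv_tmul, smul_eq_C_mul]

theorem tensorEquiv_spec :
    (∀ y, tensorEquiv a t u hu (1 ⊗ₜ y) = (M a).L0mk U (1 ⊗ₜ y)) ∧
    (∀ (i : ℕ) p y, alpha a (-((i : ℤ) + 1)) • tensorEquiv a t u hu (p ⊗ₜ y) =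
      tensorEquiv a t u hu ((X i * p) ⊗ₜ y)) ∧
    (∀ p y, alpha a 0 • tensorEquiv a t u hu (p ⊗ₜ y) =
      tensorEquiv a t u hu (p ⊗ₜ (zhuX a • y))) ∧
    (∀ (i : ℕ) p y, alpha a ((i : ℤ) + 1) • tensorEquiv a t u hu (p ⊗ₜ y) =
      tensorEquiv a t u hu ((((i : ℂ) + 1) • pderiv i p) ⊗ₜ y)) := by
  have hinj : ∀ {w w'}, toPoly a t (inducedEquiv a t u hu w) =
      toPoly a t (inducedEquiv a t u hu w') → w = w' :=
    fun h => (inducedEquiv a t u hu).injective ((toPoly a t).injective h)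
  refine ⟨fun y => hinj ?_, fun i p y => hinj ?_, fun p y => hinj ?_, fun i p y => hinj ?_⟩
  · rw [toPoly_tensorEquiv, inducedEquiv_L0mk, one_smul, toPoly_vacuumVector, map_one, mul_one]
  · rw [map_smul, toPoly_alpha_neg, toPoly_tensorEquiv, toPoly_tensorEquiv, map_mul, map_X]
    ring
  · rw [map_smul, toPoly_alpha_zero, toPoly_tensorEquiv, toPoly_tensorEquiv, zhuX, hu, zeroMode_X,
      pow_zero, one_mul, C_mul, mul_assoc]
  · rw [map_smul, toPoly_alpha_pos, toPoly_tensorEquiv, toPoly_tensorEquiv, pderiv_C_mul,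
      pderiv_map, smul_eq_C_mul _ ((i : ℂ) + 1), map_mul, map_C, mul_left_comm,
      Algebra.smul_def]
    rfl

end Induced

end Heisenberg

/-! ### Modules whose submodules are the kernels of powers of a nilpotent endomorphism -/

section Uniserial

variable {A : Type*} [Ring A] {W : Type*} [AddCommGroup W] [Module A W]

/-- The submodules of `W` are the kernels of the powers of a nilpotent endomorphism `ν`, and the
kernel of `ν ^ j` is the image of `ν ^ (k - j)`. -/
structure IsUniserialFor (k : ℕ) (ν : Module.End A W) : Prop where
  pos : 0 < k
  ne_zero : ν ^ (k - 1) ≠ 0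
  ker_eq_range : ∀ j ≤ k, LinearMap.ker (ν ^ j) = LinearMap.range (ν ^ (k - j))
  all : ∀ S : Submodule A W, ∃ j ≤ k, S = LinearMap.ker (ν ^ j)

theorem isIndecomposable_of_total {P : Submodule A W} (hP : P ≠ ⊥)
    (h : ∀ S T : Submodule A W, S ≤ T ∨ T ≤ S) : IsIndecomposable A P := by
  refine ⟨(Submodule.nontrivial_iff_ne_bot).2 hP, fun S T hST => ?_⟩
  have hle : ∀ {S T : Submodule A P}, S.map P.subtype ≤ T.map P.subtype → S ≤ T := fun h =>
    (Submodule.map_le_map_iff_of_injective P.injective_subtype _ _).1 h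
  rcases h (S.map P.subtype) (T.map P.subtype) with h | h
  · exact Or.inl (by rw [← inf_eq_left.2 (hle h), hST.inf_eq_bot])
  · exact Or.inr (by rw [← inf_eq_right.2 (hle h), hST.inf_eq_bot])

namespace IsUniserialFor

variable {k : ℕ} {ν : Module.End A W}

theorem ker_le_ker (ν : Module.End A W) {i j : ℕ} (h : i ≤ j) :
    LinearMap.ker (ν ^ i) ≤ LinearMap.ker (ν ^ j) := by
  intro w hw
  rw [LinearMap.mem_ker] at hw ⊢
  rw [← Nat.sub_add_cancel h, pow_add, Module.End.mul_apply, hw, map_zero]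

theorem ker_eq_top (h : IsUniserialFor k ν) : LinearMap.ker (ν ^ k) = ⊤ := by
  rw [h.ker_eq_range k le_rfl, Nat.sub_self, pow_zero, Module.End.one_eq_id, LinearMap.range_id]

theorem ker_zero (ν : Module.End A W) : LinearMap.ker (ν ^ 0) = ⊥ := by
  rw [pow_zero, Module.End.one_eq_id, LinearMap.ker_id]

/-- If two consecutive kernels agreed, the sequence would be constant from there on, hence equal to
the whole module already below the exponent `k`. -/
theorem ker_lt_ker_succ (h : IsUniserialFor k ν) {j : ℕ} (hj : j < k) :
    LinearMap.ker (ν ^ j) < LinearMap.ker (ν ^ (j + 1)) := by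
  refine lt_of_le_of_ne (ker_le_ker ν j.le_succ) fun he => h.ne_zero ?_
  have h1 : ∀ m, LinearMap.ker (ν ^ (j + m)) ≤ LinearMap.ker (ν ^ j) := by
    intro m
    induction m with
    | zero => exact le_rfl
    | succ m ih =>
      intro w hw
      refine ih ?_
      rw [LinearMap.mem_ker] at hw ⊢
      rw [show j + (m + 1) = j + 1 + m by ring, pow_add, Module.End.mul_apply, ← LinearMap.mem_ker,
        ← he, LinearMap.mem_ker, ← Module.End.mul_apply, ← pow_add] at hw
      exact hw
  have h2 := h1 (k - j)
  rw [Nat.add_sub_cancel' hj.le, h.ker_eq_top] at h2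
  exact LinearMap.ker_eq_top.1 (top_le_iff.1 (h2.trans (ker_le_ker ν (by omega))))

theorem total (h : IsUniserialFor k ν) (S T : Submodule A W) : S ≤ T ∨ T ≤ S := by
  obtain ⟨i, -, rfl⟩ := h.all S
  obtain ⟨j, -, rfl⟩ := h.all T
  exact (le_total i j).imp (ker_le_ker ν) (ker_le_ker ν)

/-- The chain of all submodules. -/
def chain (ν : Module.End A W) (k : ℕ) (j : Fin (k + 1)) : Submodule A W :=
  LinearMap.ker (ν ^ (j : ℕ))

theorem strictMono (h : IsUniserialFor k ν) : StrictMono (chain ν k) :=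
  Fin.strictMono_iff_lt_succ.2 fun j => h.ker_lt_ker_succ j.2

theorem isAtom_iff (h : IsUniserialFor k ν) {S : Submodule A W} :
    IsAtom S ↔ S = LinearMap.ker (ν ^ 1) := by
  have h1 : LinearMap.ker (ν ^ 1) ≠ ⊥ := by
    rw [← ker_zero ν]
    exact (h.ker_lt_ker_succ h.pos).ne'
  have h2 : ∀ T : Submodule A W, T ≠ ⊥ → LinearMap.ker (ν ^ 1) ≤ T := by
    intro T hT
    obtain ⟨j, -, rfl⟩ := h.all T
    rcases j with _ | j
    · exact absurd (ker_zero ν) hT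
    · exact ker_le_ker ν (by omega)
  constructor
  · intro hS
    exact ((hS.le_iff.1 (h2 S hS.1)).resolve_left h1).symm
  · rintro rfl
    refine ⟨h1, fun T hT => ?_⟩
    by_contra hT'
    exact hT.not_ge (h2 T hT')

theorem isCoatom_iff (h : IsUniserialFor k ν) {S : Submodule A W} :
    IsCoatom S ↔ S = LinearMap.ker (ν ^ (k - 1)) := by
  have h1 : LinearMap.ker (ν ^ (k - 1)) ≠ ⊤ := fun h' => h.ne_zero (LinearMap.ker_eq_top.1 h')
  have h2 : ∀ T : Submodule A W, T ≠ ⊤ → T ≤ LinearMap.ker (ν ^ (k - 1)) := by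
    intro T hT
    obtain ⟨j, hj, rfl⟩ := h.all T
    rcases eq_or_ne j k with rfl | hjk
    · exact absurd h.ker_eq_top hT
    · exact ker_le_ker ν (by omega)
  constructor
  · intro hS
    exact ((hS.le_iff.1 (h2 S hS.1)).resolve_left h1).symm
  · rintro rfl
    refine ⟨h1, fun T hT => ?_⟩
    by_contra hT'
    exact hT.not_ge (h2 T hT')

theorem socle_eq (h : IsUniserialFor k ν) : socle A W = LinearMap.ker (ν ^ 1) := by
  have h1 : {S : Submodule A W | IsSimpleModule A S} = {LinearMap.ker (ν ^ 1)} :=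
    Set.ext fun S => isSimpleModule_iff_isAtom.trans h.isAtom_iff
  rw [socle, h1, sSup_singleton]

theorem jacobson_eq (h : IsUniserialFor k ν) :
    Module.jacobson A W = LinearMap.ker (ν ^ (k - 1)) := by
  have h1 : {S : Submodule A W | IsCoatom S} = {LinearMap.ker (ν ^ (k - 1))} :=
    Set.ext fun S => h.isCoatom_iff
  rw [Module.jacobson, h1, sInf_singleton]

/-- `ker ν ^ j ≅ W / ker ν ^ (k - j)`. -/
def kerEquiv (h : IsUniserialFor k ν) {j : ℕ} (hj : j ≤ k) :
    LinearMap.ker (ν ^ j) ≃ₗ[A] W ⧸ LinearMap.ker (ν ^ (k - j)) :=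
  (LinearEquiv.ofEq _ _ (h.ker_eq_range j hj)).trans (ν ^ (k - j)).quotKerEquivRange.symm

theorem isInterlockedChain (h : IsUniserialFor k ν) :
    IsInterlockedChain A W k (chain ν k) where
  bot := ker_zero ν
  top := h.ker_eq_top
  strictMono := h.strictMono
  all S := by
    obtain ⟨j, hj, rfl⟩ := h.all S
    exact ⟨⟨j, by omega⟩, rfl⟩
  indecomposable j hj := by
    refine isIndecomposable_of_total (fun h0 => hj ?_) h.total
    exact h.strictMono.injective (h0.trans (ker_zero ν).symm)
  eq_socle j hj := by rw [h.socle_eq, chain, hj]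
  eq_radical j hj := by
    have hj' : (j : ℕ) = k - 1 := by omega
    rw [h.jacobson_eq, chain, hj']
  interlocked j := by
    have h1 := h.kerEquiv (j := j) (by omega)
    have h2 : (j.rev : ℕ) = k - j := by rw [Fin.val_rev]; omega
    rw [chain, chain, h2]
    exact ⟨h1⟩

theorem isInterlocked (h : IsUniserialFor k ν) : IsInterlocked A W := by
  constructor
  · have hn : Nontrivial W := by
      by_contra hn
      rw [not_nontrivial_iff_subsingleton] at hn
      exact h.ne_zero (Subsingleton.elim _ _)
    refine ⟨hn, fun S T hST => ?_⟩
    rcases h.total S T with h' | h'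
    · exact Or.inl (by rw [← inf_eq_left.2 h', hST.inf_eq_bot])
    · exact Or.inr (by rw [← inf_eq_right.2 h', hST.inf_eq_bot])
  · intro S
    obtain ⟨j, hj, rfl⟩ := h.all S
    refine ⟨LinearMap.ker (ν ^ (k - j)), ⟨h.kerEquiv hj⟩, ⟨?_⟩⟩
    have := h.kerEquiv (j := k - j) (by omega)
    rwa [Nat.sub_sub_self hj] at this

theorem isStronglyInterlocked (h : IsUniserialFor k ν) : IsStronglyInterlocked A W :=
  ⟨h.isInterlocked, k, _, h.isInterlockedChain⟩

theorem quotient_jacobson (h : IsUniserialFor k ν) :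
    Nonempty ((W ⧸ Module.jacobson A W) ≃ₗ[A] socle A W) := by
  rw [h.socle_eq, h.jacobson_eq]
  exact ⟨(h.kerEquiv h.pos).symm⟩

theorem quotient_socle (h : IsUniserialFor k ν) :
    Nonempty ((W ⧸ socle A W) ≃ₗ[A] Module.jacobson A W) := by
  rw [h.socle_eq, h.jacobson_eq]
  have := h.kerEquiv (j := k - 1) (by omega)
  rw [Nat.sub_sub_self h.pos] at this
  exact ⟨this.symm⟩

/-- The two rings may differ; it suffices that each scalar of `A'` is realised pointwise by some
scalar of `A`. This serves both the passage from the Zhu algebra to its quotient `ℂ[τ]/(τ ^ k)` and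
isomorphisms of `V`-modules. -/
theorem of_addEquiv {A' : Type*} [Ring A'] {W' : Type*} [AddCommGroup W'] [Module A' W']
    {ν' : Module.End A' W'} (h : IsUniserialFor k ν') (e : W ≃+ W')
    (he : ∀ (a' : A') w, ∃ a : A, e (a • w) = a' • e w) (hν : ∀ w, e (ν w) = ν' (e w)) :
    IsUniserialFor k ν := by
  have hpow : ∀ j w, e ((ν ^ j) w) = (ν' ^ j) (e w) := by
    intro j
    induction j with
    | zero => intro w; rfl
    | succ j ih => intro w; rw [pow_succ, pow_succ, Module.End.mul_apply, ih, hν]; rfl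
  have hker : ∀ j w, w ∈ LinearMap.ker (ν ^ j) ↔ e w ∈ LinearMap.ker (ν' ^ j) := by
    intro j w
    rw [LinearMap.mem_ker, LinearMap.mem_ker, ← hpow, map_eq_zero_iff e e.injective]
  refine ⟨h.pos, fun h0 => h.ne_zero ?_, fun j hj => ?_, fun S => ?_⟩
  · refine LinearMap.ext fun w => ?_
    obtain ⟨w, rfl⟩ := e.surjective w
    rw [← hpow, h0]
    simp
  · ext w
    rw [hker, h.ker_eq_range j hj]
    constructor
    · rintro ⟨x, hx⟩
      obtain ⟨x, rfl⟩ := e.surjective x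
      exact ⟨x, e.injective (by rw [hpow, hx])⟩
    · rintro ⟨x, rfl⟩
      exact ⟨e x, (hpow _ _).symm⟩
  · let S' : Submodule A' W' :=
      { S.toAddSubgroup.map e.toAddMonoidHom with
        smul_mem' := by
          rintro a' _ ⟨w, hw, rfl⟩
          obtain ⟨a, ha⟩ := he a' w
          exact ⟨a • w, S.smul_mem a hw, ha⟩ }
    obtain ⟨j, hj, hS⟩ := h.all S'
    refine ⟨j, hj, ?_⟩
    ext w
    rw [hker, ← hS]
    constructor
    · intro hw
      exact ⟨w, hw, rfl⟩
    · rintro ⟨w', hw', h'⟩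
      rwa [← e.injective h']

end IsUniserialFor

end Uniserial

namespace Heisenberg
open MvPolynomial Filter

/-! ### The ring `ℂ[τ]/(τ ^ k)` -/

section Trunc

/-- The truncated polynomial ring `ℂ[τ] / (τ ^ k)`. -/
abbrev Trunc (k : ℕ) : Type := AdjoinRoot (Polynomial.X ^ k : Polynomial ℂ)

variable (k : ℕ)

/-- The generator of `ℂ[τ] / (τ ^ k)`. -/
def tau : Trunc k := AdjoinRoot.root _

theorem mk_X_pow (j : ℕ) : AdjoinRoot.mk (Polynomial.X ^ k) (Polynomial.X ^ j) = tau k ^ j := by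
  rw [map_pow, AdjoinRoot.mk_X, tau]

theorem tau_pow_eq_zero_iff {j : ℕ} : tau k ^ j = 0 ↔ k ≤ j := by
  rw [← mk_X_pow, AdjoinRoot.mk_eq_zero]
  exact pow_dvd_pow_iff Polynomial.X_ne_zero Polynomial.not_isUnit_X

theorem tau_pow_mul_eq_zero_iff {j : ℕ} (hj : j ≤ k) (r : Trunc k) :
    tau k ^ j * r = 0 ↔ ∃ r', tau k ^ (k - j) * r' = r := by
  constructor
  · intro h
    obtain ⟨f, rfl⟩ := AdjoinRoot.mk_surjective r
    rw [← mk_X_pow, ← map_mul, AdjoinRoot.mk_eq_zero] at h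
    have h1 : (Polynomial.X : Polynomial ℂ) ^ (k - j) ∣ f := by
      rw [← mul_dvd_mul_iff_left (pow_ne_zero j Polynomial.X_ne_zero), ← pow_add,
        Nat.add_sub_cancel' hj]
      exact h
    obtain ⟨g, rfl⟩ := h1
    exact ⟨AdjoinRoot.mk _ g, by rw [map_mul, mk_X_pow]⟩
  · rintro ⟨r', rfl⟩
    rw [← mul_assoc, ← pow_add, Nat.add_sub_cancel' hj, (tau_pow_eq_zero_iff k).2 le_rfl, zero_mul]

/-- The preimage in `ℂ[τ]` is principal and its generator divides `τ ^ k`, so the ideal is generated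
by some `τ ^ i` and is the annihilator of `τ ^ (k - i)`. -/
theorem exists_ideal_eq (I : Ideal (Trunc k)) :
    ∃ j ≤ k, ∀ r, r ∈ I ↔ tau k ^ j * r = 0 := by
  obtain ⟨g, hg⟩ := (IsPrincipalIdealRing.principal
    (I.comap (AdjoinRoot.mk (Polynomial.X ^ k : Polynomial ℂ)))).principal
  have hgk : g ∣ Polynomial.X ^ k := by
    rw [← Ideal.mem_span_singleton, ← Ideal.submodule_span_eq, ← hg, Ideal.mem_comap,
      AdjoinRoot.mk_self]
    exact I.zero_mem
  obtain ⟨i, hi, hgi⟩ := (dvd_prime_pow Polynomial.prime_X k).1 hgk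
  refine ⟨k - i, Nat.sub_le _ _, fun r => ?_⟩
  obtain ⟨f, rfl⟩ := AdjoinRoot.mk_surjective r
  rw [tau_pow_mul_eq_zero_iff k (Nat.sub_le _ _), Nat.sub_sub_self hi, ← Ideal.mem_comap, hg,
    Ideal.submodule_span_eq, Ideal.mem_span_singleton, hgi.dvd_iff_dvd_left]
  constructor
  · rintro ⟨q, rfl⟩
    exact ⟨AdjoinRoot.mk _ q, by rw [map_mul, mk_X_pow]⟩
  · rintro ⟨r', h⟩
    obtain ⟨q, rfl⟩ := AdjoinRoot.mk_surjective r'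
    rw [← mk_X_pow, ← map_mul, AdjoinRoot.mk_eq_mk] at h
    have h1 := (dvd_sub_right (Dvd.intro q rfl)).1 ((pow_dvd_pow Polynomial.X hi).trans h)
    exact h1

/-- Multiplication by `τ` on `ℂ[τ] / (τ ^ k)`. -/
theorem isUniserialFor_trunc (hk : 0 < k) :
    IsUniserialFor k (LinearMap.mulLeft (Trunc k) (tau k) : Module.End (Trunc k) (Trunc k)) := by
  have hp : ∀ j r, ((LinearMap.mulLeft (Trunc k) (tau k) : Module.End (Trunc k) (Trunc k)) ^ j) r
      = tau k ^ j * r := fun j r => by rw [LinearMap.pow_mulLeft, LinearMap.mulLeft_apply]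
  refine ⟨hk, fun h => ?_, fun j hj => ?_, fun S => ?_⟩
  · have h1 := hp (k - 1) 1
    rw [h, LinearMap.zero_apply, mul_one] at h1
    have := (tau_pow_eq_zero_iff k).1 h1.symm
    omega
  · ext r
    rw [LinearMap.mem_ker, hp, tau_pow_mul_eq_zero_iff k hj, LinearMap.mem_range]
    simp only [hp]
  · obtain ⟨j, hj, h⟩ := exists_ideal_eq k S
    refine ⟨j, hj, ?_⟩
    ext r
    rw [h, LinearMap.mem_ker, hp]

/-- The basis `1, τ, …, τ ^ (k - 1)`. -/
def tauBasis : Module.Basis (Fin k) ℂ (Trunc k) :=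
  ((AdjoinRoot.powerBasis' (Polynomial.monic_X_pow (R := ℂ) k)).basis).reindex
    (finCongr (by simp))

theorem tauBasis_apply (i : Fin k) : tauBasis k i = tau k ^ (i : ℕ) := by
  rw [tauBasis, Module.Basis.reindex_apply, PowerBasis.basis_eq_pow]
  rfl

/-- The coefficient of `τ ^ m`. -/
def tauCoeff (m : ℕ) : Trunc k →ₗ[ℂ] ℂ :=
  if h : m < k then (tauBasis k).coord ⟨m, h⟩ else 0

theorem tauCoeff_pow (m n : ℕ) : tauCoeff k m (tau k ^ n) = if m = n ∧ m < k then 1 else 0 := by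
  by_cases hm : m < k
  · rw [tauCoeff, dif_pos hm]
    rcases lt_or_ge n k with hn | hn
    · rw [← tauBasis_apply k ⟨n, hn⟩, Module.Basis.coord_apply, Module.Basis.repr_self,
        Finsupp.single_apply]
      simp [hm, eq_comm]
    · rw [(tau_pow_eq_zero_iff k).2 hn, map_zero, if_neg (by omega)]
  · rw [tauCoeff, dif_neg hm, if_neg (by tauto), LinearMap.zero_apply]

theorem tauCoeff_pow_mul (m n : ℕ) (r : Trunc k) :
    tauCoeff k m (tau k ^ n * r) = if n ≤ m ∧ m < k then tauCoeff k (m - n) r else 0 := by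
  have h : tauCoeff k m ∘ₗ LinearMap.mulLeft ℂ (tau k ^ n) =
      if n ≤ m ∧ m < k then tauCoeff k (m - n) else 0 := by
    refine (tauBasis k).ext fun i => ?_
    rw [LinearMap.comp_apply, LinearMap.mulLeft_apply, tauBasis_apply, ← pow_add, tauCoeff_pow]
    have hi := i.2
    split_ifs with h1 h2 h2
    · rw [tauCoeff_pow, if_pos (by omega)]
    · omega
    · rw [tauCoeff_pow, if_neg (by omega)]
    · rfl
  have h1 := congr($h r)
  rw [LinearMap.comp_apply, LinearMap.mulLeft_apply] at h1
  rw [h1]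
  split_ifs <;> rfl

theorem tau_pow_mul_eq_zero_iff_coeff {j : ℕ} (r : Trunc k) :
    tau k ^ j * r = 0 ↔ ∀ m, m + j < k → tauCoeff k m r = 0 := by
  have h0 : ∀ x : Trunc k, x = 0 ↔ ∀ m : Fin k, tauCoeff k m x = 0 := by
    intro x
    rw [← (tauBasis k).repr.map_eq_zero_iff, Finsupp.ext_iff]
    refine forall_congr' fun m => ?_
    rw [tauCoeff, dif_pos m.2]
    rfl
  rw [h0]
  constructor
  · intro h m hm
    have := h ⟨m + j, hm⟩
    rwa [tauCoeff_pow_mul, if_pos (by dsimp only; omega), Nat.add_sub_cancel] at this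
  · intro h m
    rw [tauCoeff_pow_mul]
    split_ifs with hj
    · exact h _ (by omega)
    · rfl

variable (lam : ℂ)

/-- The element `λ + τ` of `ℂ[τ] / (τ ^ k)`. -/
def shift : Trunc k := tau k + algebraMap ℂ _ lam

theorem trunc_induction {P : Trunc k → Prop} (hc : ∀ c : ℂ, P (algebraMap ℂ _ c))
    (hs : P (shift k lam)) (ha : ∀ x y, P x → P y → P (x + y)) (hm : ∀ x y, P x → P y → P (x * y))
    (x : Trunc k) : P x := by
  let A : Subalgebra ℂ (Trunc k) :=
    { carrier := {x | P x}
      mul_mem' := hm _ _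
      add_mem' := ha _ _
      algebraMap_mem' := hc }
  have h1 : tau k ∈ A := by
    have : tau k = shift k lam - algebraMap ℂ _ lam := by rw [shift, add_sub_cancel_right]
    rw [this]
    exact A.sub_mem hs (hc lam)
  have h2 : Algebra.adjoin ℂ {tau k} ≤ A := Algebra.adjoin_le (Set.singleton_subset_iff.2 h1)
  rw [tau, AdjoinRoot.adjoinRoot_eq_top] at h2
  exact h2 Algebra.mem_top

end Trunc

/-! ### Submodules of `M(1) ⊗ Ω(λ, k)` -/

section FockTrunc

variable (a lam : ℂ) (k : ℕ)

/-- The module `M(1) ⊗ Ω(λ, k)`. -/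
abbrev FockTrunc : Type := FockModule a (shift k lam)

/-- The multiplication by `τ` on `M(1) ⊗ Ω(λ, k)`. -/
def nilp : Module.End (M a).ModeAlgebra (FockTrunc a lam k) :=
  (M a).homOfGen ((toPoly a (shift k lam)).symm.toLinearMap ∘ₗ LinearMap.mulLeft ℂ (C (tau k)) ∘ₗ
    (toPoly a (shift k lam)).toLinearMap) fun v m w => (toPoly a (shift k lam)).injective <| by
      rw [toPoly_gen_smul]
      change C (tau k) * toPoly a _ ((M a).gen v m • w) = fieldMode _ v m (C (tau k) * toPoly a _ w)
      rw [toPoly_gen_smul, fieldMode_C_mul]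

theorem toPoly_nilp_pow (j : ℕ) (w : FockTrunc a lam k) :
    toPoly a _ ((nilp a lam k ^ j) w) = C (tau k ^ j) * toPoly a _ w := by
  induction j generalizing w with
  | zero => rw [pow_zero, pow_zero, C_1, one_mul]; rfl
  | succ j ih =>
    rw [pow_succ, Module.End.mul_apply, ih]
    change C (tau k ^ j) * (C (tau k) * toPoly a _ w) = _
    rw [← mul_assoc, ← C_mul, pow_succ]

theorem mem_ker_nilp_pow {j : ℕ} {w : FockTrunc a lam k} :
    w ∈ LinearMap.ker (nilp a lam k ^ j) ↔ ∀ s, tau k ^ j * coeff s (toPoly a _ w) = 0 := by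
  rw [LinearMap.mem_ker, ← (toPoly a (shift k lam)).map_eq_zero_iff, toPoly_nilp_pow,
    MvPolynomial.ext_iff]
  simp only [coeff_C_mul, coeff_zero]

/-- The operator `α₀` acts as `λ + τ`, which generates the coefficient ring as a `ℂ`-algebra. -/
theorem C_mul_mem {S : Submodule (M a).ModeAlgebra (FockTrunc a lam k)} (r : Trunc k) :
    ∀ {w : FockTrunc a lam k}, w ∈ S → (toPoly a _).symm (C r * toPoly a _ w) ∈ S := by
  induction r using trunc_induction k lam with
  | hc c =>
    intro w hw
    have h1 : (toPoly a (shift k lam)).symm (C (algebraMap ℂ _ c) * toPoly a _ w) =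
        algebraMap ℂ (M a).ModeAlgebra c • w := by
      rw [algebraMap_smul]
      apply (toPoly a _).injective
      rw [LinearEquiv.apply_symm_apply, map_smul, Algebra.smul_def]
      rfl
    rw [h1]
    exact S.smul_mem _ hw
  | hs =>
    intro w hw
    rw [← toPoly_alpha_zero, LinearEquiv.symm_apply_apply]
    exact S.smul_mem _ hw
  | ha x y hx hy =>
    intro w hw
    rw [C_add, add_mul, map_add]
    exact S.add_mem (hx hw) (hy hw)
  | hm x y hx hy =>
    intro w hw
    have := hx (hy hw)
    rwa [LinearEquiv.apply_symm_apply, ← mul_assoc, ← C_mul] at this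

/-- Induction on a bound for the weights. An annihilation operator lowers the weights and, up to a
nonzero scalar, turns a nonconstant coefficient into a coefficient of smaller weight; the constant
one is what remains after subtracting all other terms. -/
theorem coeff_mem {S : Submodule (M a).ModeAlgebra (FockTrunc a lam k)} (n : ℕ) :
    ∀ w ∈ S, (∀ s, coeff s (toPoly a _ w) ≠ 0 → wt s < n) →
      ∀ s, vacuumVector a _ (coeff s (toPoly a _ w)) ∈ S := by
  induction n with
  | zero =>
    intro w hw h s
    have h1 : coeff s (toPoly a _ w) = 0 := by
      by_contra hs
      exact absurd (h s hs) (Nat.not_lt_zero _)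
    rw [h1, map_zero]
    exact S.zero_mem
  | succ n ih =>
    intro w hw h
    have key : ∀ s, s ≠ 0 → vacuumVector a _ (coeff s (toPoly a _ w)) ∈ S := by
      intro s hs
      obtain ⟨i, hi⟩ := Finsupp.ne_iff.1 hs
      obtain ⟨s', rfl⟩ : ∃ s', s = Finsupp.single i 1 + s' :=
        ⟨s - Finsupp.single i 1, (add_tsub_cancel_of_le
          (by simpa [Nat.one_le_iff_ne_zero] using hi)).symm⟩
      have hc : coeff s' (toPoly a _ (alpha a ((i : ℤ) + 1) • w)) =
          (((i : ℂ) + 1) * ((s' i : ℂ) + 1)) • coeff (Finsupp.single i 1 + s') (toPoly a _ w) := by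
        rw [toPoly_alpha_pos, coeff_smul, coeff_pderiv, add_comm s', ← smul_smul]
        congr 1
        rw [Algebra.smul_def, mul_comm]
        simp
      have h1 := ih _ (S.smul_mem (alpha a ((i : ℤ) + 1)) hw) (fun s'' hs'' => ?_) s'
      · rw [hc, map_smul] at h1
        have h2 : ((i : ℂ) + 1) * ((s' i : ℂ) + 1) ≠ 0 :=
          mul_ne_zero (Nat.cast_add_one_ne_zero _) (Nat.cast_add_one_ne_zero _)
        have h3 := S.smul_mem (algebraMap ℂ (M a).ModeAlgebra (((i : ℂ) + 1) * ((s' i : ℂ) + 1))⁻¹) h1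
        rwa [algebraMap_smul, smul_smul, inv_mul_cancel₀ h2, one_smul] at h3
      · have h4 : coeff (s'' + Finsupp.single i 1) (toPoly a _ w) ≠ 0 := by
          intro h0
          apply hs''
          rw [toPoly_alpha_pos, coeff_smul, coeff_pderiv, h0, zero_mul, smul_zero]
        have := h _ h4
        rw [map_add, wt_single] at this
        omega
    choose x hx hmon using exists_monomial (R := Trunc k) a (shift k lam)
    intro s
    rcases eq_or_ne s 0 with rfl | hs
    · classical
      have h1 : w - ∑ s ∈ (toPoly a _ w).support.erase 0,
          x s • vacuumVector a _ (coeff s (toPoly a _ w)) =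
          vacuumVector a _ (coeff 0 (toPoly a _ w)) := by
        rw [sub_eq_iff_eq_add]
        apply (toPoly a _).injective
        rw [map_add, map_sum]
        simp only [hmon]
        rw [toPoly_vacuumVector]
        conv_lhs => rw [← (toPoly a _ w).support_sum_monomial_coeff]
        by_cases h0 : 0 ∈ (toPoly a _ w).support
        · rw [← Finset.add_sum_erase _ _ h0]
          rfl
        · rw [Finset.erase_eq_of_notMem h0, notMem_support_iff.1 h0, C_0, zero_add]
      rw [← h1]
      exact S.sub_mem hw (S.sum_mem fun s hs => S.smul_mem _ (key s (Finset.ne_of_mem_erase hs)))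
    · exact key s hs

/-- A submodule is determined by its vacuum vectors, which form an ideal of `ℂ[τ]/(τ ^ k)`, and the
ideals are the annihilators of powers of `τ`. -/
theorem isUniserialFor_fockTrunc (hk : 0 < k) : IsUniserialFor k (nilp a lam k) := by
  refine ⟨hk, fun h => ?_, fun j hj => ?_, fun S => ?_⟩
  · have h1 := toPoly_nilp_pow a lam k (k - 1) ((toPoly a _).symm 1)
    rw [h, LinearMap.zero_apply, LinearEquiv.apply_symm_apply, map_zero, mul_one] at h1
    have := (tau_pow_eq_zero_iff k).1 (C_eq_zero.1 h1.symm)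
    omega
  · ext w
    rw [mem_ker_nilp_pow, LinearMap.mem_range]
    constructor
    · intro h
      choose r hr using fun s => (tau_pow_mul_eq_zero_iff k hj _).1 (h s)
      refine ⟨(toPoly a _).symm (∑ s ∈ (toPoly a _ w).support, monomial s (r s)), ?_⟩
      apply (toPoly a _).injective
      rw [toPoly_nilp_pow, LinearEquiv.apply_symm_apply, Finset.mul_sum]
      simp only [C_mul_monomial, hr]
      exact (toPoly a _ w).support_sum_monomial_coeff
    · rintro ⟨w, rfl⟩ s
      rw [toPoly_nilp_pow, coeff_C_mul, tau_pow_mul_eq_zero_iff k hj]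
      exact ⟨_, rfl⟩
  · let I : Ideal (Trunc k) :=
      { carrier := {r | vacuumVector a (shift k lam) r ∈ S}
        zero_mem' := by
          rw [Set.mem_ofPred_eq, map_zero]
          exact S.zero_mem
        add_mem' := fun {r r'} h h' => by
          rw [Set.mem_ofPred_eq, map_add]
          exact S.add_mem h h'
        smul_mem' := fun r r' h => by
          have := C_mul_mem a lam k r h
          rw [toPoly_vacuumVector, ← C_mul] at this
          exact this }
    obtain ⟨j, hj, h⟩ := exists_ideal_eq k I
    refine ⟨j, hj, ?_⟩
    ext w
    rw [mem_ker_nilp_pow]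
    simp only [← h]
    constructor
    · intro hw s
      exact coeff_mem a lam k ((toPoly a _ w).support.sup wt + 1) w hw (fun s hs =>
        Nat.lt_succ_of_le (Finset.le_sup (f := wt) (mem_support_iff.2 hs))) s
    · intro hw
      choose x hx hmon using exists_monomial (R := Trunc k) a (shift k lam)
      have h1 : w = ∑ s ∈ (toPoly a _ w).support,
          x s • vacuumVector a _ (coeff s (toPoly a _ w)) := by
        apply (toPoly a _).injective
        rw [map_sum]
        simp only [hmon]
        exact (toPoly a _ w).support_sum_monomial_coeff.symm
      rw [h1]
      exact S.sum_mem fun s _ => S.smul_mem _ (hw s)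

end FockTrunc

end Heisenberg

/-! ### Transport of gradings and generalized modules along isomorphisms -/

theorem isInternal_comap {ι : Type*} [DecidableEq ι] {W W' : Type*} [AddCommGroup W] [Module ℂ W]
    [AddCommGroup W'] [Module ℂ W'] (e : W ≃ₗ[ℂ] W') {G : ι → Submodule ℂ W'}
    (h : DirectSum.IsInternal G) : DirectSum.IsInternal fun i => (G i).comap e.toLinearMap := by
  rw [DirectSum.isInternal_submodule_iff_iSupIndep_and_iSup_eq_top] at h ⊢
  have h1 : (fun i => (G i).comap e.toLinearMap) = (Submodule.orderIsoMapComap e).symm ∘ G := rfl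
  refine ⟨h1 ▸ h.1.map_orderIso _, ?_⟩
  rw [h1]
  change ⨆ i, (Submodule.orderIsoMapComap e).symm (G i) = ⊤
  rw [← OrderIso.map_iSup, h.2, OrderIso.map_top]

namespace VertexData

variable {V : Type} [AddCommGroup V] [Module ℂ V] {D : VertexData V}
  {W W' : Type*} [AddCommGroup W] [Module ℂ W] [Module D.ModeAlgebra W]
  [IsScalarTower ℂ D.ModeAlgebra W] [AddCommGroup W'] [Module ℂ W'] [Module D.ModeAlgebra W']
  [IsScalarTower ℂ D.ModeAlgebra W']

theorem IsGrading.comap {G : ℤ → Submodule ℂ W'} (h : D.IsGrading W' G)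
    (e : W ≃ₗ[D.ModeAlgebra] W') :
    D.IsGrading W fun ℓ => (G ℓ).comap (e.restrictScalars ℂ).toLinearMap where
  internal := isInternal_comap (e.restrictScalars ℂ) h.internal
  nonneg ℓ hℓ := by
    rw [h.nonneg ℓ hℓ]
    exact LinearEquiv.ker (e.restrictScalars ℂ)
  zero_ne_bot := by
    intro h0
    refine h.zero_ne_bot ((Submodule.eq_bot_iff _).2 fun w hw => ?_)
    have h1 : e.symm w ∈ (G 0).comap (e.restrictScalars ℂ).toLinearMap := by
      change e (e.symm w) ∈ G 0
      rwa [e.apply_symm_apply]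
    rw [h0, Submodule.mem_bot, e.symm.map_eq_zero_iff] at h1
    exact h1
  map n v hv m ℓ w hw := by
    change e _ ∈ G _
    rw [map_smul]
    exact h.map n v hv m ℓ _ hw

theorem mem_weightSpace {μ : ℂ} {w : W} : w ∈ D.weightSpace W μ ↔
    ∃ n : ℕ, ((D.gen D.omega 1 - algebraMap ℂ _ μ) ^ n) • w = 0 := by
  rw [weightSpace, Module.End.mem_maxGenEigenspace]
  refine exists_congr fun n => ?_
  have h : (D.op W (D.gen D.omega 1) - μ • 1) ^ n =
      D.op W ((D.gen D.omega 1 - algebraMap ℂ _ μ) ^ n) := by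
    rw [op, op, map_pow, map_sub, AlgHom.commutes, Algebra.algebraMap_eq_smul_one]
  rw [h]
  rfl

theorem weightSpace_eq_comap (e : W ≃ₗ[D.ModeAlgebra] W') (μ : ℂ) :
    D.weightSpace W μ = (D.weightSpace W' μ).comap (e.restrictScalars ℂ).toLinearMap := by
  ext w
  rw [Submodule.mem_comap, mem_weightSpace, mem_weightSpace]
  refine exists_congr fun n => ?_
  change _ ↔ _ • e w = 0
  rw [← map_smul, e.map_eq_zero_iff]

theorem IsGeneralizedModule.ofEquiv (h : D.IsGeneralizedModule W') (e : W ≃ₗ[D.ModeAlgebra] W') :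
    D.IsGeneralizedModule W where
  weak := h.weak.ofEquiv e.symm
  gradable := by
    obtain ⟨G, hG⟩ := h.gradable
    exact ⟨_, hG.comap e⟩
  decomposition := by
    have := isInternal_comap (e.restrictScalars ℂ) h.decomposition
    simp only [← weightSpace_eq_comap] at this
    exact this
  bounded μ := by
    obtain ⟨N, hN⟩ := h.bounded μ
    refine ⟨N, fun n hn => ?_⟩
    rw [weightSpace_eq_comap e, hN n hn]
    exact LinearEquiv.ker (e.restrictScalars ℂ)
  finite μ := by
    rw [weightSpace_eq_comap e]
    have := h.finite μ
    exact Module.Finite.equiv ((e.restrictScalars ℂ).ofSubmodule' (D.weightSpace W' μ)).symm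

end VertexData

namespace Heisenberg
open MvPolynomial Filter

/-! ### `L₀`-weight spaces and bases of `M(1) ⊗ Ω(λ, k)` -/

section GeneralizedModule

variable (a lam : ℂ) (k : ℕ)

/-- The generalized eigenvalue of `L_0` on the vectors of degree zero. -/
def lowestWeight : ℂ := (1 / 2) * lam ^ 2 - a * lam

/-- On vacuum vectors `L₀` differs from its generalized eigenvalue by `τ (τ / 2 + λ - a)`, a
multiple of `τ`. -/
theorem isNilpotent_lowestWeight :
    ((1 / 2 : ℂ) • shift k lam ^ 2 - a • shift k lam - algebraMap ℂ _ (lowestWeight a lam)) ^ k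
      = 0 := by
  have h : (1 / 2 : ℂ) • shift k lam ^ 2 - a • shift k lam - algebraMap ℂ _ (lowestWeight a lam) =
      tau k * ((1 / 2 : ℂ) • tau k + algebraMap ℂ _ (lam - a)) := by
    have h2 : (algebraMap ℂ (Trunc k) (1 / 2)) * 2 = 1 := by
      rw [← map_ofNat (algebraMap ℂ (Trunc k)) 2, ← map_mul, div_mul_cancel₀ _ two_ne_zero, map_one]
    rw [shift, lowestWeight, Algebra.smul_def, Algebra.smul_def, Algebra.smul_def, map_sub, map_sub,
      map_mul, map_mul, map_pow]
    linear_combination (tau k * algebraMap ℂ (Trunc k) lam) * h2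
  rw [h, mul_pow, (tau_pow_eq_zero_iff k).2 le_rfl, zero_mul]

theorem coeff_L0_pow (μ : ℂ) (n : ℕ) (w : FockTrunc a lam k) (s : ℕ →₀ ℕ) :
    coeff s (toPoly a _ ((((M a).gen (M a).omega 1 - algebraMap ℂ _ μ) ^ n) • w)) =
      (algebraMap ℂ _ ((wt s : ℂ) - μ) + ((1 / 2 : ℂ) • shift k lam ^ 2 - a • shift k lam)) ^ n *
        coeff s (toPoly a _ w) := by
  induction n with
  | zero => rw [pow_zero, pow_zero, one_smul, one_mul]
  | succ n ih =>
    rw [pow_succ', mul_smul, sub_smul, map_sub, toPoly_gen_smul, algebraMap_smul,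
      LinearEquiv.map_smul, coeff_sub]
    change coeff s (fieldMode _ (conformalVector a) 1 _) - _ = _
    rw [coeff_conformal, coeff_smul, ih, pow_succ', map_sub, map_natCast, Algebra.smul_def μ,
      nsmul_eq_mul]
    ring

/-- On the coefficient of a monomial, `L₀ - μ` is multiplication by a scalar plus a nilpotent
element. This is nilpotent if the scalar is zero and a unit otherwise. -/
theorem mem_weightSpace_iff {μ : ℂ} {w : FockTrunc a lam k} :
    w ∈ (M a).weightSpace (FockTrunc a lam k) μ ↔
      ∀ s, coeff s (toPoly a _ w) ≠ 0 → lowestWeight a lam + wt s = μ := by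
  have hx : ∀ s, algebraMap ℂ (Trunc k) ((wt s : ℂ) - μ) +
      ((1 / 2 : ℂ) • shift k lam ^ 2 - a • shift k lam) =
      algebraMap ℂ _ (lowestWeight a lam + wt s - μ) + ((1 / 2 : ℂ) • shift k lam ^ 2 -
        a • shift k lam - algebraMap ℂ _ (lowestWeight a lam)) := fun s => by
    rw [map_sub, map_sub, map_add]
    ring
  have hn := isNilpotent_lowestWeight a lam k
  rw [VertexData.mem_weightSpace]
  constructor
  · rintro ⟨n, h⟩ s hs
    by_contra hne
    have h1 := coeff_L0_pow a lam k μ n w s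
    rw [h, map_zero, coeff_zero, hx] at h1
    have hu : IsUnit (algebraMap ℂ (Trunc k) (lowestWeight a lam + wt s - μ) +
        ((1 / 2 : ℂ) • shift k lam ^ 2 - a • shift k lam -
          algebraMap ℂ _ (lowestWeight a lam))) :=
      IsNilpotent.isUnit_add_left_of_commute ⟨k, hn⟩
        ((isUnit_iff_ne_zero.2 (sub_ne_zero.2 hne)).map (algebraMap ℂ (Trunc k))) (Commute.all _ _)
    exact hs (((hu.pow n).mul_right_eq_zero).1 h1.symm)
  · intro h
    refine ⟨k, (toPoly a _).injective ?_⟩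
    ext s
    rw [coeff_L0_pow, map_zero, coeff_zero]
    by_cases hs : coeff s (toPoly a _ w) = 0
    · rw [hs, mul_zero]
    · rw [hx, h s hs, sub_self, map_zero, zero_add, hn, zero_mul]

/-- The grading of the Fock module by the degree of polynomials. -/
def fockDegree (ℓ : ℤ) : Submodule ℂ (FockTrunc a lam k) :=
  (degreePart (Trunc k) ℓ).comap (toPoly a (shift k lam)).toLinearMap

theorem mem_fockDegree {ℓ : ℤ} {w : FockTrunc a lam k} :
    w ∈ fockDegree a lam k ℓ ↔ toPoly a _ w ∈ degreePart (Trunc k) ℓ := Iff.rfl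

theorem weightSpace_eq (ℓ : ℤ) :
    (M a).weightSpace (FockTrunc a lam k) (lowestWeight a lam + ℓ) = fockDegree a lam k ℓ := by
  ext w
  rw [mem_weightSpace_iff, mem_fockDegree, mem_degreePart]
  refine forall_congr' fun s => imp_congr_right fun _ => ?_
  rw [add_right_inj]
  norm_cast

theorem weightSpace_eq_bot {μ : ℂ} (h : ∀ n : ℕ, lowestWeight a lam + n ≠ μ) :
    (M a).weightSpace (FockTrunc a lam k) μ = ⊥ := by
  rw [eq_bot_iff]
  intro w hw
  rw [mem_weightSpace_iff] at hw
  rw [Submodule.mem_bot]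
  apply (toPoly a _).injective
  ext s
  by_contra hs
  exact h _ (hw s hs)

theorem isInternal_weightSpace :
    DirectSum.IsInternal ((M a).weightSpace (FockTrunc a lam k)) := by
  rw [DirectSum.isInternal_submodule_iff_iSupIndep_and_iSup_eq_top]
  refine ⟨Module.End.independent_maxGenEigenspace _, ?_⟩
  rw [eq_top_iff]
  rintro w -
  have h : w = ∑ s ∈ (toPoly a _ w).support,
      (toPoly a _).symm (monomial s (coeff s (toPoly a _ w))) := by
    apply (toPoly a _).injective
    rw [map_sum]
    simp only [LinearEquiv.apply_symm_apply]
    exact (toPoly a _ w).support_sum_monomial_coeff.symm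
  rw [h]
  refine Submodule.sum_mem _ fun s _ => Submodule.mem_iSup_of_mem (lowestWeight a lam + (wt s : ℤ)) ?_
  rw [weightSpace_eq]
  exact mem_degreePart_monomial s _

theorem isInternal_fockDegree : DirectSum.IsInternal (fockDegree a lam k) := by
  have h := isInternal_weightSpace a lam k
  rw [DirectSum.isInternal_submodule_iff_iSupIndep_and_iSup_eq_top] at h ⊢
  have hf : fockDegree a lam k = fun ℓ : ℤ => (M a).weightSpace (FockTrunc a lam k)
    (lowestWeight a lam + ℓ) := funext fun ℓ => (weightSpace_eq a lam k ℓ).symm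
  constructor
  · rw [hf]
    exact h.1.comp (f := fun ℓ : ℤ => lowestWeight a lam + ℓ) fun x y hxy => by simpa using hxy
  · rw [eq_top_iff, ← h.2]
    refine iSup_le fun μ => ?_
    by_cases hμ : ∃ n : ℕ, lowestWeight a lam + n = μ
    · obtain ⟨n, rfl⟩ := hμ
      have := weightSpace_eq a lam k n
      rw [Int.cast_natCast] at this
      rw [this]
      exact le_iSup (fockDegree a lam k) (n : ℤ)
    · push Not at hμ
      rw [weightSpace_eq_bot a lam k hμ]
      exact bot_le

theorem isGrading_fockDegree (hk : 0 < k) : (M a).IsGrading (FockTrunc a lam k)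
    (fockDegree a lam k) where
  internal := isInternal_fockDegree a lam k
  nonneg ℓ hℓ := by
    rw [eq_bot_iff]
    intro w hw
    rw [Submodule.mem_bot]
    exact (toPoly a _).injective (eq_zero_of_mem_degreePart hℓ hw)
  zero_ne_bot h := by
    have h1 : vacuumVector a (shift k lam) 1 ∈ fockDegree a lam k 0 := C_mem_degreePart 1
    rw [h, Submodule.mem_bot] at h1
    have h2 : (1 : Trunc k) = 0 := C_injective ℕ _ (by
      rw [← toPoly_vacuumVector a (shift k lam), h1, map_zero, C_0])
    have h3 := (tau_pow_eq_zero_iff k (j := 0)).1 (by rw [pow_zero, h2])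
    omega
  map n v hv m ℓ w hw := by
    have h := smul_mem_degreePart a (shift k lam) (m := m) hv hw
    rwa [show n - m - 1 + ℓ = ℓ + n - m - 1 by ring] at h

/-- An enumeration of the monomials of degree `ℓ`. -/
def monomialIndex (ℓ : ℕ) : Fin (numPartitions ℓ) ≃ {s : ℕ →₀ ℕ // wt s = ℓ} :=
  (Fintype.equivFin (Nat.Partition ℓ)).symm.trans (partitionEquiv ℓ).symm

/-- The coordinates on the degree `ℓ` space of `M(1) ⊗ Ω(λ, k)`. -/
def degreeCoord (ℓ : ℕ) : fockDegree a lam k ℓ →ₗ[ℂ] (Fin k × Fin (numPartitions ℓ) → ℂ) where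
  -- Powers of `τ` are numbered downwards, so that the first block is the multiples of `τ ^ (k -
  -- 1)`, the socle, and the first `j` blocks are killed by `τ ^ j`.
  toFun w p := tauCoeff k (k - 1 - p.1) (coeff (monomialIndex ℓ p.2).1 (toPoly a _ w.1))
  map_add' w w' := funext fun p => by
    rw [Submodule.coe_add, map_add, coeff_add, map_add]
    rfl
  map_smul' c w := funext fun p => by
    rw [Submodule.coe_smul, map_smul, coeff_smul, map_smul]
    rfl

/-- The vectors `τ ^ (k - 1 - i) p`, with `p` a monomial. -/
def degreeVector (ℓ : ℕ) (p : Fin k × Fin (numPartitions ℓ)) : fockDegree a lam k ℓ :=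
  ⟨(toPoly a _).symm (monomial (monomialIndex ℓ p.2).1 (tau k ^ (k - 1 - p.1 : ℕ))), by
    rw [mem_fockDegree, LinearEquiv.apply_symm_apply]
    have h := mem_degreePart_monomial (monomialIndex ℓ p.2).1 (tau k ^ (k - 1 - p.1 : ℕ))
    rwa [(monomialIndex ℓ p.2).2] at h⟩

theorem toPoly_degreeVector (ℓ : ℕ) (p : Fin k × Fin (numPartitions ℓ)) :
    toPoly a _ (degreeVector a lam k ℓ p).1 =
      monomial (monomialIndex ℓ p.2).1 (tau k ^ (k - 1 - p.1 : ℕ)) := rfl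

theorem degreeCoord_apply (ℓ : ℕ) (w : fockDegree a lam k ℓ) (p : Fin k × Fin (numPartitions ℓ)) :
    degreeCoord a lam k ℓ w p =
      tauCoeff k (k - 1 - p.1) (coeff (monomialIndex ℓ p.2).1 (toPoly a _ w.1)) := rfl

theorem degreeCoord_degreeVector (ℓ : ℕ) (p : Fin k × Fin (numPartitions ℓ)) :
    degreeCoord a lam k ℓ (degreeVector a lam k ℓ p) = Pi.single p 1 := by
  classical
  funext q
  rw [degreeCoord_apply, toPoly_degreeVector, coeff_monomial]
  have hp := p.1.2
  have hq := q.1.2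
  by_cases h2 : p.2 = q.2
  · rw [if_pos (by rw [h2]), tauCoeff_pow]
    by_cases h1 : p.1 = q.1
    · rw [Prod.ext h1 h2, Pi.single_eq_same, if_pos (by omega)]
    · have h1' : (p.1 : ℕ) ≠ q.1 := fun h => h1 (Fin.ext h)
      rw [if_neg (by omega), Pi.single_eq_of_ne (fun h => h1 (by rw [h]))]
  · rw [if_neg (fun h => h2 ((monomialIndex ℓ).injective (Subtype.ext h))), map_zero,
      Pi.single_eq_of_ne (fun h => h2 (by rw [h]))]

theorem degreeCoord_bijective (ℓ : ℕ) : Function.Bijective (degreeCoord a lam k ℓ) := by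
  constructor
  · rw [injective_iff_map_eq_zero]
    intro w hw
    apply Subtype.ext
    apply (toPoly a _).injective
    ext s
    rw [Submodule.coe_zero, map_zero, coeff_zero]
    by_contra hs
    obtain ⟨i, hi⟩ := (monomialIndex ℓ).surjective ⟨s, by exact_mod_cast w.2 s hs⟩
    apply hs
    have h := (tau_pow_mul_eq_zero_iff_coeff k (j := 0) (coeff s (toPoly a _ w.1))).2 fun m hm => by
      have h1 := congr_fun hw (⟨k - 1 - m, by omega⟩, i)
      rw [degreeCoord_apply, hi] at h1
      dsimp only at h1
      rwa [show k - 1 - (k - 1 - m) = m by omega] at h1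
    rwa [pow_zero, one_mul] at h
  · intro f
    refine ⟨∑ p, f p • degreeVector a lam k ℓ p, ?_⟩
    rw [map_sum]
    simp only [map_smul, degreeCoord_degreeVector]
    funext q
    simp [Finset.sum_apply, Pi.single_apply]

/-- The basis of the degree `ℓ` space of `M(1) ⊗ Ω(λ, k)` that consists of the vectors
`τ ^ (k - 1 - i) p`, with `p` a monomial. -/
def degreeBasis (ℓ : ℕ) :
    Module.Basis (Fin k × Fin (numPartitions ℓ)) ℂ (fockDegree a lam k ℓ) :=
  Module.Basis.ofEquivFun (LinearEquiv.ofBijective _ (degreeCoord_bijective a lam k ℓ))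

theorem degreeBasis_repr (ℓ : ℕ) (w : fockDegree a lam k ℓ) (p : Fin k × Fin (numPartitions ℓ)) :
    (degreeBasis a lam k ℓ).repr w p = degreeCoord a lam k ℓ w p := rfl

theorem degreeBasis_apply (ℓ : ℕ) (p : Fin k × Fin (numPartitions ℓ)) :
    degreeBasis a lam k ℓ p = degreeVector a lam k ℓ p := by
  apply (degreeCoord_bijective a lam k ℓ).1
  rw [degreeCoord_degreeVector]
  funext q
  rw [← degreeBasis_repr, Module.Basis.repr_self, Finsupp.single_eq_pi_single]

theorem isGeneralizedModule_fockTrunc (hk : 0 < k) :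
    (M a).IsGeneralizedModule (FockTrunc a lam k) where
  weak := fockModule_isWeakModule a _
  gradable := ⟨_, isGrading_fockDegree a lam k hk⟩
  decomposition := isInternal_weightSpace a lam k
  bounded μ := by
    by_cases hμ : ∃ m : ℤ, μ = lowestWeight a lam + m
    · obtain ⟨m, rfl⟩ := hμ
      refine ⟨-m, fun n hn => weightSpace_eq_bot a lam k fun i hi => ?_⟩
      rw [add_assoc, add_right_inj] at hi
      have : (i : ℤ) = m + n := by exact_mod_cast hi
      omega
    · refine ⟨0, fun n _ => weightSpace_eq_bot a lam k fun i hi => hμ ⟨i - n, ?_⟩⟩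
      push_cast
      linear_combination -hi
  finite μ := by
    by_cases hμ : ∃ n : ℕ, lowestWeight a lam + n = μ
    · obtain ⟨n, rfl⟩ := hμ
      have := weightSpace_eq a lam k n
      rw [Int.cast_natCast] at this
      rw [this]
      exact Module.Finite.of_basis (degreeBasis a lam k n)
    · push Not at hμ
      rw [weightSpace_eq_bot a lam k hμ]
      infer_instance

end GeneralizedModule

/-! ### Chains, bases and zero modes on modules isomorphic to `M(1) ⊗ Ω(λ, k)` -/

section Transport

variable {a lam : ℂ} {k : ℕ} {W : Type*} [AddCommGroup W] [Module ℂ W]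
  [Module (M a).ModeAlgebra W] [IsScalarTower ℂ (M a).ModeAlgebra W]
  (Ψ : W ≃ₗ[(M a).ModeAlgebra] FockTrunc a lam k)

/-- The nilpotent endomorphism of a module isomorphic to `M(1) ⊗ Ω(λ, k)`. -/
def nilpOf : Module.End (M a).ModeAlgebra W :=
  Ψ.symm.toLinearMap ∘ₗ nilp a lam k ∘ₗ Ψ.toLinearMap

theorem apply_nilpOf_pow (j : ℕ) (w : W) : Ψ ((nilpOf Ψ ^ j) w) = (nilp a lam k ^ j) (Ψ w) := by
  induction j generalizing w with
  | zero => rfl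
  | succ j ih =>
    rw [pow_succ, pow_succ, Module.End.mul_apply, Module.End.mul_apply, ih]
    congr 1
    exact Ψ.apply_symm_apply _

theorem isUniserialFor_nilpOf (hk : 0 < k) : IsUniserialFor k (nilpOf Ψ) :=
  (isUniserialFor_fockTrunc a lam k hk).of_addEquiv Ψ.toAddEquiv
    (fun x w => ⟨x, Ψ.map_smul x w⟩) fun _ => Ψ.apply_symm_apply _

theorem isStronglyInterlockedModule_of_equiv {lam : ℂ} {k : ℕ}
    (Ψ : W ≃ₗ[(M a).ModeAlgebra] FockTrunc a lam k) (hk : 0 < k) :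
    (M a).IsStronglyInterlockedModule W :=
  ⟨(isGeneralizedModule_fockTrunc a lam k hk).ofEquiv Ψ,
    (isUniserialFor_nilpOf Ψ hk).isStronglyInterlocked⟩

/-- The degree spaces of a module isomorphic to `M(1) ⊗ Ω(λ, k)`. -/
def degreeOf (ℓ : ℤ) : Submodule ℂ W :=
  (fockDegree a lam k ℓ).comap (Ψ.restrictScalars ℂ).toLinearMap

/-- The basis of the degree spaces of a module isomorphic to `M(1) ⊗ Ω(λ, k)`. -/
def basisOf (ℓ : ℕ) : Module.Basis (Fin k × Fin (numPartitions ℓ)) ℂ (degreeOf Ψ ℓ) :=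
  (degreeBasis a lam k ℓ).map ((Ψ.restrictScalars ℂ).ofSubmodule' (fockDegree a lam k ℓ)).symm

theorem apply_basisOf (ℓ : ℕ) (p : Fin k × Fin (numPartitions ℓ)) :
    toPoly a _ (Ψ (basisOf Ψ ℓ p)) =
      monomial (monomialIndex ℓ p.2).1 (tau k ^ (k - 1 - p.1 : ℕ)) := by
  have h : Ψ (basisOf Ψ ℓ p) = (degreeBasis a lam k ℓ p).1 := Ψ.apply_symm_apply _
  rw [h, degreeBasis_apply, toPoly_degreeVector]

theorem basisOf_repr (ℓ : ℕ) (w : degreeOf Ψ ℓ) (p : Fin k × Fin (numPartitions ℓ)) :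
    (basisOf Ψ ℓ).repr w p =
      tauCoeff k (k - 1 - p.1) (coeff (monomialIndex ℓ p.2).1 (toPoly a _ (Ψ w))) := rfl

theorem mem_chain {j : Fin (k + 1)} {w : W} : w ∈ IsUniserialFor.chain (nilpOf Ψ) k j ↔
    ∀ s, tau k ^ (j : ℕ) * coeff s (toPoly a _ (Ψ w)) = 0 := by
  rw [IsUniserialFor.chain, LinearMap.mem_ker, ← Ψ.map_eq_zero_iff, apply_nilpOf_pow,
    ← LinearMap.mem_ker, mem_ker_nilp_pow]

/-- The power `τ ^ j` kills `τ ^ (k - 1 - i)` exactly when `i < j`. -/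
theorem span_basisOf (ℓ : ℕ) (j : Fin (k + 1)) :
    Submodule.span ℂ {w : W | ∃ (i : Fin k) (s : Fin (numPartitions ℓ)), (i : ℕ) < (j : ℕ) ∧
      w = basisOf Ψ ℓ (i, s)} =
    (IsUniserialFor.chain (nilpOf Ψ) k j).restrictScalars ℂ ⊓ degreeOf Ψ ℓ := by
  apply le_antisymm
  · rw [Submodule.span_le]
    rintro _ ⟨i, s, hij, rfl⟩
    refine ⟨(mem_chain Ψ).2 fun s' => ?_, (basisOf Ψ ℓ (i, s)).2⟩
    classical
    rw [apply_basisOf, coeff_monomial]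
    split_ifs
    · dsimp only
      rw [← pow_add, tau_pow_eq_zero_iff]
      have := i.2
      omega
    · rw [mul_zero]
  · rintro w ⟨hw, hw'⟩
    have h1 := congr_arg Subtype.val ((basisOf Ψ ℓ).sum_repr ⟨w, hw'⟩)
    rw [Submodule.coe_sum] at h1
    change _ = w at h1
    rw [← h1]
    refine Submodule.sum_mem _ fun p _ => ?_
    rw [Submodule.coe_smul]
    by_cases hp : (p.1 : ℕ) < j
    · exact Submodule.smul_mem _ _ (Submodule.subset_span ⟨p.1, p.2, hp, rfl⟩)
    · have hj : j.1 ≤ k := by omega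
      have := p.1.2
      rw [basisOf_repr, (tau_pow_mul_eq_zero_iff_coeff k _).1 ((mem_chain Ψ).1 hw _) _ (by omega),
        zero_smul]
      exact Submodule.zero_mem _

theorem finrank_socle (hk : 0 < k) (ℓ : ℕ) :
    Module.finrank ℂ ↥((socle (M a).ModeAlgebra W).restrictScalars ℂ ⊓ degreeOf Ψ ℓ) =
      numPartitions ℓ := by
  have h := span_basisOf Ψ ℓ ⟨1, by omega⟩
  have h1 : socle (M a).ModeAlgebra W = IsUniserialFor.chain (nilpOf Ψ) k ⟨1, by omega⟩ :=
    (isUniserialFor_nilpOf Ψ hk).socle_eq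
  rw [h1, ← h]
  let f : Fin (numPartitions ℓ) → W := fun s => basisOf Ψ ℓ (⟨0, hk⟩, s)
  have hf : LinearIndependent ℂ f :=
    ((basisOf Ψ ℓ).linearIndependent.map' _ (degreeOf Ψ ℓ).ker_subtype).comp
      (fun s => ((⟨0, hk⟩ : Fin k), s)) fun s s' hs => (Prod.mk.inj hs).2
  have hr : {w : W | ∃ (i : Fin k) (s : Fin (numPartitions ℓ)), (i : ℕ) < 1 ∧
      w = basisOf Ψ ℓ (i, s)} = Set.range f := by
    ext w
    constructor
    · rintro ⟨i, s, hi, rfl⟩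
      have : i = ⟨0, hk⟩ := Fin.ext (by dsimp only; omega)
      exact ⟨s, by rw [this]⟩
    · rintro ⟨s, rfl⟩
      exact ⟨⟨0, hk⟩, s, zero_lt_one, rfl⟩
  dsimp only
  rw [hr, finrank_span_eq_card hf, Fintype.card_fin]

/-- The zero mode is linear over `ℂ[τ]/(τ ^ k)`, so it is given by a matrix `ρ` with entries in this
ring. Block `(i, j)` of its complex matrix consists of the coefficients of `τ ^ (j - i)` in `ρ`. -/
theorem exists_matrix (ℓ : ℕ) {n : ℤ} {v : Fock} (hv : (M a).HasWeight n v) :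
    ∃ T : Matrix (Fin k × Fin (numPartitions ℓ)) (Fin k × Fin (numPartitions ℓ)) ℂ,
      IsInterlockedMatrix T ∧ ∀ j, (M a).gen v (n - 1) • (basisOf Ψ ℓ j : W) =
        ∑ i, T i j • (basisOf Ψ ℓ i : W) := by
  let ρ : Fin (numPartitions ℓ) → Fin (numPartitions ℓ) → Trunc k := fun s s' =>
    coeff (monomialIndex ℓ s).1
      (fieldMode (shift k lam) v (n - 1) (monomial (monomialIndex ℓ s').1 1))
  let T : Matrix (Fin k × Fin (numPartitions ℓ)) (Fin k × Fin (numPartitions ℓ)) ℂ := fun i j =>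
    tauCoeff k (k - 1 - i.1) (tau k ^ (k - 1 - j.1 : ℕ) * ρ i.2 j.2)
  -- The blocks depend only on `j - i` and vanish below the diagonal. All three matrix properties
  -- follow from this; block `j` of the first row and block `k - 1 - j` of the last column both have
  -- difference `j`.
  have hT : ∀ i j, T i j = if (i.1 : ℕ) ≤ j.1 then tauCoeff k (j.1 - i.1) (ρ i.2 j.2) else 0 := by
    intro i j
    have hi := i.1.2
    have hj := j.1.2
    dsimp only [T]
    rw [tauCoeff_pow_mul]
    by_cases h : (i.1 : ℕ) ≤ j.1
    · rw [if_pos h, if_pos (by omega), show k - 1 - (i.1 : ℕ) - (k - 1 - j.1) = j.1 - i.1 by omega]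
    · rw [if_neg h, if_neg (by omega)]
  refine ⟨T, ⟨fun i j hij s t => ?_, fun i j s t => ?_, fun i l j hi hl s t => ?_⟩, fun j => ?_⟩
  · rw [hT, if_neg]
    exact not_le.2 hij
  · rw [hT, hT, if_pos le_rfl, if_pos le_rfl, Nat.sub_self, Nat.sub_self]
  · have hj := j.2
    rw [hT, hT, if_pos (by dsimp only; omega), if_pos (by dsimp only; omega)]
    dsimp only
    rw [Fin.val_rev, hi, show (l : ℕ) - (k - (j + 1)) = j - 0 by omega]
  · have hmem : (M a).gen v (n - 1) • (basisOf Ψ ℓ j : W) ∈ degreeOf Ψ ℓ := by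
      have h := smul_mem_degreePart a (shift k lam) (m := n - 1) hv (basisOf Ψ ℓ j).2
      rw [show n - (n - 1) - 1 + (ℓ : ℤ) = ℓ by ring] at h
      change Ψ _ ∈ fockDegree a lam k ℓ
      rw [map_smul]
      exact h
    have h1 := congr_arg Subtype.val ((basisOf Ψ ℓ).sum_repr ⟨_, hmem⟩)
    rw [Submodule.coe_sum] at h1
    refine h1.symm.trans (Finset.sum_congr rfl fun i _ => ?_)
    rw [Submodule.coe_smul, basisOf_repr]
    congr 1
    dsimp only
    rw [map_smul, toPoly_gen_smul, apply_basisOf, ← mul_one (tau k ^ _), ← C_mul_monomial,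
      fieldMode_C_mul, coeff_C_mul]

end Transport

end Heisenberg

/-! ### The `A_0(V)`-module `U(λ, k)` -/

namespace Heisenberg
open MvPolynomial Filter

variable (a lam : ℂ) (k : ℕ)

/-- The map `A_0(V) → ℂ[τ] / (τ ^ k)` that sends `x` to `τ + λ`. -/
def zhuToTrunc : (M a).ZhuAlgebra →ₐ[ℂ] Trunc k :=
  (Polynomial.aeval (shift k lam)).comp (zhuToPoly a)

theorem zhuToTrunc_zhuClass (v : Fock) :
    zhuToTrunc a lam k ((M a).zhuClass v) = zeroMode (shift k lam) v := by
  rw [zhuToTrunc, AlgHom.comp_apply, zhuToPoly_zhuClass, zeroMode, ← AlgHom.comp_apply, comp_aeval,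
    zeroMode]
  congr 2
  funext i
  simp

/-- Substituting `λ + τ` turns divisibility by `(x - λ) ^ k` into divisibility by `τ ^ k`. -/
theorem aeval_shift_eq_zero_iff (f : ℂ[X]) : Polynomial.aeval (shift k lam) f = 0 ↔
    (Polynomial.X - Polynomial.C lam) ^ k ∣ f := by
  rw [Polynomial.X_sub_C_pow_dvd_iff, ← AdjoinRoot.mk_eq_zero, ← AdjoinRoot.aeval_eq,
    Polynomial.aeval_comp]
  congr! 2
  simp [shift, tau]

theorem zhuToTrunc_surjective : Function.Surjective (zhuToTrunc a lam k) := by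
  intro r
  obtain ⟨f, rfl⟩ := AdjoinRoot.mk_surjective r
  obtain ⟨x, hx⟩ := (zhuToPoly_bijective a).2 (f.comp (Polynomial.X - Polynomial.C lam))
  refine ⟨x, ?_⟩
  rw [zhuToTrunc, AlgHom.comp_apply, hx, Polynomial.aeval_comp, ← AdjoinRoot.aeval_eq]
  congr 1
  simp [shift, tau]

theorem ker_zhuToTrunc : LinearMap.ker (zhuToTrunc a lam k).toLinearMap =
    (Ideal.span {(zhuX a - algebraMap ℂ (M a).ZhuAlgebra lam) ^ k}).restrictScalars ℂ := by
  ext x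
  rw [LinearMap.mem_ker, AlgHom.toLinearMap_apply, zhuToTrunc, AlgHom.comp_apply,
    aeval_shift_eq_zero_iff, Submodule.restrictScalars_mem, Ideal.mem_span_singleton']
  have h : zhuToPoly a ((zhuX a - algebraMap ℂ (M a).ZhuAlgebra lam) ^ k) =
      (Polynomial.X - Polynomial.C lam) ^ k := by
    rw [map_pow, map_sub, zhuToPoly_zhuX, AlgHom.commutes]
    rfl
  constructor
  · rintro ⟨f, hf⟩
    obtain ⟨y, hy⟩ := (zhuToPoly_bijective a).2 f
    refine ⟨y, (zhuToPoly_bijective a).1 ?_⟩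
    rw [map_mul, h, hy, hf, mul_comm]
  · rintro ⟨y, rfl⟩
    rw [map_mul, h]
    exact dvd_mul_left _ _

/-- `U(λ, k) ≅ ℂ[τ] / (τ ^ k)`. -/
def truncEquiv : U a lam k ≃ₗ[ℂ] Trunc k :=
  (Submodule.Quotient.restrictScalarsEquiv ℂ _).symm ≪≫ₗ
    Submodule.quotEquivOfEq _ _ (ker_zhuToTrunc a lam k).symm ≪≫ₗ
    (zhuToTrunc a lam k).toLinearMap.quotKerEquivOfSurjective (zhuToTrunc_surjective a lam k)

theorem truncEquiv_smul (x : (M a).ZhuAlgebra) (y : U a lam k) :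
    truncEquiv a lam k (x • y) = zhuToTrunc a lam k x * truncEquiv a lam k y := by
  obtain ⟨z, rfl⟩ := Submodule.Quotient.mk_surjective _ y
  exact map_mul (zhuToTrunc a lam k) x z

theorem truncEquiv_zhuClass_smul (v : Fock) (y : U a lam k) :
    truncEquiv a lam k ((M a).zhuClass v • y) =
      zeroMode (shift k lam) v * truncEquiv a lam k y := by
  rw [truncEquiv_smul, zhuToTrunc_zhuClass]

/-- The action of `x - λ` on `U(λ, k)`. -/
def nilpU : Module.End (M a).ZhuAlgebra (U a lam k) where
  toFun y := (truncEquiv a lam k).symm (tau k * truncEquiv a lam k y)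
  map_add' y z := by rw [map_add, mul_add, map_add]
  map_smul' x y := by
    rw [RingHom.id_apply, LinearEquiv.symm_apply_eq, truncEquiv_smul, truncEquiv_smul,
      LinearEquiv.apply_symm_apply, mul_left_comm]

theorem isUniserialFor_nilpU (hk : 0 < k) : IsUniserialFor k (nilpU a lam k) :=
  (isUniserialFor_trunc k hk).of_addEquiv (truncEquiv a lam k).toAddEquiv
    (fun r y => by
      obtain ⟨x, rfl⟩ := zhuToTrunc_surjective a lam k r
      exact ⟨x, truncEquiv_smul a lam k x y⟩)
    fun _ => (truncEquiv a lam k).apply_symm_apply _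

/-- `W(a, λ, k) ≅ M(1) ⊗ Ω(λ, k)`. -/
def fockEquiv : W a lam k ≃ₗ[(M a).ModeAlgebra] FockTrunc a lam k :=
  inducedEquiv a (shift k lam) (truncEquiv a lam k) (truncEquiv_zhuClass_smul a lam k)

theorem L0deg_eq : (M a).L0deg (U a lam k) = degreeOf (fockEquiv a lam k) := by
  funext ℓ
  ext w
  exact mem_L0deg_iff a _ _ (truncEquiv_zhuClass_smul a lam k)

end Heisenberg

/-! ### Heisenberg operators and the number operator on gradable weak modules -/

namespace Heisenberg
open MvPolynomial Filter

open scoped IsMulCommutative in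
/-- A family of commuting elements of an algebra can be substituted for the variables of a
polynomial. -/
theorem exists_algHom_of_commute {B ι : Type*} [Ring B] [Algebra ℂ B] (c : ι → B)
    (hc : ∀ i j, c i * c j = c j * c i) : ∃ f : MvPolynomial ι ℂ →ₐ[ℂ] B, ∀ i, f (X i) = c i := by
  have : IsMulCommutative (Algebra.adjoin ℂ (Set.range c)) := Algebra.isMulCommutative_adjoin ℂ (by
    rintro _ ⟨i, rfl⟩ _ ⟨j, rfl⟩
    exact hc i j)
  let c' : ι → Algebra.adjoin ℂ (Set.range c) := fun i =>
    ⟨c i, Algebra.subset_adjoin ⟨i, rfl⟩⟩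
  exact ⟨(Algebra.adjoin ℂ (Set.range c)).val.comp (aeval c'), fun i => by
    rw [AlgHom.comp_apply, aeval_X]
    rfl⟩

theorem mode_X_zero (a : ℂ) (i : ℕ) :
    (M a).mode (X 0) i (X 0) = if i = 1 then 1 else 0 := by
  rw [mode_eq]
  rcases i with _ | i
  · rw [Nat.cast_zero, fieldMode_X_zero_zero, C_0, zero_mul, if_neg zero_ne_one]
  · rw [Nat.cast_succ, fieldMode_X_zero_pos, pderiv_X]
    rcases i with _ | i
    · simp
    · rw [Pi.single_eq_of_ne (by omega), smul_zero, if_neg (by omega)]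

/-- In the bracket with `v(m)` the binomials `(0 choose i)` leave only the mode `i = 0`, and `α₀` is
zero on `V`. -/
theorem commute_alpha_zero (a : ℂ) (x : (M a).ModeAlgebra) :
    alpha a 0 * x = x * alpha a 0 := by
  induction x using (M a).modeAlgebra_induction with
  | hc c => exact (Algebra.commutes c _).symm
  | hg v m =>
    obtain ⟨N, hN⟩ := fieldMode_truncated (0 : ℂ) (X 0) v
    rw [alpha, (M a).gen_bracket (X 0) v 0 m N.toNat fun i hi => by
      rw [mode_eq]; exact hN i (by omega), add_eq_left]
    refine Finset.sum_eq_zero fun i _ => ?_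
    rcases i with _ | i
    · rw [mode_eq, Nat.cast_zero, fieldMode_X_zero_zero, C_0, zero_mul, VertexData.gen_zero,
        smul_zero]
    · rw [Ring.choose_zero_pos ℤ (by omega), zero_smul]
  | ha x y hx hy => rw [mul_add, hx, hy, add_mul]
  | hm x y hx hy => rw [← mul_assoc, hx, mul_assoc, hy, mul_assoc]

section WeakModule

variable {a : ℂ} {W : Type*} [AddCommGroup W] [Module ℂ W] [Module (M a).ModeAlgebra W]
  [IsScalarTower ℂ (M a).ModeAlgebra W]

theorem smul_smul_comm' (x : (M a).ModeAlgebra) (c : ℂ) (w : W) : x • c • w = c • x • w := by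
  rw [← algebraMap_smul (M a).ModeAlgebra c w, ← mul_smul, ← Algebra.commutes, mul_smul,
    algebraMap_smul]

theorem alpha_smul_alpha_smul (hW : (M a).IsWeakModule W) (m n : ℤ) (w : W) :
    alpha a m • alpha a n • w =
      alpha a n • alpha a m • w + if m + n = 0 then (m : ℂ) • w else 0 := by
  rw [← mul_smul, alpha, alpha, (M a).gen_bracket (X 0) (X 0) m n 2 fun i hi => by
    rw [mode_X_zero, if_neg (by omega)], Finset.sum_range_succ, Finset.sum_range_one,
    mode_X_zero, mode_X_zero, if_neg zero_ne_one, if_pos rfl, VertexData.gen_zero, smul_zero,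
    zero_add, add_smul, mul_smul, Nat.cast_one, Ring.choose_one_right, smul_assoc,
    show (M a).gen 1 = (M a).gen (M a).vac from rfl, hW.vacuum]
  congr 1
  simp only [show m + n - 1 = -1 ↔ m + n = 0 by omega]
  split_ifs
  · rw [Int.cast_smul_eq_zsmul]
  · rw [smul_zero]

/-- The creation operator `α_{-i-1}`. -/
def creationOp (a : ℂ) (W : Type*) [AddCommGroup W] [Module ℂ W] [Module (M a).ModeAlgebra W]
    [IsScalarTower ℂ (M a).ModeAlgebra W] (i : ℕ) : Module.End ℂ W :=
  (M a).op W (alpha a (-((i : ℤ) + 1)))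

/-- The annihilation operator `α_{i+1}`. -/
def annihilationOp (a : ℂ) (W : Type*) [AddCommGroup W] [Module ℂ W] [Module (M a).ModeAlgebra W]
    [IsScalarTower ℂ (M a).ModeAlgebra W] (i : ℕ) : Module.End ℂ W :=
  (M a).op W (alpha a ((i : ℤ) + 1))

theorem creationOp_comm (hW : (M a).IsWeakModule W) (i j : ℕ) (w : W) :
    creationOp a W i (creationOp a W j w) = creationOp a W j (creationOp a W i w) :=
  (alpha_smul_alpha_smul hW _ _ w).trans (by rw [if_neg (by omega), add_zero]; rfl)

theorem annihilationOp_comm (hW : (M a).IsWeakModule W) (i j : ℕ) (w : W) :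
    annihilationOp a W i (annihilationOp a W j w) =
      annihilationOp a W j (annihilationOp a W i w) :=
  (alpha_smul_alpha_smul hW _ _ w).trans (by rw [if_neg (by omega), add_zero]; rfl)

theorem annihilationOp_creationOp (hW : (M a).IsWeakModule W) (i j : ℕ) (w : W) :
    annihilationOp a W i (creationOp a W j w) =
      creationOp a W j (annihilationOp a W i w) + if i = j then ((i : ℂ) + 1) • w else 0 :=
  (alpha_smul_alpha_smul hW _ _ w).trans (by
    simp only [show (i : ℤ) + 1 + -(j + 1) = 0 ↔ i = j by omega]
    push_cast
    rfl)

/-- The operator `∑_{n > 0} α_{-n} α_n`. -/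
def numberOp (a : ℂ) (W : Type*) [AddCommGroup W] [Module ℂ W] [Module (M a).ModeAlgebra W]
    [IsScalarTower ℂ (M a).ModeAlgebra W] : Module.End ℂ W :=
  (M a).op W ((M a).gen (M a).omega 1) - (1 / 2 : ℂ) • (M a).op W (alpha a 0 * alpha a 0)
    + a • (M a).op W (alpha a 0)

theorem gen_X_one (m : ℤ) : (M a).gen (X 1) m = -m • alpha a (m - 1) := by
  rw [alpha, ← VertexData.gen_derivative, VertexData.L, mode_eq]
  congr 1
  refine Eq.trans ?_ (conformal_neg_one a (X 0)).symm
  rw [translation_X, Nat.cast_zero, zero_add, one_smul]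

/-- Expanding the mode of `α₋₁²` by the Jacobi identity gives every `α₋ₙ αₙ` with `n > 0` twice and
`α₀²` once, while the mode of `α₋₂𝟏` is `-α₀`. The correction terms in `numberOp` are chosen to
leave just the sum. -/
theorem numberOp_eventually (hW : (M a).IsWeakModule W) (w : W) : ∀ᶠ n in atTop,
    numberOp a W w = ∑ i ∈ Finset.range n, creationOp a W i (annihilationOp a W i w) := by
  obtain ⟨N, hN⟩ := hW.truncated (X 0) w
  filter_upwards [(tendsto_add_atTop_nat 1).eventually (gen_X_mul_smul hW 0 (X 0) 1 w),
    eventually_ge_atTop N.toNat] with n hn hNn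
  have h0 : ∀ i : ℕ, ((-1 : ℤ) ^ i * Ring.choose (-(((0 : ℕ) : ℤ) + 1)) i) = 1 := fun i => by
    rw [Nat.cast_zero, zero_add, Ring.choose_neg, show (1 : ℤ) + i - 1 = (i : ℕ) by ring,
      Ring.choose_natCast, Nat.choose_self, Nat.cast_one, Units.smul_def, Int.coe_negOnePow_natCast,
      smul_eq_mul, mul_one, ← mul_pow]
    norm_num
  have h1 : (M a).gen (X 0 * X 0) 1 • w =
      (2 : ℂ) • ∑ i ∈ Finset.range n, creationOp a W i (annihilationOp a W i w) +
        alpha a 0 • alpha a 0 • w := by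
    rw [hn]
    have h2 : alpha a ((n : ℤ) + 1) • w = 0 := hN _ (by omega)
    have h3 : ∀ i : ℕ, alpha a (-(((0 : ℕ) : ℤ) + 1) - i) • (M a).gen (X 0) (1 + i) • w =
        creationOp a W i (annihilationOp a W i w) := fun i => by
      rw [show -(((0 : ℕ) : ℤ) + 1) - i = -((i : ℤ) + 1) by push_cast; ring, add_comm 1]
      rfl
    have h4 : annihilationOp a W n w = 0 := h2
    simp only [h0, one_smul, h3]
    rw [Nat.cast_zero, zero_add, Int.negOnePow_neg, Int.negOnePow_one]
    simp only [Units.val_neg, Units.val_one, neg_smul, one_smul, sub_neg_eq_add, sub_self, zero_sub]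
    rw [Finset.sum_add_distrib, Finset.sum_range_succ, h4, map_zero, add_zero,
      Finset.sum_range_succ', two_smul, add_assoc]
    congr 1
  change (M a).gen (M a).omega 1 • w - (1 / 2 : ℂ) • ((alpha a 0 * alpha a 0) • w) +
    a • alpha a 0 • w = _
  rw [show (M a).omega = (1 / 2 : ℂ) • (X 0 * X 0) + a • X 1 by rw [← sq]; rfl,
    VertexData.gen_add, VertexData.gen_smul, VertexData.gen_smul, gen_X_one, add_smul, smul_assoc,
    h1, mul_smul, smul_assoc, smul_assoc, sub_self]
  generalize alpha a 0 • alpha a 0 • w = x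
  generalize ∑ i ∈ Finset.range n, creationOp a W i (annihilationOp a W i w) = y
  generalize alpha a 0 • w = z
  module

theorem numberOp_annihilationOp (hW : (M a).IsWeakModule W) (i : ℕ) (w : W) :
    numberOp a W (annihilationOp a W i w) =
      annihilationOp a W i (numberOp a W w) - ((i : ℂ) + 1) • annihilationOp a W i w := by
  obtain ⟨n, h1, h2, hn⟩ := ((numberOp_eventually hW w).and
    ((numberOp_eventually hW (annihilationOp a W i w)).and (eventually_gt_atTop i))).exists
  rw [h1, h2, map_sum, eq_sub_iff_add_eq]
  simp only [annihilationOp_creationOp hW, annihilationOp_comm hW i]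
  rw [Finset.sum_add_distrib, Finset.sum_ite_eq, if_pos (Finset.mem_range.2 hn)]

theorem numberOp_creationOp (hW : (M a).IsWeakModule W) (i : ℕ) (w : W) :
    numberOp a W (creationOp a W i w) =
      creationOp a W i (numberOp a W w) + ((i : ℂ) + 1) • creationOp a W i w := by
  obtain ⟨n, h1, h2, hn⟩ := ((numberOp_eventually hW w).and
    ((numberOp_eventually hW (creationOp a W i w)).and (eventually_gt_atTop i))).exists
  rw [h1, h2, map_sum]
  simp only [annihilationOp_creationOp hW, map_add, creationOp_comm hW i]
  rw [Finset.sum_add_distrib]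
  congr 1
  rw [Finset.sum_eq_single i (fun j _ hj => by rw [if_neg hj, map_zero])
    fun h => absurd (Finset.mem_range.2 hn) h, if_pos rfl, map_smul]

theorem creationOp_mem_eigenspace (hW : (M a).IsWeakModule W) (i : ℕ) {μ : ℂ} {w : W}
    (hw : w ∈ (numberOp a W).eigenspace μ) :
    creationOp a W i w ∈ (numberOp a W).eigenspace (μ + (i + 1)) := by
  rw [Module.End.mem_eigenspace_iff] at hw ⊢
  rw [numberOp_creationOp hW, hw, map_smul, add_smul μ]

theorem annihilationOp_mem_eigenspace (hW : (M a).IsWeakModule W) (i : ℕ) {μ : ℂ} {w : W}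
    (hw : w ∈ (numberOp a W).eigenspace μ) :
    annihilationOp a W i w ∈ (numberOp a W).eigenspace (μ - (i + 1)) := by
  rw [Module.End.mem_eigenspace_iff] at hw ⊢
  rw [numberOp_annihilationOp hW, hw, map_smul, sub_smul]

/-- The sum of the degree spaces of degree less than `d`. -/
def degreeLT (G : ℤ → Submodule ℂ W) (d : ℕ) : Submodule ℂ W := ⨆ ℓ : {ℓ : ℤ // ℓ < d}, G ℓ

variable {G : ℤ → Submodule ℂ W}

theorem exists_mem_degreeLT (hG : (M a).IsGrading W G) (w : W) : ∃ d, w ∈ degreeLT G d := by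
  have hm : Monotone (degreeLT G) := fun d e h =>
    iSup_le fun ℓ => le_iSup (fun ℓ : {ℓ : ℤ // ℓ < e} => G ℓ) ⟨ℓ.1, by have := ℓ.2; omega⟩
  have h : ⨆ d, degreeLT G d = ⊤ := by
    rw [eq_top_iff, ← hG.internal.submodule_iSup_eq_top]
    refine iSup_le fun ℓ => le_trans ?_ (le_iSup _ (ℓ + 1).toNat)
    exact le_iSup (fun ℓ' : {ℓ' : ℤ // ℓ' < (ℓ + 1).toNat} => G ℓ') ⟨ℓ, by omega⟩
  rw [← Submodule.mem_iSup_of_directed _ hm.directed_le, h]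
  exact Submodule.mem_top

theorem degreeLT_zero (hG : (M a).IsGrading W G) : degreeLT G 0 = ⊥ :=
  eq_bot_iff.2 (iSup_le fun ℓ => (hG.nonneg _ ℓ.2).le)

theorem annihilationOp_mem_degreeLT (hG : (M a).IsGrading W G) (i : ℕ) {d : ℕ} {w : W}
    (hw : w ∈ degreeLT G d) : annihilationOp a W i w ∈ degreeLT G (d - (i + 1)) := by
  have h : degreeLT G d ≤ (degreeLT G (d - (i + 1))).comap (annihilationOp a W i) := by
    refine iSup_le fun ℓ w hw => ?_
    have h1 : annihilationOp a W i w ∈ G (ℓ - (i + 1)) := by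
      have h2 := hG.map 1 (X 0) (hasWeight_X a 0) (i + 1) ℓ w hw
      rwa [show (ℓ : ℤ) + 1 - (i + 1) - 1 = ℓ - (i + 1) by ring] at h2
    have hl := ℓ.2
    by_cases hd : (ℓ : ℤ) < i + 1
    · rw [hG.nonneg _ (by omega), Submodule.mem_bot] at h1
      rw [Submodule.mem_comap, h1]
      exact Submodule.zero_mem _
    · exact Submodule.mem_iSup_of_mem (p := fun ℓ' : {ℓ' : ℤ // ℓ' < (d - (i + 1) : ℕ)} => G ℓ')
        ⟨ℓ - (i + 1), by omega⟩ h1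
  exact h hw

/-- Induction on degree. If `w` has bounded degree, each `αₙ w` has smaller degree and is a sum of
eigenvectors; so `N w = ∑ α₋ₙ αₙ w`, with `N` the number operator, is a sum of eigenvectors with
positive eigenvalues, where `N` is invertible. -/
theorem iSup_eigenspace_numberOp (hW : (M a).IsWeakModule W) (hG : (M a).IsGrading W G) :
    ⨆ n : ℕ, (numberOp a W).eigenspace n = ⊤ := by
  have h1 : ∀ i, ⨆ n : ℕ, (numberOp a W).eigenspace (n : ℂ) ≤
      (⨆ n : ℕ, (numberOp a W).eigenspace ((n : ℂ) + 1)).comap (creationOp a W i) := fun i => by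
    refine iSup_le fun n w hw => Submodule.mem_iSup_of_mem (n + i) ?_
    have := creationOp_mem_eigenspace hW i hw
    rwa [← add_assoc, ← Nat.cast_add] at this
  have h2 : ⨆ n : ℕ, (numberOp a W).eigenspace ((n : ℂ) + 1) ≤
      (⨆ n : ℕ, (numberOp a W).eigenspace ((n : ℂ) + 1)).map (numberOp a W) := by
    refine iSup_le fun n w hw => ⟨((n : ℂ) + 1)⁻¹ • w, Submodule.mem_iSup_of_mem n
      (Submodule.smul_mem _ _ hw), ?_⟩
    rw [map_smul, Module.End.mem_eigenspace_iff.1 hw, inv_smul_smul₀ (Nat.cast_add_one_ne_zero n)]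
  have h3 : ⨆ n : ℕ, (numberOp a W).eigenspace ((n : ℂ) + 1) ≤
      ⨆ n : ℕ, (numberOp a W).eigenspace (n : ℂ) :=
    iSup_le fun n => by
      rw [← Nat.cast_succ]
      exact le_iSup (fun n : ℕ => (numberOp a W).eigenspace (n : ℂ)) (n + 1)
  have h4 : ∀ d, degreeLT G d ≤ ⨆ n : ℕ, (numberOp a W).eigenspace (n : ℂ) := by
    intro d
    induction d using Nat.strong_induction_on with
    | h d ih =>
      intro w hw
      rcases d with _ | d
      · rw [degreeLT_zero hG, Submodule.mem_bot] at hw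
        rw [hw]
        exact Submodule.zero_mem _
      obtain ⟨n, hn⟩ := (numberOp_eventually hW w).exists
      have h5 : numberOp a W w ∈ ⨆ n : ℕ, (numberOp a W).eigenspace ((n : ℂ) + 1) := by
        rw [hn]
        exact Submodule.sum_mem _ fun i _ =>
          h1 i (ih _ (by omega) (annihilationOp_mem_degreeLT hG i hw))
      -- Now `y` has the same image as `w` under the number operator, so `w - y` lies in its kernel.
      obtain ⟨y, hy, hy'⟩ := h2 h5
      rw [← sub_add_cancel w y]
      refine Submodule.add_mem _ (Submodule.mem_iSup_of_mem 0 ?_) (h3 hy)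
      rw [Module.End.mem_eigenspace_iff, map_sub, hy', sub_self, Nat.cast_zero, zero_smul]
  rw [eq_top_iff]
  rintro w -
  obtain ⟨d, hd⟩ := exists_mem_degreeLT hG w
  exact h4 d hd

theorem eigenspace_numberOp_eq_bot (hW : (M a).IsWeakModule W) (hG : (M a).IsGrading W G) {μ : ℂ}
    (hμ : ∀ n : ℕ, (n : ℂ) ≠ μ) : (numberOp a W).eigenspace μ = ⊥ := by
  have h := (numberOp a W).eigenspaces_iSupIndep μ
  rw [show ⨆ j, ⨆ (_ : j ≠ μ), (numberOp a W).eigenspace j = ⊤ by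
    rw [eq_top_iff, ← iSup_eigenspace_numberOp hW hG]
    exact iSup_le fun n => le_iSup₂_of_le (n : ℂ) (hμ n) le_rfl, disjoint_top] at h
  exact h

/-- The vectors of `Ω(W)` are annihilated by `α_n`, `n > 0`. -/
theorem annihilationOp_eq_zero (hW : (M a).IsWeakModule W) (hG : (M a).IsGrading W G) (i : ℕ)
    {w : W} (hw : w ∈ (numberOp a W).eigenspace 0) : annihilationOp a W i w = 0 := by
  have h := annihilationOp_mem_eigenspace hW i hw
  rwa [eigenspace_numberOp_eq_bot hW hG fun n hn => ?_, Submodule.mem_bot] at h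
  have h1 : ((n + i + 1 : ℕ) : ℂ) = 0 := by
    push_cast
    linear_combination hn
  exact absurd (Nat.cast_eq_zero.1 h1) (by omega)

/-- An eigenvector with eigenvalue `n + 1` is `(n + 1)⁻¹ ∑ α₋ᵢ αᵢ w`, and the vectors `αᵢ w` have
smaller eigenvalues. So the kernel of the number operator generates the module. -/
theorem eq_top_of_eigenspace_le (hW : (M a).IsWeakModule W) (hG : (M a).IsGrading W G)
    {S : Submodule (M a).ModeAlgebra W} (hS : ∀ w ∈ (numberOp a W).eigenspace 0, w ∈ S) :
    S = ⊤ := by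
  have h : ∀ n : ℕ, (numberOp a W).eigenspace (n : ℂ) ≤ S.restrictScalars ℂ := by
    intro n
    induction n using Nat.strong_induction_on with
    | h n ih =>
      intro w hw
      rcases n with _ | n
      · exact hS w (by rwa [Nat.cast_zero] at hw)
      obtain ⟨m, hm⟩ := (numberOp_eventually hW w).exists
      have h0 : ((n + 1 : ℕ) : ℂ) ≠ 0 := Nat.cast_ne_zero.2 n.succ_ne_zero
      rw [← inv_smul_smul₀ h0 w, ← Module.End.mem_eigenspace_iff.1 hw, hm]
      refine Submodule.smul_mem _ _ (Submodule.sum_mem _ fun i _ => S.smul_mem _ ?_)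
      have h1 := annihilationOp_mem_eigenspace hW i hw
      by_cases hi : i ≤ n
      · refine ih (n - i) (by omega) ?_
        rwa [Nat.cast_sub hi, show (n : ℂ) - i = ((n + 1 : ℕ) : ℂ) - (i + 1) by push_cast; ring]
      · rw [eigenspace_numberOp_eq_bot hW hG fun m hm' => ?_, Submodule.mem_bot] at h1
        · rw [h1]
          exact S.zero_mem
        · have h2 : ((m + i : ℕ) : ℂ) = (n : ℕ) := by
            push_cast at hm' ⊢
            linear_combination hm'
          have := Nat.cast_injective h2
          omega
  rw [eq_top_iff]
  rintro w -
  have h1 : w ∈ ⨆ n : ℕ, (numberOp a W).eigenspace (n : ℂ) := by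
    rw [iSup_eigenspace_numberOp hW hG]
    exact Submodule.mem_top
  exact iSup_le h h1

/-- A nonzero vector of the submodule with minimal degree bound is killed by all annihilation
operators, hence by the number operator. -/
theorem exists_mem_eigenspace (hW : (M a).IsWeakModule W) (hG : (M a).IsGrading W G)
    {S : Submodule (M a).ModeAlgebra W} (hS : S ≠ ⊥) :
    ∃ w ∈ S, w ≠ 0 ∧ w ∈ (numberOp a W).eigenspace 0 := by
  classical
  have h : ∃ d, ∃ w ∈ S, w ≠ 0 ∧ w ∈ degreeLT G d := by
    obtain ⟨w, hw, hw0⟩ := S.exists_mem_ne_zero_of_ne_bot hS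
    obtain ⟨d, hd⟩ := exists_mem_degreeLT hG w
    exact ⟨d, w, hw, hw0, hd⟩
  obtain ⟨w, hw, hw0, hd⟩ := Nat.find_spec h
  refine ⟨w, hw, hw0, ?_⟩
  have hpos : 0 < Nat.find h := by
    rw [pos_iff_ne_zero]
    intro h0
    rw [h0, degreeLT_zero hG] at hd
    exact hw0 hd
  obtain ⟨n, hn⟩ := (numberOp_eventually hW w).exists
  rw [Module.End.mem_eigenspace_iff, zero_smul, hn]
  refine Finset.sum_eq_zero fun i _ => ?_
  rw [show annihilationOp a W i w = 0 by
    by_contra h0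
    exact Nat.find_min h (m := Nat.find h - (i + 1)) (by omega)
      ⟨_, S.smul_mem _ hw, h0, annihilationOp_mem_degreeLT hG i hd⟩, map_zero]

/-- Creation operators raise the eigenvalue, so their images lie in eigenspaces with nonzero
eigenvalue. -/
theorem disjoint_range_creationOp (hW : (M a).IsWeakModule W) (hG : (M a).IsGrading W G) :
    Disjoint ((numberOp a W).eigenspace 0) (⨆ i, LinearMap.range (creationOp a W i)) := by
  refine ((numberOp a W).eigenspaces_iSupIndep 0).mono_right (iSup_le fun i => ?_)
  rw [LinearMap.range_eq_map, ← iSup_eigenspace_numberOp hW hG, Submodule.map_iSup]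
  refine iSup_le fun n => ?_
  rintro _ ⟨w, hw, rfl⟩
  have h1 : ((n : ℂ) + (i + 1)) ≠ 0 := by
    have : ((n + i + 1 : ℕ) : ℂ) ≠ 0 := Nat.cast_ne_zero.2 (by omega)
    push_cast at this
    rwa [← add_assoc]
  exact Submodule.mem_iSup_of_mem _ (Submodule.mem_iSup_of_mem h1
    (creationOp_mem_eigenspace hW i hw))

end WeakModule

end Heisenberg

/-! ### Cyclic subspaces of nilpotent operators, and submodules generated by vacuum vectors -/

namespace Heisenberg
open MvPolynomial Filter

/-- A nilpotent endomorphism `ν` of index `k` has a cyclic subspace of dimension `k` with an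
invariant complement. -/
theorem exists_cyclic_isCompl {V : Type*} [AddCommGroup V] [Module ℂ V] {ν : Module.End ℂ V} {k : ℕ}
    (hk : 0 < k) (hν : ν ^ k = 0) (hν' : ν ^ (k - 1) ≠ 0) :
    ∃ (φ : Trunc k →ₗ[ℂ] V) (T : Submodule ℂ V), (∀ r, φ (tau k * r) = ν (φ r)) ∧
      φ (tau k ^ (k - 1)) ≠ 0 ∧ (∀ v ∈ T, ν v ∈ T) ∧ IsCompl (LinearMap.range φ) T := by
  obtain ⟨w, hw⟩ : ∃ w, (ν ^ (k - 1)) w ≠ 0 := by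
    by_contra! h
    exact hν' (LinearMap.ext h)
  obtain ⟨f, hf⟩ : ∃ f : Module.Dual ℂ V, f ((ν ^ (k - 1)) w) ≠ 0 := by
    by_contra! h
    exact hw ((Module.forall_dual_apply_eq_zero_iff ℂ _).1 h)
  let φ : Trunc k →ₗ[ℂ] V := (tauBasis k).constr ℂ fun i => (ν ^ (i : ℕ)) w
  have hν0 : ∀ n, k ≤ n → ν ^ n = 0 := fun n hn => pow_eq_zero_of_le hn hν
  have hφ : ∀ n, φ (tau k ^ n) = (ν ^ n) w := fun n => by
    by_cases hn : n < k
    · rw [← tauBasis_apply k ⟨n, hn⟩]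
      exact (tauBasis k).constr_basis ℂ _ _
    · rw [(tau_pow_eq_zero_iff k).2 (by omega), map_zero, hν0 n (by omega), LinearMap.zero_apply]
  have hτ : ∀ r, φ (tau k * r) = ν (φ r) := by
    have h : φ ∘ₗ LinearMap.mulLeft ℂ (tau k) = ν ∘ₗ φ := (tauBasis k).ext fun i => by
      rw [LinearMap.comp_apply, LinearMap.comp_apply, LinearMap.mulLeft_apply, tauBasis_apply,
        ← pow_succ', hφ, hφ, pow_succ', Module.End.mul_apply]
    exact fun r => LinearMap.congr_fun h r
  have hsum : ∀ j r, f ((ν ^ j) (φ r)) =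
      ∑ i : Fin k, (tauBasis k).repr r i * f ((ν ^ (j + i)) w) := fun j r => by
    conv_lhs => rw [← (tauBasis k).sum_repr r]
    rw [map_sum, map_sum, map_sum]
    refine Finset.sum_congr rfl fun i _ => ?_
    rw [map_smul, map_smul, map_smul, tauBasis_apply, hφ, pow_add, Module.End.mul_apply, smul_eq_mul]
  -- The complement is `ker ψ`. It is invariant because `ν ^ k = 0`. In the basis of powers of `τ`
  -- the map `ψ ∘ₗ φ` is anti-triangular with the nonzero entry `f (ν ^ (k - 1) w)` on the
  -- antidiagonal, so it is bijective.
  let ψ : V →ₗ[ℂ] Fin k → ℂ := LinearMap.pi fun i => f ∘ₗ ν ^ (i : ℕ)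
  have hinj : Function.Injective (ψ ∘ₗ φ) := by
    rw [injective_iff_map_eq_zero]
    intro r hr
    have h : ∀ m (hm : m < k), (tauBasis k).repr r ⟨m, hm⟩ = 0 := by
      intro m
      induction m using Nat.strong_induction_on with
      | h m ih =>
        intro hm
        have h1 := congr_fun hr ⟨k - 1 - m, by omega⟩
        change f ((ν ^ (k - 1 - m)) (φ r)) = 0 at h1
        rw [hsum, Finset.sum_eq_single ⟨m, hm⟩ (fun i _ hi => ?_) (by simp)] at h1
        · rw [show k - 1 - m + m = k - 1 by omega] at h1
          exact (mul_eq_zero.1 h1).resolve_right hf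
        · have hi' : (i : ℕ) ≠ m := fun h => hi (Fin.ext h)
          rcases lt_or_gt_of_ne hi' with h | h
          · rw [ih i h i.2, zero_mul]
          · rw [hν0 _ (by omega), LinearMap.zero_apply, map_zero, mul_zero]
    exact (tauBasis k).repr.map_eq_zero_iff.1 (Finsupp.ext fun i => h i i.2)
  have : Module.Finite ℂ (Trunc k) := Module.Finite.of_basis (tauBasis k)
  have hsurj : Function.Surjective (ψ ∘ₗ φ) :=
    (LinearMap.injective_iff_surjective_of_finrank_eq_finrank (by
      rw [Module.finrank_eq_card_basis (tauBasis k), Module.finrank_fin_fun, Fintype.card_fin])).1 hinj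
  refine ⟨φ, LinearMap.ker ψ, hτ, by rwa [hφ], fun v hv => ?_, ?_, ?_⟩
  · funext i
    by_cases hi : (i : ℕ) + 1 < k
    · have := congr_fun hv ⟨i + 1, hi⟩
      change f ((ν ^ ((i : ℕ) + 1)) v) = 0 at this
      rwa [pow_succ, Module.End.mul_apply] at this
    · change f ((ν ^ (i : ℕ)) (ν v)) = 0
      rw [← Module.End.mul_apply, ← pow_succ, hν0 _ (by omega), LinearMap.zero_apply, map_zero]
  · rw [Submodule.disjoint_def]
    rintro _ ⟨r, rfl⟩ hr
    rw [hinj (hr.trans (map_zero (ψ ∘ₗ φ)).symm), map_zero]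
  · rw [codisjoint_iff, eq_top_iff]
    rintro v -
    obtain ⟨r, hr⟩ := hsurj (ψ v)
    rw [← add_sub_cancel (φ r) v]
    refine Submodule.add_mem_sup ⟨r, rfl⟩ ?_
    rw [LinearMap.mem_ker, map_sub, ← hr, LinearMap.comp_apply, sub_self]

section Vacuum

variable {a : ℂ} {W : Type*} [AddCommGroup W] [Module ℂ W] [Module (M a).ModeAlgebra W]
  [IsScalarTower ℂ (M a).ModeAlgebra W] {G : ℤ → Submodule ℂ W}

theorem op_alpha_zero_commute (x : (M a).ModeAlgebra) (w : W) :
    alpha a 0 • x • w = x • alpha a 0 • w := by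
  rw [← mul_smul, commute_alpha_zero, mul_smul]

theorem exists_creationHom (hW : (M a).IsWeakModule W) :
    ∃ κ : Fock →ₐ[ℂ] Module.End ℂ W, ∀ i, κ (X i) = creationOp a W i :=
  exists_algHom_of_commute _ fun i j => LinearMap.ext fun w => creationOp_comm hW i j w

variable {κ : Fock →ₐ[ℂ] Module.End ℂ W} (hκ : ∀ i, κ (X i) = creationOp a W i)

theorem creationHom_X_mul (hκ : ∀ i, κ (X i) = creationOp a W i) (i : ℕ) (p : Fock) (w : W) :
    κ (X i * p) w = creationOp a W i (κ p w) := by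
  rw [map_mul, hκ, Module.End.mul_apply]

theorem alpha_zero_smul_creationHom (hκ : ∀ i, κ (X i) = creationOp a W i) (p : Fock) (w : W) :
    alpha a 0 • κ p w = κ p (alpha a 0 • w) := by
  induction p using MvPolynomial.induction_on with
  | C c =>
    rw [← algebraMap_eq, AlgHom.commutes, Module.algebraMap_end_apply, Module.algebraMap_end_apply,
      smul_smul_comm']
  | add p q hp hq => rw [map_add, LinearMap.add_apply, LinearMap.add_apply, smul_add, hp, hq]
  | mul_X p j ih =>
    rw [mul_comm, creationHom_X_mul hκ, creationHom_X_mul hκ, ← ih]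
    exact op_alpha_zero_commute _ _

theorem annihilationOp_creationHom (hW : (M a).IsWeakModule W) (hG : (M a).IsGrading W G)
    (hκ : ∀ i, κ (X i) = creationOp a W i) (i : ℕ) (p : Fock)
    {w : W} (hw : w ∈ (numberOp a W).eigenspace 0) :
    annihilationOp a W i (κ p w) = κ (((i : ℂ) + 1) • pderiv i p) w := by
  induction p using MvPolynomial.induction_on with
  | C c =>
    rw [pderiv_C, smul_zero, map_zero, LinearMap.zero_apply, ← algebraMap_eq, AlgHom.commutes,
      Module.algebraMap_end_apply, map_smul, annihilationOp_eq_zero hW hG i hw, smul_zero]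
  | add p q hp hq =>
    rw [map_add κ, LinearMap.add_apply, map_add, map_add, smul_add, map_add κ, LinearMap.add_apply,
      hp, hq]
  | mul_X p j ih =>
    rw [mul_comm, creationHom_X_mul hκ, annihilationOp_creationOp hW, ih, pderiv_mul, pderiv_X,
      smul_add, map_add κ, LinearMap.add_apply, ← mul_smul_comm _ (X j), creationHom_X_mul hκ,
      add_comm]
    congr 1
    by_cases h : i = j
    · rw [h, if_pos rfl, Pi.single_eq_same, one_mul, map_smul, LinearMap.smul_apply]
    · rw [if_neg h, Pi.single_eq_of_ne (Ne.symm h), zero_mul, smul_zero, map_zero, LinearMap.zero_apply]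

theorem alpha_zero_mem_eigenspace {w : W} (hw : w ∈ (numberOp a W).eigenspace 0) :
    alpha a 0 • w ∈ (numberOp a W).eigenspace 0 := by
  have h : numberOp a W (alpha a 0 • w) = alpha a 0 • numberOp a W w := by
    change (M a).gen (M a).omega 1 • alpha a 0 • w -
      (1 / 2 : ℂ) • ((alpha a 0 * alpha a 0) • alpha a 0 • w) + a • alpha a 0 • alpha a 0 • w =
      alpha a 0 • ((M a).gen (M a).omega 1 • w -
      (1 / 2 : ℂ) • ((alpha a 0 * alpha a 0) • w) + a • alpha a 0 • w)
    rw [smul_add, smul_sub, smul_smul_comm', smul_smul_comm',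
      op_alpha_zero_commute ((M a).gen (M a).omega 1), op_alpha_zero_commute (alpha a 0 * alpha a 0)]
  rw [Module.End.mem_eigenspace_iff, zero_smul] at hw ⊢
  rw [h, hw, smul_zero]

/-- The submodule generated by a space of vacuum vectors. -/
def vacuumSpan (hW : (M a).IsWeakModule W) (hG : (M a).IsGrading W G)
    (hκ : ∀ i, κ (X i) = creationOp a W i) (T : Submodule ℂ W)
    (hT : T ≤ (numberOp a W).eigenspace 0) (hT' : ∀ w ∈ T, alpha a 0 • w ∈ T) :
    Submodule (M a).ModeAlgebra W :=
  submoduleOfAlpha hW (Submodule.span ℂ {w | ∃ p, ∃ y ∈ T, w = κ p y}) fun m w hw => by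
    have h : Submodule.span ℂ {w | ∃ p, ∃ y ∈ T, w = κ p y} ≤
        (Submodule.span ℂ {w | ∃ p, ∃ y ∈ T, w = κ p y}).comap ((M a).op W (alpha a m)) := by
      rw [Submodule.span_le]
      rintro _ ⟨p, y, hy, rfl⟩
      apply Submodule.subset_span
      rcases lt_trichotomy m 0 with hm | rfl | hm
      · obtain ⟨i, rfl⟩ : ∃ i : ℕ, m = -((i : ℤ) + 1) := ⟨(-m - 1).toNat, by omega⟩
        exact ⟨X i * p, y, hy, (creationHom_X_mul hκ i p y).symm⟩
      · exact ⟨p, _, hT' y hy, alpha_zero_smul_creationHom hκ p y⟩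
      · obtain ⟨i, rfl⟩ : ∃ i : ℕ, m = (i : ℤ) + 1 := ⟨(m - 1).toNat, by omega⟩
        exact ⟨_, y, hy, annihilationOp_creationHom hW hG hκ i p (hT hy)⟩
    exact h hw

variable (hW : (M a).IsWeakModule W) (hG : (M a).IsGrading W G) {T : Submodule ℂ W}
    (hT : T ≤ (numberOp a W).eigenspace 0) (hT' : ∀ w ∈ T, alpha a 0 • w ∈ T)

theorem mem_vacuumSpan_of_mem {w : W} (hw : w ∈ T) : w ∈ vacuumSpan hW hG hκ T hT hT' :=
  Submodule.subset_span ⟨1, w, hw, by rw [map_one, Module.End.one_apply]⟩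

/-- The generated submodule lies in `T` plus the images of the creation operators, and these images
meet the vacuum vectors only in zero. -/
theorem mem_of_mem_vacuumSpan {w : W} (hw : w ∈ vacuumSpan hW hG hκ T hT hT')
    (hw' : w ∈ (numberOp a W).eigenspace 0) : w ∈ T := by
  have h : Submodule.span ℂ {w | ∃ p, ∃ y ∈ T, w = κ p y} ≤
      T ⊔ ⨆ i, LinearMap.range (creationOp a W i) := by
    rw [Submodule.span_le]
    rintro _ ⟨p, y, hy, rfl⟩
    induction p using MvPolynomial.induction_on with
    | C c =>
      rw [← algebraMap_eq, AlgHom.commutes, Module.algebraMap_end_apply]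
      exact Submodule.mem_sup_left (T.smul_mem c hy)
    | add p q hp hq =>
      rw [map_add, LinearMap.add_apply]
      exact Submodule.add_mem _ hp hq
    | mul_X p j ih =>
      rw [mul_comm, creationHom_X_mul hκ]
      exact Submodule.mem_sup_right (Submodule.mem_iSup_of_mem j ⟨_, rfl⟩)
  obtain ⟨y, hy, z, hz, rfl⟩ := Submodule.mem_sup.1 (h hw)
  have h1 : z ∈ (numberOp a W).eigenspace 0 := by
    have := Submodule.sub_mem _ hw' (hT hy)
    rwa [add_sub_cancel_left] at this
  rw [Submodule.disjoint_def.1 (disjoint_range_creationOp hW hG) z h1 hz, add_zero]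
  exact hy

/-- Complementary `α₀`-stable spaces of vacuum vectors generate complementary submodules: a nonzero
intersection would contain a common vacuum vector, and the sum contains all vacuum vectors. By
indecomposability the part generated by `T ≠ ⊥` is everything, so `T` contains all vacuum vectors.
-/
theorem eq_top_of_isIndecomposable (hW : (M a).IsWeakModule W) (hG : (M a).IsGrading W G)
    (hT : T ≤ (numberOp a W).eigenspace 0) (hT' : ∀ w ∈ T, alpha a 0 • w ∈ T)
    (hX : IsIndecomposable (M a).ModeAlgebra W)
    {T' : Submodule ℂ W} (hT₂ : T' ≤ (numberOp a W).eigenspace 0)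
    (hT₂' : ∀ w ∈ T', alpha a 0 • w ∈ T') (hsup : (numberOp a W).eigenspace 0 ≤ T ⊔ T')
    (hdisj : Disjoint T T') (hne : T ≠ ⊥) {S : Submodule (M a).ModeAlgebra W}
    (hS : T ≤ S.restrictScalars ℂ) : S = ⊤ := by
  obtain ⟨κ, hκ⟩ := exists_creationHom hW
  have hc : IsCompl (vacuumSpan hW hG hκ T hT hT') (vacuumSpan hW hG hκ T' hT₂ hT₂') := by
    constructor
    · rw [disjoint_iff]
      by_contra h
      obtain ⟨w, hw, hw0, hw'⟩ := exists_mem_eigenspace hW hG h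
      exact hw0 (Submodule.disjoint_def.1 hdisj w (mem_of_mem_vacuumSpan _ _ _ _ _ hw.1 hw')
        (mem_of_mem_vacuumSpan _ _ _ _ _ hw.2 hw'))
    · rw [codisjoint_iff]
      refine eq_top_of_eigenspace_le hW hG fun w hw => ?_
      obtain ⟨y, hy, z, hz, rfl⟩ := Submodule.mem_sup.1 (hsup hw)
      exact Submodule.add_mem _ (Submodule.mem_sup_left (mem_vacuumSpan_of_mem _ _ _ _ _ hy))
        (Submodule.mem_sup_right (mem_vacuumSpan_of_mem _ _ _ _ _ hz))
  rcases hX.2 _ _ hc with h | h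
  · refine absurd ((Submodule.eq_bot_iff _).2 fun w hw => ?_) hne
    have := mem_vacuumSpan_of_mem hκ hW hG hT hT' hw
    rwa [h, Submodule.mem_bot] at this
  · rw [h] at hc
    refine eq_top_of_eigenspace_le hW hG fun w hw => ?_
    have h1 : w ∈ vacuumSpan hW hG hκ T hT hT' := by
      rw [eq_top_of_isCompl_bot hc]
      exact Submodule.mem_top
    exact hS (mem_of_mem_vacuumSpan _ _ _ _ _ h1 hw)

end Vacuum

end Heisenberg

/-! ### Classification of indecomposable generalized modules -/

namespace Heisenberg
open MvPolynomial Filter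

section Classification

variable {a : ℂ} {W : Type*} [AddCommGroup W] [Module ℂ W] [Module (M a).ModeAlgebra W]
  [IsScalarTower ℂ (M a).ModeAlgebra W] {G : ℤ → Submodule ℂ W}

/-- Vectors of a finite-dimensional invariant subspace are sums of generalized eigenvectors. -/
theorem le_iSup_maxGenEigenspace {V : Type*} [AddCommGroup V] [Module ℂ V] (f : Module.End ℂ V)
    (p : Submodule ℂ V) [FiniteDimensional ℂ p] (hp : ∀ v ∈ p, f v ∈ p) :
    p ≤ ⨆ μ, f.maxGenEigenspace μ := by
  let g : Module.End ℂ p := f.restrict hp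
  have h : ∀ μ, (g.maxGenEigenspace μ).map p.subtype ≤ f.maxGenEigenspace μ := by
    rintro μ _ ⟨v, hv, rfl⟩
    obtain ⟨n, hn⟩ := (Module.End.mem_maxGenEigenspace _ _ _).1 hv
    refine (Module.End.mem_maxGenEigenspace _ _ _).2 ⟨n, ?_⟩
    have h1 : ∀ (n : ℕ) (v : p), (((g - μ • 1) ^ n) v : V) = ((f - μ • 1) ^ n) v := by
      intro n
      induction n with
      | zero => exact fun v => rfl
      | succ n ih =>
        intro v
        rw [pow_succ, pow_succ, Module.End.mul_apply, Module.End.mul_apply, ih]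
        rfl
    rw [Submodule.subtype_apply, ← h1, hn, Submodule.coe_zero]
  calc p = (⨆ μ, g.maxGenEigenspace μ).map p.subtype := by
        rw [Module.End.iSup_maxGenEigenspace_eq_top, Submodule.map_subtype_top]
    _ ≤ _ := by
        rw [Submodule.map_iSup]
        exact iSup_mono h

/-- On an indecomposable generalized module, `α_0` has a single generalized eigenvalue. -/
theorem exists_maxGenEigenspace_eq_top (hX : (M a).IsGeneralizedModule W)
    (hX' : IsIndecomposable (M a).ModeAlgebra W) :
    ∃ lam, ((M a).op W (alpha a 0)).maxGenEigenspace lam = ⊤ := by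
  set f := (M a).op W (alpha a 0)
  have hcomm : ∀ (x : (M a).ModeAlgebra) (w : W), f (x • w) = x • f w := op_alpha_zero_commute
  -- The weight spaces of `L₀` are finite-dimensional, span the module, and are stable under `α₀`,
  -- which is central.
  have htop : ⨆ μ, f.maxGenEigenspace μ = ⊤ := by
    rw [eq_top_iff, ← hX.decomposition.submodule_iSup_eq_top]
    refine iSup_le fun μ => ?_
    have := hX.finite μ
    refine le_iSup_maxGenEigenspace f _ fun w hw => ?_
    obtain ⟨n, hn⟩ := (Module.End.mem_maxGenEigenspace _ _ _).1 hw
    refine (Module.End.mem_maxGenEigenspace _ _ _).2 ⟨n, ?_⟩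
    have h0 : Commute ((M a).op W ((M a).gen (M a).omega 1)) f :=
      LinearMap.ext fun w => (hcomm _ w).symm
    have h1 : Commute ((M a).op W ((M a).gen (M a).omega 1) - μ • 1) f :=
      h0.sub_left ((Commute.one_left f).smul_left μ)
    rw [← Module.End.mul_apply, (h1.pow_left n).eq, Module.End.mul_apply, hn, map_zero]
  have hsmul : ∀ (x : (M a).ModeAlgebra) μ w, w ∈ f.maxGenEigenspace μ →
      x • w ∈ f.maxGenEigenspace μ := by
    intro x μ w hw
    obtain ⟨n, hn⟩ := (Module.End.mem_maxGenEigenspace _ _ _).1 hw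
    refine (Module.End.mem_maxGenEigenspace _ _ _).2 ⟨n, ?_⟩
    have h0 : Commute f ((M a).op W x) := LinearMap.ext fun w => hcomm x w
    have h1 : Commute (f - μ • 1) ((M a).op W x) :=
      h0.sub_left ((Commute.one_left _).smul_left μ)
    change ((f - μ • 1) ^ n) ((M a).op W x w) = 0
    rw [← Module.End.mul_apply, (h1.pow_left n).eq, Module.End.mul_apply, hn, map_zero]
  obtain ⟨lam, hlam⟩ : ∃ lam, f.maxGenEigenspace lam ≠ ⊥ := by
    by_contra! h
    have := hX'.1
    simp only [h, iSup_bot] at htop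
    exact bot_ne_top htop
  let S : Submodule (M a).ModeAlgebra W :=
    { f.maxGenEigenspace lam with smul_mem' := fun x w hw => hsmul x lam w hw }
  let T : Submodule (M a).ModeAlgebra W :=
    { (⨆ μ, ⨆ (_ : μ ≠ lam), f.maxGenEigenspace μ) with
      smul_mem' := fun x w hw => by
        have h : (⨆ μ, ⨆ (_ : μ ≠ lam), f.maxGenEigenspace μ) ≤
            (⨆ μ, ⨆ (_ : μ ≠ lam), f.maxGenEigenspace μ).comap ((M a).op W x) :=
          iSup₂_le fun μ hμ w hw =>
            Submodule.mem_iSup_of_mem μ (Submodule.mem_iSup_of_mem hμ (hsmul x μ w hw))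
        exact h hw }
  refine ⟨lam, ?_⟩
  have hST : IsCompl S T := by
    constructor
    · rw [Submodule.disjoint_def]
      exact fun w hw hw' => Submodule.disjoint_def.1 (f.independent_maxGenEigenspace lam) w hw hw'
    · rw [codisjoint_iff, eq_top_iff]
      rintro w -
      have h : ⨆ μ, f.maxGenEigenspace μ ≤ (S ⊔ T).restrictScalars ℂ := by
        refine iSup_le fun μ w hw => ?_
        by_cases hμ : μ = lam
        · subst hμ
          exact Submodule.mem_sup_left (T := T) (S := S) hw
        · exact Submodule.mem_sup_right (T := T) (S := S)
            (Submodule.mem_iSup_of_mem μ (Submodule.mem_iSup_of_mem hμ hw))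
      rw [htop] at h
      exact h Submodule.mem_top
  rcases hX'.2 S T hST with h | h
  · refine absurd ((Submodule.eq_bot_iff _).2 fun w hw => ?_) hlam
    rw [← Submodule.mem_bot (M a).ModeAlgebra, ← h]
    exact hw
  · rw [h] at hST
    rw [eq_top_iff]
    rintro w -
    have h1 : w ∈ S := by
      rw [eq_top_of_isCompl_bot hST]
      exact Submodule.mem_top
    exact h1

/-- The vacuum vectors have the generalized `L_0`-weight `λ² / 2 - a λ`. -/
theorem eigenspace_le_weightSpace {lam : ℂ}
    (hlam : ((M a).op W (alpha a 0)).maxGenEigenspace lam = ⊤) :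
    (numberOp a W).eigenspace 0 ≤ (M a).weightSpace W (lowestWeight a lam) := by
  intro w hw
  set f := (M a).op W (alpha a 0) with hf
  have hw1 : w ∈ f.maxGenEigenspace lam := by
    rw [hlam]
    exact Submodule.mem_top
  obtain ⟨n, hn⟩ := (Module.End.mem_maxGenEigenspace _ _ _).1 hw1
  refine (Module.End.mem_maxGenEigenspace _ _ _).2 ⟨n, ?_⟩
  set g : Module.End ℂ W := (1 / 2 : ℂ) • f + (lam / 2 - a) • 1 with hg
  -- With `f = α₀` this factors `f² / 2 - a f - (λ² / 2 - a λ)` as `(f / 2 + λ / 2 - a)(f - λ)`; the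
  -- number operator drops out on vacuum vectors.
  have h1 : (M a).op W ((M a).gen (M a).omega 1) - lowestWeight a lam • 1 =
      g * (f - lam • 1) + numberOp a W := by
    have h2 : (M a).op W (alpha a 0 * alpha a 0) = f * f :=
      map_mul (Algebra.lsmul ℂ ℂ W) _ _
    rw [numberOp, h2, hg, lowestWeight, ← hf]
    simp only [add_mul, mul_sub, smul_mul_assoc, mul_smul_comm, one_mul, mul_one]
    module
  have hgf : Commute g (f - lam • 1) := by
    refine Commute.sub_right ?_ ((Commute.one_right _).smul_right _)
    exact ((Commute.refl f).smul_left _).add_left ((Commute.one_left f).smul_left _)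
  have hstable : ∀ v ∈ (numberOp a W).eigenspace 0, (g * (f - lam • 1)) v ∈
      (numberOp a W).eigenspace 0 := by
    have h3 : ∀ v ∈ (numberOp a W).eigenspace 0, f v ∈ (numberOp a W).eigenspace 0 :=
      fun v hv => alpha_zero_mem_eigenspace hv
    intro v hv
    have h4 : (f - lam • 1) v ∈ (numberOp a W).eigenspace 0 :=
      Submodule.sub_mem _ (h3 v hv) (Submodule.smul_mem _ _ hv)
    exact Submodule.add_mem _ (Submodule.smul_mem _ _ (h3 _ h4)) (Submodule.smul_mem _ _ h4)
  have h5 : ∀ m : ℕ, ∀ v ∈ (numberOp a W).eigenspace 0,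
      ((g * (f - lam • 1) + numberOp a W) ^ m) v = ((g * (f - lam • 1)) ^ m) v := by
    intro m
    induction m with
    | zero => exact fun v _ => rfl
    | succ m ih =>
      intro v hv
      rw [pow_succ, pow_succ, Module.End.mul_apply, Module.End.mul_apply, LinearMap.add_apply,
        Module.End.mem_eigenspace_iff.1 hv, zero_smul, add_zero, ih _ (hstable v hv)]
  rw [h1, h5 n w hw, hgf.mul_pow, Module.End.mul_apply, hn, map_zero]

/-- A linear map from the vectors of degree zero of `M(1) ⊗ U'` to the vacuum vectors of `W` that
commutes with `α_0` extends to a homomorphism. -/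
theorem exists_hom_of_tensor {W' U' : Type*} [AddCommGroup W'] [Module ℂ W']
    [Module (M a).ModeAlgebra W'] [IsScalarTower ℂ (M a).ModeAlgebra W'] [AddCommGroup U']
    [Module ℂ U'] (hW' : (M a).IsWeakModule W') (hW : (M a).IsWeakModule W)
    (hG : (M a).IsGrading W G) (e : Fock ⊗[ℂ] U' ≃ₗ[ℂ] W') {x : U' → U'}
    (hneg : ∀ (i : ℕ) p y, alpha a (-((i : ℤ) + 1)) • e (p ⊗ₜ y) = e ((X i * p) ⊗ₜ y))
    (hzero : ∀ p y, alpha a 0 • e (p ⊗ₜ y) = e (p ⊗ₜ x y))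
    (hpos : ∀ (i : ℕ) p y, alpha a ((i : ℤ) + 1) • e (p ⊗ₜ y) =
      e ((((i : ℂ) + 1) • pderiv i p) ⊗ₜ y))
    (φ : U' →ₗ[ℂ] W) (hφ : ∀ y, φ y ∈ (numberOp a W).eigenspace 0)
    (hφ' : ∀ y, φ (x y) = alpha a 0 • φ y) :
    ∃ Φ : W' →ₗ[(M a).ModeAlgebra] W, ∀ y, Φ (e (1 ⊗ₜ y)) = φ y := by
  obtain ⟨κ, hκ⟩ := exists_creationHom hW
  let Φ₀ : Fock ⊗[ℂ] U' →ₗ[ℂ] W := TensorProduct.lift (κ.toLinearMap.compl₂ φ)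
  have hΦ₀ : ∀ p y, Φ₀ (p ⊗ₜ y) = κ p (φ y) := fun p y => rfl
  have hcomm : ∀ m, ∀ w : W',
      (Φ₀ ∘ₗ e.symm.toLinearMap) (alpha a m • w) = alpha a m • (Φ₀ ∘ₗ e.symm.toLinearMap) w := by
    intro m w
    obtain ⟨z, rfl⟩ := e.surjective w
    rw [LinearMap.comp_apply, LinearMap.comp_apply, LinearEquiv.coe_coe, e.symm_apply_apply]
    induction z using TensorProduct.induction_on with
    | zero => simp only [map_zero, smul_zero]
    | add x y hx hy => rw [map_add, smul_add, map_add, map_add, map_add, smul_add, hx, hy]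
    | tmul p y =>
      rw [hΦ₀]
      rcases lt_trichotomy m 0 with hm | rfl | hm
      · obtain ⟨i, rfl⟩ : ∃ i : ℕ, m = -((i : ℤ) + 1) := ⟨(-m - 1).toNat, by omega⟩
        rw [hneg, e.symm_apply_apply, hΦ₀, creationHom_X_mul hκ]
        rfl
      · rw [hzero, e.symm_apply_apply, hΦ₀, alpha_zero_smul_creationHom hκ, hφ']
      · obtain ⟨i, rfl⟩ : ∃ i : ℕ, m = (i : ℤ) + 1 := ⟨(m - 1).toNat, by omega⟩
        rw [hpos, e.symm_apply_apply, hΦ₀, ← annihilationOp_creationHom hW hG hκ i p (hφ _)]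
        rfl
  refine ⟨homOfAlpha hW' hW _ hcomm, fun y => ?_⟩
  change Φ₀ (e.symm (e _)) = _
  rw [e.symm_apply_apply, hΦ₀, map_one, Module.End.one_apply]

/-- A homomorphism from `W(a, λ, k)` that is given on the vectors of degree zero. -/
theorem exists_hom (hW : (M a).IsWeakModule W) (hG : (M a).IsGrading W G) {lam : ℂ} {k : ℕ}
    (φ : Trunc k →ₗ[ℂ] W) (hφ : ∀ r, φ r ∈ (numberOp a W).eigenspace 0)
    (hφ' : ∀ r, φ (shift k lam * r) = alpha a 0 • φ r) :
    ∃ Φ : Heisenberg.W a lam k →ₗ[(M a).ModeAlgebra] W,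
      ∀ r, Φ (tensorEquiv a (shift k lam) (truncEquiv a lam k) (truncEquiv_zhuClass_smul a lam k)
        (1 ⊗ₜ (truncEquiv a lam k).symm r)) = φ r := by
  have hu := truncEquiv_zhuClass_smul a lam k
  obtain ⟨-, h2, h3, h4⟩ := tensorEquiv_spec a (shift k lam) (truncEquiv a lam k) hu
  obtain ⟨Φ, hΦ⟩ := exists_hom_of_tensor (x := fun y => zhuX a • y)
    ((fockModule_isWeakModule a (shift k lam)).ofEquiv (fockEquiv a lam k).symm) hW hG
    (tensorEquiv a (shift k lam) (truncEquiv a lam k) hu) h2 h3 h4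
    (φ ∘ₗ (truncEquiv a lam k).toLinearMap) (fun y => hφ _) fun y => by
      change φ (truncEquiv a lam k ((M a).zhuClass (X 0) • y)) = alpha a 0 • φ (truncEquiv a lam k y)
      rw [hu, zeroMode_X, pow_zero, one_mul, hφ']
  refine ⟨Φ, fun r => ?_⟩
  rw [hΦ, LinearMap.comp_apply, LinearEquiv.coe_coe, LinearEquiv.apply_symm_apply]

/-- The kernel is one of the submodules `ker τ ^ j`. If `j > 0` it contains the socle, in particular
the vacuum vector `τ ^ (k - 1)`. -/
theorem injective_of_ne_zero {lam : ℂ} {k : ℕ} (hk : 0 < k)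
    (Φ : Heisenberg.W a lam k →ₗ[(M a).ModeAlgebra] W)
    (h : Φ (tensorEquiv a (shift k lam) (truncEquiv a lam k) (truncEquiv_zhuClass_smul a lam k)
        (1 ⊗ₜ (truncEquiv a lam k).symm (tau k ^ (k - 1)))) ≠ 0) : Function.Injective Φ := by
  rw [← LinearMap.ker_eq_bot]
  obtain ⟨j, hj, hj'⟩ := (isUniserialFor_nilpOf (fockEquiv a lam k) hk).all (LinearMap.ker Φ)
  rcases Nat.eq_zero_or_pos j with rfl | hpos
  · rw [hj', IsUniserialFor.ker_zero]
  · refine absurd ?_ h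
    rw [← LinearMap.mem_ker, hj']
    refine (mem_chain (fockEquiv a lam k) (j := ⟨j, by omega⟩)).2 fun s => ?_
    have h1 := toPoly_tensorEquiv a (shift k lam) (truncEquiv a lam k)
      (truncEquiv_zhuClass_smul a lam k) 1 ((truncEquiv a lam k).symm (tau k ^ (k - 1)))
    rw [LinearEquiv.apply_symm_apply, map_one, mul_one] at h1
    rw [fockEquiv, h1, coeff_C]
    split_ifs
    · rw [← pow_add, tau_pow_eq_zero_iff]
      dsimp only
      omega
    · rw [mul_zero]

/-- The vacuum vectors `Ω` lie in a single generalized weight space of `L₀`, so they have finite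
dimension, and `α₀ - λ` is nilpotent on them. Its nilpotency index is the required `k`. -/
theorem exists_equiv_fockTrunc (hX : (M a).IsGeneralizedModule W)
    (hX' : IsIndecomposable (M a).ModeAlgebra W) :
    ∃ (lam : ℂ) (k : ℕ), 0 < k ∧ Nonempty (W ≃ₗ[(M a).ModeAlgebra] FockTrunc a lam k) := by
  obtain ⟨lam, hlam⟩ := exists_maxGenEigenspace_eq_top hX hX'
  obtain ⟨G, hG⟩ := hX.gradable
  have hW := hX.weak
  have hle := eigenspace_le_weightSpace hlam
  have := hX.finite (lowestWeight a lam)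
  set Ω := (numberOp a W).eigenspace 0 with hΩ
  have : FiniteDimensional ℂ Ω := Submodule.finiteDimensional_of_le hle
  have hstable : ∀ w ∈ Ω, ((M a).op W (alpha a 0) - lam • 1) w ∈ Ω := fun w hw =>
    Submodule.sub_mem _ (alpha_zero_mem_eigenspace hw) (Submodule.smul_mem _ _ hw)
  let ν : Module.End ℂ Ω := ((M a).op W (alpha a 0) - lam • 1).restrict hstable
  have hνpow : ∀ n (w : Ω), ((ν ^ n) w : W) = (((M a).op W (alpha a 0) - lam • 1) ^ n) w := by
    intro n
    induction n with
    | zero => exact fun v => rfl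
    | succ n ih =>
      intro v
      rw [pow_succ, pow_succ, Module.End.mul_apply, Module.End.mul_apply, ih]
      rfl
  have hν1 : ∀ w : Ω, alpha a 0 • (w : W) = (ν w : W) + lam • (w : W) := fun w =>
    (sub_add_cancel (alpha a 0 • (w : W)) (lam • (w : W))).symm
  have hnil : IsNilpotent ν := by
    rw [Module.End.isNilpotent_iff_of_finite]
    intro w
    have hw : (w : W) ∈ ((M a).op W (alpha a 0)).maxGenEigenspace lam := by
      rw [hlam]
      exact Submodule.mem_top
    obtain ⟨n, hn⟩ := (Module.End.mem_maxGenEigenspace _ _ _).1 hw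
    exact ⟨n, Subtype.ext ((hνpow n w).trans hn)⟩
  have : Nontrivial Ω := by
    have := hX'.1
    obtain ⟨w, -, hw0, hw⟩ := exists_mem_eigenspace hW hG (S := ⊤) top_ne_bot
    exact ⟨⟨w, hw⟩, 0, fun h => hw0 (congr_arg Subtype.val h)⟩
  have hk : 0 < nilpotencyClass ν := pos_nilpotencyClass_iff.2 hnil
  have hpow := pow_nilpotencyClass hnil
  have hpred := pow_pred_nilpotencyClass hnil
  generalize nilpotencyClass ν = k at hk hpow hpred
  obtain ⟨φ, T, hφ, hφ0, hT, hc⟩ := exists_cyclic_isCompl hk hpow hpred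
  have hφ1 : ∀ r, (φ (shift k lam * r) : W) = alpha a 0 • (φ r : W) := fun r => by
    rw [shift, add_mul, map_add, hφ, ← Algebra.smul_def, map_smul, hν1]
    rfl
  obtain ⟨Φ, hΦ⟩ := exists_hom hW hG (lam := lam) (Ω.subtype ∘ₗ φ) (fun r => (φ r).2) hφ1
  have hinj : Function.Injective Φ := injective_of_ne_zero hk Φ (by
    rw [hΦ]
    exact fun h => hφ0 (Subtype.ext h))
  -- The image contains the cyclic subspace, whose invariant complement in `Ω` supplies the second
  -- summand that indecomposability excludes.
  have hrange : LinearMap.range Φ = ⊤ := by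
    refine eq_top_of_isIndecomposable (T := (LinearMap.range φ).map Ω.subtype)
      (T' := T.map Ω.subtype) hW hG (Submodule.map_subtype_le _ _) ?_ hX'
      (Submodule.map_subtype_le _ _) ?_ ?_ ?_ ?_ ?_
    · rintro _ ⟨_, ⟨r, rfl⟩, rfl⟩
      exact ⟨_, ⟨_, rfl⟩, hφ1 r⟩
    · rintro _ ⟨w, hw, rfl⟩
      exact ⟨ν w + lam • w, T.add_mem (hT w hw) (T.smul_mem _ hw), (hν1 w).symm⟩
    · rw [← Submodule.map_sup, hc.sup_eq_top, Submodule.map_subtype_top]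
    · exact Submodule.disjoint_map Ω.injective_subtype hc.disjoint
    · exact fun h => hφ0 (Subtype.ext ((Submodule.eq_bot_iff _).1 h _ ⟨_, ⟨_, rfl⟩, rfl⟩))
    · rintro _ ⟨_, ⟨r, rfl⟩, rfl⟩
      exact ⟨_, hΦ r⟩
  exact ⟨lam, k, hk, ⟨(LinearEquiv.ofBijective Φ ⟨hinj, LinearMap.range_eq_top.1 hrange⟩).symm.trans
    (fockEquiv a lam k)⟩⟩

end Classification

end Heisenberg

end

/-! ### Assembly of the theorem -/

theorem proposition4p6 (a : ℂ) :
    -- the setting: a vertex operator algebra whose Zhu algebra is `V / O_0(V) = ℂ[x]`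
    (Heisenberg.M a).IsVertexOperatorAlgebra (1 - 12 * a ^ 2) ∧
    Function.Bijective (Heisenberg.M a).zhuOfQuotient ∧
    Function.Bijective (Polynomial.aeval (R := ℂ) (Heisenberg.zhuX a)) ∧
    (∀ (lam : ℂ) (k : ℕ), 0 < k →
      -- `W(a, lam, k) = M_a(1) ⊗ Ω(lam, k)`, with `Ω(lam, k) = U(lam, k)` and `α_0 = x` on it
      (∃ e : Heisenberg.Fock ⊗[ℂ] Heisenberg.U a lam k ≃ₗ[ℂ] Heisenberg.W a lam k,
        (∀ y, e (1 ⊗ₜ y) = (Heisenberg.M a).L0mk (Heisenberg.U a lam k) (1 ⊗ₜ y)) ∧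
        (∀ (i : ℕ) p y, Heisenberg.alpha a (-((i : ℤ) + 1)) • e (p ⊗ₜ y) =
          e ((MvPolynomial.X i * p) ⊗ₜ y)) ∧
        (∀ p y, Heisenberg.alpha a 0 • e (p ⊗ₜ y) = e (p ⊗ₜ (Heisenberg.zhuX a • y))) ∧
        (∀ (i : ℕ) p y, Heisenberg.alpha a ((i : ℤ) + 1) • e (p ⊗ₜ y) =
          e ((((i : ℂ) + 1) • MvPolynomial.pderiv i p) ⊗ₜ y))) ∧
      -- both modules are strongly interlocked
      IsStronglyInterlocked (Heisenberg.M a).ZhuAlgebra (Heisenberg.U a lam k) ∧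
      (Heisenberg.M a).IsStronglyInterlockedModule (Heisenberg.W a lam k) ∧
      -- `W / Rad W ≅ Soc W` and `W / Soc W ≅ Rad W`
      Nonempty
        ((Heisenberg.W a lam k ⧸
            Module.jacobson (Heisenberg.M a).ModeAlgebra (Heisenberg.W a lam k))
          ≃ₗ[(Heisenberg.M a).ModeAlgebra]
            socle (Heisenberg.M a).ModeAlgebra (Heisenberg.W a lam k)) ∧
      Nonempty
        ((Heisenberg.W a lam k ⧸ socle (Heisenberg.M a).ModeAlgebra (Heisenberg.W a lam k))
          ≃ₗ[(Heisenberg.M a).ModeAlgebra]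
            Module.jacobson (Heisenberg.M a).ModeAlgebra (Heisenberg.W a lam k)) ∧
      -- the grading and the strongly interlocked bases of the degree spaces
      (Heisenberg.M a).IsGrading (Heisenberg.W a lam k)
        ((Heisenberg.M a).L0deg (Heisenberg.U a lam k)) ∧
      ∃ c : Fin (k + 1) → Submodule (Heisenberg.M a).ModeAlgebra (Heisenberg.W a lam k),
        IsInterlockedChain (Heisenberg.M a).ModeAlgebra (Heisenberg.W a lam k) k c ∧
        ∀ ℓ : ℕ,
          Module.finrank ℂ
            ↥((socle (Heisenberg.M a).ModeAlgebra (Heisenberg.W a lam k)).restrictScalars ℂ ⊓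
              (Heisenberg.M a).L0deg (Heisenberg.U a lam k) ℓ) = Heisenberg.numPartitions ℓ ∧
          ∃ b : Module.Basis (Fin k × Fin (Heisenberg.numPartitions ℓ)) ℂ
              ↥((Heisenberg.M a).L0deg (Heisenberg.U a lam k) ℓ),
            (∀ j : Fin (k + 1),
              Submodule.span ℂ {w : Heisenberg.W a lam k |
                  ∃ (i : Fin k) (s : _), (i : ℕ) < (j : ℕ) ∧ w = (b (i, s) : Heisenberg.W a lam k)} =
                (c j).restrictScalars ℂ ⊓
                  (Heisenberg.M a).L0deg (Heisenberg.U a lam k) ℓ) ∧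
            ∀ (n : ℤ) (v : Heisenberg.Fock), (Heisenberg.M a).HasWeight n v →
              ∃ T : Matrix (Fin k × Fin (Heisenberg.numPartitions ℓ))
                  (Fin k × Fin (Heisenberg.numPartitions ℓ)) ℂ,
                IsInterlockedMatrix T ∧
                ∀ j, (Heisenberg.M a).gen v (n - 1) • (b j : Heisenberg.W a lam k) =
                  ∑ i, T i j • (b i : Heisenberg.W a lam k)) ∧
    -- these are all the indecomposable generalized modules, hence all of them are
    -- strongly interlocked
    (∀ (X : Type u) [AddCommGroup X] [Module ℂ X] [Module (Heisenberg.M a).ModeAlgebra X]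
      [IsScalarTower ℂ (Heisenberg.M a).ModeAlgebra X],
      (Heisenberg.M a).IsGeneralizedModule X →
      IsIndecomposable (Heisenberg.M a).ModeAlgebra X →
      (Heisenberg.M a).IsStronglyInterlockedModule X ∧
      ∃ (lam : ℂ) (k : ℕ), 0 < k ∧
        Nonempty (X ≃ₗ[(Heisenberg.M a).ModeAlgebra] Heisenberg.W a lam k)) := by
  open Heisenberg in
  refine ⟨isVertexOperatorAlgebra a, zhuOfQuotient_bijective a, aeval_zhuX_bijective a,
    fun lam k hk => ?_, fun X _ _ _ _ hX hX' => ?_⟩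
  · have hU := isUniserialFor_nilpU a lam k hk
    have hW := isUniserialFor_nilpOf (fockEquiv a lam k) hk
    have hS := isStronglyInterlockedModule_of_equiv (fockEquiv a lam k) hk
    have hG := (isGrading_fockDegree a lam k hk).comap (fockEquiv a lam k)
    refine ⟨⟨_, tensorEquiv_spec a (shift k lam) (truncEquiv a lam k)
      (truncEquiv_zhuClass_smul a lam k)⟩, hU.isStronglyInterlocked, hS,
      hW.quotient_jacobson, hW.quotient_socle, ?_, ?_⟩
    · rw [L0deg_eq]
      exact hG
    · refine ⟨_, hW.isInterlockedChain, fun ℓ => ?_⟩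
      rw [L0deg_eq]
      exact ⟨finrank_socle _ hk ℓ, basisOf _ ℓ, span_basisOf _ ℓ,
        fun n v hv => exists_matrix _ ℓ hv⟩
  · obtain ⟨lam, k, hk, ⟨Ψ⟩⟩ := exists_equiv_fockTrunc hX hX'
    exact ⟨isStronglyInterlockedModule_of_equiv Ψ hk, lam, k, hk,
      ⟨Ψ.trans (fockEquiv a lam k).symm⟩⟩
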